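/- Let $K$ be a field (e.g. $K=\mathbb{C}$) and $G$ a group. **Crossed categories.** A crossed $G$-category $\mathcal{C}$ is a monoidal category that is a disjoint union of full subcategories $\mathcal{C}_\alpha$, $\alpha\in G$, with $\mathcal{C}_\alpha\otimes\mathcal{C}_\beta\subseteq\mathcal{C}_{\alpha\beta}$, with a homomorphism $\beta\mapsto\Phi_\beta$ from $G$ to the strict monoidal automorphisms of $\mathcal{C}$ such that $\Phi_\beta(\mathcal{C}_\alpha)=\mathcal{C}_{\beta\alpha\beta^{-1}}$. For $U\in\mathcal{C}_\alpha$ write ${}^{U}X={}^{\alpha}X=\Phi_\alpha(X)$. A braiding is a natural family of isomorphisms $c_{U,V}:U\otimes V\to{}^{U}V\otimes U$ with the two hexagon identities for $c_{U\otimes V,W}$ and $c_{U,V\otimes W}$ and with $\Phi_\beta(c_{U,V})=c_{\Phi_\beta U,\Phi_\beta V}$. A twist is a natural family of isomorphisms $\theta_U:U\to{}^{U}U$ with $\theta_{U\otimes V}=c_{{}^{U\otimes V}V,\,{}^{U}U}\circ c_{{}^{U}U,\,{}^{V}V}\circ(\theta_U\otimes\theta_V)$ and $\Phi_\beta(\theta_U)=\theta_{\Phi_\beta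 U}$; a braided crossed category with a twist is balanced. It is ribbon if it has a choice of left duals $(U^*,b_U,d_U)$ preserved by all $\Phi_\beta$ such that $({}^{U}U\otimes\theta_{{}^{U}U^*})\circ b_{{}^{U}U}=(\theta_U\otimes U^*)\circ b_U$ for all $U$. **Center.** The objects of $\mathcal{Z}(\mathcal{C})$ are pairs $(U,\mathfrak{c})$ of an object $U$ and a natural family of isomorphisms $\mathfrak{c}_X:U\otimes X\to{}^{U}X\otimes U$ with the hexagon identity for $\mathfrak{c}_{X\otimes Y}$; arrows are the arrows of $\mathcal{C}$ that commute with the half-braidings. With the usual tensor product, with $\Phi_\beta(U,\mathfrak{c})=(\Phi_\beta U,\Phi_\beta(\mathfrak{c}_{\Phi_\beta^{-1}(\cdot)}))$ and with the braiding $c_{(U,\mathfrak{c}),(V,\mathfrak{d})}=\mathfrak{c}_V$, it is a braided crossed $G$-category. **Ribbon extension.** For a braided crossed $G$-category $\mathcal{D}$, the objects of $\mathcal{D}^{Z}$ are pairs $(U,t)$ with $t:U\to{}^{U}U$ an isomorphism; arrows $(U,t)\to(U',t')$ are the arrows $f$ with $({}^{U}f)\circ t=t'\circ f$; the tensor product is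 $(U\otimes U',\,c_{{}^{U\otimes U'}U',\,{}^{U}U}\circ c_{{}^{U}U,\,{}^{U'}U'}\circ(t\otimes t'))$; $\Phi_\beta$ and the braiding are induced from $\mathcal{D}$, and the twist is $\theta_{(U,t)}=t$. For a balanced $\mathcal{E}$, $\mathcal{N}(\mathcal{E})$ is the full subcategory of the objects $U$ that have a left dual $(U^*,b_U,d_U)$ such that (1) $\Phi_\beta$ preserves $U^*$, $b_U$ and $d_U$ whenever $\Phi_\beta(U)=U$; (2) $({}^{U}U\otimes\theta_{{}^{U}U^*})\circ{}^{U}b_U=(\theta_U\otimes U^*)\circ b_U$; (3) $(({}^{U}\theta_U)\circ\theta_U)^{-1}=({}^{\alpha\alpha}d_U\otimes U)\circ({}^{\alpha\alpha}U^*\otimes c_{{}^{\alpha\alpha}U,U}^{-1})\circ((c_{{}^{\alpha}U,{}^{\alpha}U^*}\circ{}^{\alpha}b_U)\otimes{}^{\alpha\alpha}U)$ for $U\in\mathcal{E}_\alpha$. Put $\theta(\mathcal{D})=\mathcal{N}(\mathcal{D}^{Z})$. **Crossed Hopf algebras.** A crossed Hopf $G$-algebra $H$ over $K$ (in packed form)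 is a Hopf $K$-algebra with bijective antipode $S$ that is a direct sum of subcoalgebras $H_\alpha$, $\alpha\in G$, with $H_\alpha H_\beta\subseteq H_{\alpha\beta}$, $1\in H_1$, $S(H_\alpha)\subseteq H_{\alpha^{-1}}$, and with an action $\varphi$ of $G$ by Hopf algebra automorphisms such that $\varphi_\beta(H_\alpha)\subseteq H_{\beta\alpha\beta^{-1}}$. It is coquasitriangular (cobraided) if it is endowed with a convolution-invertible linear map $\gamma:H\otimes H\to K$ such that (in Sweedler notation) $k'h'\gamma(h''\otimes k'')=\gamma(h'\otimes k')\varphi_\beta(h'')k''$ for $k\in H_\beta$; $\gamma(h_1h_2\otimes k)=\gamma(h_1\otimes k')\gamma(h_2\otimes k'')$; $\gamma(h\otimes k_1k_2)=\gamma(\varphi_\beta(h'')\otimes k_1)\gamma(h'\otimes k_2)$ for $k_2\in H_\beta$; and $\gamma\circ(\varphi_\beta\otimes\varphi_\beta)=\gamma$. It is coribbon if it is endowed moreover with a convolution-invertible linear map $\tau:H\to K$ such that $\tau(h')\varphi_\alpha(h'')=h'\tau(h'')$ for $h\in H_\alpha$; $\tau(hk)=\gamma(k'\otimes h')\tau(h'')\tau(\varphi_\alpha(k''))\gamma(h'''\otimes\varphi_\beta(k'''))$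 for $h\in H_\alpha$, $k\in H_\beta$; $\tau\circ S=\tau$; and $\tau\circ\varphi_\beta=\tau$. Isomorphisms are Hopf algebra isomorphisms that preserve the components, $\varphi$, and (where present) $\gamma$ and $\tau$. **Comodules.** $\mathrm{Com}\,H$ is the crossed $G$-category whose objects of degree $\alpha$ are the finite-dimensional left $H_\alpha$-comodules, with the coaction $m\otimes n\mapsto m_{(-1)}n_{(-1)}\otimes m_{(0)}\otimes n_{(0)}$ on tensor products, and with ${}^{\beta}M$ the vector space $M$ with the coaction composed with $\varphi_\beta$. If $H$ is coquasitriangular it is braided by $m\otimes n\mapsto\gamma(n_{(-1)}\otimes m_{(-1)})\,{}^{\alpha}n_{(0)}\otimes m_{(0)}$ (for $m\in M$ of degree $\alpha$), and if $H$ is coribbon it has the twist $m\mapsto\tau(m_{(-1)})\,{}^{\alpha}m_{(0)}$. The fiber functor of $\mathrm{Com}\,H$ is the forgetful functor to finite-dimensional vector spaces, with the identifications $m\mapsto{}^{\beta}m$; the fiber functors of $\mathcal{Z}(\mathrm{Com}\,H)$ and $\theta(\cdot)$ are its composites with the functors that forget the half-braiding and the isomorphism $t$. An isomorphism (equivalence)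 of braided, resp. ribbon, Tannakian crossed $G$-categories is an isomorphism (equivalence) of categories that strictly preserves degrees, tensor products, $\Phi$, and braidings (and twists), and whose composite with the fiber functor of the target is the fiber functor of the source. **Theorem.** (i) For every crossed Hopf $G$-algebra $H$ there is a coquasitriangular crossed Hopf $G$-algebra $D^*(H)$ such that $\mathrm{Com}\,D^*(H)$ is isomorphic to $\mathcal{Z}(\mathrm{Com}\,H)$ as a braided Tannakian crossed $G$-category. It is unique: every coquasitriangular $D'$ for which $\mathrm{Com}\,D'$ is equivalent to $\mathcal{Z}(\mathrm{Com}\,H)$ as a braided Tannakian crossed $G$-category is isomorphic to $D^*(H)$ as a coquasitriangular crossed Hopf $G$-algebra. (ii) For every coquasitriangular crossed Hopf $G$-algebra $H'$ there is a coribbon crossed Hopf $G$-algebra $R(H')$ such that $\mathrm{Com}\,R(H')$ is ribbon and isomorphic to $\theta(\mathrm{Com}\,H')$ as a ribbon Tannakian crossed $G$-category. It is unique: every coribbon $R'$ for which $\mathrm{Com}\,R'$ is equivalent to $\theta(\mathrm{Com}\,H')$ as a ribbon Tannakian crossed $G$-category is isomorphic to $R(H')$ as a coribbon crossed Hopf $G$-algebra.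 (iii) In particular, for every crossed Hopf $G$-algebra $H$, $\mathrm{Com}\,R(D^*(H))$ is isomorphic to $\theta(\mathcal{Z}(\mathrm{Com}\,H))$ as a ribbon Tannakian crossed $G$-category. -/

import Mathlib

universe w v u

open CategoryTheory MonoidalCategory

/-- A crossed `G`-category: a monoidal category whose objects have a degree in `G`, which is the
disjoint union of the full subcategories of objects of a given degree, with
`deg (X ⊗ Y) = deg X * deg Y`, and a group homomorphism `Φ` from `G` to the group of invertible
strict monoidal endofunctors (all the equations are equations of objects and of functors), with
`Φ β` mapping objects of degree `α` to objects of degree `β α β⁻¹`. -/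
class CrossedCategory (G : outParam (Type w)) [Group G] (C : Type u) [Category.{v} C]
    [MonoidalCategory C] where
  deg : C → G
  deg_eq_of_hom : ∀ {X Y : C}, (X ⟶ Y) → deg X = deg Y
  deg_tensor : ∀ X Y : C, deg (X ⊗ Y) = deg X * deg Y
  Φ : G → C ⥤ C
  deg_Φ : ∀ (β : G) (X : C), deg ((Φ β).obj X) = β * deg X * β⁻¹
  Φ_one : Φ 1 = 𝟭 C
  Φ_mul : ∀ β γ : G, Φ (β * γ) = Φ γ ⋙ Φ β
  Φ_tensor : ∀ (β : G) (X Y : C), (Φ β).obj (X ⊗ Y) = (Φ β).obj X ⊗ (Φ β).obj Y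
  Φ_unit : ∀ β : G, (Φ β).obj (𝟙_ C) = 𝟙_ C
  Φ_map_tensor : ∀ (β : G) {X X' Y Y' : C} (f : X ⟶ X') (g : Y ⟶ Y'),
    (Φ β).map (f ⊗ₘ g) =
      eqToHom (Φ_tensor β X Y) ≫ ((Φ β).map f ⊗ₘ (Φ β).map g) ≫ eqToHom (Φ_tensor β X' Y').symm
  Φ_associator : ∀ (β : G) (X Y Z : C),
    (Φ β).map (α_ X Y Z).hom =
      eqToHom (by rw [Φ_tensor, Φ_tensor]) ≫
        (α_ ((Φ β).obj X) ((Φ β).obj Y) ((Φ β).obj Z)).hom ≫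
          eqToHom (by rw [Φ_tensor, Φ_tensor])
  Φ_leftUnitor : ∀ (β : G) (X : C),
    (Φ β).map (λ_ X).hom =
      eqToHom (by rw [Φ_tensor, Φ_unit]) ≫ (λ_ ((Φ β).obj X)).hom
  Φ_rightUnitor : ∀ (β : G) (X : C),
    (Φ β).map (ρ_ X).hom =
      eqToHom (by rw [Φ_tensor, Φ_unit]) ≫ (ρ_ ((Φ β).obj X)).hom

namespace CrossedCategory

variable {G : Type w} [Group G] {C : Type u} [Category.{v} C] [MonoidalCategory C]
  [CrossedCategory G C]

/-- The object `ᵝX = Φ_β(X)`. -/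
abbrev conj (β : G) (X : C) : C := (Φ β).obj X

theorem conj_id (X : C) : conj (1 : G) X = X := by
  rw [conj, Φ_one]; rfl

theorem conj_comp (β γ : G) (X : C) : conj (β * γ) X = conj β (conj γ X) := by
  rw [conj, Φ_mul]; rfl

theorem deg_conj (β : G) (X : C) : deg (conj β X) = β * deg X * β⁻¹ := deg_Φ β X

theorem deg_unit : deg (𝟙_ C) = (1 : G) := by
  have h := deg_eq_of_hom (λ_ (𝟙_ C)).hom
  rw [deg_tensor] at h
  exact mul_eq_left.mp h

theorem conj_inv_self (β : G) (X : C) : X = conj β (conj β⁻¹ X) := by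
  rw [← conj_comp, mul_inv_cancel, conj_id]

theorem conj_inj {β : G} {X Y : C} (h : conj β X = conj β Y) : X = Y := by
  have := congrArg (conj β⁻¹) h
  rwa [← conj_comp, ← conj_comp, inv_mul_cancel, conj_id, conj_id] at this

/-- `Φ_β` on morphisms, where `X'` and `Y'` are names for the objects `ᵝX` and `ᵝY`. -/
def conjMap (β : G) {X Y X' Y' : C} (f : X ⟶ Y) (hX : X' = conj β X) (hY : Y' = conj β Y) :
    X' ⟶ Y' :=
  eqToHom hX ≫ (Φ β).map f ≫ eqToHom hY.symm

section conjMap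

variable (β γ : G) {X Y Z X' Y' Z' X'' Y'' W W' : C}

theorem conjMap_rfl (f : X ⟶ Y) : conjMap β f rfl rfl = (Φ β).map f := by simp [conjMap]

theorem conjMap_comp (f : X ⟶ Y) (g : Y ⟶ Z) (hX : X' = conj β X) (hY : Y' = conj β Y)
    (hZ : Z' = conj β Z) :
    conjMap β (f ≫ g) hX hZ = conjMap β f hX hY ≫ conjMap β g hY hZ := by
  simp [conjMap]

theorem conjMap_id (hX : X' = conj β X) (hX' : X'' = conj β X) :
    conjMap β (𝟙 X) hX hX' = eqToHom (hX.trans hX'.symm) := by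
  simp [conjMap]

theorem conjMap_id_self (hX : X' = conj β X) : conjMap β (𝟙 X) hX hX = 𝟙 X' := by
  simp [conjMap]

theorem conjMap_eqToHom (h : X = Y) (hX : X' = conj β X) (hY : Y' = conj β Y) :
    conjMap β (eqToHom h) hX hY = eqToHom (by rw [hX, hY, h]) := by
  subst h; simp [conjMap]

theorem conjMap_tensorHom (f : X ⟶ Y) (g : Z ⟶ W) (hX : X' = conj β X) (hY : Y' = conj β Y)
    (hZ : Z' = conj β Z) (hW : W' = conj β W) (h₁ : X' ⊗ Z' = conj β (X ⊗ Z))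
    (h₂ : Y' ⊗ W' = conj β (Y ⊗ W)) :
    conjMap β (f ⊗ₘ g) h₁ h₂ = conjMap β f hX hY ⊗ₘ conjMap β g hZ hW := by
  subst hX hY hZ hW
  simp [conjMap, Φ_map_tensor]

theorem conjMap_whiskerLeft (X : C) (g : Z ⟶ W) (hX : X' = conj β X)
    (hZ : Z' = conj β Z) (hW : W' = conj β W) (h₁ : X' ⊗ Z' = conj β (X ⊗ Z))
    (h₂ : X' ⊗ W' = conj β (X ⊗ W)) :
    conjMap β (X ◁ g) h₁ h₂ = X' ◁ conjMap β g hZ hW := by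
  rw [← id_tensorHom, conjMap_tensorHom β _ _ hX hX hZ hW, conjMap_id_self, id_tensorHom]

theorem conjMap_whiskerRight (f : X ⟶ Y) (Z : C) (hX : X' = conj β X) (hY : Y' = conj β Y)
    (hZ : Z' = conj β Z) (h₁ : X' ⊗ Z' = conj β (X ⊗ Z))
    (h₂ : Y' ⊗ Z' = conj β (Y ⊗ Z)) :
    conjMap β (f ▷ Z) h₁ h₂ = conjMap β f hX hY ▷ Z' := by
  rw [← tensorHom_id, conjMap_tensorHom β _ _ hX hY hZ hZ, conjMap_id_self, tensorHom_id]

theorem conjMap_associator_hom (hX : X' = conj β X) (hY : Y' = conj β Y)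
    (hZ : Z' = conj β Z) (h₁ : (X' ⊗ Y') ⊗ Z' = conj β ((X ⊗ Y) ⊗ Z))
    (h₂ : X' ⊗ Y' ⊗ Z' = conj β (X ⊗ Y ⊗ Z)) :
    conjMap β (α_ X Y Z).hom h₁ h₂ = (α_ X' Y' Z').hom := by
  subst hX hY hZ
  simp [conjMap, Φ_associator]

theorem conjMap_leftUnitor_hom (hX : X' = conj β X) (h₁ : 𝟙_ C ⊗ X' = conj β (𝟙_ C ⊗ X)) :
    conjMap β (λ_ X).hom h₁ hX = (λ_ X').hom := by
  subst hX
  simp [conjMap, Φ_leftUnitor]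

theorem conjMap_rightUnitor_hom (hX : X' = conj β X) (h₁ : X' ⊗ 𝟙_ C = conj β (X ⊗ 𝟙_ C)) :
    conjMap β (ρ_ X).hom h₁ hX = (ρ_ X').hom := by
  subst hX
  simp [conjMap, Φ_rightUnitor]

theorem conjMap_iso_inv (e : X ≅ Y) (hX : X' = conj β X) (hY : Y' = conj β Y) :
    conjMap β e.hom hX hY ≫ conjMap β e.inv hY hX = 𝟙 X' := by
  rw [← conjMap_comp, e.hom_inv_id, conjMap_id_self]

theorem conjMap_inv_iso (e : X ≅ Y) (hX : X' = conj β X) (hY : Y' = conj β Y) :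
    conjMap β e.inv hY hX ≫ conjMap β e.hom hX hY = 𝟙 Y' := by
  rw [← conjMap_comp, e.inv_hom_id, conjMap_id_self]

/-- `Φ_β` on isomorphisms. -/
@[simps]
def conjIso (e : X ≅ Y) (hX : X' = conj β X) (hY : Y' = conj β Y) : X' ≅ Y' where
  hom := conjMap β e.hom hX hY
  inv := conjMap β e.inv hY hX
  hom_inv_id := conjMap_iso_inv β e hX hY
  inv_hom_id := conjMap_inv_iso β e hX hY

theorem conjMap_associator_inv (hX : X' = conj β X) (hY : Y' = conj β Y)
    (hZ : Z' = conj β Z) (h₁ : (X' ⊗ Y') ⊗ Z' = conj β ((X ⊗ Y) ⊗ Z))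
    (h₂ : X' ⊗ Y' ⊗ Z' = conj β (X ⊗ Y ⊗ Z)) :
    conjMap β (α_ X Y Z).inv h₂ h₁ = (α_ X' Y' Z').inv := by
  rw [← cancel_epi (α_ X' Y' Z').hom, Iso.hom_inv_id,
    ← conjMap_associator_hom β hX hY hZ h₁ h₂, conjMap_iso_inv]

theorem conjMap_conjMap (f : X ⟶ Y) (hX : X' = conj γ X) (hY : Y' = conj γ Y)
    (hX' : X'' = conj β X') (hY' : Y'' = conj β Y') (δ : G) (hδ : δ = β * γ)
    (h₁ : X'' = conj δ X) (h₂ : Y'' = conj δ Y) :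
    conjMap β (conjMap γ f hX hY) hX' hY' = conjMap δ f h₁ h₂ := by
  subst hδ hX hY hX' hY'
  have := Functor.congr_hom (Φ_mul (C := C) β γ) f
  simp [conjMap, this]

theorem conjMap_one (f : X ⟶ Y) (δ : G) (hδ : δ = 1) (h₁ : X = conj δ X) (h₂ : Y = conj δ Y) :
    conjMap δ f h₁ h₂ = f := by
  subst hδ
  have := Functor.congr_hom (Φ_one (G := G) (C := C)) f
  simp [conjMap, this]

theorem conjMap_congr (f : X ⟶ Y) (δ δ' : G) (hδ : δ = δ') (h₁ : X' = conj δ X)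
    (h₂ : Y' = conj δ Y) (h₃ : X' = conj δ' X) (h₄ : Y' = conj δ' Y) :
    conjMap δ f h₁ h₂ = conjMap δ' f h₃ h₄ := by
  subst hδ; rfl

theorem conjMap_injective {f g : X ⟶ Y} (hX : X' = conj β X) (hY : Y' = conj β Y)
    (h : conjMap β f hX hY = conjMap β g hX hY) : f = g := by
  have e (Z : C) (Z' : C) (hZ : Z' = conj β Z) : Z = conj β⁻¹ Z' := by
    rw [hZ, ← conj_comp, inv_mul_cancel, conj_id]
  have := congrArg (fun k => conjMap β⁻¹ k (e X X' hX) (e Y Y' hY)) h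
  beta_reduce at this
  rwa [conjMap_conjMap _ _ _ _ _ _ _ 1 (by simp) (conj_id X).symm (conj_id Y).symm,
    conjMap_conjMap _ _ _ _ _ _ _ 1 (by simp) (conj_id X).symm (conj_id Y).symm,
    conjMap_one _ _ rfl, conjMap_one _ _ rfl] at this

theorem conjMap_rename (f : X ⟶ Y) (hX : X' = conj β X) (hY : Y' = conj β Y)
    (hX' : X'' = conj β X) (hY' : Y'' = conj β Y) :
    conjMap β f hX hY =
      eqToHom (hX.trans hX'.symm) ≫ conjMap β f hX' hY' ≫ eqToHom (hY'.trans hY.symm) := by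
  simp [conjMap]

theorem exists_conjMap_eq (hX : X' = conj β X) (hY : Y' = conj β Y) (f : X' ⟶ Y') :
    ∃ g : X ⟶ Y, f = conjMap β g hX hY := by
  have e (Z : C) (Z' : C) (hZ : Z' = conj β Z) : Z = conj β⁻¹ Z' := by
    rw [hZ, ← conj_comp, inv_mul_cancel, conj_id]
  refine ⟨conjMap β⁻¹ f (e X X' hX) (e Y Y' hY), ?_⟩
  rw [conjMap_conjMap _ _ _ _ _ _ _ 1 (by simp) (conj_id X').symm (conj_id Y').symm,
    conjMap_one _ _ rfl]

end conjMap

theorem conj_tensor {β : G} {X X' Y Y' : C} (hX : X' = conj β X) (hY : Y' = conj β Y) :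
    X' ⊗ Y' = conj β (X ⊗ Y) := by
  rw [hX, hY]; exact (Φ_tensor _ _ _).symm

theorem conj_conj_eq {β : G} {U V V' W W' : C} (hU : U = conj β V) (hW : W' = conj β W)
    (h : V' = conj (deg V) W) {T : C} (hT : T = conj β V') : T = conj (deg U) W' := by
  rw [hT, h, hU, deg_conj, hW, ← conj_comp, ← conj_comp]
  congr 1; group

theorem conj_deg_of_conj {β : G} {V W W' V' T : C} (hW : W' = conj β W)
    (hT : T = conj β V') (h : T = conj (deg (conj β V)) W') : V' = conj (deg V) W := by
  apply conj_inj (β := β)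
  rw [← hT, h, deg_conj, hW, ← conj_comp, ← conj_comp]
  congr 1; group

end CrossedCategory

open CrossedCategory

section Structures

variable {G : Type w} [Group G] (C : Type u) [Category.{v} C] [MonoidalCategory C]
  [CrossedCategory G C]

/-- A braiding in a crossed `G`-category: isomorphisms `c X Y : X ⊗ Y ≅ ˣY ⊗ X`, where
`ˣY = Φ_{deg X}(Y)`.  Throughout, a variable such as `Y'` with a hypothesis `Y' = conj (deg X) Y`
is a name for the object `ˣY`. -/
class CrossedBraiding where
  c : ∀ (X Y : C) {Y' : C}, Y' = conj (deg X) Y → (X ⊗ Y ≅ Y' ⊗ X)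
  c_natural : ∀ {X X₁ Y Y₁ Y' Y₁' : C} (f : X ⟶ X₁) (g : Y ⟶ Y₁) (h : Y' = conj (deg X) Y)
    (h₁ : Y₁' = conj (deg X₁) Y₁) (h₂ : Y₁' = conj (deg X) Y₁),
    (f ⊗ₘ g) ≫ (c X₁ Y₁ h₁).hom = (c X Y h).hom ≫ (conjMap (deg X) g h h₂ ⊗ₘ f)
  c_tensor_left : ∀ (X Y Z : C) {Z' Z'' : C} (h : Z' = conj (deg Y) Z)
    (h₁ : Z'' = conj (deg X) Z') (h₂ : Z'' = conj (deg (X ⊗ Y)) Z),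
    (c (X ⊗ Y) Z h₂).hom =
      (α_ X Y Z).hom ≫ X ◁ (c Y Z h).hom ≫ (α_ X Z' Y).inv ≫ (c X Z' h₁).hom ▷ Y ≫
        (α_ Z'' X Y).hom
  c_tensor_right : ∀ (X Y Z : C) {Y' Z' : C} (hY : Y' = conj (deg X) Y)
    (hZ : Z' = conj (deg X) Z) (h : Y' ⊗ Z' = conj (deg X) (Y ⊗ Z)),
    (c X (Y ⊗ Z) h).hom =
      (α_ X Y Z).inv ≫ (c X Y hY).hom ▷ Z ≫ (α_ Y' X Z).hom ≫ Y' ◁ (c X Z hZ).hom ≫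
        (α_ Y' Z' X).inv
  c_conj : ∀ (β : G) (X Y : C) {X' Y' Y₁ Y₁' : C} (h : Y₁ = conj (deg X) Y)
    (hX : X' = conj β X) (hY : Y' = conj β Y) (hY₁ : Y₁' = conj β Y₁)
    (h₁ : Y₁' = conj (deg X') Y') (hs : X' ⊗ Y' = conj β (X ⊗ Y))
    (ht : Y₁' ⊗ X' = conj β (Y₁ ⊗ X)),
    conjMap β (c X Y h).hom hs ht = (c X' Y' h₁).hom

open CrossedBraiding

/-- A twist in a braided crossed `G`-category: isomorphisms `θ X : X ≅ ˣX`. -/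
class CrossedTwist [CrossedBraiding C] where
  θ : ∀ (X : C) {X' : C}, X' = conj (deg X) X → (X ≅ X')
  θ_natural : ∀ {X Y X' Y' : C} (f : X ⟶ Y) (hX : X' = conj (deg X) X)
    (hY : Y' = conj (deg Y) Y) (hY' : Y' = conj (deg X) Y),
    f ≫ (θ Y hY).hom = (θ X hX).hom ≫ conjMap (deg X) f hX hY'
  θ_tensor : ∀ (X Y : C) {X₁ Y₁ X₂ Y₂ : C} (hX : X₁ = conj (deg X) X)
    (hY : Y₁ = conj (deg Y) Y) (h₁ : Y₂ = conj (deg X₁) Y₁) (h₂ : X₂ = conj (deg Y₂) X₁)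
    (h : X₂ ⊗ Y₂ = conj (deg (X ⊗ Y)) (X ⊗ Y)),
    (θ (X ⊗ Y) h).hom =
      ((θ X hX).hom ⊗ₘ (θ Y hY).hom) ≫ (c X₁ Y₁ h₁).hom ≫ (c Y₂ X₁ h₂).hom
  θ_conj : ∀ (β : G) (X : C) {X₁ X' X₁' : C} (h : X₁ = conj (deg X) X) (hX : X' = conj β X)
    (hX₁ : X₁' = conj β X₁) (h' : X₁' = conj (deg X') X'),
    conjMap β (θ X h).hom hX hX₁ = (θ X' h').hom

end Structures

/-! ### The center -/

section Center

variable {G : Type w} [Group G] {C : Type u} [Category.{v} C] [MonoidalCategory C]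
  [CrossedCategory G C]

/-- A half-braiding on `U`: a natural isomorphism `U ⊗ _ ≅ ᵁ_ ⊗ U` which is compatible with
tensor products. -/
@[ext]
structure CrossedHalfBraiding (U : C) where
  c : ∀ (V : C) {V' : C}, V' = conj (deg U) V → (U ⊗ V ≅ V' ⊗ U)
  natural : ∀ {V W V' W' : C} (f : V ⟶ W) (hV : V' = conj (deg U) V) (hW : W' = conj (deg U) W),
    U ◁ f ≫ (c W hW).hom = (c V hV).hom ≫ conjMap (deg U) f hV hW ▷ U
  tensor : ∀ (V W : C) {V' W' : C} (hV : V' = conj (deg U) V) (hW : W' = conj (deg U) W)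
    (h : V' ⊗ W' = conj (deg U) (V ⊗ W)),
    (c (V ⊗ W) h).hom =
      (α_ U V W).inv ≫ (c V hV).hom ▷ W ≫ (α_ V' U W).hom ≫ V' ◁ (c W hW).hom ≫
        (α_ V' W' U).inv

variable (C) in
/-- The objects of the center `𝒵(C)`. -/
structure CrossedCenter where
  obj : C
  hb : CrossedHalfBraiding obj

namespace CrossedCenter

/-- The arrows of the center. -/
@[ext]
structure Hom (X Y : CrossedCenter C) where
  f : X.obj ⟶ Y.obj
  comm : ∀ (W : C) {W' : C} (hX : W' = conj (deg X.obj) W) (hY : W' = conj (deg Y.obj) W),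
    (X.hb.c W hX).hom ≫ W' ◁ f = f ▷ W ≫ (Y.hb.c W hY).hom

instance : Category (CrossedCenter C) where
  Hom X Y := Hom X Y
  id X := ⟨𝟙 _, by intros; simp⟩
  comp {X Y Z} f g := ⟨f.f ≫ g.f, by
    intro W W' hX hZ
    have hY : W' = conj (deg Y.obj) W := by rw [hX, deg_eq_of_hom f.f]
    rw [MonoidalCategory.whiskerLeft_comp, ← Category.assoc, f.comm W hX hY, Category.assoc,
      g.comm W hY hZ, comp_whiskerRight, Category.assoc]⟩

@[ext]
theorem hom_ext {X Y : CrossedCenter C} {f g : X ⟶ Y} (h : f.f = g.f) : f = g := Hom.ext h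

@[simp] theorem id_f (X : CrossedCenter C) : (𝟙 X : X ⟶ X).f = 𝟙 X.obj := rfl
@[simp] theorem comp_f {X Y Z : CrossedCenter C} (f : X ⟶ Y) (g : Y ⟶ Z) :
    (f ≫ g).f = f.f ≫ g.f := rfl

/-- The forgetful functor `Z : 𝒵(C) ⥤ C`. -/
abbrev forget : CrossedCenter C ⥤ C where
  obj X := X.obj
  map f := f.f

instance : (forget (C := C)).Faithful where
  map_injective h := hom_ext h

theorem eqToHom_f {X Y : CrossedCenter C} (h : X = Y) :
    (eqToHom h).f = eqToHom (congrArg obj h) := by subst h; rfl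

/-- An isomorphism in the center from an isomorphism of the underlying objects. -/
@[simps]
def isoMk {X Y : CrossedCenter C} (e : X.obj ≅ Y.obj)
    (h : ∀ (W : C) {W' : C} (hX : W' = conj (deg X.obj) W) (hY : W' = conj (deg Y.obj) W),
      (X.hb.c W hX).hom ≫ W' ◁ e.hom = e.hom ▷ W ≫ (Y.hb.c W hY).hom) : X ≅ Y where
  hom := ⟨e.hom, h⟩
  inv := ⟨e.inv, fun W W' hY hX => by
    rw [← cancel_epi (e.hom ▷ W), ← Category.assoc, ← h W hX hY]
    simp⟩
  hom_inv_id := by ext; simp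
  inv_hom_id := by ext; simp

theorem obj_ext {X Y : CrossedCenter C} (h : X.obj = Y.obj)
    (h' : ∀ (W : C) {W' : C} (hX : W' = conj (deg X.obj) W) (hY : W' = conj (deg Y.obj) W),
      (X.hb.c W hX).hom = eqToHom (by rw [h]) ≫ (Y.hb.c W hY).hom ≫ eqToHom (by rw [h])) :
    X = Y := by
  obtain ⟨U, c⟩ := X
  obtain ⟨V, d⟩ := Y
  obtain rfl : U = V := h
  congr
  ext W W' hW : 5
  simpa using h' W hW hW

theorem conj_deg_mul_eq {X Y V V' V'' : C} (hV : V' = conj (deg Y) V)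
    (h : V'' = conj (deg (X ⊗ Y)) V) : V'' = conj (deg X) V' := by
  rw [h, hV, deg_tensor, conj_comp]

/-- The isomorphisms underlying the half-braiding of a tensor product. -/
def tensorC (X Y : CrossedCenter C) (V : C) {V' V'' : C} (hV : V' = conj (deg Y.obj) V)
    (h : V'' = conj (deg X.obj) V') : (X.obj ⊗ Y.obj) ⊗ V ≅ V'' ⊗ X.obj ⊗ Y.obj :=
  α_ _ _ _ ≪≫ whiskerLeftIso X.obj (Y.hb.c V hV) ≪≫ (α_ _ _ _).symm ≪≫
    whiskerRightIso (X.hb.c V' h) Y.obj ≪≫ α_ _ _ _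

theorem tensorC_hom (X Y : CrossedCenter C) (V : C) {V' V'' : C} (hV : V' = conj (deg Y.obj) V)
    (h : V'' = conj (deg X.obj) V') :
    (tensorC X Y V hV h).hom = (α_ _ _ _).hom ≫ X.obj ◁ (Y.hb.c V hV).hom ≫ (α_ _ _ _).inv ≫
      (X.hb.c V' h).hom ▷ Y.obj ≫ (α_ _ _ _).hom := rfl

/-- The tensor product in the center, with the half-braiding
`(c ⊗ c')_V = (c_{ᵁ'V} ⊗ U') ∘ (U ⊗ c'_V)`. -/
abbrev tensorObj (X Y : CrossedCenter C) : CrossedCenter C where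
  obj := X.obj ⊗ Y.obj
  hb :=
    { c := fun V _ h => tensorC X Y V rfl (conj_deg_mul_eq rfl h)
      natural := by
        intro V W V' W' f hV hW
        rw [tensorC_hom, tensorC_hom]
        have e1 := Y.hb.natural f rfl rfl
        have e2 := X.hb.natural (conjMap (deg Y.obj) f rfl rfl) (conj_deg_mul_eq rfl hV)
          (conj_deg_mul_eq rfl hW)
        rw [conjMap_conjMap _ _ _ _ _ _ _ _ (deg_tensor _ _) hV hW] at e2
        calc
          _ = 𝟙 _ ⊗≫ (X.obj ◁ (Y.obj ◁ f ≫ (Y.hb.c W rfl).hom)) ⊗≫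
              (X.hb.c (conj (deg Y.obj) W) (conj_deg_mul_eq rfl hW)).hom ▷ Y.obj ⊗≫ 𝟙 _ := by
            monoidal
          _ = 𝟙 _ ⊗≫ X.obj ◁ (Y.hb.c V rfl).hom ⊗≫
              (X.obj ◁ conjMap (deg Y.obj) f rfl rfl ≫
                (X.hb.c (conj (deg Y.obj) W) (conj_deg_mul_eq rfl hW)).hom) ▷ Y.obj ⊗≫ 𝟙 _ := by
            rw [e1]; monoidal
          _ = _ := by rw [e2]; monoidal
      tensor := by
        intro V W V' W' hV hW h
        have hX : conj (deg Y.obj) (V ⊗ W) = conj (deg Y.obj) V ⊗ conj (deg Y.obj) W :=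
          Φ_tensor _ _ _
        have key : ∀ {T T' : C} (hT : T = conj (deg Y.obj) (V ⊗ W)) (h1 : T' = conj (deg X.obj) T)
            (h2 : T' = conj (deg X.obj) (conj (deg Y.obj) (V ⊗ W))),
            tensorC X Y (V ⊗ W) hT h1 = tensorC X Y (V ⊗ W) rfl h2 := by
          intro T T' hT h1 h2; subst hT; rfl
        rw [← key hX.symm (by rw [← hX]; exact conj_deg_mul_eq rfl h), tensorC_hom, tensorC_hom,
          tensorC_hom, Y.hb.tensor V W rfl rfl hX.symm,
          X.hb.tensor _ _ (conj_deg_mul_eq rfl hV) (conj_deg_mul_eq rfl hW)]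
        calc
          _ = 𝟙 _ ⊗≫
            X.obj ◁ (Y.hb.c V rfl).hom ▷ W ⊗≫
              (_ ◁ (Y.hb.c W rfl).hom ≫
                (X.hb.c _ (conj_deg_mul_eq rfl hV)).hom ▷ _) ⊗≫
                  V' ◁ (X.hb.c _ (conj_deg_mul_eq rfl hW)).hom ▷ Y.obj ⊗≫ 𝟙 _ := by monoidal
          _ = _ := by rw [whisker_exchange]; monoidal }

theorem tensorObj_c (X Y : CrossedCenter C) (V : C) {V' V'' : C} (hV : V' = conj (deg Y.obj) V)
    (h : V'' = conj (deg X.obj) V') (h' : V'' = conj (deg (X.obj ⊗ Y.obj)) V) :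
    ((tensorObj X Y).hb.c V h').hom =
      (α_ _ _ _).hom ≫ X.obj ◁ (Y.hb.c V hV).hom ≫ (α_ _ _ _).inv ≫
      (X.hb.c V' h).hom ▷ Y.obj ≫ (α_ _ _ _).hom := by
  subst hV; rfl

theorem whiskerLeft_comm (X : CrossedCenter C) {Y₁ Y₂ : CrossedCenter C} (f : Y₁ ⟶ Y₂)
    (W : C) {W' : C} (h₁ : W' = conj (deg (tensorObj X Y₁).obj) W)
    (h₂ : W' = conj (deg (tensorObj X Y₂).obj) W) :
    ((tensorObj X Y₁).hb.c W h₁).hom ≫ W' ◁ X.obj ◁ f.f =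
      (X.obj ◁ f.f) ▷ W ≫ ((tensorObj X Y₂).hb.c W h₂).hom := by
  have hY : conj (deg Y₁.obj) W = conj (deg Y₂.obj) W := by rw [deg_eq_of_hom f.f]
  have e := f.comm W rfl hY
  rw [tensorObj_c X Y₁ W rfl (conj_deg_mul_eq rfl h₁),
    tensorObj_c X Y₂ W hY (conj_deg_mul_eq rfl h₁)]
  symm
  calc
    _ = 𝟙 _ ⊗≫ X.obj ◁ (f.f ▷ W ≫ (Y₂.hb.c W hY).hom) ⊗≫
        (X.hb.c _ (conj_deg_mul_eq rfl h₁)).hom ▷ Y₂.obj ⊗≫ 𝟙 _ := by monoidal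
    _ = 𝟙 _ ⊗≫ X.obj ◁ (Y₁.hb.c W rfl).hom ⊗≫
        ((X.obj ⊗ _) ◁ f.f ≫ (X.hb.c _ (conj_deg_mul_eq rfl h₁)).hom ▷ Y₂.obj) ⊗≫ 𝟙 _ := by
      rw [← e]; monoidal
    _ = _ := by rw [whisker_exchange]; monoidal

theorem whiskerRight_comm {X₁ X₂ : CrossedCenter C} (f : X₁ ⟶ X₂) (Y : CrossedCenter C)
    (W : C) {W' : C} (h₁ : W' = conj (deg (tensorObj X₁ Y).obj) W)
    (h₂ : W' = conj (deg (tensorObj X₂ Y).obj) W) :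
    ((tensorObj X₁ Y).hb.c W h₁).hom ≫ W' ◁ f.f ▷ Y.obj =
      (f.f ▷ Y.obj) ▷ W ≫ ((tensorObj X₂ Y).hb.c W h₂).hom := by
  have e := f.comm (conj (deg Y.obj) W) (conj_deg_mul_eq rfl h₁) (conj_deg_mul_eq rfl h₂)
  rw [tensorObj_c X₁ Y W rfl (conj_deg_mul_eq rfl h₁),
    tensorObj_c X₂ Y W rfl (conj_deg_mul_eq rfl h₂)]
  symm
  calc
    _ = 𝟙 _ ⊗≫ (f.f ▷ (Y.obj ⊗ W) ≫ X₂.obj ◁ (Y.hb.c W rfl).hom) ⊗≫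
        (X₂.hb.c _ (conj_deg_mul_eq rfl h₂)).hom ▷ Y.obj ⊗≫ 𝟙 _ := by monoidal
    _ = 𝟙 _ ⊗≫ X₁.obj ◁ (Y.hb.c W rfl).hom ⊗≫
        (f.f ▷ _ ≫ (X₂.hb.c _ (conj_deg_mul_eq rfl h₂)).hom) ▷ Y.obj ⊗≫ 𝟙 _ := by
      rw [← whisker_exchange]; monoidal
    _ = _ := by rw [← e]; monoidal

/-- The unit of the center. -/
abbrev tensorUnit : CrossedCenter C where
  obj := 𝟙_ C
  hb :=
    { c := fun V V' h => λ_ V ≪≫ (ρ_ V).symm ≪≫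
        whiskerRightIso (eqToIso (by rw [h, deg_unit, conj_id])) (𝟙_ C)
      natural := by
        intro V W V' W' f hV hW
        obtain rfl : V' = V := by rw [hV, deg_unit, conj_id]
        obtain rfl : W' = W := by rw [hW, deg_unit, conj_id]
        rw [conjMap_one f _ deg_unit]
        simp
      tensor := by
        intro V W V' W' hV hW h
        obtain rfl : V' = V := by rw [hV, deg_unit, conj_id]
        obtain rfl : W' = W := by rw [hW, deg_unit, conj_id]
        simp }

theorem tensorUnit_c (V : C) (h : V = conj (deg (𝟙_ C)) V) :
    ((tensorUnit (C := C)).hb.c V h).hom = (λ_ V).hom ≫ (ρ_ V).inv := by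
  simp [tensorUnit]

instance : MonoidalCategoryStruct (CrossedCenter C) where
  tensorObj := tensorObj
  whiskerLeft X _ _ f := ⟨X.obj ◁ f.f, fun W _ h₁ h₂ => whiskerLeft_comm X f W h₁ h₂⟩
  whiskerRight f Y := ⟨f.f ▷ Y.obj, fun W _ h₁ h₂ => whiskerRight_comm f Y W h₁ h₂⟩
  tensorHom {X₁ Y₁ X₂ Y₂} f g := ⟨f.f ⊗ₘ g.f, fun W W' h₁ h₂ => by
    have h₃ : W' = conj (deg (tensorObj Y₁ X₂).obj) W := by
      rw [h₁]
      exact congrArg (fun a => conj a W) (deg_eq_of_hom (f.f ▷ X₂.obj))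
    rw [MonoidalCategory.tensorHom_def, MonoidalCategory.whiskerLeft_comp, ← Category.assoc,
      whiskerRight_comm f X₂ W h₁ h₃, Category.assoc, whiskerLeft_comm Y₁ g W h₃ h₂]
    simp⟩
  tensorUnit := tensorUnit
  associator X Y Z := isoMk (α_ X.obj Y.obj Z.obj) (by
    intro W W' h₁ h₂
    have a₁ := conj_deg_mul_eq (X := X.obj ⊗ Y.obj) (Y := Z.obj) (V := W) rfl h₁
    have a₂ := conj_deg_mul_eq (X := X.obj) (Y := Y.obj) rfl a₁
    have h₃ := conj_deg_mul_eq (X := X.obj) (Y := Y.obj ⊗ Z.obj) (V := W) rfl h₂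
    have e : conj (deg Y.obj) (conj (deg Z.obj) W) = conj (deg (Y.obj ⊗ Z.obj)) W := by
      rw [deg_tensor, conj_comp]
    rw [tensorObj_c (tensorObj X Y) Z W rfl a₁, tensorObj_c X Y _ rfl a₂,
      tensorObj_c X (tensorObj Y Z) W e a₂, tensorObj_c Y Z W rfl rfl]
    dsimp only [tensorObj]
    monoidal)
  leftUnitor X := isoMk (λ_ X.obj) (by
    intro W W' h₁ h₂
    have e : W' = conj (deg (𝟙_ C)) W' := by rw [deg_unit, conj_id]
    rw [tensorObj_c tensorUnit X W h₂ e, tensorUnit_c]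
    dsimp only [tensorUnit, tensorObj]
    monoidal)
  rightUnitor X := isoMk (ρ_ X.obj) (by
    intro W W' h₁ h₂
    have e : W = conj (deg (𝟙_ C)) W := by rw [deg_unit, conj_id]
    rw [tensorObj_c X tensorUnit W e h₂, tensorUnit_c]
    dsimp only [tensorUnit, tensorObj]
    monoidal)

@[simp] theorem tensor_obj (X Y : CrossedCenter C) : (X ⊗ Y).obj = X.obj ⊗ Y.obj := rfl
@[simp] theorem unit_obj : (𝟙_ (CrossedCenter C)).obj = 𝟙_ C := rfl
@[simp] theorem whiskerLeft_f (X : CrossedCenter C) {Y₁ Y₂ : CrossedCenter C} (f : Y₁ ⟶ Y₂) :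
    (X ◁ f).f = X.obj ◁ f.f := rfl
@[simp] theorem whiskerRight_f {X₁ X₂ : CrossedCenter C} (f : X₁ ⟶ X₂) (Y : CrossedCenter C) :
    (f ▷ Y).f = f.f ▷ Y.obj := rfl
@[simp] theorem tensorHom_f {X₁ X₂ Y₁ Y₂ : CrossedCenter C} (f : X₁ ⟶ Y₁) (g : X₂ ⟶ Y₂) :
    (f ⊗ₘ g).f = f.f ⊗ₘ g.f := rfl
@[simp] theorem associator_hom_f (X Y Z : CrossedCenter C) :
    (α_ X Y Z).hom.f = (α_ X.obj Y.obj Z.obj).hom := rfl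
@[simp] theorem associator_inv_f (X Y Z : CrossedCenter C) :
    (α_ X Y Z).inv.f = (α_ X.obj Y.obj Z.obj).inv := rfl
@[simp] theorem leftUnitor_hom_f (X : CrossedCenter C) : (λ_ X).hom.f = (λ_ X.obj).hom := rfl
@[simp] theorem rightUnitor_hom_f (X : CrossedCenter C) : (ρ_ X).hom.f = (ρ_ X.obj).hom := rfl

instance : MonoidalCategory (CrossedCenter C) :=
  Monoidal.induced forget
    { μIso := fun _ _ => Iso.refl _
      εIso := Iso.refl _
      whiskerLeft_eq := by intros; simp
      whiskerRight_eq := by intros; simp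
      tensorHom_eq := by intros; simp
      associator_eq := by intros; simp
      leftUnitor_eq := by intros; simp
      rightUnitor_eq := by intros; simp }

theorem hb_congr (X : CrossedCenter C) {V W V' W' : C} (hV : V' = conj (deg X.obj) V)
    (hW : W' = conj (deg X.obj) W) (e : V = W) (e' : V' = W') :
    (X.hb.c V hV).hom = X.obj ◁ eqToHom e ≫ (X.hb.c W hW).hom ≫ eqToHom e'.symm ▷ X.obj := by
  subst e; subst e'; simp

/-- The conjugation `Φ_β(U, c) = (Φ_β(U), V ↦ Φ_β(c_{Φ_β⁻¹(V)}))`. -/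
abbrev conjObj (β : G) (X : CrossedCenter C) : CrossedCenter C where
  obj := conj β X.obj
  hb :=
    { c := fun V V' h => conjIso β
        (X.hb.c (conj β⁻¹ V) (V' := conj β⁻¹ V')
          (conj_deg_of_conj (conj_inv_self β V) (conj_inv_self β V') h))
        (conj_tensor rfl (conj_inv_self β V)) (conj_tensor (conj_inv_self β V') rfl)
      natural := by
        intro V W V' W' f hV hW
        have a := conj_inv_self β V
        have b := conj_inv_self β W
        have a' := conj_inv_self β V'
        have b' := conj_inv_self β W'
        obtain ⟨g, rfl⟩ := exists_conjMap_eq β a b f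
        have hV₀ := conj_deg_of_conj a a' hV
        have hW₀ := conj_deg_of_conj b b' hW
        have e : conjMap (deg (conj β X.obj)) (conjMap β g a b) hV hW =
            conjMap β (conjMap (deg X.obj) g hV₀ hW₀) a' b' := by
          have hd : β * deg X.obj = deg (conj β X.obj) * β := by rw [deg_conj]; group
          rw [conjMap_conjMap _ _ _ _ _ _ _ (β * deg X.obj) hd
            (by rw [a', hV₀, ← conj_comp, ]) (by rw [b', hW₀, ← conj_comp]),
            conjMap_conjMap _ _ _ _ _ _ _ (β * deg X.obj) rfl]
        simp only [conjIso_hom, e]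
        rw [← conjMap_whiskerLeft β X.obj g rfl a b (conj_tensor rfl a) (conj_tensor rfl b),
          ← conjMap_comp, X.hb.natural g hV₀ hW₀, conjMap_comp β _ _ _ (conj_tensor a' rfl),
          conjMap_whiskerRight β _ X.obj a' b' rfl]
      tensor := by
        intro V W V' W' hV hW h
        have a := conj_inv_self β V
        have b := conj_inv_self β W
        have a' := conj_inv_self β V'
        have b' := conj_inv_self β W'
        have hV₀ := conj_deg_of_conj a a' hV
        have hW₀ := conj_deg_of_conj b b' hW
        have t (A B : C) : conj β⁻¹ (A ⊗ B) = conj β⁻¹ A ⊗ conj β⁻¹ B := Φ_tensor _ _ _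
        have h₀ : conj β⁻¹ V' ⊗ conj β⁻¹ W' = conj (deg X.obj) (conj β⁻¹ V ⊗ conj β⁻¹ W) := by
          rw [← t, ← t]
          exact conj_deg_of_conj (conj_inv_self β _) (conj_inv_self β _) h
        simp only [conjIso_hom]
        rw [hb_congr X _ h₀ (t V W) (t V' W'), X.hb.tensor _ _ hV₀ hW₀ h₀]
        have r : conj β X.obj = conj β X.obj := rfl
        have e₁ := conj_tensor r (conj_tensor a b)
        have e₂ := conj_tensor (conj_tensor r a) b
        have e₃ := conj_tensor (conj_tensor a' r) b
        have e₄ := conj_tensor a' (conj_tensor r b)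
        have e₅ := conj_tensor a' (conj_tensor b' r)
        have e₆ := conj_tensor (conj_tensor a' b') r
        rw [conjMap_comp β _ _ _ e₁, conjMap_comp β _ _ e₁ e₆, conjMap_comp β _ _ e₁ e₂,
          conjMap_comp β _ _ e₂ e₃, conjMap_comp β _ _ e₃ e₄, conjMap_comp β _ _ e₄ e₅,
          conjMap_associator_inv β r a b, conjMap_associator_hom β a' r b,
          conjMap_associator_inv β a' b' r,
          conjMap_whiskerRight β _ _ (conj_tensor r a) (conj_tensor a' r) b,
          conjMap_whiskerLeft β _ _ a' (conj_tensor r b) (conj_tensor b' r),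
          conjMap_whiskerLeft β _ _ r (conj_inv_self β _) (conj_tensor a b),
          conjMap_whiskerRight β _ _ (conj_tensor a' b') (conj_inv_self β _) r,
          conjMap_eqToHom, conjMap_eqToHom]
        simp }

theorem conjObj_c (β : G) (X : CrossedCenter C) {V V' W W' : C} (hW : W = conj β V)
    (hW' : W' = conj β V') (h : V' = conj (deg X.obj) V)
    (h' : W' = conj (deg (conj β X.obj)) W) :
    ((conjObj β X).hb.c W h').hom =
      conjMap β (X.hb.c V h).hom (conj_tensor rfl hW) (conj_tensor hW' rfl) := by
  obtain rfl : V = conj β⁻¹ W := by rw [hW, ← conj_comp, inv_mul_cancel, conj_id]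
  obtain rfl : V' = conj β⁻¹ W' := by rw [hW', ← conj_comp, inv_mul_cancel, conj_id]
  rfl

theorem exists_conj (β : G) (V : C) : ∃ V₀, V = conj β V₀ := ⟨_, conj_inv_self β V⟩

variable (C) in
/-- The conjugation functors of the center. -/
abbrev conjFunctor (β : G) : CrossedCenter C ⥤ CrossedCenter C where
  obj X := conjObj β X
  map {X Y} f := ⟨(Φ β).map f.f, by
    intro W W' hX hY
    obtain ⟨V, rfl⟩ := exists_conj β W
    obtain ⟨V', rfl⟩ := exists_conj β W'
    have hX' := conj_deg_of_conj rfl rfl hX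
    have hY' := conj_deg_of_conj rfl rfl hY
    rw [conjObj_c β X rfl rfl hX', conjObj_c β Y rfl rfl hY', ← conjMap_rfl,
      ← conjMap_whiskerLeft β V' f.f rfl rfl rfl (conj_tensor rfl rfl) (conj_tensor rfl rfl),
      ← conjMap_whiskerRight β f.f V rfl rfl rfl (conj_tensor rfl rfl) (conj_tensor rfl rfl),
      ← conjMap_comp, ← conjMap_comp, f.comm V hX' hY']⟩
  map_id X := by ext; simp
  map_comp f g := by ext; simp

theorem functor_ext {D : Type*} [Category D] {F F' : D ⥤ CrossedCenter C}
    (h : ∀ X, F.obj X = F'.obj X)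
    (h' : ∀ {X Y : D} (f : X ⟶ Y), (F.map f).f = eqToHom (congrArg obj (h X)) ≫
      (F'.map f).f ≫ eqToHom (congrArg obj (h Y)).symm) : F = F' :=
  CategoryTheory.Functor.ext h (fun X Y f => by ext; simp [eqToHom_f, h' f])

theorem conjObj_tensor (β : G) (X Y : CrossedCenter C) :
    conjObj β (X ⊗ Y) = conjObj β X ⊗ conjObj β Y :=
  obj_ext (Φ_tensor _ _ _) (by
    intro W W' h₁ h₂
    obtain ⟨V, rfl⟩ := exists_conj β W
    obtain ⟨V', rfl⟩ := exists_conj β W'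
    have hX' := conj_deg_of_conj rfl rfl h₁
    have hV := conj_deg_mul_eq (X := X.obj) (Y := Y.obj) (V := V) rfl hX'
    have hs : conj β (conj (deg Y.obj) V) = conj (deg (conj β Y.obj)) (conj β V) :=
      conj_conj_eq rfl rfl rfl rfl
    have r {U : C} : conj β U = conj β U := rfl
    have e₁ := conj_tensor (conj_tensor (r (U := X.obj)) (r (U := Y.obj))) (r (U := V))
    have e₂ := conj_tensor (r (U := V')) (conj_tensor (r (U := X.obj)) (r (U := Y.obj)))
    have e₃ := conj_tensor (r (U := X.obj)) (conj_tensor (r (U := Y.obj)) (r (U := V)))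
    have e₄ := conj_tensor (r (U := X.obj))
      (conj_tensor (r (U := conj (deg Y.obj) V)) (r (U := Y.obj)))
    have e₅ := conj_tensor (conj_tensor (r (U := X.obj)) (r (U := conj (deg Y.obj) V)))
      (r (U := Y.obj))
    have e₆ := conj_tensor (conj_tensor (r (U := V')) (r (U := X.obj))) (r (U := Y.obj))
    rw [conjObj_c β (X ⊗ Y) rfl rfl hX', conjMap_rename β _ _ _ e₁ e₂]
    congr 2
    refine Eq.trans ?_ (tensorObj_c (conjObj β X) (conjObj β Y) (conj β V) hs
      (conj_conj_eq rfl rfl hV rfl) h₂).symm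
    rw [conjObj_c β X rfl rfl hV, conjObj_c β Y rfl rfl rfl]
    rw [show ((X ⊗ Y).hb.c V hX').hom = _ from tensorObj_c X Y V rfl hV hX',
      conjMap_comp β _ _ _ e₃, conjMap_comp β _ _ e₃ e₄, conjMap_comp β _ _ e₄ e₅,
      conjMap_comp β _ _ e₅ e₆, conjMap_associator_hom β r r r, conjMap_associator_inv β r r r,
      conjMap_associator_hom β r r r, conjMap_whiskerLeft β _ _ r (conj_tensor r r)
        (conj_tensor r r), conjMap_whiskerRight β _ _ (conj_tensor r r) (conj_tensor r r) r])

theorem conjObj_unit (β : G) : conjObj β (𝟙_ (CrossedCenter C)) = 𝟙_ (CrossedCenter C) :=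
  obj_ext (Φ_unit _) (by
    intro W W' h₁ h₂
    obtain rfl : W' = W := by rw [h₂, unit_obj, deg_unit, conj_id]
    obtain ⟨V, rfl⟩ := exists_conj β W'
    have hV : V = conj (deg (𝟙_ C)) V := by rw [deg_unit, conj_id]
    have u : 𝟙_ C = conj β (𝟙_ C) := (Φ_unit β).symm
    have e₁ := conj_tensor u (rfl : conj β V = conj β V)
    have e₂ := conj_tensor (rfl : conj β V = conj β V) u
    have e : conjMap β (ρ_ V).inv rfl e₂ = (ρ_ (conj β V)).inv := by
      rw [← cancel_epi (ρ_ (conj β V)).hom, Iso.hom_inv_id, ← conjMap_rightUnitor_hom β rfl e₂,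
        conjMap_iso_inv]
    rw [conjObj_c β (𝟙_ (CrossedCenter C)) rfl rfl hV, conjMap_rename β _ _ _ e₁ e₂]
    congr 2
    rw [show ((𝟙_ (CrossedCenter C)).hb.c V hV).hom = _ from tensorUnit_c V hV,
      show ((𝟙_ (CrossedCenter C)).hb.c _ h₂).hom = _ from tensorUnit_c _ h₂,
      conjMap_comp β _ _ _ rfl, conjMap_leftUnitor_hom, e])

theorem conjFunctor_id : conjFunctor C (1 : G) = 𝟭 (CrossedCenter C) :=
  functor_ext (fun X => obj_ext (conj_id _) (by
      intro W W' hX hY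
      have h := conjObj_c (1 : G) X (conj_id W).symm (conj_id W').symm hY hX
      refine h.trans ?_
      rw [conjMap_rename 1 _ _ _ (conj_id _).symm (conj_id _).symm, conjMap_one _ _ rfl]
      rfl))
    (fun f => Functor.congr_hom (Φ_one (G := G) (C := C)) f.f)

theorem conjFunctor_comp (β γ : G) :
    conjFunctor C (β * γ) = conjFunctor C γ ⋙ conjFunctor C β :=
  functor_ext (fun X => obj_ext (conj_comp _ _ _) (by
      intro W W' hX hY
      obtain ⟨V₁, rfl⟩ := exists_conj β W
      obtain ⟨V₁', rfl⟩ := exists_conj β W'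
      obtain ⟨V, rfl⟩ := exists_conj γ V₁
      obtain ⟨V', rfl⟩ := exists_conj γ V₁'
      have h₁ := conj_deg_of_conj rfl rfl hY
      have h := conj_deg_of_conj rfl rfl h₁
      have e : conj γ X.obj ⊗ conj γ V = conj γ (X.obj ⊗ V) := conj_tensor rfl rfl
      have e' : conj γ V' ⊗ conj γ X.obj = conj γ (V' ⊗ X.obj) := conj_tensor rfl rfl
      have d : conj β (conj γ X.obj) ⊗ conj β (conj γ V) = conj β (conj γ X.obj ⊗ conj γ V) :=
        conj_tensor rfl rfl
      have d' : conj β (conj γ V') ⊗ conj β (conj γ X.obj) =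
        conj β (conj γ V' ⊗ conj γ X.obj) := conj_tensor rfl rfl
      refine (conjObj_c (β * γ) X (conj_comp β γ V).symm (conj_comp β γ V').symm h hX).trans ?_
      refine Eq.trans ?_ (congrArg (fun k => _ ≫ k ≫ _)
        (conjObj_c β (conjObj γ X) rfl rfl h₁ hY)).symm
      rw [conjObj_c γ X rfl rfl h, conjMap_conjMap β γ _ e e' d d' _ rfl
        (by rw [d, e, ← conj_comp]) (by rw [d', e', ← conj_comp])]
      exact conjMap_rename _ _ _ _ _ _))
    (fun f => Functor.congr_hom (Φ_mul (C := C) β γ) f.f)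

instance : CrossedCategory G (CrossedCenter C) where
  deg X := deg X.obj
  deg_eq_of_hom f := deg_eq_of_hom f.f
  deg_tensor X Y := deg_tensor X.obj Y.obj
  Φ β := conjFunctor C β
  deg_Φ β X := deg_Φ β X.obj
  Φ_one := conjFunctor_id
  Φ_mul := conjFunctor_comp
  Φ_tensor := conjObj_tensor
  Φ_unit := conjObj_unit
  Φ_map_tensor β X X' Y Y' f g := by
    ext; simp only [comp_f, eqToHom_f]; exact Φ_map_tensor β f.f g.f
  Φ_associator β X Y Z := by
    ext; simp only [comp_f, eqToHom_f]; exact Φ_associator β X.obj Y.obj Z.obj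
  Φ_leftUnitor β X := by
    ext; simp only [comp_f, eqToHom_f]; exact Φ_leftUnitor β X.obj
  Φ_rightUnitor β X := by
    ext; simp only [comp_f, eqToHom_f]; exact Φ_rightUnitor β X.obj

theorem deg_def (X : CrossedCenter C) : deg X = deg X.obj := rfl
theorem conj_obj (β : G) (X : CrossedCenter C) : (conj β X).obj = conj β X.obj := rfl

theorem conjMap_f (β : G) {X Y X' Y' : CrossedCenter C} (f : X ⟶ Y) (hX : X' = conj β X)
    (hY : Y' = conj β Y) :
    (conjMap β f hX hY).f = conjMap β f.f (congrArg obj hX) (congrArg obj hY) := by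
  simp only [conjMap, comp_f, eqToHom_f]; rfl

theorem braiding_comm (X Y : CrossedCenter C) {Y' : CrossedCenter C}
    (h : Y' = conj (deg X) Y) (W : C) {W'' : C} (h₁ : W'' = conj (deg (X ⊗ Y).obj) W)
    (h₂ : W'' = conj (deg (Y' ⊗ X).obj) W) :
    ((X ⊗ Y).hb.c W h₁).hom ≫ W'' ◁ (X.hb.c Y.obj (congrArg obj h)).hom =
      (X.hb.c Y.obj (congrArg obj h)).hom ▷ W ≫ ((Y' ⊗ X).hb.c W h₂).hom := by
  subst h
  have hT := conj_deg_mul_eq (X := X.obj) (Y := Y.obj) (V := W) rfl h₁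
  have hW := conj_deg_mul_eq (X := conj (deg X.obj) Y.obj) (Y := X.obj) (V := W) rfl h₂
  rw [show ((X ⊗ Y).hb.c W h₁).hom = _ from tensorObj_c X Y W rfl hT h₁,
    show ((conj (deg X) Y ⊗ X).hb.c W h₂).hom = _ from
      tensorObj_c (conj (deg X) Y) X W rfl hW h₂,
    show ((conj (deg X) Y).hb.c (conj (deg X.obj) W) hW).hom = _ from
      conjObj_c (deg X.obj) Y rfl hT rfl hW]
  have n := X.hb.natural (Y.hb.c W rfl).hom (conj_tensor rfl rfl) (conj_tensor hT rfl)
  rw [X.hb.tensor _ _ hT rfl, X.hb.tensor _ _ rfl rfl] at n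
  calc
    _ = (α_ X.obj Y.obj W).hom ≫ (X.obj ◁ (Y.hb.c W rfl).hom ≫
        (α_ X.obj (conj (deg Y.obj) W) Y.obj).inv ≫
          (X.hb.c (conj (deg Y.obj) W) hT).hom ▷ Y.obj ≫
            (α_ W'' X.obj Y.obj).hom ≫ W'' ◁ (X.hb.c Y.obj rfl).hom ≫
              (α_ W'' (conj (deg X.obj) Y.obj) X.obj).inv) ≫
                (α_ W'' (conj (deg X.obj) Y.obj) X.obj).hom := by
      simp
    _ = _ := by
      rw [n]; simp; rfl

/-- The braiding of the center, `c_{(U, c), (U', c')} = c_{U'}`. -/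
instance : CrossedBraiding (CrossedCenter C) where
  c X Y {Y'} h := isoMk (X.hb.c Y.obj (congrArg obj h))
    (fun W _ h₁ h₂ => braiding_comm X Y h W h₁ h₂)
  c_natural {X X₁ Y Y₁ Y' Y₁'} f g h h₁ h₂ := by
    ext
    simp only [comp_f, isoMk_hom_f, tensorHom_f, conjMap_f]
    have e := f.comm Y₁.obj (congrArg obj h₂) (congrArg obj h₁)
    have n := X.hb.natural g.f (congrArg obj h) (congrArg obj h₂)
    rw [MonoidalCategory.tensorHom_def', Category.assoc, ← e, ← Category.assoc, n,
      Category.assoc, MonoidalCategory.tensorHom_def]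
    rfl
  c_tensor_left X Y Z Z' Z'' h h₁ h₂ := by
    ext
    exact tensorObj_c X Y Z.obj (congrArg obj h) (congrArg obj h₁) (congrArg obj h₂)
  c_tensor_right X Y Z Y' Z' hY hZ h := by
    ext
    exact X.hb.tensor Y.obj Z.obj (congrArg obj hY) (congrArg obj hZ) (congrArg obj h)
  c_conj β X Y X' Y' Y₁ Y₁' h hX hY hY₁ h₁ hs ht := by
    ext
    subst hX
    rw [conjMap_f]
    exact (conjObj_c β X (congrArg obj hY) (congrArg obj hY₁) (congrArg obj h)
      (congrArg obj h₁)).symm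

theorem braiding_f (X Y : CrossedCenter C) {Y' : CrossedCenter C} (h : Y' = conj (deg X) Y) :
    (CrossedBraiding.c X Y h).hom.f = (X.hb.c Y.obj (congrArg obj h)).hom := rfl

end CrossedCenter

end Center

/-! ### Balanced objects -/

section Twisted

variable {G : Type w} [Group G] {C : Type u} [Category.{v} C] [MonoidalCategory C]
  [CrossedCategory G C]

theorem twist_target {X Y X₁ Y₁ X₂ Y₂ : C} (hX : X₁ = conj (deg X) X)
    (hY : Y₁ = conj (deg Y) Y) (h₁ : Y₂ = conj (deg X₁) Y₁) (h₂ : X₂ = conj (deg Y₂) X₁) :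
    X₂ ⊗ Y₂ = conj (deg (X ⊗ Y)) (X ⊗ Y) := by
  subst hX hY h₁ h₂
  apply conj_tensor
  · rw [← conj_comp]; congr 1; simp only [deg_conj, deg_tensor]; group
  · rw [← conj_comp]; congr 1; simp only [deg_conj, deg_tensor]; group

variable (C) in
/-- The objects of the category `Cᶻ`: pairs `(U, t)` of an object `U` and an isomorphism
`t : U ≅ ᵁU`. -/
structure TwistedObject where
  obj : C
  t : obj ≅ conj (deg obj) obj

namespace TwistedObject

/-- The isomorphism `t : U ≅ U'`, where `U'` is a name for `ᵁU`. -/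
def tw (X : TwistedObject C) {U' : C} (h : U' = conj (deg X.obj) X.obj) : X.obj ≅ U' :=
  X.t ≪≫ eqToIso h.symm

/-- The arrows of `Cᶻ`. -/
@[ext]
structure Hom (X Y : TwistedObject C) where
  f : X.obj ⟶ Y.obj
  comm : ∀ {X' Y' : C} (hX : X' = conj (deg X.obj) X.obj) (hY : Y' = conj (deg Y.obj) Y.obj)
    (hY' : Y' = conj (deg X.obj) Y.obj),
    (X.tw hX).hom ≫ conjMap (deg X.obj) f hX hY' = f ≫ (Y.tw hY).hom

instance : Category (TwistedObject C) where
  Hom X Y := Hom X Y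
  id X := ⟨𝟙 _, by
    intro X' Y' hX hY hY'
    rw [conjMap_id, Category.id_comp]
    obtain rfl : X' = Y' := hX.trans hY.symm
    simp⟩
  comp {X Y Z} f g := ⟨f.f ≫ g.f, by
    intro X' Z' hX hZ hZ'
    have d := deg_eq_of_hom f.f
    have key := g.comm (X' := conj (deg Y.obj) Y.obj) rfl hZ (by rw [hZ', d])
    have key' := f.comm hX rfl (by rw [d])
    rw [conjMap_comp _ _ _ hX (Y' := conj (deg Y.obj) Y.obj) (by rw [d]) hZ', ← Category.assoc,
      key', Category.assoc, Category.assoc, ← key]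
    congr 2
    exact conjMap_congr _ _ _ d _ _ _ _⟩

@[ext]
theorem hom_ext {X Y : TwistedObject C} {f g : X ⟶ Y} (h : f.f = g.f) : f = g := Hom.ext h

@[simp] theorem id_f (X : TwistedObject C) : (𝟙 X : X ⟶ X).f = 𝟙 X.obj := rfl
@[simp] theorem comp_f {X Y Z : TwistedObject C} (f : X ⟶ Y) (g : Y ⟶ Z) :
    (f ≫ g).f = f.f ≫ g.f := rfl

/-- The forgetful functor `Cᶻ ⥤ C`. -/
abbrev forget : TwistedObject C ⥤ C where
  obj X := X.obj
  map f := f.f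

instance : (forget (C := C)).Faithful where
  map_injective h := hom_ext h

theorem eqToHom_f {X Y : TwistedObject C} (h : X = Y) :
    (eqToHom h).f = eqToHom (congrArg obj h) := by subst h; rfl

theorem obj_ext {X Y : TwistedObject C} (h : X.obj = Y.obj)
    (h' : ∀ {U' : C} (hX : U' = conj (deg X.obj) X.obj) (hY : U' = conj (deg Y.obj) Y.obj),
      (X.tw hX).hom = eqToHom h ≫ (Y.tw hY).hom) : X = Y := by
  obtain ⟨U, t⟩ := X
  obtain ⟨V, s⟩ := Y
  obtain rfl : U = V := h
  congr
  ext
  simpa [tw] using h' rfl rfl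

theorem tw_rename (X : TwistedObject C) {U U' : C} (h : U = conj (deg X.obj) X.obj)
    (h' : U' = conj (deg X.obj) X.obj) :
    (X.tw h).hom = (X.tw h').hom ≫ eqToHom (h'.trans h.symm) := by
  simp [tw]

/-- It suffices to check that an arrow of `C` is an arrow of `Cᶻ` for one choice of names. -/
theorem comm_of {X Y : TwistedObject C} (f : X.obj ⟶ Y.obj) {X' Y' : C}
    (hX : X' = conj (deg X.obj) X.obj) (hY : Y' = conj (deg Y.obj) Y.obj)
    (hY' : Y' = conj (deg X.obj) Y.obj)
    (h : (X.tw hX).hom ≫ conjMap (deg X.obj) f hX hY' = f ≫ (Y.tw hY).hom) :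
    ∀ {X' Y' : C} (hX : X' = conj (deg X.obj) X.obj) (hY : Y' = conj (deg Y.obj) Y.obj)
    (hY' : Y' = conj (deg X.obj) Y.obj),
    (X.tw hX).hom ≫ conjMap (deg X.obj) f hX hY' = f ≫ (Y.tw hY).hom := by
  intro A B hA hB hB'
  obtain rfl : A = X' := hA.trans hX.symm
  obtain rfl : B = Y' := hB.trans hY.symm
  exact h

end TwistedObject

end Twisted

section Braided

variable {G : Type w} [Group G] {C : Type u} [Category.{v} C] [MonoidalCategory C]
  [CrossedCategory G C] [CrossedBraiding C]

open CrossedBraiding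

namespace CrossedBraiding

theorem natural_left {X X₁ Y Y' : C} (f : X ⟶ X₁) (h : Y' = conj (deg X) Y)
    (h₁ : Y' = conj (deg X₁) Y) : f ▷ Y ≫ (c X₁ Y h₁).hom = (c X Y h).hom ≫ Y' ◁ f := by
  have := c_natural f (𝟙 Y) h h₁ h
  rwa [conjMap_id_self, tensorHom_id, id_tensorHom] at this

theorem natural_right {X Y Y₁ Y' Y₁' : C} (g : Y ⟶ Y₁) (h : Y' = conj (deg X) Y)
    (h₁ : Y₁' = conj (deg X) Y₁) :
    X ◁ g ≫ (c X Y₁ h₁).hom = (c X Y h).hom ≫ conjMap (deg X) g h h₁ ▷ X := by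
  have := c_natural (𝟙 X) g h h₁ h₁
  rwa [tensorHom_id, id_tensorHom] at this

theorem c_unit_right (X : C) (h : 𝟙_ C = conj (deg X) (𝟙_ C)) :
    (c X (𝟙_ C) h).hom = (ρ_ X).hom ≫ (λ_ X).inv := by
  have h₂ : 𝟙_ C ⊗ 𝟙_ C = conj (deg X) (𝟙_ C ⊗ 𝟙_ C) := conj_tensor h h
  have n := natural_right (X := X) (λ_ (𝟙_ C)).hom h₂ h
  rw [conjMap_leftUnitor_hom, c_tensor_right X _ _ h h] at n
  rw [← cancel_mono (λ_ X).hom, Category.assoc, Iso.inv_hom_id, Category.comp_id]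
  have n' : (α_ X (𝟙_ C) (𝟙_ C)).inv ≫ (ρ_ X).hom ▷ 𝟙_ C ≫ (c X (𝟙_ C) h).hom =
      (α_ X (𝟙_ C) (𝟙_ C)).inv ≫ ((c X (𝟙_ C) h).hom ≫ (λ_ X).hom) ▷ 𝟙_ C ≫
        (c X (𝟙_ C) h).hom := by
    calc
      _ = X ◁ (λ_ (𝟙_ C)).hom ≫ (c X (𝟙_ C) h).hom := by monoidal
      _ = _ := by rw [n]; monoidal
  rw [cancel_epi, cancel_mono] at n'
  exact (whiskerRight_iff _ _).mp n'.symm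

theorem c_unit_left (Y : C) (h : Y = conj (deg (𝟙_ C)) Y) :
    (c (𝟙_ C) Y h).hom = (λ_ Y).hom ≫ (ρ_ Y).inv := by
  have h₂ : Y = conj (deg (𝟙_ C ⊗ 𝟙_ C)) Y := by rw [deg_tensor, deg_unit, one_mul, conj_id]
  have n := natural_left (λ_ (𝟙_ C)).hom h₂ h
  rw [c_tensor_left (𝟙_ C) (𝟙_ C) Y h h] at n
  rw [← cancel_mono (ρ_ Y).hom, Category.assoc, Iso.inv_hom_id, Category.comp_id]
  have n' : (α_ (𝟙_ C) (𝟙_ C) Y).hom ≫ 𝟙_ C ◁ (λ_ Y).hom ≫ (c (𝟙_ C) Y h).hom =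
      (α_ (𝟙_ C) (𝟙_ C) Y).hom ≫ 𝟙_ C ◁ ((c (𝟙_ C) Y h).hom ≫ (ρ_ Y).hom) ≫
        (c (𝟙_ C) Y h).hom := by
    calc
      _ = (λ_ (𝟙_ C)).hom ▷ Y ≫ (c (𝟙_ C) Y h).hom := by
        monoidal
      _ = _ := by rw [n]; monoidal
  rw [cancel_epi, cancel_mono] at n'
  exact (whiskerLeft_iff _ _).mp n'.symm

/-- The double braiding `A ⊗ B ⟶ ᴬB ⊗ A ⟶ A' ⊗ ᴬB`. -/
def double (A B : C) {A' B' : C} (hB : B' = conj (deg A) B) (hA : A' = conj (deg B') A) :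
    A ⊗ B ≅ A' ⊗ B' := c A B hB ≪≫ c B' A hA

theorem double_hom (A B : C) {A' B' : C} (hB : B' = conj (deg A) B)
    (hA : A' = conj (deg B') A) :
    (double A B hB hA).hom = (c A B hB).hom ≫ (c B' A hA).hom := rfl

theorem double_natural {A B A₁ B₁ A' B' A₁' B₁' : C} (f : A ⟶ A₁) (g : B ⟶ B₁)
    (hB : B' = conj (deg A) B) (hA : A' = conj (deg B') A) (hB₁ : B₁' = conj (deg A₁) B₁)
    (hA₁ : A₁' = conj (deg B₁') A₁) (k : B₁' = conj (deg A) B₁) (l : A₁' = conj (deg B') A₁) :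
    (f ⊗ₘ g) ≫ (double A₁ B₁ hB₁ hA₁).hom =
      (double A B hB hA).hom ≫ (conjMap (deg B') f hA l ⊗ₘ conjMap (deg A) g hB k) := by
  rw [double_hom, double_hom, ← Category.assoc, c_natural f g hB hB₁ k, Category.assoc,
    c_natural _ f hA hA₁ l, Category.assoc]

theorem double_associator {A B D A' B' D₁ A₄ B₄ B₂ D₂ : C} (hB : B' = conj (deg A) B)
    (hA : A' = conj (deg B') A) (h₁ : D₁ = conj (deg (A' ⊗ B')) D)
    (h₂ : A₄ = conj (deg D₁) A') (h₃ : B₄ = conj (deg D₁) B')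
    (h₄ : A₄ ⊗ B₄ = conj (deg D₁) (A' ⊗ B')) (k₁ : D₂ = conj (deg B) D)
    (k₂ : B₂ = conj (deg D₂) B) (k₃ : D₁ = conj (deg A) D₂) (k₄ : B₄ = conj (deg A) B₂)
    (k₅ : B₄ ⊗ D₁ = conj (deg A) (B₂ ⊗ D₂)) (k₆ : A₄ = conj (deg (B₄ ⊗ D₁)) A) :
    (double A B hB hA).hom ▷ D ≫ (double (A' ⊗ B') D h₁ h₄).hom ≫ (α_ A₄ B₄ D₁).hom =
      (α_ A B D).hom ≫ A ◁ (double B D k₁ k₂).hom ≫ (double A (B₂ ⊗ D₂) k₅ k₆).hom := by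
  have e₁ : D₁ = conj (deg (B' ⊗ A)) D := by rw [h₁, deg_eq_of_hom (c B' A hA).hom]
  obtain ⟨Da, hDa⟩ : ∃ Da, Da = conj (deg A) D := ⟨_, rfl⟩
  obtain ⟨A₂, hA₂⟩ : ∃ A₂, A₂ = conj (deg D₁) A := ⟨_, rfl⟩
  have e₂ : B₄ ⊗ A₂ = conj (deg D₁) (B' ⊗ A) := conj_tensor h₃ hA₂
  have e₃ : A₄ = conj (deg B₄) A₂ := conj_conj_eq h₃ hA₂ hA h₂
  have e₄ : D₁ = conj (deg B') Da := by
    rw [e₁, deg_tensor, conj_comp, hDa]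
  have e₅ : D₁ ⊗ B' = conj (deg A) (D₂ ⊗ B) := conj_tensor k₃ hB
  have e₆ : B' ⊗ Da = conj (deg A) (B ⊗ D) := conj_tensor hB hDa
  rw [double_hom, double_hom, double_hom, double_hom]
  -- left hand side
  have l₁ := natural_left (c B' A hA).hom (Y := D) (Y' := D₁) e₁ h₁
  have l₂ := natural_right (X := D₁) (c B' A hA).hom e₂ h₄
  rw [c_conj (deg D₁) B' A hA h₃ hA₂ h₂ e₃] at l₂
  rw [c_tensor_left B' A D hDa e₄] at l₁
  rw [c_tensor_right D₁ B' A h₃ hA₂] at l₂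
  -- right hand side
  have r₁ := natural_right (X := A) (c D₂ B k₂).hom e₅ k₅
  rw [c_conj (deg A) D₂ B k₂ k₃ hB k₄ h₃] at r₁
  have r₂ := natural_right (X := A) (c B D k₁).hom e₆ e₅
  rw [c_conj (deg A) B D k₁ hB hDa k₃ e₄, c_tensor_right A B D hB hDa] at r₂
  rw [c_tensor_left B₄ D₁ A hA₂ e₃]
  calc
    _ = (c A B hB).hom ▷ D ≫ ((c B' A hA).hom ▷ D ≫ (c (A' ⊗ B') D h₁).hom) ≫
        (c D₁ (A' ⊗ B') h₄).hom ≫ (α_ A₄ B₄ D₁).hom := by simp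
    _ = (c A B hB).hom ▷ D ≫ (α_ B' A D).hom ≫ B' ◁ (c A D hDa).hom ≫ (α_ B' Da A).inv ≫
        (c B' Da e₄).hom ▷ A ≫ (α_ D₁ B' A).hom ≫
          (D₁ ◁ (c B' A hA).hom ≫ (c D₁ (A' ⊗ B') h₄).hom) ≫ (α_ A₄ B₄ D₁).hom := by
      rw [l₁]; simp
    _ = (α_ A B D).hom ≫ ((α_ A B D).inv ≫ (c A B hB).hom ▷ D ≫ (α_ B' A D).hom ≫
        B' ◁ (c A D hDa).hom ≫ (α_ B' Da A).inv) ≫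
        (c B' Da e₄).hom ▷ A ≫ (c D₁ B' h₃).hom ▷ A ≫ (α_ B₄ D₁ A).hom ≫
          B₄ ◁ (c D₁ A hA₂).hom ≫ (α_ B₄ A₂ D₁).inv ≫ (c B₄ A₂ e₃).hom ▷ D₁ ≫
            (α_ A₄ B₄ D₁).hom := by
      rw [l₂]; simp
    _ = (α_ A B D).hom ≫ (((α_ A B D).inv ≫ (c A B hB).hom ▷ D ≫ (α_ B' A D).hom ≫
        B' ◁ (c A D hDa).hom ≫ (α_ B' Da A).inv) ≫
        (c B' Da e₄).hom ▷ A) ≫ (c D₁ B' h₃).hom ▷ A ≫ (α_ B₄ D₁ A).hom ≫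
          B₄ ◁ (c D₁ A hA₂).hom ≫ (α_ B₄ A₂ D₁).inv ≫ (c B₄ A₂ e₃).hom ▷ D₁ ≫
            (α_ A₄ B₄ D₁).hom := by simp only [Category.assoc]
    _ = (α_ A B D).hom ≫ A ◁ (c B D k₁).hom ≫ ((c A (D₂ ⊗ B) e₅).hom ≫
        (c D₁ B' h₃).hom ▷ A) ≫ (α_ B₄ D₁ A).hom ≫
          B₄ ◁ (c D₁ A hA₂).hom ≫ (α_ B₄ A₂ D₁).inv ≫ (c B₄ A₂ e₃).hom ▷ D₁ ≫
            (α_ A₄ B₄ D₁).hom := by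
      rw [← r₂]; simp only [Category.assoc]
    _ = _ := by
      rw [← r₁]; simp

theorem double_conj (β : G) {A B A₁ B₁ A' B' A₁' B₁' : C} (hB : B' = conj (deg A) B)
    (hA : A' = conj (deg B') A) (kA : A₁ = conj β A) (kB : B₁ = conj β B)
    (kA' : A₁' = conj β A') (kB' : B₁' = conj β B')
    (hB₁ : B₁' = conj (deg A₁) B₁) (hA₁ : A₁' = conj (deg B₁') A₁)
    (s : A₁ ⊗ B₁ = conj β (A ⊗ B)) (t : A₁' ⊗ B₁' = conj β (A' ⊗ B')) :
    conjMap β (double A B hB hA).hom s t = (double A₁ B₁ hB₁ hA₁).hom := by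
  rw [double_hom, conjMap_comp β _ _ s (conj_tensor kB' kA) t,
    c_conj β A B hB kA kB kB' hB₁, c_conj β B' A hA kB' kA kA' hA₁, double_hom]

end CrossedBraiding

namespace TwistedObject

/-- The tensor product of `Cᶻ`, with
`t ⊗ t' = c_{⁽ᵁ⊗ᵁ'⁾U', ᵁU} ∘ c_{ᵁU, ᵁ'U'} ∘ (t ⊗ t')`. -/
abbrev tensorObj (X Y : TwistedObject C) : TwistedObject C where
  obj := X.obj ⊗ Y.obj
  t := (X.t ⊗ᵢ Y.t) ≪≫ c (conj (deg X.obj) X.obj) (conj (deg Y.obj) Y.obj) rfl ≪≫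
    c _ (conj (deg X.obj) X.obj) rfl ≪≫ eqToIso (twist_target rfl rfl rfl rfl)

theorem tensorObj_tw (X Y : TwistedObject C) {X₁ Y₁ X₂ Y₂ : C} (hX : X₁ = conj (deg X.obj) X.obj)
    (hY : Y₁ = conj (deg Y.obj) Y.obj) (h₁ : Y₂ = conj (deg X₁) Y₁) (h₂ : X₂ = conj (deg Y₂) X₁)
    (h : X₂ ⊗ Y₂ = conj (deg (X.obj ⊗ Y.obj)) (X.obj ⊗ Y.obj)) :
    ((tensorObj X Y).tw h).hom =
      ((X.tw hX).hom ⊗ₘ (Y.tw hY).hom) ≫ (double X₁ Y₁ h₁ h₂).hom := by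
  subst hX hY h₁ h₂
  simp [tw, double]

theorem tensor_comm {X₁ Y₁ X₂ Y₂ : TwistedObject C} (f : X₁ ⟶ Y₁) (g : X₂ ⟶ Y₂) :
    ∀ {X' Y' : C} (hX : X' = conj (deg (tensorObj X₁ X₂).obj) (tensorObj X₁ X₂).obj)
    (hY : Y' = conj (deg (tensorObj Y₁ Y₂).obj) (tensorObj Y₁ Y₂).obj)
    (hY' : Y' = conj (deg (tensorObj X₁ X₂).obj) (tensorObj Y₁ Y₂).obj),
    ((tensorObj X₁ X₂).tw hX).hom ≫ conjMap (deg (tensorObj X₁ X₂).obj) (f.f ⊗ₘ g.f) hX hY' =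
      (f.f ⊗ₘ g.f) ≫ ((tensorObj Y₁ Y₂).tw hY).hom := by
  have d₁ := deg_eq_of_hom f.f
  have d₂ := deg_eq_of_hom g.f
  obtain ⟨A, hA⟩ : ∃ A, A = conj (deg X₁.obj) X₁.obj := ⟨_, rfl⟩
  obtain ⟨B, hB⟩ : ∃ B, B = conj (deg X₂.obj) X₂.obj := ⟨_, rfl⟩
  obtain ⟨B', hB'⟩ : ∃ B', B' = conj (deg A) B := ⟨_, rfl⟩
  obtain ⟨A', hA'⟩ : ∃ A', A' = conj (deg B') A := ⟨_, rfl⟩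
  obtain ⟨P, hP⟩ : ∃ A, A = conj (deg Y₁.obj) Y₁.obj := ⟨_, rfl⟩
  obtain ⟨Q, hQ⟩ : ∃ B, B = conj (deg Y₂.obj) Y₂.obj := ⟨_, rfl⟩
  obtain ⟨Q', hQ'⟩ : ∃ B', B' = conj (deg P) Q := ⟨_, rfl⟩
  obtain ⟨P', hP'⟩ : ∃ A', A' = conj (deg Q') P := ⟨_, rfl⟩
  have kP : P = conj (deg X₁.obj) Y₁.obj := by rw [hP, d₁]
  have kQ : Q = conj (deg X₂.obj) Y₂.obj := by rw [hQ, d₂]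
  have dA := deg_eq_of_hom (conjMap _ f.f hA kP)
  have dB := deg_eq_of_hom (conjMap _ g.f hB kQ)
  have kQ' : Q' = conj (deg A) Q := by rw [hQ', dA]
  have dB' := deg_eq_of_hom (conjMap _ (conjMap _ g.f hB kQ) hB' kQ')
  have kP' : P' = conj (deg B') P := by rw [hP', dB']
  have s := twist_target hA hB hB' hA'
  have t := twist_target hP hQ hQ' hP'
  have t' : P' ⊗ Q' = conj (deg (X₁.obj ⊗ X₂.obj)) (Y₁.obj ⊗ Y₂.obj) := by
    rw [t]; congr 1; rw [deg_tensor, deg_tensor, d₁, d₂]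
  intro _ _ q₁ q₂ q₃
  refine comm_of (X := tensorObj X₁ X₂) (Y := tensorObj Y₁ Y₂) _ s t t' ?_ q₁ q₂ q₃
  rw [tensorObj_tw X₁ X₂ hA hB hB' hA' s, tensorObj_tw Y₁ Y₂ hP hQ hQ' hP' t]
  have n := double_natural (conjMap _ f.f hA kP) (conjMap _ g.f hB kQ) hB' hA' hQ' hP' kQ' kP'
  have m : deg B' * deg X₁.obj = deg (X₁.obj ⊗ X₂.obj) := by
    rw [hB', hA, hB]; simp only [deg_conj, deg_tensor]; group
  have m' : deg A * deg X₂.obj = deg (X₁.obj ⊗ X₂.obj) := by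
    rw [hA]; simp only [deg_conj, deg_tensor]; group
  have v₁ : A' = conj (deg (X₁.obj ⊗ X₂.obj)) X₁.obj := by rw [hA', hA, ← conj_comp, m]
  have v₂ : P' = conj (deg (X₁.obj ⊗ X₂.obj)) Y₁.obj := by rw [kP', kP, ← conj_comp, m]
  have v₃ : B' = conj (deg (X₁.obj ⊗ X₂.obj)) X₂.obj := by
    rw [← m', conj_comp, ← hB]; exact hB'
  have v₄ : Q' = conj (deg (X₁.obj ⊗ X₂.obj)) Y₂.obj := by
    rw [← m', conj_comp, ← kQ]; exact kQ'
  rw [conjMap_conjMap _ _ f.f _ _ _ _ _ m.symm v₁ v₂,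
    conjMap_conjMap _ _ g.f _ _ _ _ _ m'.symm v₃ v₄] at n
  rw [conjMap_tensorHom _ f.f g.f v₁ v₂ v₃ v₄, Category.assoc, ← n, ← Category.assoc,
    ← Category.assoc, tensorHom_comp_tensorHom, tensorHom_comp_tensorHom, f.comm hA hP kP,
    g.comm hB hQ kQ]

/-- The unit of `Cᶻ`. -/
abbrev tensorUnit : TwistedObject C where
  obj := 𝟙_ C
  t := eqToIso (by rw [deg_unit, conj_id])

/-- An isomorphism of `Cᶻ` from an isomorphism of the underlying objects. -/
@[simps]
def isoMk {X Y : TwistedObject C} (e : X.obj ≅ Y.obj)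
    (h : ∀ {X' Y' : C} (hX : X' = conj (deg X.obj) X.obj) (hY : Y' = conj (deg Y.obj) Y.obj)
    (hY' : Y' = conj (deg X.obj) Y.obj),
    (X.tw hX).hom ≫ conjMap (deg X.obj) e.hom hX hY' = e.hom ≫ (Y.tw hY).hom) : X ≅ Y where
  hom := ⟨e.hom, h⟩
  inv := ⟨e.inv, by
    have d := deg_eq_of_hom e.hom
    intro Y' X' hY hX hX'
    have k : Y' = conj (deg X.obj) Y.obj := by rw [hY, d]
    rw [← cancel_epi e.hom, ← Category.assoc, ← h hX hY k, Category.assoc,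
      conjMap_congr e.inv _ _ d.symm hY hX' k hX, conjMap_iso_inv]
    simp⟩
  hom_inv_id := by ext; simp
  inv_hom_id := by ext; simp

theorem associator_comm (X Y Z : TwistedObject C) :
    ∀ {X' Y' : C}
    (hX : X' = conj (deg ((X.obj ⊗ Y.obj) ⊗ Z.obj)) ((X.obj ⊗ Y.obj) ⊗ Z.obj))
    (hY : Y' = conj (deg (X.obj ⊗ Y.obj ⊗ Z.obj)) (X.obj ⊗ Y.obj ⊗ Z.obj))
    (hY' : Y' = conj (deg ((X.obj ⊗ Y.obj) ⊗ Z.obj)) (X.obj ⊗ Y.obj ⊗ Z.obj)),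
    ((tensorObj (tensorObj X Y) Z).tw hX).hom ≫
      conjMap (deg ((X.obj ⊗ Y.obj) ⊗ Z.obj)) (α_ X.obj Y.obj Z.obj).hom hX hY' =
      (α_ X.obj Y.obj Z.obj).hom ≫ ((tensorObj X (tensorObj Y Z)).tw hY).hom := by
  obtain ⟨A, hA⟩ : ∃ A, A = conj (deg X.obj) X.obj := ⟨_, rfl⟩
  obtain ⟨B, hB⟩ : ∃ A, A = conj (deg Y.obj) Y.obj := ⟨_, rfl⟩
  obtain ⟨D, hD⟩ : ∃ A, A = conj (deg Z.obj) Z.obj := ⟨_, rfl⟩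
  obtain ⟨B', hB'⟩ : ∃ B', B' = conj (deg A) B := ⟨_, rfl⟩
  obtain ⟨A', hA'⟩ : ∃ A', A' = conj (deg B') A := ⟨_, rfl⟩
  obtain ⟨D₁, h₁⟩ : ∃ D₁, D₁ = conj (deg (A' ⊗ B')) D := ⟨_, rfl⟩
  obtain ⟨A₄, h₂⟩ : ∃ A₄, A₄ = conj (deg D₁) A' := ⟨_, rfl⟩
  obtain ⟨B₄, h₃⟩ : ∃ B₄, B₄ = conj (deg D₁) B' := ⟨_, rfl⟩
  obtain ⟨D₂, k₁⟩ : ∃ D₂, D₂ = conj (deg B) D := ⟨_, rfl⟩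
  obtain ⟨B₂, k₂⟩ : ∃ B₂, B₂ = conj (deg D₂) B := ⟨_, rfl⟩
  have dA : deg A = deg X.obj := by rw [hA, deg_conj]; group
  have dB : deg B = deg Y.obj := by rw [hB, deg_conj]; group
  have dD : deg D = deg Z.obj := by rw [hD, deg_conj]; group
  have dAB : deg (A' ⊗ B') = deg A * deg B := by
    rw [deg_tensor, hA', hB']; simp only [deg_conj]; group
  have k₃ : D₁ = conj (deg A) D₂ := by rw [h₁, dAB, conj_comp, k₁]
  have k₄ : B₄ = conj (deg A) B₂ := by
    rw [h₃, k₂, hB', ← conj_comp, ← conj_comp, k₃, deg_conj]; congr 1; group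
  have k₅ : B₄ ⊗ D₁ = conj (deg A) (B₂ ⊗ D₂) := conj_tensor k₄ k₃
  have h₄ : A₄ ⊗ B₄ = conj (deg D₁) (A' ⊗ B') := conj_tensor h₂ h₃
  have k₆ : A₄ = conj (deg (B₄ ⊗ D₁)) A := by
    rw [h₂, hA', ← conj_comp, deg_tensor, h₃, deg_conj]; congr 1; group
  have u₁ := twist_target hA hB hB' hA'
  have u₂ := twist_target u₁ hD h₁ h₄
  have u₃ := twist_target hB hD k₁ k₂
  have u₄ := twist_target hA u₃ k₅ k₆
  have u₅ : A₄ ⊗ B₄ ⊗ D₁ = conj (deg ((X.obj ⊗ Y.obj) ⊗ Z.obj)) (X.obj ⊗ Y.obj ⊗ Z.obj) := by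
    rw [u₄]; congr 1; simp only [deg_tensor]; group
  intro _ _ q₁ q₂ q₃
  refine comm_of (X := tensorObj (tensorObj X Y) Z) (Y := tensorObj X (tensorObj Y Z)) _ u₂ u₄
    u₅ ?_ q₁ q₂ q₃
  have p₁ : A₄ = conj (deg ((X.obj ⊗ Y.obj) ⊗ Z.obj)) X.obj := by
    rw [k₆, hA, ← conj_comp]; congr 1; rw [deg_tensor, h₃, hB']
    simp only [deg_conj, deg_tensor, k₃, k₁, dA, dB, dD]; group
  have p₂ : B₄ = conj (deg ((X.obj ⊗ Y.obj) ⊗ Z.obj)) Y.obj := by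
    rw [k₄, k₂, hB, ← conj_comp, ← conj_comp]; congr 1
    simp only [deg_conj, deg_tensor, k₁, dA, dB, dD]; group
  have p₃ : D₁ = conj (deg ((X.obj ⊗ Y.obj) ⊗ Z.obj)) Z.obj := by
    rw [k₃, k₁, hD, ← conj_comp, ← conj_comp]; congr 1
    simp only [deg_tensor, dA, dB]
  rw [conjMap_associator_hom _ p₁ p₂ p₃, tensorObj_tw (tensorObj X Y) Z u₁ hD h₁ h₄ u₂,
    tensorObj_tw X Y hA hB hB' hA' u₁, tensorObj_tw X (tensorObj Y Z) hA u₃ k₅ k₆ u₄,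
    tensorObj_tw Y Z hB hD k₁ k₂ u₃]
  have key := double_associator hB' hA' h₁ h₂ h₃ h₄ k₁ k₂ k₃ k₄ k₅ k₆
  have e₁ : ((((X.tw hA).hom ⊗ₘ (Y.tw hB).hom) ≫ (double A B hB' hA').hom) ⊗ₘ (Z.tw hD).hom) =
      (((X.tw hA).hom ⊗ₘ (Y.tw hB).hom) ⊗ₘ (Z.tw hD).hom) ≫ (double A B hB' hA').hom ▷ D := by
    rw [← tensorHom_id, tensorHom_comp_tensorHom, Category.comp_id]
  have e₂ : ((X.tw hA).hom ⊗ₘ (((Y.tw hB).hom ⊗ₘ (Z.tw hD).hom) ≫ (double B D k₁ k₂).hom)) =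
      ((X.tw hA).hom ⊗ₘ ((Y.tw hB).hom ⊗ₘ (Z.tw hD).hom)) ≫ A ◁ (double B D k₁ k₂).hom := by
    rw [← id_tensorHom, tensorHom_comp_tensorHom, Category.comp_id]
  rw [e₁, e₂]
  simp only [Category.assoc]
  rw [key, associator_naturality_assoc]

instance : MonoidalCategoryStruct (TwistedObject C) where
  tensorObj := tensorObj
  tensorHom f g := ⟨f.f ⊗ₘ g.f, tensor_comm f g⟩
  whiskerLeft X _ _ f := ⟨X.obj ◁ f.f, by
    intro _ _ h₁ h₂ h₃
    have := tensor_comm (𝟙 X) f h₁ h₂ h₃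
    simp only [id_f, id_tensorHom] at this
    exact this⟩
  whiskerRight f Y := ⟨f.f ▷ Y.obj, by
    intro _ _ h₁ h₂ h₃
    have := tensor_comm f (𝟙 Y) h₁ h₂ h₃
    simp only [id_f, tensorHom_id] at this
    exact this⟩
  tensorUnit := tensorUnit
  associator X Y Z := isoMk (α_ X.obj Y.obj Z.obj) (associator_comm X Y Z)
  leftUnitor X := isoMk (λ_ X.obj) (by
    obtain ⟨A, hA⟩ : ∃ A, A = conj (deg X.obj) X.obj := ⟨_, rfl⟩
    have u : 𝟙_ C = conj (deg (𝟙_ C)) (𝟙_ C) := by rw [deg_unit, conj_id]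
    have h₁ : A = conj (deg (𝟙_ C)) A := by rw [deg_unit, conj_id]
    have h₂ : 𝟙_ C = conj (deg A) (𝟙_ C) := (Φ_unit _).symm
    have t := twist_target u hA h₁ h₂
    have hA' : A = conj (deg (𝟙_ C ⊗ X.obj)) X.obj := by rw [deg_tensor, deg_unit, one_mul, hA]
    intro _ _ q₁ q₂ q₃
    refine comm_of (X := tensorObj tensorUnit X) (λ_ X.obj).hom t hA hA' ?_ q₁ q₂ q₃
    rw [tensorObj_tw tensorUnit X u hA h₁ h₂ t, conjMap_leftUnitor_hom, double_hom,
      c_unit_left, c_unit_right]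
    subst hA
    simp [tw])
  rightUnitor X := isoMk (ρ_ X.obj) (by
    obtain ⟨A, hA⟩ : ∃ A, A = conj (deg X.obj) X.obj := ⟨_, rfl⟩
    have u : 𝟙_ C = conj (deg (𝟙_ C)) (𝟙_ C) := by rw [deg_unit, conj_id]
    have h₁ : A = conj (deg (𝟙_ C)) A := by rw [deg_unit, conj_id]
    have h₂ : 𝟙_ C = conj (deg A) (𝟙_ C) := (Φ_unit _).symm
    have t := twist_target hA u h₂ h₁
    have hA' : A = conj (deg (X.obj ⊗ 𝟙_ C)) X.obj := by rw [deg_tensor, deg_unit, mul_one, hA]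
    intro _ _ q₁ q₂ q₃
    refine comm_of (X := tensorObj X tensorUnit) (ρ_ X.obj).hom t hA hA' ?_ q₁ q₂ q₃
    rw [tensorObj_tw X tensorUnit hA u h₂ h₁ t, conjMap_rightUnitor_hom, double_hom,
      c_unit_left, c_unit_right]
    subst hA
    simp [tw])

@[simp] theorem tensor_obj (X Y : TwistedObject C) : (X ⊗ Y).obj = X.obj ⊗ Y.obj := rfl
@[simp] theorem unit_obj : (𝟙_ (TwistedObject C)).obj = 𝟙_ C := rfl
@[simp] theorem whiskerLeft_f (X : TwistedObject C) {Y₁ Y₂ : TwistedObject C} (f : Y₁ ⟶ Y₂) :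
    (X ◁ f).f = X.obj ◁ f.f := rfl
@[simp] theorem whiskerRight_f {X₁ X₂ : TwistedObject C} (f : X₁ ⟶ X₂) (Y : TwistedObject C) :
    (f ▷ Y).f = f.f ▷ Y.obj := rfl
@[simp] theorem tensorHom_f {X₁ X₂ Y₁ Y₂ : TwistedObject C} (f : X₁ ⟶ Y₁) (g : X₂ ⟶ Y₂) :
    (f ⊗ₘ g).f = f.f ⊗ₘ g.f := rfl
@[simp] theorem associator_hom_f (X Y Z : TwistedObject C) :
    (α_ X Y Z).hom.f = (α_ X.obj Y.obj Z.obj).hom := rfl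
@[simp] theorem associator_inv_f (X Y Z : TwistedObject C) :
    (α_ X Y Z).inv.f = (α_ X.obj Y.obj Z.obj).inv := rfl
@[simp] theorem leftUnitor_hom_f (X : TwistedObject C) : (λ_ X).hom.f = (λ_ X.obj).hom := rfl
@[simp] theorem rightUnitor_hom_f (X : TwistedObject C) : (ρ_ X).hom.f = (ρ_ X.obj).hom := rfl

instance : MonoidalCategory (TwistedObject C) :=
  Monoidal.induced forget
    { μIso := fun _ _ => Iso.refl _
      εIso := Iso.refl _
      whiskerLeft_eq := by intros; simp
      whiskerRight_eq := by intros; simp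
      tensorHom_eq := by intros; simp
      associator_eq := by intros; simp
      leftUnitor_eq := by intros; simp
      rightUnitor_eq := by intros; simp }

/-- The conjugation `Φ_β(U, t) = (Φ_β(U), Φ_β(t))`. -/
abbrev conjObj (β : G) (X : TwistedObject C) : TwistedObject C where
  obj := conj β X.obj
  t := conjIso β X.t rfl (conj_conj_eq rfl rfl rfl rfl).symm

theorem conjObj_tw (β : G) (X : TwistedObject C) {U U' V' : C} (hU : U = conj (deg X.obj) X.obj)
    (hU' : U' = conj β U) (hV : V' = conj (deg (conj β X.obj)) (conj β X.obj)) (hV' : V' = U') :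
    ((conjObj β X).tw hV).hom = conjMap β (X.tw hU).hom rfl (hV'.trans hU') := by
  subst hV' hU
  simp [tw, conjMap]

variable (C) in
/-- The conjugation functors of `Cᶻ`. -/
abbrev conjFunctor (β : G) : TwistedObject C ⥤ TwistedObject C where
  obj X := conjObj β X
  map {X Y} f := ⟨(Φ β).map f.f, by
    intro _ _ q₁ q₂ q₃
    have d := deg_eq_of_hom f.f
    obtain ⟨A, hA⟩ : ∃ A, A = conj (deg X.obj) X.obj := ⟨_, rfl⟩
    obtain ⟨B, hB⟩ : ∃ A, A = conj (deg Y.obj) Y.obj := ⟨_, rfl⟩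
    obtain ⟨A', hA'⟩ : ∃ A', A' = conj β A := ⟨_, rfl⟩
    obtain ⟨B', hB'⟩ : ∃ A', A' = conj β B := ⟨_, rfl⟩
    have hB₁ : B = conj (deg X.obj) Y.obj := by rw [hB, d]
    have e₁ : A' = conj (deg (conj β X.obj)) (conj β X.obj) := conj_conj_eq rfl rfl hA hA'
    have e₂ : B' = conj (deg (conj β Y.obj)) (conj β Y.obj) := conj_conj_eq rfl rfl hB hB'
    have e₃ : B' = conj (deg (conj β X.obj)) (conj β Y.obj) := conj_conj_eq rfl rfl hB₁ hB'
    refine comm_of (X := conjObj β X) (Y := conjObj β Y) _ e₁ e₂ e₃ ?_ q₁ q₂ q₃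
    rw [conjObj_tw β X hA hA' e₁ rfl, conjObj_tw β Y hB hB' e₂ rfl, ← conjMap_rfl]
    have hd : deg (conj β X.obj) * β = β * deg X.obj := by rw [deg_conj]; group
    rw [conjMap_conjMap _ _ f.f _ _ _ _ _ hd.symm (by rw [hA', hA, ← conj_comp])
      (by rw [hB', hB₁, ← conj_comp]),
      ← conjMap_conjMap β (deg X.obj) f.f hA hB₁ hA' hB' _ rfl, ← conjMap_comp,
      ← conjMap_comp, f.comm hA hB hB₁]⟩
  map_id X := by ext; simp
  map_comp f g := by ext; simp

theorem functor_ext {D : Type*} [Category D] {F F' : D ⥤ TwistedObject C}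
    (h : ∀ X, F.obj X = F'.obj X)
    (h' : ∀ {X Y : D} (f : X ⟶ Y), (F.map f).f = eqToHom (congrArg obj (h X)) ≫
      (F'.map f).f ≫ eqToHom (congrArg obj (h Y)).symm) : F = F' :=
  CategoryTheory.Functor.ext h (fun X Y f => by ext; simp [eqToHom_f, h' f])

theorem conjObj_tensor (β : G) (X Y : TwistedObject C) :
    conjObj β (X ⊗ Y) = conjObj β X ⊗ conjObj β Y :=
  obj_ext (Φ_tensor _ _ _) (by
    intro T q₁ q₂
    obtain ⟨A, hA⟩ : ∃ A, A = conj (deg X.obj) X.obj := ⟨_, rfl⟩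
    obtain ⟨B, hB⟩ : ∃ A, A = conj (deg Y.obj) Y.obj := ⟨_, rfl⟩
    obtain ⟨B₁, hB₁⟩ : ∃ B', B' = conj (deg A) B := ⟨_, rfl⟩
    obtain ⟨A₁, hA₁⟩ : ∃ A', A' = conj (deg B₁) A := ⟨_, rfl⟩
    obtain ⟨A', hA'⟩ : ∃ A', A' = conj β A := ⟨_, rfl⟩
    obtain ⟨B', hB'⟩ : ∃ A', A' = conj β B := ⟨_, rfl⟩
    obtain ⟨A₁', hA₁'⟩ : ∃ A', A' = conj β A₁ := ⟨_, rfl⟩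
    obtain ⟨B₁', hB₁'⟩ : ∃ A', A' = conj β B₁ := ⟨_, rfl⟩
    have a : A' = conj (deg (conj β X.obj)) (conj β X.obj) := conj_conj_eq rfl rfl hA hA'
    have b : B' = conj (deg (conj β Y.obj)) (conj β Y.obj) := conj_conj_eq rfl rfl hB hB'
    have b₁ : B₁' = conj (deg A') B' := conj_conj_eq hA' hB' hB₁ hB₁'
    have a₁ : A₁' = conj (deg B₁') A' := conj_conj_eq hB₁' hA' hA₁ hA₁'
    have t := twist_target hA hB hB₁ hA₁
    have t' := twist_target a b b₁ a₁
    obtain rfl : T = A₁' ⊗ B₁' := q₂.trans t'.symm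
    have e : A₁' ⊗ B₁' = conj β (A₁ ⊗ B₁) := conj_tensor hA₁' hB₁'
    refine (conjObj_tw β (X ⊗ Y) t e q₁ rfl).trans ?_
    refine Eq.trans ?_ (congrArg (fun k => _ ≫ k)
      (tensorObj_tw (conjObj β X) (conjObj β Y) a b b₁ a₁ t').symm)
    rw [conjObj_tw β X hA hA' a rfl, conjObj_tw β Y hB hB' b rfl,
      show ((X ⊗ Y).tw t).hom = _ from tensorObj_tw X Y hA hB hB₁ hA₁ t,
      ← double_conj β hB₁ hA₁ hA' hB' hA₁' hB₁' b₁ a₁ (conj_tensor hA' hB') e,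
      ← conjMap_tensorHom β _ _ rfl hA' rfl hB' (conj_tensor rfl rfl) (conj_tensor hA' hB'),
      ← conjMap_comp, conjMap_rename β _ _ _ (conj_tensor rfl rfl) e]
    simp)

theorem tensorUnit_tw {U' : C} (h : U' = conj (deg (𝟙_ C)) (𝟙_ C)) :
    ((𝟙_ (TwistedObject C) : TwistedObject C).tw h).hom =
      eqToHom (C := C) (X := 𝟙_ C) (Y := U') (by rw [h, deg_unit, conj_id]) := by
  change (eqToIso _ ≪≫ eqToIso _).hom = _
  simp

theorem conjObj_unit (β : G) : conjObj β (𝟙_ (TwistedObject C)) = 𝟙_ (TwistedObject C) :=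
  obj_ext (Φ_unit _) (by
    intro T q₁ q₂
    have h : 𝟙_ C = conj (deg (𝟙_ C)) (𝟙_ C) := by rw [deg_unit, conj_id]
    obtain rfl : T = 𝟙_ C := q₂.trans h.symm
    refine (conjObj_tw β (𝟙_ (TwistedObject C)) h (Φ_unit β).symm q₁ rfl).trans ?_
    refine Eq.trans ?_ (congrArg (fun k => _ ≫ k) (tensorUnit_tw q₂).symm)
    rw [tensorUnit_tw, conjMap_eqToHom, eqToHom_trans])

theorem conjFunctor_id : conjFunctor C (1 : G) = 𝟭 (TwistedObject C) :=
  functor_ext (fun X => obj_ext (conj_id _) (by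
      intro T q₁ q₂
      refine (conjObj_tw (1 : G) X q₂ (conj_id _).symm q₁ rfl).trans ?_
      rw [conjMap_rename 1 _ _ _ (conj_id _).symm (conj_id _).symm, conjMap_one _ _ rfl]
      simp))
    (fun f => Functor.congr_hom (Φ_one (G := G) (C := C)) f.f)

theorem conjFunctor_comp (β γ : G) :
    conjFunctor C (β * γ) = conjFunctor C γ ⋙ conjFunctor C β :=
  functor_ext (fun X => obj_ext (conj_comp _ _ _) (by
      intro T q₁ q₂
      obtain ⟨A, hA⟩ : ∃ A, A = conj (deg X.obj) X.obj := ⟨_, rfl⟩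
      have hA' : conj γ A = conj (deg (conj γ X.obj)) (conj γ X.obj) :=
        conj_conj_eq rfl rfl hA rfl
      obtain rfl : T = conj β (conj γ A) := q₂.trans (conj_conj_eq rfl rfl hA' rfl).symm
      refine (conjObj_tw (β * γ) X hA (conj_comp β γ A).symm q₁ rfl).trans ?_
      refine Eq.trans ?_ (congrArg (fun k => _ ≫ k)
        (conjObj_tw β (conjObj γ X) hA' rfl q₂ rfl).symm)
      rw [conjObj_tw γ X hA rfl hA' rfl, conjMap_conjMap β γ _ _ _ _ _ _ rfl
        (conj_comp _ _ _).symm (conj_comp _ _ _).symm,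
        conjMap_rename _ _ _ _ (conj_comp _ _ _).symm (conj_comp _ _ _).symm]
      simp))
    (fun f => Functor.congr_hom (Φ_mul (C := C) β γ) f.f)

instance : CrossedCategory G (TwistedObject C) where
  deg X := deg X.obj
  deg_eq_of_hom f := deg_eq_of_hom f.f
  deg_tensor X Y := deg_tensor X.obj Y.obj
  Φ β := conjFunctor C β
  deg_Φ β X := deg_Φ β X.obj
  Φ_one := conjFunctor_id
  Φ_mul := conjFunctor_comp
  Φ_tensor := conjObj_tensor
  Φ_unit := conjObj_unit
  Φ_map_tensor β X X' Y Y' f g := by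
    ext; simp only [comp_f, eqToHom_f]; exact Φ_map_tensor β f.f g.f
  Φ_associator β X Y Z := by
    ext; simp only [comp_f, eqToHom_f]; exact Φ_associator β X.obj Y.obj Z.obj
  Φ_leftUnitor β X := by
    ext; simp only [comp_f, eqToHom_f]; exact Φ_leftUnitor β X.obj
  Φ_rightUnitor β X := by
    ext; simp only [comp_f, eqToHom_f]; exact Φ_rightUnitor β X.obj

theorem conjMap_f (β : G) {X Y X' Y' : TwistedObject C} (f : X ⟶ Y) (hX : X' = conj β X)
    (hY : Y' = conj β Y) :
    (conjMap β f hX hY).f = conjMap β f.f (congrArg obj hX) (congrArg obj hY) := by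
  simp only [conjMap, comp_f, eqToHom_f]; rfl

theorem braiding_comm (X Y : TwistedObject C) {Y' : TwistedObject C} (h : Y' = conj (deg X) Y) :
    ∀ {P Q : C} (hX : P = conj (deg (X.obj ⊗ Y.obj)) (X.obj ⊗ Y.obj))
    (hY : Q = conj (deg (Y'.obj ⊗ X.obj)) (Y'.obj ⊗ X.obj))
    (hY' : Q = conj (deg (X.obj ⊗ Y.obj)) (Y'.obj ⊗ X.obj)),
    ((tensorObj X Y).tw hX).hom ≫
        conjMap (deg (X.obj ⊗ Y.obj)) (c X.obj Y.obj (congrArg obj h)).hom hX hY' =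
      (c X.obj Y.obj (congrArg obj h)).hom ≫ ((tensorObj Y' X).tw hY).hom := by
  subst h
  intro _ _ q₁ q₂ q₃
  obtain ⟨A, hA⟩ : ∃ A, A = conj (deg X.obj) X.obj := ⟨_, rfl⟩
  obtain ⟨B, hB⟩ : ∃ A, A = conj (deg Y.obj) Y.obj := ⟨_, rfl⟩
  obtain ⟨B₁, hB₁⟩ : ∃ B', B' = conj (deg A) B := ⟨_, rfl⟩
  obtain ⟨A₁, hA₁⟩ : ∃ A', A' = conj (deg B₁) A := ⟨_, rfl⟩
  obtain ⟨B₂, hB₂⟩ : ∃ B', B' = conj (deg A₁) B₁ := ⟨_, rfl⟩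
  have dA : deg A = deg X.obj := by rw [hA, deg_conj]; group
  have dB : deg B = deg Y.obj := by rw [hB, deg_conj]; group
  have hB₁' : B₁ = conj (deg X.obj) B := by rw [hB₁, dA]
  have hb : B₁ = conj (deg (conj (deg X.obj) Y.obj)) (conj (deg X.obj) Y.obj) :=
    conj_conj_eq rfl rfl hB hB₁'
  have t := twist_target hA hB hB₁ hA₁
  have t' := twist_target (X := conj (deg X.obj) Y.obj) hb hA hA₁ hB₂
  have t'' : B₂ ⊗ A₁ = conj (deg (X.obj ⊗ Y.obj)) (conj (deg X.obj) Y.obj ⊗ X.obj) := by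
    rw [t']; congr 1; simp only [deg_tensor, deg_conj]; group
  refine comm_of (X := tensorObj X Y) (Y := tensorObj (conj (deg X.obj) Y : TwistedObject C) X)
    _ t t' t'' ?_ q₁ q₂ q₃
  have v₁ : A₁ = conj (deg (X.obj ⊗ Y.obj)) X.obj := by
    rw [hA₁, hB₁', hA, ← conj_comp]; congr 1; simp only [deg_tensor, deg_conj, dB]; group
  have v₂ : B₁ = conj (deg (X.obj ⊗ Y.obj)) Y.obj := by
    rw [hB₁', hB, ← conj_comp, deg_tensor]
  have v₃ : B₂ = conj (deg (X.obj ⊗ Y.obj)) (conj (deg X.obj) Y.obj) := by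
    rw [hB₂, v₁, v₂, ← conj_comp, ← conj_comp, deg_conj]; congr 1; group
  rw [tensorObj_tw X Y hA hB hB₁ hA₁ t, tensorObj_tw _ X hb hA hA₁ hB₂ t',
    c_conj _ X.obj Y.obj rfl v₁ v₂ v₃ hB₂, double_hom, double_hom]
  have n := c_natural (X.tw hA).hom (Y.tw hB).hom (rfl : _ = conj (deg X.obj) Y.obj) hB₁ hB₁'
  rw [Category.assoc, Category.assoc, ← Category.assoc, n, Category.assoc,
    show ((conj (deg X.obj) Y : TwistedObject C).tw hb).hom = _ from
      conjObj_tw (deg X.obj) Y hB hB₁' hb rfl]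

instance : CrossedBraiding (TwistedObject C) where
  c X Y {Y'} h := isoMk (c X.obj Y.obj (congrArg obj h)) (braiding_comm X Y h)
  c_natural f g h h₁ h₂ := by
    ext
    simp only [comp_f, isoMk_hom_f, tensorHom_f, conjMap_f]
    exact c_natural f.f g.f _ _ _
  c_tensor_left X Y Z Z' Z'' h h₁ h₂ := by
    ext
    exact c_tensor_left X.obj Y.obj Z.obj (congrArg obj h) (congrArg obj h₁) (congrArg obj h₂)
  c_tensor_right X Y Z Y' Z' hY hZ h := by
    ext
    exact c_tensor_right X.obj Y.obj Z.obj (congrArg obj hY) (congrArg obj hZ) (congrArg obj h)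
  c_conj β X Y X' Y' Y₁ Y₁' h hX hY hY₁ h₁ hs ht := by
    ext
    rw [conjMap_f]
    exact c_conj β X.obj Y.obj (congrArg obj h) (congrArg obj hX) (congrArg obj hY)
      (congrArg obj hY₁) (congrArg obj h₁) (congrArg obj hs) (congrArg obj ht)

theorem tw_comm (X : TwistedObject C) {X' : TwistedObject C} (h : X' = conj (deg X) X) :
    ∀ {P Q : C} (hX : P = conj (deg X.obj) X.obj) (hY : Q = conj (deg X'.obj) X'.obj)
    (hY' : Q = conj (deg X.obj) X'.obj),
    (X.tw hX).hom ≫ conjMap (deg X.obj) (X.tw (congrArg obj h)).hom hX hY' =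
      (X.tw (congrArg obj h)).hom ≫ (X'.tw hY).hom := by
  subst h
  intro P Q hX hY hY'
  obtain rfl : P = conj (deg X.obj) X.obj := hX
  rw [show ((conj (deg X) X : TwistedObject C).tw hY).hom = _ from
    conjObj_tw (deg X.obj) X rfl hY' hY rfl]

instance : CrossedTwist (TwistedObject C) where
  θ X {X'} h := isoMk (X.tw (congrArg obj h)) (tw_comm X h)
  θ_natural {X Y X' Y'} f hX hY hY' := by
    ext
    simp only [comp_f, isoMk_hom_f, conjMap_f]
    exact (f.comm _ _ _).symm
  θ_tensor X Y X₁ Y₁ X₂ Y₂ hX hY h₁ h₂ h := by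
    ext
    exact tensorObj_tw X Y (congrArg obj hX) (congrArg obj hY) (congrArg obj h₁)
      (congrArg obj h₂) (congrArg obj h)
  θ_conj β X X₁ X' X₁' h hX hX₁ h' := by
    ext
    subst hX
    rw [conjMap_f]
    exact (conjObj_tw β X (congrArg obj h) (congrArg obj hX₁) (congrArg obj h') rfl).symm

end TwistedObject

end Braided

/-! ### Duals, ribbon structures and the ribbon extension -/

section Ribbon

variable {G : Type w} [Group G] {C : Type u} [Category.{v} C] [MonoidalCategory C]
  [CrossedCategory G C]

open CrossedBraiding CrossedTwist

/-- A left dual of an object of degree `α` has degree `α⁻¹`. -/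
theorem deg_dual (U V : C) [ExactPairing U V] : deg V = (deg U)⁻¹ := by
  have h := deg_eq_of_hom (η_ U V)
  rw [deg_unit, deg_tensor] at h
  exact eq_inv_of_mul_eq_one_right h.symm

/-- If `V = U*` and `V₁ = ᵁV`, then `V` is `ᵂV₁` for `W = V₁`. -/
theorem dual_eq_conj {U V V₁ : C} [ExactPairing U V] (hV : V₁ = conj (deg U) V) :
    V = conj (deg V₁) V₁ := by
  rw [hV, deg_conj, deg_dual U V, ← conj_comp]
  simp [conj_id]

/-- If `U₁ = ᵁU` and `U₂ = ᵁU₁`, then `U₁` is `ᵂU` for `W = U₂`. -/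
theorem eq_conj_deg {U U₁ U₂ : C} (h₁ : U₁ = conj (deg U) U) (h₂ : U₂ = conj (deg U) U₁) :
    U₁ = conj (deg U₂) U := by
  rw [h₂, h₁, deg_conj, deg_conj]
  simp

/-- If `U₁ = ᵁU` then the degree of `U₁` is that of `U`. -/
theorem deg_conj_self {U U₁ : C} (h₁ : U₁ = conj (deg U) U) : deg U₁ = deg U := by
  rw [h₁, deg_conj]; simp

/-- The left dual `V = U*`, with coevaluation `b : 𝟙 ⟶ U ⊗ V` and evaluation `d : V ⊗ U ⟶ 𝟙`, is
compatible with the conjugation: `Φ_β` preserves `V`, `b` and `d` for all `β` such that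
`Φ_β U = U`.  This means that `(Φ_β b, Φ_β d)` only depends on the object `Φ_β U`, so that it
defines a choice of left duals on the orbit of `U`. -/
def ConjStable (U V : C) [ExactPairing U V] : Prop :=
  ∀ (β : G) (hU : U = conj β U), ∃ hV : V = conj β V,
    conjMap β (η_ U V) (Φ_unit β).symm (conj_tensor hU hV) = η_ U V ∧
      conjMap β (ε_ U V) (conj_tensor hV hU) (Φ_unit β).symm = ε_ U V

/-- The tortility equation `(ᵁU ⊗ θ_{ᵁU*}) ∘ b_{ᵁU} = (θ_U ⊗ U*) ∘ b_U`, where `V = U*`,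
`U₁ = ᵁU`, `V₁ = ᵁV` and `b_{ᵁU} = ᵁ(b_U)`. -/
def Tortile [CrossedBraiding C] [CrossedTwist C] (U V : C) [ExactPairing U V] : Prop :=
  ∀ {U₁ V₁ : C} (hU : U₁ = conj (deg U) U) (hV : V₁ = conj (deg U) V),
    conjMap (deg U) (η_ U V) (Φ_unit (deg U)).symm (conj_tensor hU hV) ≫
        U₁ ◁ (θ V₁ (dual_eq_conj hV)).hom =
      η_ U V ≫ (θ U hU).hom ▷ V

/-- The equation `θ_U⁻² = ω_{(b_U, d_U)}`, where `V = U*`, where `U₁ = ᵁU`, `V₁ = ᵁV` and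
`U₂ = ᵁU₁`, `V₂ = ᵁV₁` are conjugates, where `θ_U² = (ᵁθ_U) ∘ θ_U : U ⟶ U₂` and where
`ω = (d_{U₂} ⊗ U) ∘ (V₂ ⊗ (c_{U₂, U})⁻¹) ∘ ((c_{U₁, V₁} ∘ b_{U₁}) ⊗ U₂)`. -/
def SquareTwist [CrossedBraiding C] [CrossedTwist C] (U V : C) [ExactPairing U V] : Prop :=
  ∀ {U₁ V₁ U₂ V₂ : C} (hU : U₁ = conj (deg U) U) (hV : V₁ = conj (deg U) V)
    (hU₁ : U₂ = conj (deg U) U₁) (hV₁ : V₂ = conj (deg U) V₁),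
    (θ U hU ≪≫ conjIso (deg U) (θ U hU) hU hU₁).inv =
      (λ_ U₂).inv ≫
        (conjMap (deg U) (η_ U V) (Φ_unit (deg U)).symm (conj_tensor hU hV) ≫
          (c U₁ V₁ (by rw [deg_conj_self hU, hV₁])).hom) ▷ U₂ ≫
        (α_ V₂ U₁ U₂).hom ≫
        V₂ ◁ (c U₂ U (eq_conj_deg hU hU₁)).inv ≫
        (α_ V₂ U₂ U).inv ≫
        conjMap (deg U * deg U) (ε_ U V)
          (conj_tensor (by rw [hV₁, hV, conj_comp]) (by rw [hU₁, hU, conj_comp]))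
          (Φ_unit (deg U * deg U)).symm ▷ U ≫
        (λ_ U).hom

/-- The objects of the full subcategory `𝒩(C)` of a balanced crossed `G`-category `C`. -/
def IsRibbonObject [CrossedBraiding C] [CrossedTwist C] (U : C) : Prop :=
  ∃ (V : C) (_ : ExactPairing U V), ConjStable U V ∧ Tortile U V ∧ SquareTwist U V

/-- `C` is left autonomous: a choice of left duals which is compatible with the conjugation. -/
structure CrossedLeftDuals (C : Type u) [Category.{v} C] [MonoidalCategory C]
    [CrossedCategory G C] where
  dual : C → C
  pairing : ∀ U : C, ExactPairing U (dual U)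
  dual_conj : ∀ (β : G) (U : C), dual (conj β U) = conj β (dual U)
  coev_conj : ∀ (β : G) (U : C),
    conjMap β (η_ U (dual U)) (Φ_unit β).symm (conj_tensor rfl (dual_conj β U)) =
      η_ (conj β U) (dual (conj β U))
  ev_conj : ∀ (β : G) (U : C),
    conjMap β (ε_ U (dual U)) (conj_tensor (dual_conj β U) rfl) (Φ_unit β).symm =
      ε_ (conj β U) (dual (conj β U))

variable (C) in
/-- The balanced crossed `G`-category `C` is ribbon. -/
def IsRibbonCategory [CrossedBraiding C] [CrossedTwist C] : Prop :=
  ∃ D : CrossedLeftDuals C, ∀ U : C, letI := D.pairing U; Tortile U (D.dual U)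

variable (C) in
/-- The ribbon extension `θ(C) = 𝒩(Cᶻ)` of a braided crossed `G`-category `C`, as a full
subcategory of `Cᶻ`. -/
def ribbonExtension [CrossedBraiding C] : ObjectProperty (TwistedObject C) :=
  fun U => IsRibbonObject U

end Ribbon

/-! ### Functors of crossed categories and fiber functors -/

section Functors

variable {G : Type w} [Group G]

/-- A strict functor of crossed `G`-categories. -/
structure CrossedFunctor (C : Type*) [Category* C] [MonoidalCategory C] [CrossedCategory G C]
    (D : Type*) [Category* D] [MonoidalCategory D] [CrossedCategory G D] where
  F : C ⥤ D
  deg_obj : ∀ X : C, deg (F.obj X) = deg X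
  obj_tensor : ∀ X Y : C, F.obj (X ⊗ Y) = F.obj X ⊗ F.obj Y
  obj_unit : F.obj (𝟙_ C) = 𝟙_ D
  map_tensor : ∀ {X X' Y Y' : C} (f : X ⟶ X') (g : Y ⟶ Y'),
    F.map (f ⊗ₘ g) =
      eqToHom (obj_tensor X Y) ≫ (F.map f ⊗ₘ F.map g) ≫ eqToHom (obj_tensor X' Y').symm
  map_associator : ∀ X Y Z : C,
    F.map (α_ X Y Z).hom =
      eqToHom (by rw [obj_tensor, obj_tensor]) ≫ (α_ (F.obj X) (F.obj Y) (F.obj Z)).hom ≫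
        eqToHom (by rw [obj_tensor, obj_tensor])
  map_leftUnitor : ∀ X : C,
    F.map (λ_ X).hom = eqToHom (by rw [obj_tensor, obj_unit]) ≫ (λ_ (F.obj X)).hom
  map_rightUnitor : ∀ X : C,
    F.map (ρ_ X).hom = eqToHom (by rw [obj_tensor, obj_unit]) ≫ (ρ_ (F.obj X)).hom
  obj_conj : ∀ (β : G) (X : C), F.obj (conj β X) = conj β (F.obj X)
  map_conj : ∀ (β : G) {X Y : C} (f : X ⟶ Y),
    F.map ((Φ β).map f) =
      eqToHom (obj_conj β X) ≫ (Φ β).map (F.map f) ≫ eqToHom (obj_conj β Y).symm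

namespace CrossedFunctor

variable {C : Type*} [Category* C] [MonoidalCategory C] [CrossedCategory G C]
  {D : Type*} [Category* D] [MonoidalCategory D] [CrossedCategory G D]

theorem obj_conj_deg (F : CrossedFunctor C D) {X Y Y' : C} (h : Y' = conj (deg X) Y) :
    F.F.obj Y' = conj (deg (F.F.obj X)) (F.F.obj Y) := by
  rw [h, F.obj_conj, F.deg_obj]

/-- `F` preserves the braidings. -/
def IsBraided [CrossedBraiding C] [CrossedBraiding D] (F : CrossedFunctor C D) : Prop :=
  ∀ (X Y : C) {Y' : C} (h : Y' = conj (deg X) Y),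
    F.F.map (CrossedBraiding.c X Y h).hom =
      eqToHom (F.obj_tensor X Y) ≫
        (CrossedBraiding.c (F.F.obj X) (F.F.obj Y) (F.obj_conj_deg h)).hom ≫
          eqToHom (F.obj_tensor Y' X).symm

/-- `F` preserves the twists. -/
def IsBalanced [CrossedBraiding C] [CrossedBraiding D] [CrossedTwist C] [CrossedTwist D]
    (F : CrossedFunctor C D) : Prop :=
  ∀ (X : C) {X' : C} (h : X' = conj (deg X) X),
    F.F.map (CrossedTwist.θ X h).hom = (CrossedTwist.θ (F.F.obj X) (F.obj_conj_deg h)).hom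

/-- `F` is an isomorphism of categories from `C` to the full subcategory of `D` on the objects
which satisfy `P`. -/
structure IsIsoOnto (F : CrossedFunctor C D) (P : ObjectProperty D) : Prop where
  full : F.F.Full
  faithful : F.F.Faithful
  injective : Function.Injective F.F.obj
  range : ∀ Y : D, P Y ↔ ∃ X : C, F.F.obj X = Y

/-- `F` is an equivalence of categories from `C` to the full subcategory of `D` on the objects
which satisfy `P`. -/
structure IsEquivOnto (F : CrossedFunctor C D) (P : ObjectProperty D) : Prop where
  full : F.F.Full
  faithful : F.F.Faithful
  prop_obj : ∀ X : C, P (F.F.obj X)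
  essSurj : ∀ Y : D, P Y → ∃ X : C, Nonempty (F.F.obj X ≅ Y)

end CrossedFunctor

/-- A fiber functor on a crossed `G`-category: a faithful tensor functor to finite-dimensional
vector spaces, with natural isomorphisms `φ β : F ≅ F ∘ Φ_β` which are compatible with the
composition of the functors `Φ_β`.  (The exactness of a fiber functor on an abelian crossed
category is a property, not a structure; it plays no role for the notion of an isomorphism or
an equivalence of Tannakian crossed categories.) -/
structure CrossedFiberFunctor (K : Type u) [Field K] (C : Type*) [Category* C]
    [MonoidalCategory C] [CrossedCategory G C] where
  F : C ⥤ ModuleCat.{u} K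
  faithful : F.Faithful
  finite : ∀ X : C, Module.Finite K (F.obj X)
  monoidal : F.Monoidal
  φ : ∀ β : G, F ≅ Φ β ⋙ F
  φ_one : ∀ X : C, (φ 1).hom.app X = F.map (eqToHom (conj_id X).symm)
  φ_mul : ∀ (β γ : G) (X : C),
    (φ (β * γ)).hom.app X =
      (φ γ).hom.app X ≫ (φ β).hom.app (conj γ X) ≫ F.map (eqToHom (conj_comp β γ X).symm)

namespace CrossedFiberFunctor

variable {K : Type u} [Field K] {C : Type*} [Category* C] [MonoidalCategory C]
  [CrossedCategory G C]

attribute [instance] monoidal faithful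

/-- The composite of the forgetful functor `Z : 𝒵(C) ⥤ C` and a fiber functor. -/
def center (X : CrossedFiberFunctor K C) : CrossedFiberFunctor K (CrossedCenter C) where
  F := CrossedCenter.forget ⋙ X.F
  faithful := inferInstance
  finite U := X.finite U.obj
  monoidal :=
    letI : (CrossedCenter.forget (C := C)).Monoidal := Functor.CoreMonoidal.toMonoidal
      { εIso := Iso.refl _
        μIso := fun _ _ => Iso.refl _ }
    inferInstance
  φ β := NatIso.ofComponents (fun U => (X.φ β).app U.obj)
    (fun f => (X.φ β).hom.naturality f.f)
  φ_one U := by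
    refine (X.φ_one U.obj).trans ?_
    simp only [Functor.comp_map, CrossedCenter.eqToHom_f]
  φ_mul β γ U := by
    refine (X.φ_mul β γ U.obj).trans ?_
    simp only [Functor.comp_map, CrossedCenter.eqToHom_f]
    rfl

/-- The composite of the forgetful functor `Cᶻ ⥤ C` and a fiber functor. -/
def twisted [CrossedBraiding C] (X : CrossedFiberFunctor K C) :
    CrossedFiberFunctor K (TwistedObject C) where
  F := TwistedObject.forget ⋙ X.F
  faithful := inferInstance
  finite U := X.finite U.obj
  monoidal :=
    letI : (TwistedObject.forget (C := C)).Monoidal := Functor.CoreMonoidal.toMonoidal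
      { εIso := Iso.refl _
        μIso := fun _ _ => Iso.refl _ }
    inferInstance
  φ β := NatIso.ofComponents (fun U => (X.φ β).app U.obj)
    (fun f => (X.φ β).hom.naturality f.f)
  φ_one U := by
    refine (X.φ_one U.obj).trans ?_
    simp only [Functor.comp_map, TwistedObject.eqToHom_f]
  φ_mul β γ U := by
    refine (X.φ_mul β γ U.obj).trans ?_
    simp only [Functor.comp_map, TwistedObject.eqToHom_f]
    rfl

end CrossedFiberFunctor

open Functor.LaxMonoidal in
/-- The equation `X = Y ∘ F` of fiber functors. -/
structure CrossedFunctor.PreservesFiber {K : Type u} [Field K] {C : Type*} [Category* C]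
    [MonoidalCategory C] [CrossedCategory G C] {D : Type*} [Category* D] [MonoidalCategory D]
    [CrossedCategory G D] (F : CrossedFunctor C D) (X : CrossedFiberFunctor K C)
    (Y : CrossedFiberFunctor K D) : Prop where
  obj : ∀ A : C, X.F.obj A = Y.F.obj (F.F.obj A)
  map : ∀ {A B : C} (f : A ⟶ B),
    X.F.map f = eqToHom (obj A) ≫ Y.F.map (F.F.map f) ≫ eqToHom (obj B).symm
  unit : ε X.F =
    ε Y.F ≫ Y.F.map (eqToHom F.obj_unit.symm) ≫ eqToHom (obj (𝟙_ C)).symm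
  tensor : ∀ A B : C, μ X.F A B =
    (eqToHom (obj A) ⊗ₘ eqToHom (obj B)) ≫ μ Y.F (F.F.obj A) (F.F.obj B) ≫
      Y.F.map (eqToHom (F.obj_tensor A B).symm) ≫ eqToHom (obj (A ⊗ B)).symm
  conj : ∀ (β : G) (A : C), (X.φ β).hom.app A =
    eqToHom (obj A) ≫ (Y.φ β).hom.app (F.F.obj A) ≫
      Y.F.map (eqToHom (F.obj_conj β A).symm) ≫ eqToHom (obj (CrossedCategory.conj β A)).symm

end Functors

/-! ### Coactions of coalgebras -/

section Coaction

open TensorProduct Coalgebra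

variable {K : Type u} [Field K]

/-- A (left) coaction of the coalgebra `A` on `V`. -/
structure IsCoaction (A : Type u) [AddCommGroup A] [Module K A] [Coalgebra K A] {V : Type u}
    [AddCommGroup V] [Module K V] (ρ : V →ₗ[K] A ⊗[K] V) : Prop where
  coassoc : ∀ m : V, TensorProduct.assoc K A A V ((comul (R := K) (A := A)).rTensor V (ρ m)) =
    ρ.lTensor A (ρ m)
  counit : ∀ m : V, TensorProduct.lid K V ((counit (R := K) (A := A)).rTensor V (ρ m)) = m

variable {A B : Type u} [AddCommGroup A] [Module K A] [AddCommGroup B] [Module K B] {V W : Type u} [AddCommGroup V] [Module K V] [AddCommGroup W] [Module K W]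

/-- The coaction `m ↦ f(m') ⊗ m''` -/
def pushCoaction (f : A →ₗ[K] B) (ρ : V →ₗ[K] A ⊗[K] V) : V →ₗ[K] B ⊗[K] V := f.rTensor V ∘ₗ ρ

theorem pushCoaction_apply (f : A →ₗ[K] B) (ρ : V →ₗ[K] A ⊗[K] V) (m : V) :
    pushCoaction f ρ m = f.rTensor V (ρ m) := rfl

/-- The map `m ⊗ n ↦ (m' ⊗ n') ⊗ (m'' ⊗ n'')`. -/
def prodCoaction (ρ : V →ₗ[K] A ⊗[K] V) (σ : W →ₗ[K] B ⊗[K] W) :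
    V ⊗[K] W →ₗ[K] (A ⊗[K] B) ⊗[K] (V ⊗[K] W) :=
  (TensorProduct.tensorTensorTensorComm K A V B W).toLinearMap ∘ₗ TensorProduct.map ρ σ

theorem prodCoaction_tmul (ρ : V →ₗ[K] A ⊗[K] V) (σ : W →ₗ[K] B ⊗[K] W) (m : V) (n : W) :
    prodCoaction ρ σ (m ⊗ₜ n) = TensorProduct.tensorTensorTensorComm K A V B W (ρ m ⊗ₜ σ n) := rfl

/-- The endomorphism `m ↦ f(m') m''`. -/
def coact (f : A →ₗ[K] K) (ρ : V →ₗ[K] A ⊗[K] V) : V →ₗ[K] V :=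
  (TensorProduct.lid K V).toLinearMap ∘ₗ f.rTensor V ∘ₗ ρ

theorem coact_apply (f : A →ₗ[K] K) (ρ : V →ₗ[K] A ⊗[K] V) (m : V) :
    coact f ρ m = TensorProduct.lid K V (f.rTensor V (ρ m)) := rfl

variable [Coalgebra K A] [Coalgebra K B]

/-- The convolution product `a ↦ f(a') g(a'')`. -/
def convProd (f g : A →ₗ[K] K) : A →ₗ[K] K :=
  (TensorProduct.lid K K).toLinearMap ∘ₗ TensorProduct.map f g ∘ₗ comul

theorem IsCoaction.push {ρ : V →ₗ[K] A ⊗[K] V} (h : IsCoaction A ρ) (f : A →ₗc[K] B) :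
    IsCoaction B (pushCoaction f.toLinearMap ρ) where
  coassoc m := by
    have e : ∀ x : A ⊗[K] V, TensorProduct.assoc K B B V
        ((comul (R := K) (A := B)).rTensor V (f.toLinearMap.rTensor V x)) =
        TensorProduct.map f.toLinearMap (f.toLinearMap.rTensor V)
          (TensorProduct.assoc K A A V ((comul (R := K) (A := A)).rTensor V x)) := by
      intro x
      induction x with
      | zero => simp
      | add x y hx hy => simp only [map_add, hx, hy]
      | tmul a v =>
        have := f.map_comp_comul
        have := LinearMap.congr_fun this a
        simp only [LinearMap.rTensor_tmul, LinearMap.comp_apply] at this ⊢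
        rw [← this]
        generalize comul (R := K) a = y
        induction y with
        | zero => simp
        | add x y hx hy => simp only [map_add, add_tmul, hx, hy]
        | tmul b c => simp
    have e' : ∀ x : A ⊗[K] V, TensorProduct.map f.toLinearMap (f.toLinearMap.rTensor V)
        (ρ.lTensor A x) =
        (pushCoaction f.toLinearMap ρ).lTensor B (f.toLinearMap.rTensor V x) := by
      intro x
      induction x with
      | zero => simp
      | add x y hx hy => simp only [map_add, hx, hy]
      | tmul a v => simp [pushCoaction]
    rw [pushCoaction_apply, e, h.coassoc, e']
  counit m := by
    have e := f.counit_comp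
    rw [pushCoaction_apply, ← LinearMap.comp_apply, ← LinearMap.rTensor_comp, e, h.counit]

theorem IsCoaction.prod {ρ : V →ₗ[K] A ⊗[K] V} {σ : W →ₗ[K] B ⊗[K] W} (h : IsCoaction A ρ)
    (k : IsCoaction B σ) : IsCoaction (A ⊗[K] B) (prodCoaction ρ σ) where
  coassoc p := by
    let T : (A ⊗[K] (A ⊗[K] V)) ⊗[K] (B ⊗[K] (B ⊗[K] W)) →ₗ[K]
        (A ⊗[K] B) ⊗[K] ((A ⊗[K] B) ⊗[K] (V ⊗[K] W)) :=
      (TensorProduct.tensorTensorTensorComm K A V B W).toLinearMap.lTensor (A ⊗[K] B) ∘ₗ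
        (TensorProduct.tensorTensorTensorComm K A (A ⊗[K] V) B (B ⊗[K] W)).toLinearMap
    have e₁ : ∀ (x : A ⊗[K] V) (y : B ⊗[K] W),
        TensorProduct.assoc K (A ⊗[K] B) (A ⊗[K] B) (V ⊗[K] W)
          ((comul (R := K) (A := A ⊗[K] B)).rTensor (V ⊗[K] W)
            (TensorProduct.tensorTensorTensorComm K A V B W (x ⊗ₜ y))) =
        T (TensorProduct.assoc K A A V ((comul (R := K) (A := A)).rTensor V x) ⊗ₜ
          TensorProduct.assoc K B B W ((comul (R := K) (A := B)).rTensor W y)) := by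
      intro x y
      induction x with
      | zero => simp
      | add x x' hx hx' => simp only [map_add, add_tmul, hx, hx']
      | tmul a v =>
      induction y with
      | zero => simp
      | add x x' hx hx' => simp only [map_add, tmul_add, hx, hx']
      | tmul b w =>
        simp only [LinearMap.rTensor_tmul, tensorTensorTensorComm_tmul,
          TensorProduct.comul_tmul]
        generalize comul (R := K) a = r
        generalize comul (R := K) b = s
        induction r with
        | zero => simp
        | add x x' hx hx' => simp only [map_add, add_tmul, hx, hx']
        | tmul a₁ a₂ =>
        induction s with
        | zero => simp
        | add x x' hx hx' => simp only [map_add, add_tmul, tmul_add, hx, hx']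
        | tmul b₁ b₂ => simp [T]
    have e₂ : ∀ (x : A ⊗[K] V) (y : B ⊗[K] W),
        (prodCoaction ρ σ).lTensor (A ⊗[K] B)
            (TensorProduct.tensorTensorTensorComm K A V B W (x ⊗ₜ y)) =
        T (ρ.lTensor A x ⊗ₜ σ.lTensor B y) := by
      intro x y
      induction x with
      | zero => simp
      | add x x' hx hx' => simp only [map_add, add_tmul, hx, hx']
      | tmul a v =>
      induction y with
      | zero => simp
      | add x x' hx hx' => simp only [map_add, tmul_add, hx, hx']
      | tmul b w => simp [T, prodCoaction_tmul]
    induction p with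
    | zero => simp
    | add x y hx hy => simp only [map_add, hx, hy]
    | tmul m n => rw [prodCoaction_tmul, e₁, e₂, h.coassoc, k.coassoc]
  counit p := by
    have e : ∀ (x : A ⊗[K] V) (y : B ⊗[K] W), TensorProduct.lid K (V ⊗[K] W)
          ((Coalgebra.counit (R := K) (A := A ⊗[K] B)).rTensor (V ⊗[K] W)
            (TensorProduct.tensorTensorTensorComm K A V B W (x ⊗ₜ y))) =
        (TensorProduct.lid K V ((Coalgebra.counit (R := K) (A := A)).rTensor V x)) ⊗ₜ
          (TensorProduct.lid K W ((Coalgebra.counit (R := K) (A := B)).rTensor W y)) := by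
      intro x y
      induction x with
      | zero => simp
      | add x x' hx hx' => simp only [map_add, add_tmul, hx, hx']
      | tmul a v =>
      induction y with
      | zero => simp
      | add x x' hx hx' => simp only [map_add, tmul_add, hx, hx']
      | tmul b w => simp [smul_tmul, tmul_smul, smul_smul, mul_comm]
    induction p with
    | zero => simp
    | add x y hx hy => simp only [map_add, hx, hy]
    | tmul m n => rw [prodCoaction_tmul, e, h.counit, k.counit]

theorem IsCoaction.rTensor_coact {ρ : V →ₗ[K] A ⊗[K] V} (h : IsCoaction A ρ) {B : Type u}
    [AddCommGroup B] [Module K B] (t : A →ₗ[K] B) (f : A →ₗ[K] K) (m : V) :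
    t.rTensor V (ρ (coact f ρ m)) =
      ((TensorProduct.lid K B).toLinearMap ∘ₗ TensorProduct.map f t ∘ₗ comul).rTensor V (ρ m) := by
  have e : ∀ x : A ⊗[K] V, t.rTensor V (ρ (TensorProduct.lid K V (f.rTensor V x))) =
      TensorProduct.lid K _ (TensorProduct.map f (t.rTensor V) (ρ.lTensor A x)) := by
    intro x
    induction x with
    | zero => simp
    | add x y hx hy => simp only [map_add, hx, hy]
    | tmul a v => simp
  have e' : ∀ x : A ⊗[K] V, TensorProduct.lid K _ (TensorProduct.map f (t.rTensor V)
        (TensorProduct.assoc K A A V ((comul (R := K) (A := A)).rTensor V x))) =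
      ((TensorProduct.lid K B).toLinearMap ∘ₗ TensorProduct.map f t ∘ₗ comul).rTensor V x := by
    intro x
    induction x with
    | zero => simp
    | add x y hx hy => simp only [map_add, hx, hy]
    | tmul a v =>
      simp only [LinearMap.rTensor_tmul, LinearMap.comp_apply]
      generalize comul (R := K) a = y
      induction y with
      | zero => simp
      | add x y hx hy => simp only [map_add, add_tmul, hx, hy]
      | tmul b c => simp [smul_tmul']
  rw [coact_apply, e, ← h.coassoc, e']

theorem IsCoaction.lTensor_coact {ρ : V →ₗ[K] A ⊗[K] V} (h : IsCoaction A ρ) {B : Type u}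
    [AddCommGroup B] [Module K B] (t : A →ₗ[K] B) (f : A →ₗ[K] K) (m : V) :
    (coact f ρ).lTensor B (t.rTensor V (ρ m)) =
      ((TensorProduct.rid K B).toLinearMap ∘ₗ TensorProduct.map t f ∘ₗ comul).rTensor V (ρ m) := by
  let S : A ⊗[K] (A ⊗[K] V) →ₗ[K] B ⊗[K] V :=
    TensorProduct.map t ((TensorProduct.lid K V).toLinearMap ∘ₗ f.rTensor V)
  have e : ∀ x : A ⊗[K] V, (coact f ρ).lTensor B (t.rTensor V x) = S (ρ.lTensor A x) := by
    intro x
    induction x with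
    | zero => simp
    | add x y hx hy => simp only [map_add, hx, hy]
    | tmul a v => simp [S, coact]
  have e' : ∀ x : A ⊗[K] V,
      S (TensorProduct.assoc K A A V ((comul (R := K) (A := A)).rTensor V x)) =
      ((TensorProduct.rid K B).toLinearMap ∘ₗ TensorProduct.map t f ∘ₗ comul).rTensor V x := by
    intro x
    induction x with
    | zero => simp
    | add x y hx hy => simp only [map_add, hx, hy]
    | tmul a v =>
      simp only [LinearMap.rTensor_tmul, LinearMap.comp_apply]
      generalize comul (R := K) a = y
      induction y with
      | zero => simp
      | add x y hx hy => simp only [map_add, add_tmul, hx, hy]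
      | tmul b c => simp [S, smul_tmul]
  rw [e, ← h.coassoc, e']

theorem IsCoaction.coact_coact {ρ : V →ₗ[K] A ⊗[K] V} (h : IsCoaction A ρ) (f g : A →ₗ[K] K)
    (m : V) : coact f ρ (coact g ρ m) = coact (convProd g f) ρ m := by
  rw [coact_apply f, h.rTensor_coact f g m, coact_apply]
  rfl

theorem IsCoaction.coact_counit {ρ : V →ₗ[K] A ⊗[K] V} (h : IsCoaction A ρ) :
    coact Coalgebra.counit ρ = LinearMap.id := LinearMap.ext h.counit

end Coaction

/-! ### Crossed Hopf algebras -/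

section CrossedHopf

open TensorProduct Coalgebra

/-- A crossed Hopf `G`-algebra over `K`, in packed form: a Hopf algebra `H` with bijective antipode,
which is the direct sum of subcoalgebras `H_α`, `α ∈ G`, with `H_α H_β ⊆ H_{αβ}`, `1 ∈ H_1`,
`S(H_α) ⊆ H_{α⁻¹}`, and an action `φ` of `G` by automorphisms of the Hopf algebra `H` with
`φ_β(H_α) ⊆ H_{βαβ⁻¹}`. -/
structure CrossedHopfAlgebra (K : Type u) [Field K] (G : Type u) [Group G] where
  carrier : Type u
  [ring : Ring carrier]
  [hopf : HopfAlgebra K carrier]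
  comp : G → Submodule K carrier
  indep : iSupIndep comp
  iSup_comp : ⨆ α, comp α = ⊤
  comul_mem : ∀ (α : G), ∀ h ∈ comp α,
    comul (R := K) h ∈ LinearMap.range (TensorProduct.mapIncl (comp α) (comp α))
  one_mem : (1 : carrier) ∈ comp 1
  mul_mem : ∀ {α β : G} {h k : carrier}, h ∈ comp α → k ∈ comp β → h * k ∈ comp (α * β)
  antipode_mem : ∀ {α : G} {h : carrier}, h ∈ comp α → HopfAlgebra.antipode K h ∈ comp α⁻¹
  antipode_bijective : Function.Bijective (HopfAlgebra.antipode K : carrier →ₗ[K] carrier)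
  φ : G → (carrier ≃ₐc[K] carrier)
  φ_one : ∀ h : carrier, φ 1 h = h
  φ_mul : ∀ (β γ : G) (h : carrier), φ (β * γ) h = φ β (φ γ h)
  φ_mem : ∀ (β : G) {α : G} {h : carrier}, h ∈ comp α → φ β h ∈ comp (β * α * β⁻¹)

attribute [instance] CrossedHopfAlgebra.ring CrossedHopfAlgebra.hopf

variable {K : Type u} [Field K] {G : Type u} [Group G]

namespace CrossedHopfAlgebra

/-- The linear map underlying `φ_β`. -/
def φl (H : CrossedHopfAlgebra K G) (β : G) : H.carrier →ₗ[K] H.carrier :=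
  (H.φ β).toCoalgEquiv.toCoalgHom.toLinearMap

@[simp] theorem φl_apply (H : CrossedHopfAlgebra K G) (β : G) (h : H.carrier) :
    H.φl β h = H.φ β h := rfl

/-- A cobraided (coquasitriangular) structure `γ_{α,β} : H_α ⊗ H_β → K` on `H`, packed into a
linear map `γ : H ⊗ H → K`. -/
@[ext]
structure Cobraiding (H : CrossedHopfAlgebra K G) where
  γ : H.carrier ⊗[K] H.carrier →ₗ[K] K
  /-- `γ` is invertible for the convolution product. -/
  invertible : ∃ γ' : H.carrier ⊗[K] H.carrier →ₗ[K] K,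
    convProd γ' γ = Coalgebra.counit ∧ convProd γ γ' = Coalgebra.counit
  /-- `k' h' γ(h'' ⊗ k'') = γ(h' ⊗ k') φ_β(h'') k''` for `k ∈ H_β` -/
  mul_comm' : ∀ (β : G) (h k : H.carrier), k ∈ H.comp β →
    TensorProduct.rid K H.carrier
        (TensorProduct.map
          (LinearMap.mul' K H.carrier ∘ₗ (TensorProduct.comm K H.carrier H.carrier).toLinearMap) γ
          (comul (R := K) (h ⊗ₜ[K] k))) =
      TensorProduct.lid K H.carrier
        (TensorProduct.map γ (LinearMap.mul' K H.carrier ∘ₗ (H.φl β).rTensor H.carrier)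
          (comul (R := K) (h ⊗ₜ[K] k)))
  /-- `γ(h₁ h₂ ⊗ k) = γ(h₁ ⊗ k') γ(h₂ ⊗ k'')` -/
  mul_left : ∀ h₁ h₂ k : H.carrier,
    γ ((h₁ * h₂) ⊗ₜ k) =
      LinearMap.mul' K K
        (TensorProduct.map (TensorProduct.curry γ h₁) (TensorProduct.curry γ h₂)
          (comul (R := K) k))
  /-- `γ(h ⊗ k₁ k₂) = γ(h' ⊗ k₂) γ(φ_β(h'') ⊗ k₁)` for `k₂ ∈ H_β` -/
  mul_right : ∀ (β : G) (h k₁ k₂ : H.carrier), k₂ ∈ H.comp β →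
    γ (h ⊗ₜ (k₁ * k₂)) =
      LinearMap.mul' K K
        (TensorProduct.map ((TensorProduct.curry γ).flip k₂)
          ((TensorProduct.curry γ).flip k₁ ∘ₗ H.φl β) (comul (R := K) h))
  /-- `γ(φ_β(h) ⊗ φ_β(k)) = γ(h ⊗ k)` -/
  φ_invariant : ∀ (β : G) (h k : H.carrier), γ (H.φ β h ⊗ₜ H.φ β k) = γ (h ⊗ₜ k)

/-- The functional `h'' ⊗ h''' ⊗ k'' ⊗ k''' ↦ τ(h'') τ(φ_α k'') γ(h''' ⊗ φ_β k''')`, which is used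
for `h ∈ H_α` and `k ∈ H_β`. -/
noncomputable def twistTail (H : CrossedHopfAlgebra K G) (c : H.Cobraiding) (τ : H.carrier →ₗ[K] K) (α β : G) :
    H.carrier ⊗[K] H.carrier →ₗ[K] K :=
  convProd
    (LinearMap.mul' K K ∘ₗ TensorProduct.map τ (τ ∘ₗ H.φl α))
    (c.γ ∘ₗ (H.φl β).lTensor H.carrier)

/-- A cotwisted structure `τ_α : H_α → K` on a cobraided crossed Hopf `G`-algebra `H`, packed into a
linear map `τ : H → K`. -/
@[ext]
structure Cotwist (H : CrossedHopfAlgebra K G) (c : H.Cobraiding) where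
  τ : H.carrier →ₗ[K] K
  /-- `τ` is invertible for the convolution product. -/
  invertible : ∃ τ' : H.carrier →ₗ[K] K,
    convProd τ τ' = Coalgebra.counit ∧ convProd τ' τ = Coalgebra.counit
  /-- `τ(h') φ_α(h'') = h' τ(h'')` for `h ∈ H_α` -/
  central : ∀ (α : G) (h : H.carrier), h ∈ H.comp α →
    TensorProduct.lid K H.carrier (TensorProduct.map τ (H.φl α) (comul (R := K) h)) =
      TensorProduct.rid K H.carrier (TensorProduct.map LinearMap.id τ (comul (R := K) h))
  /-- `τ(h k) = γ(k' ⊗ h') τ(h'') τ(φ_α k'') γ(h''' ⊗ φ_β k''')` for `h ∈ H_α` and `k ∈ H_β` -/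
  mul : ∀ (α β : G) (h k : H.carrier), h ∈ H.comp α → k ∈ H.comp β →
    τ (h * k) =
      convProd (c.γ ∘ₗ (TensorProduct.comm K H.carrier H.carrier).toLinearMap)
        (H.twistTail c τ α β) (h ⊗ₜ k)
  /-- `τ ∘ S = τ` -/
  antipode : ∀ h : H.carrier, τ (HopfAlgebra.antipode K h) = τ h
  /-- `τ ∘ φ_β = τ` -/
  φ_invariant : ∀ (β : G) (h : H.carrier), τ (H.φ β h) = τ h

/-- An isomorphism of crossed Hopf `G`-algebras. -/
structure Iso (H H' : CrossedHopfAlgebra K G) where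
  e : H.carrier ≃ₐc[K] H'.carrier
  map_comp : ∀ α : G, (H.comp α).map (e.toCoalgEquiv.toCoalgHom.toLinearMap) = H'.comp α
  map_φ : ∀ (β : G) (h : H.carrier), e (H.φ β h) = H'.φ β (e h)

/-- The isomorphism `e` preserves the cobraided structures. -/
def Iso.PreservesCobraiding {H H' : CrossedHopfAlgebra K G} (i : Iso H H') (c : H.Cobraiding)
    (c' : H'.Cobraiding) : Prop :=
  ∀ h k : H.carrier, c'.γ (i.e h ⊗ₜ i.e k) = c.γ (h ⊗ₜ k)

/-- The isomorphism `e` preserves the cotwisted structures. -/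
def Iso.PreservesCotwist {H H' : CrossedHopfAlgebra K G} (i : Iso H H') {c : H.Cobraiding}
    {c' : H'.Cobraiding} (t : H.Cotwist c) (t' : H'.Cotwist c') : Prop :=
  ∀ h : H.carrier, t'.τ (i.e h) = t.τ h

end CrossedHopfAlgebra

end CrossedHopf

/-! ### The tensor product of coactions -/

section TensorCoaction

open TensorProduct Coalgebra

variable {K : Type u} [Field K] {A : Type u} [Ring A] [Bialgebra K A] {V W U V₁ W₁ : Type u}
  [AddCommGroup V] [Module K V] [AddCommGroup W] [Module K W] [AddCommGroup U] [Module K U]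
  [AddCommGroup V₁] [Module K V₁] [AddCommGroup W₁] [Module K W₁]

theorem rTensor_induction {S : Submodule K A} {P : A ⊗[K] V → Prop} {x : A ⊗[K] V}
    (hx : x ∈ LinearMap.range (S.subtype.rTensor V)) (zero : P 0)
    (add : ∀ x y, P x → P y → P (x + y)) (tmul : ∀ a ∈ S, ∀ v, P (a ⊗ₜ v)) : P x := by
  obtain ⟨y, rfl⟩ := hx
  induction y with
  | zero => simpa using zero
  | add x y hx hy => simpa only [map_add] using add _ _ hx hy
  | tmul a v => exact tmul _ a.2 v

/-- The map `(a ⊗ v) ⊗ (b ⊗ w) ↦ a b ⊗ (v ⊗ w)` -/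
def mulT (x : A ⊗[K] V) (y : A ⊗[K] W) : A ⊗[K] (V ⊗[K] W) :=
  (LinearMap.mul' K A).rTensor (V ⊗[K] W)
    (TensorProduct.tensorTensorTensorComm K A V A W (x ⊗ₜ y))

@[simp] theorem mulT_tmul (a b : A) (v : V) (w : W) :
    mulT (K := K) (a ⊗ₜ v) (b ⊗ₜ w) = (a * b) ⊗ₜ (v ⊗ₜ w) := by simp [mulT]
@[simp] theorem mulT_zero_left (y : A ⊗[K] W) : mulT (0 : A ⊗[K] V) y = 0 := by simp [mulT]
@[simp] theorem mulT_zero_right (x : A ⊗[K] V) : mulT x (0 : A ⊗[K] W) = 0 := by simp [mulT]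
theorem mulT_add_left (x x' : A ⊗[K] V) (y : A ⊗[K] W) :
    mulT (x + x') y = mulT x y + mulT x' y := by simp [mulT, add_tmul]
theorem mulT_add_right (x : A ⊗[K] V) (y y' : A ⊗[K] W) :
    mulT x (y + y') = mulT x y + mulT x y' := by simp [mulT, tmul_add]

theorem mulT_mem {S T R : Submodule K A} (h : ∀ a ∈ S, ∀ b ∈ T, a * b ∈ R) {x : A ⊗[K] V}
    {y : A ⊗[K] W} (hx : x ∈ LinearMap.range (S.subtype.rTensor V))
    (hy : y ∈ LinearMap.range (T.subtype.rTensor W)) :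
    mulT x y ∈ LinearMap.range (R.subtype.rTensor (V ⊗[K] W)) := by
  refine rTensor_induction (P := fun x => mulT x y ∈
    LinearMap.range (R.subtype.rTensor (V ⊗[K] W))) hx ?_ ?_ ?_
  · simp
  · intro x x' h h'
    rw [mulT_add_left]
    exact add_mem h h'
  intro a ha v
  refine rTensor_induction (P := fun y => mulT (a ⊗ₜ v) y ∈
    LinearMap.range (R.subtype.rTensor (V ⊗[K] W))) hy ?_ ?_ ?_
  · simp
  · intro x x' h h'
    rw [mulT_add_right]
    exact add_mem h h'
  intro b hb w
  exact ⟨⟨a * b, h a ha b hb⟩ ⊗ₜ (v ⊗ₜ w), by simp⟩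

theorem mulT_lTensor (f : V →ₗ[K] V₁) (g : W →ₗ[K] W₁) (x : A ⊗[K] V) (y : A ⊗[K] W) :
    mulT (f.lTensor A x) (g.lTensor A y) = (TensorProduct.map f g).lTensor A (mulT x y) := by
  induction x with
  | zero => simp
  | add x x' hx hx' => simp only [map_add, mulT_add_left, hx, hx']
  | tmul a v =>
  induction y with
  | zero => simp
  | add x x' hx hx' => simp only [map_add, mulT_add_right, hx, hx']
  | tmul b w => simp

theorem mulT_rTensor (f : A →ₗ[K] A) (hf : ∀ a b, f (a * b) = f a * f b) (x : A ⊗[K] V)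
    (y : A ⊗[K] W) : mulT (f.rTensor V x) (f.rTensor W y) = f.rTensor (V ⊗[K] W) (mulT x y) := by
  induction x with
  | zero => simp
  | add x x' hx hx' => simp only [map_add, mulT_add_left, hx, hx']
  | tmul a v =>
  induction y with
  | zero => simp
  | add x x' hx hx' => simp only [map_add, mulT_add_right, hx, hx']
  | tmul b w => simp [hf]

theorem mulT_assoc (x : A ⊗[K] V) (y : A ⊗[K] W) (z : A ⊗[K] U) :
    mulT x (mulT y z) =
      (TensorProduct.assoc K V W U).toLinearMap.lTensor A (mulT (mulT x y) z) := by
  induction x with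
  | zero => simp
  | add x x' hx hx' => simp only [map_add, mulT_add_left, hx, hx']
  | tmul a v =>
  induction y with
  | zero => simp
  | add x x' hx hx' => simp only [map_add, mulT_add_right, mulT_add_left, hx, hx']
  | tmul b w =>
  induction z with
  | zero => simp
  | add x x' hx hx' => simp only [map_add, mulT_add_right, hx, hx']
  | tmul c u => simp [mul_assoc]

theorem mulT_one_left (c : K) (y : A ⊗[K] W) :
    (TensorProduct.lid K W).toLinearMap.lTensor A (mulT ((1 : A) ⊗ₜ[K] c) y) = c • y := by
  induction y with
  | zero => simp
  | add x x' hx hx' => simp only [map_add, mulT_add_right, hx, hx', smul_add]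
  | tmul b w => simp

theorem mulT_one_right (c : K) (y : A ⊗[K] W) :
    (TensorProduct.rid K W).toLinearMap.lTensor A (mulT y ((1 : A) ⊗ₜ[K] c)) = c • y := by
  induction y with
  | zero => simp
  | add x x' hx hx' => simp only [map_add, mulT_add_left, hx, hx', smul_add]
  | tmul b w => simp

/-- The coaction `m ⊗ n ↦ m' n' ⊗ (m'' ⊗ n'')` on `V ⊗ W`. -/
def tensorCoaction (ρ : V →ₗ[K] A ⊗[K] V) (σ : W →ₗ[K] A ⊗[K] W) :
    V ⊗[K] W →ₗ[K] A ⊗[K] (V ⊗[K] W) :=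
  pushCoaction (LinearMap.mul' K A) (prodCoaction ρ σ)

@[simp] theorem tensorCoaction_tmul (ρ : V →ₗ[K] A ⊗[K] V) (σ : W →ₗ[K] A ⊗[K] W) (m : V)
    (n : W) : tensorCoaction ρ σ (m ⊗ₜ n) = mulT (ρ m) (σ n) := rfl

theorem isCoaction_tensor {ρ : V →ₗ[K] A ⊗[K] V} {σ : W →ₗ[K] A ⊗[K] W} (h : IsCoaction A ρ)
    (k : IsCoaction A σ) : IsCoaction A (tensorCoaction ρ σ) :=
  (h.prod k).push (Bialgebra.mulCoalgHom K A)

theorem isCoaction_unit : IsCoaction A (TensorProduct.mk K A K 1) where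
  coassoc m := by simp [Algebra.TensorProduct.one_def]
  counit m := by simp

end TensorCoaction

/-! ### Finite-dimensional comodules over a crossed Hopf algebra -/

section Comodules

open TensorProduct Coalgebra

variable {K : Type u} [Field K] {G : Type u} [Group G] (H : CrossedHopfAlgebra K G)

/-- The objects of `Com H`: finite-dimensional left comodules over one of the components `H_α`,
i.e. comodules over `H` whose coaction takes values in `H_α ⊗ V`. -/
structure Comod where
  deg : G
  V : ModuleCat.{u} K
  finite : Module.Finite K V
  ρ : V →ₗ[K] H.carrier ⊗[K] V
  isCoaction : IsCoaction H.carrier ρ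
  mem : ∀ m : V, ρ m ∈ LinearMap.range ((H.comp deg).subtype.rTensor V)

namespace Comod

variable {H}

attribute [instance] Comod.finite

/-- Morphisms of comodules over the same component. -/
@[ext]
structure Hom (X Y : Comod H) where
  f : X.V ⟶ Y.V
  deg_eq : X.deg = Y.deg
  comm : ∀ m : X.V, Y.ρ (f.hom m) = f.hom.lTensor H.carrier (X.ρ m)

instance : Category (Comod H) where
  Hom X Y := Hom X Y
  id X := ⟨𝟙 _, rfl, by simp⟩
  comp f g := ⟨f.f ≫ g.f, f.deg_eq.trans g.deg_eq, fun m => by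
    rw [ModuleCat.hom_comp, LinearMap.comp_apply, g.comm, f.comm, LinearMap.lTensor_comp]
    rfl⟩

@[ext]
theorem hom_ext {X Y : Comod H} {f g : X ⟶ Y} (h : f.f = g.f) : f = g := Hom.ext h

@[simp] theorem id_f (X : Comod H) : (𝟙 X : X ⟶ X).f = 𝟙 X.V := rfl
@[simp] theorem comp_f {X Y Z : Comod H} (f : X ⟶ Y) (g : Y ⟶ Z) : (f ≫ g).f = f.f ≫ g.f := rfl

/-- The forgetful functor from `Com H` to vector spaces. -/
abbrev forget : Comod H ⥤ ModuleCat.{u} K where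
  obj X := X.V
  map f := f.f

instance : (forget (H := H)).Faithful where
  map_injective h := hom_ext h

theorem eqToHom_f {X Y : Comod H} (h : X = Y) : (eqToHom h).f = eqToHom (congrArg V h) := by
  subst h; rfl

theorem obj_ext {X Y : Comod H} (hd : X.deg = Y.deg) (hV : X.V = Y.V) (hρ : HEq X.ρ Y.ρ) :
    X = Y := by
  cases X; cases Y
  cases hd; cases hV; cases hρ
  rfl

/-- An isomorphism of comodules from an isomorphism of the underlying vector spaces. -/
@[simps]
def isoMk {X Y : Comod H} (e : X.V ≅ Y.V) (hd : X.deg = Y.deg)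
    (h : ∀ m : X.V, Y.ρ (e.hom.hom m) = e.hom.hom.lTensor H.carrier (X.ρ m)) : X ≅ Y where
  hom := ⟨e.hom, hd, h⟩
  inv := ⟨e.inv, hd.symm, fun m => by
    have h₀ : e.hom.hom (e.inv.hom m) = m := e.toLinearEquiv.apply_symm_apply m
    have h₁ := h (e.inv.hom m)
    rw [h₀] at h₁
    rw [h₁, ← LinearMap.lTensor_comp_apply, ← ModuleCat.hom_comp, e.hom_inv_id]
    simp⟩

/-- The tensor product of comodules. -/
abbrev tensorObj (X Y : Comod H) : Comod H where
  deg := X.deg * Y.deg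
  V := X.V ⊗ Y.V
  finite := inferInstanceAs (Module.Finite K (X.V ⊗[K] Y.V))
  ρ := tensorCoaction X.ρ Y.ρ
  isCoaction := isCoaction_tensor X.isCoaction Y.isCoaction
  mem p := by
    change X.V ⊗[K] Y.V at p
    induction p with
    | zero => rw [map_zero]; exact zero_mem _
    | add x y hx hy => rw [map_add]; exact add_mem hx hy
    | tmul m n => exact mulT_mem (fun a ha b hb => H.mul_mem ha hb) (X.mem m) (Y.mem n)

/-- The ground field, with the coaction given by the unit of `H`. -/
abbrev tensorUnit : Comod H where
  deg := 1
  V := 𝟙_ (ModuleCat.{u} K)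
  finite := inferInstanceAs (Module.Finite K K)
  ρ := TensorProduct.mk K H.carrier K 1
  isCoaction := isCoaction_unit
  mem m := ⟨⟨1, H.one_mem⟩ ⊗ₜ m, rfl⟩

theorem map_comm {X₁ X₂ Y₁ Y₂ : Comod H} (f : X₁ ⟶ Y₁) (g : X₂ ⟶ Y₂) (p : X₁.V ⊗[K] X₂.V) :
    tensorCoaction Y₁.ρ Y₂.ρ (TensorProduct.map f.f.hom g.f.hom p) =
      (TensorProduct.map f.f.hom g.f.hom).lTensor H.carrier (tensorCoaction X₁.ρ X₂.ρ p) := by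
  induction p with
  | zero => simp only [map_zero]
  | add x y hx hy => simp only [map_add, hx, hy]
  | tmul m n =>
    rw [TensorProduct.map_tmul, tensorCoaction_tmul, tensorCoaction_tmul, f.comm, g.comm,
      mulT_lTensor]

/-- The tensor product of morphisms. -/
abbrev tensorMap {X₁ X₂ Y₁ Y₂ : Comod H} (f : X₁ ⟶ Y₁) (g : X₂ ⟶ Y₂) :
    tensorObj X₁ X₂ ⟶ tensorObj Y₁ Y₂ :=
  ⟨f.f ⊗ₘ g.f, congrArg₂ (· * ·) f.deg_eq g.deg_eq, map_comm f g⟩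

instance : MonoidalCategoryStruct (Comod H) where
  tensorObj := tensorObj
  whiskerLeft X _ _ f := tensorMap (𝟙 X) f
  whiskerRight f Y := tensorMap f (𝟙 Y)
  tensorHom f g := tensorMap f g
  tensorUnit := tensorUnit
  associator X Y Z := isoMk (α_ X.V Y.V Z.V) (mul_assoc _ _ _) (by
    intro p
    change (X.V ⊗[K] Y.V) ⊗[K] Z.V at p
    change tensorCoaction X.ρ (tensorCoaction Y.ρ Z.ρ) (TensorProduct.assoc K X.V Y.V Z.V p) =
      (TensorProduct.assoc K X.V Y.V Z.V).toLinearMap.lTensor H.carrier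
        (tensorCoaction (tensorCoaction X.ρ Y.ρ) Z.ρ p)
    induction p with
    | zero => simp only [map_zero]
    | add x y hx hy => simp only [map_add, hx, hy]
    | tmul p l =>
    induction p with
    | zero => simp only [map_zero, zero_tmul]
    | add x y hx hy => simp only [map_add, add_tmul, hx, hy]
    | tmul m n =>
      rw [TensorProduct.assoc_tmul]
      simp only [tensorCoaction_tmul]
      exact mulT_assoc _ _ _)
  leftUnitor X := isoMk (λ_ X.V) (one_mul _) (by
    intro p
    change K ⊗[K] X.V at p
    change X.ρ (TensorProduct.lid K X.V p) = (TensorProduct.lid K X.V).toLinearMap.lTensor H.carrier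
        (tensorCoaction (TensorProduct.mk K H.carrier K 1) X.ρ p)
    induction p with
    | zero => simp only [map_zero]
    | add x y hx hy => simp only [map_add, hx, hy]
    | tmul c m => simp [mulT_one_left])
  rightUnitor X := isoMk (ρ_ X.V) (mul_one _) (by
    intro p
    change X.V ⊗[K] K at p
    change X.ρ (TensorProduct.rid K X.V p) = (TensorProduct.rid K X.V).toLinearMap.lTensor H.carrier
        (tensorCoaction X.ρ (TensorProduct.mk K H.carrier K 1) p)
    induction p with
    | zero => simp only [map_zero]
    | add x y hx hy => simp only [map_add, hx, hy]
    | tmul c m => simp [mulT_one_right])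

@[simp] theorem tensor_V (X Y : Comod H) : (X ⊗ Y).V = X.V ⊗ Y.V := rfl
@[simp] theorem unit_V : (𝟙_ (Comod H)).V = 𝟙_ (ModuleCat.{u} K) := rfl
@[simp] theorem tensorHom_f {X₁ X₂ Y₁ Y₂ : Comod H} (f : X₁ ⟶ Y₁) (g : X₂ ⟶ Y₂) :
    (f ⊗ₘ g).f = f.f ⊗ₘ g.f := rfl
@[simp] theorem whiskerLeft_f (X : Comod H) {Y₁ Y₂ : Comod H} (f : Y₁ ⟶ Y₂) :
    (X ◁ f).f = X.V ◁ f.f := id_tensorHom _ _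
@[simp] theorem whiskerRight_f {X₁ X₂ : Comod H} (f : X₁ ⟶ X₂) (Y : Comod H) :
    (f ▷ Y).f = f.f ▷ Y.V := tensorHom_id _ _
@[simp] theorem associator_hom_f (X Y Z : Comod H) :
    (α_ X Y Z).hom.f = (α_ X.V Y.V Z.V).hom := rfl
@[simp] theorem associator_inv_f (X Y Z : Comod H) :
    (α_ X Y Z).inv.f = (α_ X.V Y.V Z.V).inv := rfl
@[simp] theorem leftUnitor_hom_f (X : Comod H) : (λ_ X).hom.f = (λ_ X.V).hom := rfl
@[simp] theorem rightUnitor_hom_f (X : Comod H) : (ρ_ X).hom.f = (ρ_ X.V).hom := rfl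

instance : MonoidalCategory (Comod H) :=
  Monoidal.induced forget
    { μIso := fun _ _ => CategoryTheory.Iso.refl _
      εIso := CategoryTheory.Iso.refl _
      whiskerLeft_eq := by intros; simp
      whiskerRight_eq := by intros; simp
      tensorHom_eq := by intros; simp
      associator_eq := by intros; simp
      leftUnitor_eq := by intros; simp
      rightUnitor_eq := by intros; simp }

/-- The comodule `ᵝX`: the coaction is composed with `φ_β`. -/
abbrev conjObj (β : G) (X : Comod H) : Comod H where
  deg := β * X.deg * β⁻¹
  V := X.V
  finite := X.finite
  ρ := pushCoaction (H.φl β) X.ρ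
  isCoaction := X.isCoaction.push (H.φ β).toCoalgEquiv.toCoalgHom
  mem m := by
    refine rTensor_induction (P := fun x => (H.φl β).rTensor X.V x ∈
      LinearMap.range ((H.comp (β * X.deg * β⁻¹)).subtype.rTensor X.V)) (X.mem m) ?_ ?_ ?_
    · simp
    · intro x y hx hy
      rw [map_add]; exact add_mem hx hy
    · intro a ha v
      exact ⟨⟨H.φ β a, H.φ_mem β ha⟩ ⊗ₜ v, by simp⟩

variable (H) in
/-- The functor `Φ_β` -/
abbrev conjFunctor (β : G) : Comod H ⥤ Comod H where
  obj X := conjObj β X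
  map {X Y} f := ⟨f.f, congrArg (β * · * β⁻¹) f.deg_eq, fun m => by
    rw [pushCoaction_apply, f.comm, pushCoaction_apply]
    exact LinearMap.congr_fun ((LinearMap.rTensor_comp_lTensor _ _ _).trans
      (LinearMap.lTensor_comp_rTensor _ _ _).symm) (X.ρ m)⟩

theorem functor_ext {F F' : Comod H ⥤ Comod H}
    (h : ∀ X, F.obj X = F'.obj X)
    (h' : ∀ {X Y : Comod H} (f : X ⟶ Y), (F.map f).f = eqToHom (congrArg V (h X)) ≫
      (F'.map f).f ≫ eqToHom (congrArg V (h Y)).symm) : F = F' :=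
  CategoryTheory.Functor.ext h (fun X Y f => by ext1; simp [eqToHom_f, h' f])

theorem conjObj_tensor (β : G) (X Y : Comod H) :
    conjObj β (X ⊗ Y) = conjObj β X ⊗ conjObj β Y :=
  obj_ext (by change β * (X.deg * Y.deg) * β⁻¹ = (β * X.deg * β⁻¹) * (β * Y.deg * β⁻¹); group) rfl
    (heq_of_eq (by
      refine TensorProduct.ext' fun m n => ?_
      exact (mulT_rTensor (H.φl β) (fun a b => map_mul (H.φ β) a b) (X.ρ m) (Y.ρ n)).symm))

theorem conjObj_unit (β : G) : conjObj β (𝟙_ (Comod H)) = 𝟙_ (Comod H) :=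
  obj_ext (by change β * 1 * β⁻¹ = 1; group) rfl
    (heq_of_eq (LinearMap.ext fun c => by
      change (H.φl β).rTensor K ((1 : H.carrier) ⊗ₜ[K] (c : K)) = (1 : H.carrier) ⊗ₜ[K] c
      simp))

theorem conjFunctor_id : conjFunctor H (1 : G) = 𝟭 (Comod H) :=
  functor_ext (fun X => obj_ext (by change 1 * X.deg * 1⁻¹ = X.deg; group) rfl
    (heq_of_eq (LinearMap.ext fun m => by
      have e : H.φl 1 = LinearMap.id := LinearMap.ext H.φ_one
      change (H.φl 1).rTensor X.V (X.ρ m) = X.ρ m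
      rw [e, LinearMap.rTensor_id]; rfl)))
    (fun f => by simp)

theorem conjFunctor_comp (β γ : G) :
    conjFunctor H (β * γ) = conjFunctor H γ ⋙ conjFunctor H β :=
  functor_ext (fun X => obj_ext
    (by change β * γ * X.deg * (β * γ)⁻¹ = β * (γ * X.deg * γ⁻¹) * β⁻¹; group) rfl
    (heq_of_eq (LinearMap.ext fun m => by
      have e : H.φl (β * γ) = H.φl β ∘ₗ H.φl γ := LinearMap.ext (H.φ_mul β γ)
      change (H.φl (β * γ)).rTensor X.V (X.ρ m) =
        (H.φl β).rTensor X.V ((H.φl γ).rTensor X.V (X.ρ m))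
      rw [e, LinearMap.rTensor_comp]; rfl)))
    (fun f => by simp)

instance : CrossedCategory G (Comod H) where
  deg X := X.deg
  deg_eq_of_hom f := f.deg_eq
  deg_tensor X Y := rfl
  Φ β := conjFunctor H β
  deg_Φ β X := rfl
  Φ_one := conjFunctor_id
  Φ_mul := conjFunctor_comp
  Φ_tensor := conjObj_tensor
  Φ_unit := conjObj_unit
  Φ_map_tensor β X X' Y Y' f g := by
    ext1; simp only [comp_f, eqToHom_f]; simp
  Φ_associator β X Y Z := by
    ext1; simp only [comp_f, eqToHom_f]; simp
  Φ_leftUnitor β X := by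
    ext1; simp only [comp_f, eqToHom_f]; simp
  Φ_rightUnitor β X := by
    ext1; simp only [comp_f, eqToHom_f]; simp

variable (H) in
/-- The fiber functor of `Com H`: the forgetful functor, with `φ_β : m ↦ ᵝm`. -/
def fiber : CrossedFiberFunctor K (Comod H) where
  F := forget
  faithful := inferInstance
  finite X := X.finite
  monoidal := Functor.CoreMonoidal.toMonoidal
    { εIso := CategoryTheory.Iso.refl _
      μIso := fun _ _ => CategoryTheory.Iso.refl _ }
  φ β := NatIso.ofComponents (fun X => CategoryTheory.Iso.refl X.V)
  φ_one X := by
    simp [eqToHom_f]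
  φ_mul β γ X := by
    simp [eqToHom_f]

end Comod

end Comodules

/-! ### The braiding and the twist of comodules -/

section Functionals

open TensorProduct Coalgebra

variable {K : Type u} [Field K] {A B : Type u} [AddCommGroup A] [Module K A]
  [AddCommGroup B] [Module K B] {V W U V₁ W₁ : Type u}
  [AddCommGroup V] [Module K V] [AddCommGroup W] [Module K W] [AddCommGroup U] [Module K U]
  [AddCommGroup V₁] [Module K V₁] [AddCommGroup W₁] [Module K W₁]

theorem coact_push {A' : Type u} [AddCommGroup A'] [Module K A'] (f : A' →ₗ[K] K)
    (g : A →ₗ[K] A') (ρ : V →ₗ[K] A ⊗[K] V) :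
    coact f (pushCoaction g ρ) = coact (f ∘ₗ g) ρ := by
  ext m
  rw [coact_apply, coact_apply, pushCoaction_apply, LinearMap.rTensor_comp_apply]

theorem prod_push {A' B' : Type u} [AddCommGroup A'] [Module K A'] [AddCommGroup B'] [Module K B']
    (f : A →ₗ[K] A') (g : B →ₗ[K] B') (ρ : V →ₗ[K] A ⊗[K] V) (σ : W →ₗ[K] B ⊗[K] W) :
    prodCoaction (pushCoaction f ρ) (pushCoaction g σ) =
      pushCoaction (TensorProduct.map f g) (prodCoaction ρ σ) := by
  refine TensorProduct.ext' fun m n => ?_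
  rw [prodCoaction_tmul, pushCoaction_apply, pushCoaction_apply, pushCoaction_apply,
    prodCoaction_tmul]
  generalize ρ m = x
  generalize σ n = y
  induction x with
  | zero => simp
  | add x x' hx hx' => simp only [map_add, add_tmul, hx, hx']
  | tmul a v =>
  induction y with
  | zero => simp
  | add x x' hx hx' => simp only [map_add, tmul_add, hx, hx']
  | tmul b w => simp

theorem rTensor_congr {A' : Type u} [AddCommGroup A'] [Module K A'] {S : Submodule K A}
    {f g : A →ₗ[K] A'} (h : ∀ a ∈ S, f a = g a) {x : A ⊗[K] V}
    (hx : x ∈ LinearMap.range (S.subtype.rTensor V)) : f.rTensor V x = g.rTensor V x := by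
  obtain ⟨y, rfl⟩ := hx
  rw [← LinearMap.rTensor_comp_apply, ← LinearMap.rTensor_comp_apply]
  congr 2
  ext a
  exact h a a.2

theorem coact_congr {S : Submodule K A} {f g : A →ₗ[K] K} (h : ∀ a ∈ S, f a = g a)
    {ρ : V →ₗ[K] A ⊗[K] V} {m : V} (hm : ρ m ∈ LinearMap.range (S.subtype.rTensor V)) :
    coact f ρ m = coact g ρ m := by
  rw [coact_apply, coact_apply, rTensor_congr h hm]

theorem prodCoaction_mem {S : Submodule K A} {T : Submodule K B} {ρ : V →ₗ[K] A ⊗[K] V}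
    {σ : W →ₗ[K] B ⊗[K] W} (hρ : ∀ m, ρ m ∈ LinearMap.range (S.subtype.rTensor V))
    (hσ : ∀ n, σ n ∈ LinearMap.range (T.subtype.rTensor W)) (p : V ⊗[K] W) :
    prodCoaction ρ σ p ∈ LinearMap.range
      ((LinearMap.range (TensorProduct.mapIncl S T)).subtype.rTensor (V ⊗[K] W)) := by
  induction p with
  | zero => rw [map_zero]; exact zero_mem _
  | add x y hx hy => rw [map_add]; exact add_mem hx hy
  | tmul m n =>
  rw [prodCoaction_tmul]
  obtain ⟨x, hx⟩ := hρ m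
  obtain ⟨y, hy⟩ := hσ n
  rw [← hx, ← hy]
  clear hx hy
  induction x with
  | zero => rw [map_zero, zero_tmul, map_zero]; exact zero_mem _
  | add x y hx hy => rw [map_add, add_tmul, map_add]; exact add_mem hx hy
  | tmul a v =>
  induction y with
  | zero => rw [map_zero, tmul_zero, map_zero]; exact zero_mem _
  | add x y hx hy => rw [map_add, tmul_add, map_add]; exact add_mem hx hy
  | tmul b w => exact ⟨⟨(a : A) ⊗ₜ (b : B), a ⊗ₜ b, by simp⟩ ⊗ₜ (v ⊗ₜ w), by simp⟩

theorem eq_on_range {A' : Type u} [AddCommGroup A'] [Module K A'] {S : Submodule K A}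
    {T : Submodule K B} {f g : A ⊗[K] B →ₗ[K] A'}
    (h : ∀ a ∈ S, ∀ b ∈ T, f (a ⊗ₜ b) = g (a ⊗ₜ b)) :
    ∀ x ∈ LinearMap.range (TensorProduct.mapIncl S T), f x = g x := by
  rintro _ ⟨x, rfl⟩
  induction x with
  | zero => simp
  | add x y hx hy => simp only [map_add, hx, hy]
  | tmul a b => simpa using h a a.2 b b.2

theorem prod_comm (ρ : V →ₗ[K] A ⊗[K] V) (σ : W →ₗ[K] B ⊗[K] W) (p : V ⊗[K] W) :
    prodCoaction σ ρ (TensorProduct.comm K V W p) =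
      TensorProduct.map (TensorProduct.comm K A B).toLinearMap
        (TensorProduct.comm K V W).toLinearMap (prodCoaction ρ σ p) := by
  induction p with
  | zero => simp only [map_zero]
  | add x y hx hy => simp only [map_add, hx, hy]
  | tmul m n =>
  rw [TensorProduct.comm_tmul, prodCoaction_tmul, prodCoaction_tmul]
  generalize ρ m = x
  generalize σ n = y
  induction x with
  | zero => simp
  | add x x' hx hx' => simp only [map_add, add_tmul, tmul_add, hx, hx']
  | tmul a v =>
  induction y with
  | zero => simp
  | add x x' hx hx' => simp only [map_add, add_tmul, tmul_add, hx, hx']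
  | tmul b w => simp

theorem coact_comm (f : B ⊗[K] A →ₗ[K] K) (ρ : V →ₗ[K] A ⊗[K] V) (σ : W →ₗ[K] B ⊗[K] W)
    (p : V ⊗[K] W) :
    coact f (prodCoaction σ ρ) (TensorProduct.comm K V W p) =
      TensorProduct.comm K V W
        (coact (f ∘ₗ (TensorProduct.comm K A B).toLinearMap) (prodCoaction ρ σ) p) := by
  rw [coact_apply, coact_apply, prod_comm]
  generalize prodCoaction ρ σ p = x
  induction x with
  | zero => simp only [map_zero]
  | add x y hx hy => simp only [map_add, hx, hy]
  | tmul b q => simp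

theorem coact_prod (f : A →ₗ[K] K) (g : B →ₗ[K] K) (ρ : V →ₗ[K] A ⊗[K] V)
    (σ : W →ₗ[K] B ⊗[K] W) :
    coact (LinearMap.mul' K K ∘ₗ TensorProduct.map f g) (prodCoaction ρ σ) =
      TensorProduct.map (coact f ρ) (coact g σ) := by
  refine TensorProduct.ext' fun m n => ?_
  rw [coact_apply, prodCoaction_tmul, TensorProduct.map_tmul, coact_apply, coact_apply]
  generalize ρ m = x
  generalize σ n = y
  induction x with
  | zero => simp
  | add x x' hx hx' => simp only [map_add, add_tmul, hx, hx']
  | tmul a v =>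
  induction y with
  | zero => simp
  | add x x' hx hx' => simp only [map_add, tmul_add, hx, hx']
  | tmul b w => simp [smul_tmul, tmul_smul, smul_smul, mul_comm]

theorem coact_natural (f : A →ₗ[K] K) {ρ : V →ₗ[K] A ⊗[K] V} {ρ₁ : V₁ →ₗ[K] A ⊗[K] V₁}
    (k : V →ₗ[K] V₁) (hk : ∀ m, ρ₁ (k m) = k.lTensor A (ρ m)) (m : V) :
    coact f ρ₁ (k m) = k (coact f ρ m) := by
  rw [coact_apply, coact_apply, hk]
  generalize ρ m = x
  induction x with
  | zero => simp only [map_zero]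
  | add x y hx hy => simp only [map_add, hx, hy]
  | tmul b q => simp

theorem convProd_comp [Coalgebra K A] [Coalgebra K B] (f : A →ₗc[K] B) (g g' : B →ₗ[K] K) :
    convProd (g ∘ₗ f.toLinearMap) (g' ∘ₗ f.toLinearMap) = convProd g g' ∘ₗ f.toLinearMap := by
  ext a
  have := LinearMap.congr_fun f.map_comp_comul a
  simp only [LinearMap.comp_apply] at this
  simp only [convProd, LinearMap.comp_apply, ← this, ← TensorProduct.map_map]

end Functionals

section ComodBraiding

open TensorProduct Coalgebra

variable {K : Type u} [Field K] {G : Type u} [Group G] {H : CrossedHopfAlgebra K G}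

namespace CrossedHopfAlgebra.Cobraiding

variable (c : H.Cobraiding) {V W U V₁ W₁ : Type u}
  [AddCommGroup V] [Module K V] [AddCommGroup W] [Module K W] [AddCommGroup U] [Module K U]
  [AddCommGroup V₁] [Module K V₁] [AddCommGroup W₁] [Module K W₁]

/-- The functional `h ⊗ k ↦ γ(k ⊗ h)`. -/
def γop : H.carrier ⊗[K] H.carrier →ₗ[K] K :=
  c.γ ∘ₗ (TensorProduct.comm K H.carrier H.carrier).toLinearMap

@[simp] theorem γop_tmul (h k : H.carrier) : c.γop (h ⊗ₜ k) = c.γ (k ⊗ₜ h) := rfl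

/-- The braiding `m ⊗ n ↦ γ(n' ⊗ m') n'' ⊗ m''`. -/
def braidMap (ρ : V →ₗ[K] H.carrier ⊗[K] V) (σ : W →ₗ[K] H.carrier ⊗[K] W) :
    V ⊗[K] W →ₗ[K] W ⊗[K] V :=
  (TensorProduct.comm K V W).toLinearMap ∘ₗ coact c.γop (prodCoaction ρ σ)

/-- The map `(a ⊗ v) ⊗ (b ⊗ w) ↦ γ(b ⊗ a) w ⊗ v`. -/
def bl (x : H.carrier ⊗[K] V) (y : H.carrier ⊗[K] W) : W ⊗[K] V :=
  TensorProduct.comm K V W (TensorProduct.lid K _ (c.γop.rTensor (V ⊗[K] W)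
    (TensorProduct.tensorTensorTensorComm K H.carrier V H.carrier W (x ⊗ₜ y))))

theorem braidMap_tmul (ρ : V →ₗ[K] H.carrier ⊗[K] V) (σ : W →ₗ[K] H.carrier ⊗[K] W) (m : V)
    (n : W) : c.braidMap ρ σ (m ⊗ₜ n) = c.bl (ρ m) (σ n) := rfl

@[simp] theorem bl_tmul (a b : H.carrier) (v : V) (w : W) :
    c.bl (a ⊗ₜ v) (b ⊗ₜ w) = c.γ (b ⊗ₜ a) • (w ⊗ₜ[K] v) := by simp [bl]
@[simp] theorem bl_zero_left (y : H.carrier ⊗[K] W) : c.bl (0 : H.carrier ⊗[K] V) y = 0 := by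
  simp [bl]
@[simp] theorem bl_zero_right (x : H.carrier ⊗[K] V) : c.bl x (0 : H.carrier ⊗[K] W) = 0 := by
  simp [bl]
theorem bl_add_left (x x' : H.carrier ⊗[K] V) (y : H.carrier ⊗[K] W) :
    c.bl (x + x') y = c.bl x y + c.bl x' y := by simp [bl, add_tmul]
theorem bl_add_right (x : H.carrier ⊗[K] V) (y y' : H.carrier ⊗[K] W) :
    c.bl x (y + y') = c.bl x y + c.bl x y' := by simp [bl, tmul_add]
theorem bl_smul_right (x : H.carrier ⊗[K] V) (r : K) (y : H.carrier ⊗[K] W) :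
    c.bl x (r • y) = r • c.bl x y := by simp [bl]
theorem bl_smul_left (r : K) (x : H.carrier ⊗[K] V) (y : H.carrier ⊗[K] W) :
    c.bl (r • x) y = r • c.bl x y := by simp [bl, ← smul_tmul']

theorem bl_lTensor (f : V →ₗ[K] V₁) (g : W →ₗ[K] W₁) (x : H.carrier ⊗[K] V)
    (y : H.carrier ⊗[K] W) :
    c.bl (f.lTensor _ x) (g.lTensor _ y) = TensorProduct.map g f (c.bl x y) := by
  induction x with
  | zero => simp
  | add x x' hx hx' => simp only [map_add, bl_add_left, hx, hx']
  | tmul a v =>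
  induction y with
  | zero => simp
  | add x x' hx hx' => simp only [map_add, bl_add_right, hx, hx']
  | tmul b w => simp

theorem bl_φ (β : G) (x : H.carrier ⊗[K] V) (y : H.carrier ⊗[K] W) :
    c.bl ((H.φl β).rTensor V x) ((H.φl β).rTensor W y) = c.bl x y := by
  induction x with
  | zero => simp
  | add x x' hx hx' => simp only [map_add, bl_add_left, hx, hx']
  | tmul a v =>
  induction y with
  | zero => simp
  | add x x' hx hx' => simp only [map_add, bl_add_right, hx, hx']
  | tmul b w => simp [c.φ_invariant]

/-- `x ↦ bl x y` -/
def blL (W : Type u) [AddCommGroup W] [Module K W] (V : Type u) [AddCommGroup V] [Module K V]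
    (y : H.carrier ⊗[K] W) : H.carrier ⊗[K] V →ₗ[K] W ⊗[K] V where
  toFun x := c.bl x y
  map_add' _ _ := c.bl_add_left _ _ _
  map_smul' _ _ := c.bl_smul_left _ _ _

/-- `y ↦ bl x (φ_β y)` -/
def blR (V : Type u) [AddCommGroup V] [Module K V] (W : Type u) [AddCommGroup W] [Module K W]
    (β : G) (x : H.carrier ⊗[K] V) : H.carrier ⊗[K] W →ₗ[K] W ⊗[K] V where
  toFun y := c.bl x ((H.φl β).rTensor W y)
  map_add' _ _ := by rw [map_add, c.bl_add_right]
  map_smul' _ _ := by rw [map_smul, c.bl_smul_right]; rfl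

theorem bl_mul_left {β : G} {y : H.carrier ⊗[K] W}
    (hy : y ∈ LinearMap.range ((H.comp β).subtype.rTensor W)) (x : H.carrier ⊗[K] V)
    (z : H.carrier ⊗[K] U) :
    c.bl (mulT x y) z =
      TensorProduct.assoc K U V W ((c.blR V U β x).rTensor W
        (c.bl y (TensorProduct.assoc K _ _ U
          ((comul (R := K) (A := H.carrier)).rTensor U z)))) := by
  induction x with
  | zero =>
    have : c.blR V U β 0 = 0 := by ext; simp [blR]
    simp [this]
  | add x x' hx hx' =>
    have : c.blR V U β (x + x') = c.blR V U β x + c.blR V U β x' := by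
      ext; simp [blR, bl_add_left]
    simp only [mulT_add_left, bl_add_left, hx, hx', this, LinearMap.rTensor_add,
      LinearMap.add_apply, map_add]
  | tmul a v =>
  refine rTensor_induction (P := fun y => c.bl (mulT (a ⊗ₜ v) y) z =
      TensorProduct.assoc K U V W ((c.blR V U β (a ⊗ₜ v)).rTensor W
        (c.bl y (TensorProduct.assoc K _ _ U
          ((comul (R := K) (A := H.carrier)).rTensor U z))))) hy ?_ ?_ ?_
  · simp
  · intro y y' hy hy'
    simp only [mulT_add_right, bl_add_left, hy, hy', map_add]
  intro b hb w
  induction z with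
  | zero => simp
  | add x x' hx hx' => simp only [map_add, bl_add_right, hx, hx']
  | tmul d q =>
  rw [mulT_tmul, bl_tmul, c.mul_right β d a b hb, LinearMap.rTensor_tmul]
  generalize comul (R := K) d = r
  induction r with
  | zero => simp
  | add x x' hx hx' => simp only [map_add, bl_add_right, add_tmul, hx, hx', add_smul]
  | tmul d₁ d₂ => simp [blR, ← smul_tmul', mul_smul]

theorem bl_mul_right (x : H.carrier ⊗[K] V) (y : H.carrier ⊗[K] W) (z : H.carrier ⊗[K] U) :
    c.bl x (mulT y z) =
      (TensorProduct.assoc K W U V).symm ((c.blL U V z).lTensor W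
        (c.bl (TensorProduct.assoc K _ _ V
          ((comul (R := K) (A := H.carrier)).rTensor V x)) y)) := by
  induction z with
  | zero =>
    have : c.blL U V 0 = 0 := by ext; simp [blL]
    simp [this]
  | add x x' hx hx' =>
    have : c.blL U V (x + x') = c.blL U V x + c.blL U V x' := by
      ext; simp [blL, bl_add_right]
    simp only [mulT_add_right, bl_add_right, hx, hx', this, LinearMap.lTensor_add,
      LinearMap.add_apply, map_add]
  | tmul d q =>
  induction y with
  | zero => simp
  | add x x' hx hx' => simp only [bl_add_right, mulT_add_left, map_add, hx, hx']
  | tmul b w =>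
  induction x with
  | zero => simp
  | add x x' hx hx' => simp only [bl_add_left, map_add, hx, hx']
  | tmul a v =>
  rw [mulT_tmul, bl_tmul, c.mul_left, LinearMap.rTensor_tmul]
  generalize comul (R := K) a = r
  induction r with
  | zero => simp
  | add x x' hx hx' => simp only [map_add, bl_add_left, add_tmul, hx, hx', add_smul]
  | tmul d₁ d₂ => simp [blL, tmul_smul, mul_smul]

/-- The comultiplication of `h ⊗ k` and of `k ⊗ h`. -/
theorem comul_comm (h k : H.carrier) :
    comul (R := K) (h ⊗ₜ[K] k) =
      TensorProduct.map (TensorProduct.comm K H.carrier H.carrier).toLinearMap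
        (TensorProduct.comm K H.carrier H.carrier).toLinearMap (comul (R := K) (k ⊗ₜ[K] h)) := by
  rw [TensorProduct.comul_tmul, TensorProduct.comul_tmul]
  generalize comul (R := K) h = x
  generalize comul (R := K) k = y
  induction x with
  | zero => simp
  | add x x' hx hx' => simp only [map_add, add_tmul, tmul_add, hx, hx']
  | tmul a v =>
  induction y with
  | zero => simp
  | add x x' hx hx' => simp only [map_add, add_tmul, tmul_add, hx, hx']
  | tmul b w => simp

/-- The comultiplication map `h ⊗ k ↦ φ_α(k) h`. -/
def twistedMul (H : CrossedHopfAlgebra K G) (α : G) : H.carrier ⊗[K] H.carrier →ₗ[K] H.carrier :=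
  LinearMap.mul' K H.carrier ∘ₗ (H.φl α).rTensor H.carrier ∘ₗ
    (TensorProduct.comm K H.carrier H.carrier).toLinearMap

theorem tensorCoaction_comm (α : G) (ρ : V →ₗ[K] H.carrier ⊗[K] V)
    (σ : W →ₗ[K] H.carrier ⊗[K] W) (p : V ⊗[K] W) :
    tensorCoaction (pushCoaction (H.φl α) σ) ρ (TensorProduct.comm K V W p) =
      (TensorProduct.comm K V W).toLinearMap.lTensor H.carrier
        ((twistedMul H α).rTensor (V ⊗[K] W) (prodCoaction ρ σ p)) := by
  induction p with
  | zero => simp only [map_zero]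
  | add x y hx hy => simp only [map_add, hx, hy]
  | tmul m n =>
  rw [TensorProduct.comm_tmul, tensorCoaction_tmul, prodCoaction_tmul, pushCoaction_apply]
  generalize ρ m = x
  generalize σ n = y
  induction x with
  | zero => simp
  | add x x' hx hx' => simp only [map_add, mulT_add_right, add_tmul, hx, hx']
  | tmul a v =>
  induction y with
  | zero => simp
  | add x x' hx hx' => simp only [map_add, mulT_add_left, tmul_add, hx, hx']
  | tmul b w => simp [twistedMul]

theorem twistedMul_eq (α : G) (h k : H.carrier) (hh : h ∈ H.comp α) :
    ((TensorProduct.lid K H.carrier).toLinearMap ∘ₗ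
        TensorProduct.map c.γop (twistedMul H α) ∘ₗ comul) (h ⊗ₜ[K] k) =
      ((TensorProduct.rid K H.carrier).toLinearMap ∘ₗ
        TensorProduct.map (LinearMap.mul' K H.carrier) c.γop ∘ₗ comul) (h ⊗ₜ[K] k) := by
  have e := c.mul_comm' α k h hh
  rw [comul_comm] at e
  simp only [LinearMap.comp_apply, LinearEquiv.coe_coe]
  have e₁ : ∀ x : (H.carrier ⊗[K] H.carrier) ⊗[K] (H.carrier ⊗[K] H.carrier),
      TensorProduct.map (LinearMap.mul' K H.carrier ∘ₗ
        (TensorProduct.comm K H.carrier H.carrier).toLinearMap) c.γ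
        (TensorProduct.map (TensorProduct.comm K H.carrier H.carrier).toLinearMap
        (TensorProduct.comm K H.carrier H.carrier).toLinearMap x) =
      TensorProduct.map (LinearMap.mul' K H.carrier) c.γop x := by
    intro x
    rw [← LinearMap.comp_apply, ← TensorProduct.map_comp]
    congr 2
    ext a b
    simp
  have e₂ : ∀ x : (H.carrier ⊗[K] H.carrier) ⊗[K] (H.carrier ⊗[K] H.carrier),
      TensorProduct.map c.γ (LinearMap.mul' K H.carrier ∘ₗ (H.φl α).rTensor H.carrier)
        (TensorProduct.map (TensorProduct.comm K H.carrier H.carrier).toLinearMap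
        (TensorProduct.comm K H.carrier H.carrier).toLinearMap x) =
      TensorProduct.map c.γop (twistedMul H α) x := by
    intro x
    rw [← LinearMap.comp_apply, ← TensorProduct.map_comp]
    rfl
  rw [e₁, e₂] at e
  exact e.symm

theorem braidMap_comm {α β : G} {ρ : V →ₗ[K] H.carrier ⊗[K] V} {σ : W →ₗ[K] H.carrier ⊗[K] W}
    (h : IsCoaction H.carrier ρ) (k : IsCoaction H.carrier σ)
    (hρ : ∀ m, ρ m ∈ LinearMap.range ((H.comp α).subtype.rTensor V))
    (hσ : ∀ n, σ n ∈ LinearMap.range ((H.comp β).subtype.rTensor W)) (p : V ⊗[K] W) :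
    tensorCoaction (pushCoaction (H.φl α) σ) ρ (c.braidMap ρ σ p) =
      (c.braidMap ρ σ).lTensor H.carrier (tensorCoaction ρ σ p) := by
  rw [braidMap, LinearMap.comp_apply, LinearEquiv.coe_coe, tensorCoaction_comm,
    LinearMap.lTensor_comp_apply, (h.prod k).rTensor_coact, tensorCoaction, pushCoaction_apply,
    (h.prod k).lTensor_coact]
  congr 1
  exact rTensor_congr (eq_on_range fun a ha b _ => c.twistedMul_eq α a b ha)
    (prodCoaction_mem hρ hσ p)

theorem γop_invertible : ∃ γ' : H.carrier ⊗[K] H.carrier →ₗ[K] K,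
    convProd γ' c.γop = Coalgebra.counit ∧ convProd c.γop γ' = Coalgebra.counit := by
  obtain ⟨γ', h₁, h₂⟩ := c.invertible
  let f : H.carrier ⊗[K] H.carrier →ₗc[K] H.carrier ⊗[K] H.carrier :=
    (Bialgebra.TensorProduct.comm K H.carrier H.carrier).toCoalgEquiv.toCoalgHom
  have hf : f.toLinearMap = (TensorProduct.comm K H.carrier H.carrier).toLinearMap := rfl
  refine ⟨γ' ∘ₗ f.toLinearMap, ?_, ?_⟩
  · rw [γop, ← hf, convProd_comp, h₁, f.counit_comp]
  · rw [γop, ← hf, convProd_comp, h₂, f.counit_comp]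

/-- The braiding as a linear isomorphism. -/
noncomputable def braidEquiv {ρ : V →ₗ[K] H.carrier ⊗[K] V} {σ : W →ₗ[K] H.carrier ⊗[K] W}
    (h : IsCoaction H.carrier ρ) (k : IsCoaction H.carrier σ) : V ⊗[K] W ≃ₗ[K] W ⊗[K] V :=
  { c.braidMap ρ σ with
    invFun := fun q => coact c.γop_invertible.choose (prodCoaction ρ σ) (TensorProduct.comm K W V q)
    left_inv := fun p => by
      change coact _ _ (TensorProduct.comm K W V (TensorProduct.comm K V W _)) = p
      rw [TensorProduct.comm_comm, (h.prod k).coact_coact, c.γop_invertible.choose_spec.2,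
        (h.prod k).coact_counit, LinearMap.id_apply]
    right_inv := fun q => by
      change TensorProduct.comm K V W (coact _ _ (coact _ _ _)) = q
      rw [(h.prod k).coact_coact, c.γop_invertible.choose_spec.1,
        (h.prod k).coact_counit, LinearMap.id_apply, TensorProduct.comm_comm] }

theorem braidEquiv_toLinearMap {ρ : V →ₗ[K] H.carrier ⊗[K] V} {σ : W →ₗ[K] H.carrier ⊗[K] W}
    (h : IsCoaction H.carrier ρ) (k : IsCoaction H.carrier σ) :
    (c.braidEquiv h k).toLinearMap = c.braidMap ρ σ := rfl

end CrossedHopfAlgebra.Cobraiding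

end ComodBraiding

section BraidIdentities

open TensorProduct Coalgebra

variable {K : Type u} [Field K] {G : Type u} [Group G] {H : CrossedHopfAlgebra K G}

namespace CrossedHopfAlgebra

variable {V W U V₁ W₁ : Type u}
  [AddCommGroup V] [Module K V] [AddCommGroup W] [Module K W] [AddCommGroup U] [Module K U]
  [AddCommGroup V₁] [Module K V₁] [AddCommGroup W₁] [Module K W₁]

namespace Cobraiding

variable (c : H.Cobraiding)

theorem braidMap_natural {ρ : V →ₗ[K] H.carrier ⊗[K] V} {σ : W →ₗ[K] H.carrier ⊗[K] W}
    {ρ₁ : V₁ →ₗ[K] H.carrier ⊗[K] V₁} {σ₁ : W₁ →ₗ[K] H.carrier ⊗[K] W₁} (f : V →ₗ[K] V₁)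
    (g : W →ₗ[K] W₁) (hf : ∀ m, ρ₁ (f m) = f.lTensor _ (ρ m))
    (hg : ∀ n, σ₁ (g n) = g.lTensor _ (σ n)) :
    c.braidMap ρ₁ σ₁ ∘ₗ TensorProduct.map f g = TensorProduct.map g f ∘ₗ c.braidMap ρ σ := by
  refine TensorProduct.ext' fun m n => ?_
  simp only [LinearMap.comp_apply, TensorProduct.map_tmul, braidMap_tmul, hf, hg, bl_lTensor]

theorem braidMap_push (β : G) (ρ : V →ₗ[K] H.carrier ⊗[K] V) (σ : W →ₗ[K] H.carrier ⊗[K] W) :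
    c.braidMap (pushCoaction (H.φl β) ρ) (pushCoaction (H.φl β) σ) = c.braidMap ρ σ := by
  refine TensorProduct.ext' fun m n => ?_
  rw [braidMap_tmul, braidMap_tmul, pushCoaction_apply, pushCoaction_apply, bl_φ]

theorem braidMap_tensor_left (ρ : V →ₗ[K] H.carrier ⊗[K] V)
    (σ : W →ₗ[K] H.carrier ⊗[K] W) {υ : U →ₗ[K] H.carrier ⊗[K] U}
    (hυ : IsCoaction H.carrier υ) {β : G}
    (hσ : ∀ n, σ n ∈ LinearMap.range ((H.comp β).subtype.rTensor W)) (m : V) (n : W) (l : U) :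
    c.braidMap (tensorCoaction ρ σ) υ ((m ⊗ₜ n) ⊗ₜ l) =
      TensorProduct.assoc K U V W ((c.braidMap ρ (pushCoaction (H.φl β) υ)).rTensor W
        ((TensorProduct.assoc K V U W).symm (m ⊗ₜ c.braidMap σ υ (n ⊗ₜ l)))) := by
  rw [braidMap_tmul, braidMap_tmul, tensorCoaction_tmul, c.bl_mul_left (hσ n), hυ.coassoc]
  have e₁ := c.bl_lTensor LinearMap.id υ (σ n) (υ l)
  rw [LinearMap.lTensor_id, LinearMap.id_apply] at e₁
  rw [e₁]
  generalize c.bl (σ n) (υ l) = q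
  congr 1
  induction q with
  | zero => simp
  | add x y hx hy => simp only [map_add, tmul_add, hx, hy]
  | tmul q w =>
    simp only [TensorProduct.map_tmul, LinearMap.rTensor_tmul, TensorProduct.assoc_symm_tmul,
      braidMap_tmul, LinearMap.id_apply]
    rfl

theorem braidMap_tensor_right {ρ : V →ₗ[K] H.carrier ⊗[K] V} (hρ : IsCoaction H.carrier ρ)
    (σ : W →ₗ[K] H.carrier ⊗[K] W) (υ : U →ₗ[K] H.carrier ⊗[K] U) (m : V) (n : W) (l : U) :
    c.braidMap ρ (tensorCoaction σ υ) (m ⊗ₜ (n ⊗ₜ l)) =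
      (TensorProduct.assoc K W U V).symm ((c.braidMap ρ υ).lTensor W
        (TensorProduct.assoc K W V U (c.braidMap ρ σ (m ⊗ₜ n) ⊗ₜ l))) := by
  rw [braidMap_tmul, braidMap_tmul, tensorCoaction_tmul, c.bl_mul_right, hρ.coassoc]
  have e₁ := c.bl_lTensor ρ LinearMap.id (ρ m) (σ n)
  rw [LinearMap.lTensor_id, LinearMap.id_apply] at e₁
  rw [e₁]
  generalize c.bl (ρ m) (σ n) = q
  congr 1
  induction q with
  | zero => simp
  | add x y hx hy => simp only [map_add, add_tmul, hx, hy]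
  | tmul q w =>
    simp only [TensorProduct.map_tmul, LinearMap.lTensor_tmul, TensorProduct.assoc_tmul,
      braidMap_tmul, LinearMap.id_apply]
    rfl

end Cobraiding

namespace Cotwist

variable {c : H.Cobraiding} (t : H.Cotwist c)

theorem coact_comm' {α : G} {ρ : V →ₗ[K] H.carrier ⊗[K] V} (h : IsCoaction H.carrier ρ)
    (hρ : ∀ m, ρ m ∈ LinearMap.range ((H.comp α).subtype.rTensor V)) (m : V) :
    pushCoaction (H.φl α) ρ (coact t.τ ρ m) = (coact t.τ ρ).lTensor H.carrier (ρ m) := by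
  have e := h.lTensor_coact LinearMap.id t.τ m
  rw [LinearMap.rTensor_id, LinearMap.id_apply] at e
  rw [e, pushCoaction_apply, h.rTensor_coact]
  exact rTensor_congr (t.central α) (hρ m)

theorem τ_φ (β : G) : t.τ ∘ₗ H.φl β = t.τ := LinearMap.ext fun h => t.φ_invariant β h

/-- The functional `h ⊗ k ↦ τ(h) τ(k)` -/
def ττ : H.carrier ⊗[K] H.carrier →ₗ[K] K := LinearMap.mul' K K ∘ₗ TensorProduct.map t.τ t.τ

theorem conv_ττ_γop (α β : G) (h k : H.carrier) (hh : h ∈ H.comp α) (hk : k ∈ H.comp β) :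
    convProd t.ττ (c.γop ∘ₗ TensorProduct.map (H.φl α) (H.φl β)) (h ⊗ₜ[K] k) =
      convProd c.γop t.ττ (h ⊗ₜ[K] k) := by
  have e₁ : convProd t.ττ (c.γop ∘ₗ TensorProduct.map (H.φl α) (H.φl β)) (h ⊗ₜ[K] k) =
      c.γop (TensorProduct.lid K H.carrier (TensorProduct.map t.τ (H.φl α) (comul (R := K) h)) ⊗ₜ
        TensorProduct.lid K H.carrier (TensorProduct.map t.τ (H.φl β) (comul (R := K) k))) := by
    simp only [convProd, LinearMap.comp_apply, TensorProduct.comul_tmul]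
    generalize comul (R := K) h = x
    generalize comul (R := K) k = y
    induction x with
    | zero => simp
    | add x x' hx hx' => simp only [map_add, add_tmul, hx, hx']
    | tmul a v =>
    induction y with
    | zero => simp
    | add x x' hx hx' => simp only [map_add, tmul_add, hx, hx']
    | tmul b w => simp [ττ, ← smul_tmul', tmul_smul, mul_assoc, mul_left_comm]
  have e₂ : convProd c.γop t.ττ (h ⊗ₜ[K] k) =
      c.γop (TensorProduct.rid K H.carrier
        (TensorProduct.map LinearMap.id t.τ (comul (R := K) h)) ⊗ₜ
        TensorProduct.rid K H.carrier
          (TensorProduct.map LinearMap.id t.τ (comul (R := K) k))) := by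
    simp only [convProd, LinearMap.comp_apply, TensorProduct.comul_tmul]
    generalize comul (R := K) h = x
    generalize comul (R := K) k = y
    induction x with
    | zero => simp
    | add x x' hx hx' => simp only [map_add, add_tmul, hx, hx']
    | tmul a v =>
    induction y with
    | zero => simp
    | add x x' hx hx' => simp only [map_add, tmul_add, hx, hx']
    | tmul b w =>
      simp [ττ, ← smul_tmul', tmul_smul]
      ring
  rw [e₁, e₂, t.central α h hh, t.central β k hk]

theorem coact_tensor {α β : G} {ρ : V →ₗ[K] H.carrier ⊗[K] V} {σ : W →ₗ[K] H.carrier ⊗[K] W}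
    (h : IsCoaction H.carrier ρ) (k : IsCoaction H.carrier σ)
    (hρ : ∀ m, ρ m ∈ LinearMap.range ((H.comp α).subtype.rTensor V))
    (hσ : ∀ n, σ n ∈ LinearMap.range ((H.comp β).subtype.rTensor W)) (p : V ⊗[K] W) :
    coact t.τ (tensorCoaction ρ σ) p =
      c.braidMap (pushCoaction (H.φl α) (pushCoaction (H.φl β) σ)) (pushCoaction (H.φl α) ρ)
        (c.braidMap (pushCoaction (H.φl α) ρ) (pushCoaction (H.φl β) σ)
          (TensorProduct.map (coact t.τ ρ) (coact t.τ σ) p)) := by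
  have hP := h.prod k
  have hm := prodCoaction_mem hρ hσ
  rw [c.braidMap_push, Cobraiding.braidMap, Cobraiding.braidMap, LinearMap.comp_apply,
    LinearMap.comp_apply, LinearEquiv.coe_coe, LinearEquiv.coe_coe, coact_comm,
    TensorProduct.comm_comm, prod_push, coact_push, ← coact_prod]
  change _ = coact _ _ (coact _ _ (coact t.ττ (prodCoaction ρ σ) p))
  rw [hP.coact_coact, coact_congr (eq_on_range fun a ha b hb => t.conv_ττ_γop α β a b ha hb)
    (hm p), ← hP.coact_coact]
  have e : prodCoaction ρ (pushCoaction (H.φl β) σ) =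
      pushCoaction (TensorProduct.map LinearMap.id (H.φl β)) (prodCoaction ρ σ) := by
    rw [← prod_push]
    congr 1
    ext m
    rw [pushCoaction_apply, LinearMap.rTensor_id, LinearMap.id_apply]
  rw [e, coact_push, hP.coact_coact, hP.coact_coact, tensorCoaction, coact_push]
  refine coact_congr (eq_on_range fun a ha b hb => ?_) (hm p)
  have q := t.mul α β a b ha hb
  rw [twistTail, t.τ_φ] at q
  have e' : c.γ ∘ₗ (H.φl β).lTensor H.carrier = (c.γop ∘ₗ
      (TensorProduct.comm K H.carrier H.carrier).toLinearMap) ∘ₗ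
        TensorProduct.map LinearMap.id (H.φl β) := by
    ext a b
    rfl
  rw [e'] at q
  exact q

end Cotwist

end CrossedHopfAlgebra

end BraidIdentities

section Instances

open TensorProduct Coalgebra

/-- A coquasitriangular (i.e. cobraided) crossed Hopf `G`-algebra. -/
structure CoquasitriangularHopfAlgebra (K : Type u) [Field K] (G : Type u) [Group G] extends
    CrossedHopfAlgebra K G where
  cobraiding : toCrossedHopfAlgebra.Cobraiding

/-- A coribbon crossed Hopf `G`-algebra. -/
structure CoribbonHopfAlgebra (K : Type u) [Field K] (G : Type u) [Group G] extends
    CoquasitriangularHopfAlgebra K G where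
  cotwist : toCrossedHopfAlgebra.Cotwist cobraiding

variable {K : Type u} [Field K] {G : Type u} [Group G]

namespace Comod

variable {H : CrossedHopfAlgebra K G}

/-- The braiding `m ⊗ n ↦ γ(n' ⊗ m') ᵝn'' ⊗ m''`, `β = deg X`, of `Com H`. -/
noncomputable def braid (c : H.Cobraiding) (X Y : Comod H) : X ⊗ Y ≅ conj X.deg Y ⊗ X :=
  isoMk (c.braidEquiv X.isCoaction Y.isCoaction).toModuleIso
    (by change X.deg * Y.deg = X.deg * Y.deg * X.deg⁻¹ * X.deg; group)
    (c.braidMap_comm X.isCoaction Y.isCoaction X.mem Y.mem)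

theorem braid_hom_f (c : H.Cobraiding) (X Y : Comod H) :
    (braid c X Y).hom.f = ModuleCat.ofHom (c.braidMap X.ρ Y.ρ) := rfl

noncomputable instance (Q : CoquasitriangularHopfAlgebra K G) :
    CrossedBraiding (Comod Q.toCrossedHopfAlgebra) where
  c X Y _ h := braid Q.cobraiding X Y ≪≫ eqToIso (congrArg (· ⊗ X) h.symm)
  c_natural {X X₁ Y Y₁ Y' Y₁'} f g h h₁ h₂ := by
    subst h h₂
    ext1
    simp only [comp_f, eqToHom_f, conjMap, Iso.trans_hom, eqToIso.hom, tensorHom_f]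
    simp
    ext1
    exact Q.cobraiding.braidMap_natural f.f.hom g.f.hom f.comm g.comm
  c_tensor_left X Y Z Z' Z'' h h₁ h₂ := by
    subst h h₁
    ext1
    simp only [comp_f, eqToHom_f, Iso.trans_hom, eqToIso.hom, whiskerLeft_f, whiskerRight_f,
      associator_hom_f, associator_inv_f]
    simp
    apply ModuleCat.MonoidalCategory.tensor_ext₃'
    intro m n l
    exact Q.cobraiding.braidMap_tensor_left X.ρ Y.ρ Z.isCoaction Y.mem m n l
  c_tensor_right X Y Z Y' Z' hY hZ h := by
    subst hY hZ
    ext1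
    simp only [comp_f, eqToHom_f, Iso.trans_hom, eqToIso.hom, whiskerLeft_f, whiskerRight_f,
      associator_hom_f, associator_inv_f]
    simp
    apply ModuleCat.MonoidalCategory.tensor_ext₃
    intro m n l
    exact Q.cobraiding.braidMap_tensor_right X.isCoaction Y.ρ Z.ρ m n l
  c_conj β X Y X' Y' Y₁ Y₁' h hX hY hY₁ h₁ hs ht := by
    subst h hX hY hY₁
    ext1
    simp only [comp_f, eqToHom_f, conjMap, Iso.trans_hom, eqToIso.hom]
    simp
    ext1
    exact (Q.cobraiding.braidMap_push β X.ρ Y.ρ).symm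

theorem c_hom_f (Q : CoquasitriangularHopfAlgebra K G) (X Y : Comod Q.toCrossedHopfAlgebra)
    {Y' : Comod Q.toCrossedHopfAlgebra} (h : Y' = conj (CrossedCategory.deg X) Y) :
    (CrossedBraiding.c X Y h).hom.f =
      ModuleCat.ofHom (Q.cobraiding.braidMap X.ρ Y.ρ) ≫
        eqToHom (X := Y.V ⊗ X.V) (Y := Y'.V ⊗ X.V) (by subst h; rfl) := by
  subst h
  change (braid Q.cobraiding X Y ≪≫ eqToIso _).hom.f = _
  simp only [comp_f, eqToHom_f, Iso.trans_hom, eqToIso.hom]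
  simp only [braid_hom_f, eqToHom_refl, Category.comp_id]
  exact (Category.comp_id _).symm

/-- The twist `m ↦ τ(m') ᵅm''`, `α = deg X`, of `Com H`. -/
noncomputable def twist {c : H.Cobraiding} (t : H.Cotwist c) (X : Comod H) : X ≅ conj X.deg X :=
  isoMk (LinearEquiv.toModuleIso
    { coact t.τ X.ρ with
      invFun := coact t.invertible.choose X.ρ
      left_inv := fun m => by
        change coact _ _ (coact _ _ _) = m
        rw [X.isCoaction.coact_coact, t.invertible.choose_spec.1, X.isCoaction.coact_counit]
        rfl
      right_inv := fun m => by
        change coact _ _ (coact _ _ _) = m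
        rw [X.isCoaction.coact_coact, t.invertible.choose_spec.2, X.isCoaction.coact_counit]
        rfl })
    (by change X.deg = X.deg * X.deg * X.deg⁻¹; group)
    (t.coact_comm' X.isCoaction X.mem)

theorem twist_hom_f {c : H.Cobraiding} (t : H.Cotwist c) (X : Comod H) :
    (twist t X).hom.f = ModuleCat.ofHom (coact t.τ X.ρ) := rfl

noncomputable instance (R : CoribbonHopfAlgebra K G) :
    CrossedTwist (Comod R.toCrossedHopfAlgebra) where
  θ X _ h := twist R.cotwist X ≪≫ eqToIso h.symm
  θ_natural {X Y X' Y'} f hX hY hY' := by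
    subst hX hY'
    ext1
    simp only [comp_f, eqToHom_f, conjMap, Iso.trans_hom, eqToIso.hom]
    simp
    ext m
    exact coact_natural R.cotwist.τ f.f.hom f.comm m
  θ_tensor X Y X₁ Y₁ X₂ Y₂ hX hY h₁ h₂ h := by
    have e : Y₂ = conj X.deg Y₁ := by
      rw [h₁, hX]
      exact congrArg (conj · Y₁) (mul_inv_cancel_right X.deg X.deg)
    subst hX hY e h₂
    ext1
    simp only [comp_f, eqToHom_f, Iso.trans_hom, eqToIso.hom, tensorHom_f]
    simp
    rw [twist_hom_f, twist_hom_f, twist_hom_f, c_hom_f, c_hom_f]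
    simp
    ext1
    refine LinearMap.ext fun p => ?_
    refine (R.cotwist.coact_tensor X.isCoaction Y.isCoaction X.mem Y.mem p).trans ?_
    rfl
  θ_conj β X X₁ X' X₁' h hX hX₁ h' := by
    subst h hX hX₁
    ext1
    simp only [comp_f, eqToHom_f, conjMap, Iso.trans_hom, eqToIso.hom]
    simp
    ext m
    change coact R.cotwist.τ X.ρ m = coact R.cotwist.τ (pushCoaction (R.φl β) X.ρ) m
    rw [coact_push, R.cotwist.τ_φ]

end Comod

end Instances

/-! ### Isomorphisms and equivalences of Tannakian crossed categories -/

section Tannakian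

variable {G : Type w} [Group G] {K : Type u} [Field K]
  {C : Type*} [Category* C] [MonoidalCategory C] [CrossedCategory G C] [CrossedBraiding C]
  {D : Type*} [Category* D] [MonoidalCategory D] [CrossedCategory G D] [CrossedBraiding D]

/-- There is an isomorphism `F : C ≅ P` of braided Tannakian crossed `G`-categories, where `P` is a
full subcategory of `D`, and where `X` and `Y` are the fiber functors of `C` and `D`; in particular
`X = Y ∘ F`. -/
def BraidedTannakianIso (X : CrossedFiberFunctor K C) (Y : CrossedFiberFunctor K D)
    (P : ObjectProperty D) : Prop :=
  ∃ F : CrossedFunctor C D, F.IsIsoOnto P ∧ F.IsBraided ∧ F.PreservesFiber X Y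

/-- There is an equivalence `F : C ≌ P` of braided Tannakian crossed `G`-categories. -/
def BraidedTannakianEquiv (X : CrossedFiberFunctor K C) (Y : CrossedFiberFunctor K D)
    (P : ObjectProperty D) : Prop :=
  ∃ F : CrossedFunctor C D, F.IsEquivOnto P ∧ F.IsBraided ∧ F.PreservesFiber X Y

variable [CrossedTwist C] [CrossedTwist D]

/-- `C` is ribbon, and there is an isomorphism `F : C ≅ P` of ribbon Tannakian crossed
`G`-categories. -/
def RibbonTannakianIso (X : CrossedFiberFunctor K C) (Y : CrossedFiberFunctor K D)
    (P : ObjectProperty D) : Prop :=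
  IsRibbonCategory C ∧
    ∃ F : CrossedFunctor C D, F.IsIsoOnto P ∧ F.IsBraided ∧ F.IsBalanced ∧ F.PreservesFiber X Y

/-- `C` is ribbon, and there is an equivalence `F : C ≌ P` of ribbon Tannakian crossed
`G`-categories. -/
def RibbonTannakianEquiv (X : CrossedFiberFunctor K C) (Y : CrossedFiberFunctor K D)
    (P : ObjectProperty D) : Prop :=
  IsRibbonCategory C ∧
    ∃ F : CrossedFunctor C D, F.IsEquivOnto P ∧ F.IsBraided ∧ F.IsBalanced ∧ F.PreservesFiber X Y

end Tannakian

/-! ### Coefficients of linear maps `V → M ⊗ V` -/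

section Coefficients

open TensorProduct Module

variable {K : Type*} [Field K] {M N V W : Type*} [AddCommGroup M] [Module K M] [AddCommGroup N]
  [Module K N] [AddCommGroup V] [Module K V] [AddCommGroup W] [Module K W]

/-- The map `m ⊗ v ↦ ξ(v) m`. -/
noncomputable def sliceR (M : Type*) [AddCommGroup M] [Module K M] (ξ : Dual K V) :
    M ⊗[K] V →ₗ[K] M :=
  (TensorProduct.rid K M).toLinearMap ∘ₗ ξ.lTensor M

@[simp] theorem sliceR_tmul (ξ : Dual K V) (m : M) (v : V) : sliceR M ξ (m ⊗ₜ v) = ξ v • m := by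
  simp [sliceR]

theorem sliceR_add (ξ η : Dual K V) (x : M ⊗[K] V) :
    sliceR M (ξ + η) x = sliceR M ξ x + sliceR M η x := by
  simp [sliceR, LinearMap.lTensor_add]

theorem sliceR_smul (r : K) (ξ : Dual K V) (x : M ⊗[K] V) :
    sliceR M (r • ξ) x = r • sliceR M ξ x := by
  simp [sliceR, LinearMap.lTensor_smul]

theorem sliceR_lTensor (ξ : Dual K W) (f : V →ₗ[K] W) (x : M ⊗[K] V) :
    sliceR M ξ (f.lTensor M x) = sliceR M (ξ ∘ₗ f) x := by
  simp [sliceR, LinearMap.lTensor_comp]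

theorem sliceR_rTensor (ξ : Dual K V) (f : M →ₗ[K] N) (x : M ⊗[K] V) :
    sliceR N ξ (f.rTensor V x) = f (sliceR M ξ x) := by
  induction x with
  | zero => simp
  | add x y hx hy => simp only [map_add, hx, hy]
  | tmul m v => simp

theorem eq_sum_sliceR {ι : Type*} [Fintype ι] (b : Basis ι K V) (x : M ⊗[K] V) :
    x = ∑ i, sliceR M (b.coord i) x ⊗ₜ[K] b i := by
  induction x with
  | zero => simp
  | add x y hx hy =>
    simp only [map_add, add_tmul, Finset.sum_add_distrib]
    rw [← hx, ← hy]
  | tmul m v =>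
    simp only [sliceR_tmul, smul_tmul, ← tmul_sum]
    congr 1
    exact (b.sum_repr v).symm

theorem sliceR_ext [Module.Finite K V] {x y : M ⊗[K] V}
    (h : ∀ ξ : Dual K V, sliceR M ξ x = sliceR M ξ y) : x = y := by
  rw [eq_sum_sliceR (finBasis K V) x, eq_sum_sliceR (finBasis K V) y]
  simp only [h]

/-- The coefficients `(ξ, v) ↦ ξ(v'') v'` of a linear map `v ↦ v' ⊗ v''`. -/
noncomputable def coefR (ρ : V →ₗ[K] M ⊗[K] V) : Dual K V →ₗ[K] V →ₗ[K] M :=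
  LinearMap.mk₂ K (fun ξ v => sliceR M ξ (ρ v)) (fun _ _ _ => sliceR_add _ _ _)
    (fun _ _ _ => sliceR_smul _ _ _) (by simp) (by simp)

@[simp] theorem coefR_apply (ρ : V →ₗ[K] M ⊗[K] V) (ξ : Dual K V) (v : V) :
    coefR ρ ξ v = sliceR M ξ (ρ v) := rfl

/-- The linear map with given coefficients. -/
noncomputable def ofCoefR [Module.Finite K V] (m : Dual K V →ₗ[K] V →ₗ[K] M) :
    V →ₗ[K] M ⊗[K] V :=
  ∑ i, (TensorProduct.mk K M V).flip (finBasis K V i) ∘ₗ m ((finBasis K V).coord i)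

@[simp] theorem sliceR_ofCoefR [Module.Finite K V] (m : Dual K V →ₗ[K] V →ₗ[K] M) (ξ : Dual K V)
    (v : V) : sliceR M ξ (ofCoefR m v) = m ξ v := by
  simp only [ofCoefR, LinearMap.sum_apply, LinearMap.comp_apply, LinearMap.flip_apply,
    TensorProduct.mk_apply, map_sum, sliceR_tmul]
  have e := (finBasis K V).sum_dual_apply_smul_coord ξ
  conv_rhs => rw [← e]
  simp only [map_sum, map_smul, LinearMap.sum_apply, LinearMap.smul_apply]

theorem ofCoefR_apply [Module.Finite K V] (m : Dual K V →ₗ[K] V →ₗ[K] M) {ι : Type*} [Fintype ι]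
    (b : Basis ι K V) (v : V) : ofCoefR m v = ∑ i, m (b.coord i) v ⊗ₜ[K] b i := by
  rw [eq_sum_sliceR b (ofCoefR m v)]
  simp

theorem coefR_ofCoefR [Module.Finite K V] (m : Dual K V →ₗ[K] V →ₗ[K] M) :
    coefR (ofCoefR m) = m := by
  ext ξ v; simp

theorem ofCoefR_coefR [Module.Finite K V] (ρ : V →ₗ[K] M ⊗[K] V) : ofCoefR (coefR ρ) = ρ := by
  ext v; exact sliceR_ext fun ξ => by simp

/-- A tensor is determined by its images under the maps `m ⊗ v ↦ f(m) v`. -/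
theorem rTensor_ext {x y : M ⊗[K] V}
    (h : ∀ f : Dual K M, TensorProduct.lid K V (f.rTensor V x) = TensorProduct.lid K V (f.rTensor V y)) :
    x = y := by
  rw [← sub_eq_zero]
  have h' : ∀ f : Dual K M, TensorProduct.lid K V (f.rTensor V (x - y)) = 0 := fun f => by
    simp [h f]
  generalize x - y = z at h'
  classical
  let b := Basis.ofVectorSpace K M
  obtain ⟨c, rfl⟩ := (TensorProduct.equivFinsuppOfBasisLeft (N := V) b).symm.surjective z
  have hc : c = 0 := by
    ext i
    have := h' (b.coord i)
    rw [TensorProduct.equivFinsuppOfBasisLeft_symm_apply] at this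
    simp only [Finsupp.sum, map_sum, LinearMap.rTensor_tmul, TensorProduct.lid_tmul,
      Basis.coord_apply, Basis.repr_self] at this
    rw [Finset.sum_eq_single i] at this
    · simpa using this
    · intro j _ hj; simp [Finsupp.single_eq_of_ne hj.symm]
    · intro hi; simpa using hi
  simp [hc]

theorem mem_range_lTensor {P : Submodule K V} {x : M ⊗[K] V}
    (h : ∀ f : Dual K M, TensorProduct.lid K V (f.rTensor V x) ∈ P) :
    x ∈ LinearMap.range (P.subtype.lTensor M) := by
  have hq : P.mkQ.lTensor M x = 0 := by
    refine rTensor_ext fun f => ?_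
    have e : TensorProduct.lid K (V ⧸ P) (f.rTensor _ (P.mkQ.lTensor M x)) =
        P.mkQ (TensorProduct.lid K V (f.rTensor V x)) := by
      induction x with
      | zero => simp
      | tmul m v => simp
      | add x y hx hy =>
        clear hx hy h
        have g : ∀ z : M ⊗[K] V, TensorProduct.lid K (V ⧸ P) (f.rTensor _ (P.mkQ.lTensor M z)) =
            P.mkQ (TensorProduct.lid K V (f.rTensor V z)) := by
          intro z
          induction z with
          | zero => simp
          | tmul m v => simp
          | add x y hx hy => simp only [map_add, hx, hy]
        exact g _
    rw [e]
    simpa using h f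
  have ex : Function.Exact P.subtype P.mkQ := by
    rw [LinearMap.exact_iff]; simp
  exact (lTensor_exact M ex P.mkQ_surjective x).mp hq

end Coefficients

/-! ### Linear maps on a crossed Hopf algebra are natural families of maps on coefficients -/

section UniversalProperty

open TensorProduct Coalgebra Module

variable {K : Type u} [Field K] {G : Type u} [Group G] (H : CrossedHopfAlgebra K G)

namespace CrossedHopfAlgebra

theorem isCoaction_comul : IsCoaction H.carrier (comul (R := K) (A := H.carrier)) where
  coassoc := coassoc_apply
  counit m := by rw [rTensor_counit_comul]; simp

/-- Finite-dimensional subcomodules of `H_α`. -/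
structure IsSubcomod (α : G) (W : Submodule K H.carrier) : Prop where
  le : W ≤ H.comp α
  finite : Module.Finite K W
  comul : ∀ h ∈ W, comul (R := K) h ∈ LinearMap.range (W.subtype.lTensor H.carrier)

variable {H}

namespace IsSubcomod

variable {α : G} {W W' : Submodule K H.carrier}

theorem sup (h : H.IsSubcomod α W) (h' : H.IsSubcomod α W') : H.IsSubcomod α (W ⊔ W') where
  le := sup_le h.le h'.le
  finite := by
    have := h.finite
    have := h'.finite
    exact Submodule.finite_sup W W'
  comul x hx := by
    have mono : ∀ {W₁ W₂ : Submodule K H.carrier}, W₁ ≤ W₂ → LinearMap.range (W₁.subtype.lTensor H.carrier) ≤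
        LinearMap.range (W₂.subtype.lTensor H.carrier) := by
      rintro W₁ W₂ hW _ ⟨y, rfl⟩
      refine ⟨(Submodule.inclusion hW).lTensor _ y, ?_⟩
      rw [← LinearMap.lTensor_comp_apply]; rfl
    obtain ⟨y, hy, z, hz, rfl⟩ := Submodule.mem_sup.mp hx
    rw [map_add]
    exact add_mem (mono le_sup_left (h.comul y hy)) (mono le_sup_right (h'.comul z hz))

/-- The coaction on a subcomodule. -/
noncomputable def ρ (_ : H.IsSubcomod α W) : W →ₗ[K] H.carrier ⊗[K] W :=
  (W.subtype.exists_leftInverse_of_injective W.ker_subtype).choose.lTensor H.carrier ∘ₗ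
    Coalgebra.comul ∘ₗ W.subtype

theorem lTensor_ρ (h : H.IsSubcomod α W) (w : W) :
    W.subtype.lTensor H.carrier (h.ρ w) = Coalgebra.comul (R := K) (w : H.carrier) := by
  obtain ⟨y, hy⟩ := h.comul w w.2
  have e := (W.subtype.exists_leftInverse_of_injective W.ker_subtype).choose_spec
  simp only [ρ, LinearMap.comp_apply, Submodule.subtype_apply]
  rw [← hy, ← LinearMap.lTensor_comp_apply _ _ W.subtype, e, LinearMap.lTensor_id]
  rfl

theorem lTensor_injective (M : Type u) [AddCommGroup M] [Module K M] (W : Submodule K H.carrier) :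
    Function.Injective (W.subtype.lTensor M) :=
  Module.Flat.lTensor_preserves_injective_linearMap _ W.subtype_injective

/-- A finite-dimensional subcomodule of `H_α` as an object of `Com H`. -/
noncomputable abbrev comod (h : H.IsSubcomod α W) : Comod H where
  deg := α
  V := ModuleCat.of K W
  finite := h.finite
  ρ := h.ρ
  isCoaction :=
    { coassoc := fun m => by
        apply Module.Flat.lTensor_preserves_injective_linearMap _ (lTensor_injective H.carrier W)
        have e₁ : ∀ x : H.carrier ⊗[K] W,
            (W.subtype.lTensor H.carrier).lTensor H.carrier
              (TensorProduct.assoc K _ _ _ ((Coalgebra.comul (R := K)).rTensor W x)) =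
            TensorProduct.assoc K _ _ _ ((Coalgebra.comul (R := K)).rTensor H.carrier
              (W.subtype.lTensor H.carrier x)) := by
          intro x
          induction x with
          | zero => simp
          | add x y hx hy => simp only [map_add, hx, hy]
          | tmul a v =>
            simp only [LinearMap.rTensor_tmul, LinearMap.lTensor_tmul]
            generalize Coalgebra.comul (R := K) a = y
            induction y with
            | zero => simp
            | add x y hx hy => simp only [map_add, add_tmul, hx, hy]
            | tmul b c => simp
        have e₂ : ∀ x : H.carrier ⊗[K] W,
            (W.subtype.lTensor H.carrier).lTensor H.carrier (h.ρ.lTensor H.carrier x) =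
            (Coalgebra.comul (R := K)).lTensor H.carrier (W.subtype.lTensor H.carrier x) := by
          intro x
          rw [← LinearMap.lTensor_comp_apply, ← LinearMap.lTensor_comp_apply]
          congr 2
          exact LinearMap.ext h.lTensor_ρ
        refine (e₁ _).trans (Eq.trans ?_ (e₂ _).symm)
        rw [h.lTensor_ρ, coassoc_apply]
      counit := fun m => by
        apply W.subtype_injective
        have e : ∀ x : H.carrier ⊗[K] W,
            W.subtype (TensorProduct.lid K W ((Coalgebra.counit (R := K)).rTensor W x)) =
            TensorProduct.lid K H.carrier ((Coalgebra.counit (R := K)).rTensor _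
              (W.subtype.lTensor H.carrier x)) := by
          intro x
          induction x with
          | zero => simp
          | add x y hx hy => simp only [map_add, hx, hy]
          | tmul a v => simp
        refine (e _).trans ?_
        rw [h.lTensor_ρ, rTensor_counit_comul]
        simp }
  mem m := by
    obtain ⟨y, hy⟩ := H.comul_mem α _ (h.le m.2)
    refine ⟨((W.subtype.exists_leftInverse_of_injective W.ker_subtype).choose ∘ₗ
      (H.comp α).subtype).lTensor _ y, ?_⟩
    change _ = h.ρ m
    simp only [ρ, LinearMap.comp_apply, Submodule.subtype_apply, ← hy]
    generalize (W.subtype.exists_leftInverse_of_injective W.ker_subtype).choose = r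
    clear hy
    induction y with
    | zero => simp
    | add x y hx hy => simp only [map_add, hx, hy]
    | tmul a b => simp [TensorProduct.mapIncl]

/-- The counit of `H` on a subcomodule. -/
noncomputable def ε (_ : H.IsSubcomod α W) : Dual K W := Coalgebra.counit ∘ₗ W.subtype

theorem coefR_ε (h : H.IsSubcomod α W) (w : W) : coefR h.ρ h.ε w = w := by
  rw [coefR_apply, ε, ← sliceR_lTensor, h.lTensor_ρ, sliceR]
  simp

/-- Colinear maps to a subcomodule of `H`. -/
noncomputable def homMk (h : H.IsSubcomod α W) {X : Comod H} (hX : X.deg = α)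
    (f : X.V →ₗ[K] W)
    (hf : ∀ v, Coalgebra.comul (R := K) (f v : H.carrier) =
      (W.subtype ∘ₗ f).lTensor H.carrier (X.ρ v)) : X ⟶ h.comod where
  f := ModuleCat.ofHom f
  deg_eq := hX
  comm v := by
    apply lTensor_injective H.carrier W
    refine (h.lTensor_ρ (f v)).trans ?_
    rw [hf, LinearMap.lTensor_comp_apply]
    rfl

end IsSubcomod

theorem coefR_comm {X : Comod H} (ξ : Dual K X.V) (v : X.V) :
    comul (R := K) (coefR X.ρ ξ v) = (coefR X.ρ ξ).lTensor H.carrier (X.ρ v) := by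
  have e : ∀ x : H.carrier ⊗[K] X.V, comul (R := K) (sliceR H.carrier ξ x) =
      (sliceR H.carrier ξ).lTensor H.carrier (TensorProduct.assoc K _ _ _
        ((comul (R := K)).rTensor X.V x)) := by
    intro x
    induction x with
    | zero => simp
    | add x y hx hy => simp only [map_add, hx, hy]
    | tmul a v =>
      simp only [LinearMap.rTensor_tmul, sliceR_tmul, map_smul]
      generalize comul (R := K) a = y
      induction y with
      | zero => simp
      | add x y hx hy => simp only [map_add, add_tmul, smul_add, hx, hy]
      | tmul b c => simp
  rw [coefR_apply, e, X.isCoaction.coassoc, ← LinearMap.lTensor_comp_apply]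
  rfl

theorem sliceR_mem {S : Submodule K H.carrier} {V : Type*} [AddCommGroup V] [Module K V]
    (ξ : Dual K V) {x : H.carrier ⊗[K] V} (hx : x ∈ LinearMap.range (S.subtype.rTensor V)) :
    sliceR H.carrier ξ x ∈ S := by
  obtain ⟨y, rfl⟩ := hx
  rw [sliceR_rTensor]
  exact Subtype.property _

theorem coefR_mem (X : Comod H) (ξ : Dual K X.V) (v : X.V) : coefR X.ρ ξ v ∈ H.comp X.deg :=
  sliceR_mem ξ (X.mem v)

theorem isSubcomod_range (X : Comod H) (ξ : Dual K X.V) :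
    H.IsSubcomod X.deg (LinearMap.range (coefR X.ρ ξ)) where
  le := by rintro _ ⟨v, rfl⟩; exact coefR_mem X ξ v
  finite := inferInstance
  comul := by
    rintro _ ⟨v, rfl⟩
    rw [coefR_comm]
    exact ⟨(coefR X.ρ ξ).rangeRestrict.lTensor _ (X.ρ v), by
      rw [← LinearMap.lTensor_comp_apply]; rfl⟩

/-- The subcomodule generated by an element. -/
theorem exists_isSubcomod {α : G} {h : H.carrier} (hh : h ∈ H.comp α) :
    ∃ W, H.IsSubcomod α W ∧ h ∈ W := by
  let L : Dual K H.carrier →ₗ[K] H.carrier :=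
    { toFun := fun f => coact f comul h
      map_add' := fun f g => by simp [coact, LinearMap.rTensor_add]
      map_smul' := fun r f => by simp [coact, LinearMap.rTensor_smul] }
  have hL : ∀ f, L f = coact f comul h := fun _ => rfl
  refine ⟨LinearMap.range L, ⟨?_, ?_, ?_⟩, Coalgebra.counit, ?_⟩
  · rintro _ ⟨f, rfl⟩
    obtain ⟨y, hy⟩ := H.comul_mem α _ hh
    rw [hL, coact_apply, ← hy]
    clear hy
    induction y with
    | zero => simp
    | add x y hx hy => simp only [map_add]; exact add_mem hx hy
    | tmul a b => simp [TensorProduct.mapIncl, Submodule.smul_mem]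
  · obtain ⟨s, hs⟩ := TensorProduct.exists_finset (comul (R := K) h)
    have : LinearMap.range L ≤ Submodule.span K (Prod.snd '' (s : Set (H.carrier × H.carrier))) := by
      rintro _ ⟨f, rfl⟩
      rw [hL, coact_apply, hs]
      simp only [map_sum, LinearMap.rTensor_tmul, TensorProduct.lid_tmul]
      exact Submodule.sum_mem _ fun i hi => Submodule.smul_mem _ _
        (Submodule.subset_span ⟨i, hi, rfl⟩)
    have : Module.Finite K (Submodule.span K (Prod.snd '' (s : Set (H.carrier × H.carrier)))) :=
      Module.Finite.span_of_finite K (s.finite_toSet.image _)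
    exact Submodule.finiteDimensional_of_le ‹_›
  · rintro _ ⟨f, rfl⟩
    refine mem_range_lTensor fun g => ⟨convProd f g, ?_⟩
    rw [hL, hL, ← H.isCoaction_comul.coact_coact]
    rfl
  · rw [hL, H.isCoaction_comul.coact_counit]; rfl

/-- Every homogeneous element is a coefficient. -/
theorem exists_coefR {α : G} {h : H.carrier} (hh : h ∈ H.comp α) :
    ∃ X : Comod H, X.deg = α ∧ ∃ (ξ : Dual K X.V) (v : X.V), coefR X.ρ ξ v = h := by
  obtain ⟨W, hW, hm⟩ := exists_isSubcomod hh
  exact ⟨hW.comod, rfl, hW.ε, ⟨h, hm⟩, hW.coefR_ε ⟨h, hm⟩⟩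

theorem hom_eqOn_of_coefR {M : Type*} [AddCommGroup M] [Module K M] {t t' : H.carrier →ₗ[K] M}
    {α : G} (h : ∀ (X : Comod H) (_ : X.deg = α) (ξ : Dual K X.V) (v : X.V),
      t (coefR X.ρ ξ v) = t' (coefR X.ρ ξ v)) : Set.EqOn t t' (H.comp α) := by
  intro a ha
  obtain ⟨X, hX, ξ, v, rfl⟩ := exists_coefR ha
  exact h X hX ξ v

theorem induction_comp {P : H.carrier → Prop} (add : ∀ x y, P x → P y → P (x + y)) (h₀ : P 0)
    (h : ∀ α, ∀ a ∈ H.comp α, P a) (a : H.carrier) : P a := by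
  have ha : a ∈ ⨆ α, H.comp α := by rw [H.iSup_comp]; trivial
  exact Submodule.iSup_induction _ (motive := P) ha h h₀ add

theorem hom_ext_comp {M : Type*} [AddCommGroup M] [Module K M] {t t' : H.carrier →ₗ[K] M}
    (h : ∀ α, ∀ a ∈ H.comp α, t a = t' a) : t = t' :=
  LinearMap.ext (induction_comp (fun x y hx hy => by simp [hx, hy]) (by simp) h)

theorem hom_ext_of_coefR {M : Type*} [AddCommGroup M] [Module K M] {t t' : H.carrier →ₗ[K] M}
    (h : ∀ (X : Comod H) (ξ : Dual K X.V) (v : X.V),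
      t (coefR X.ρ ξ v) = t' (coefR X.ρ ξ v)) : t = t' :=
  hom_ext_comp fun _ => hom_eqOn_of_coefR fun X _ => h X

variable {M : Type*} [AddCommGroup M] [Module K M]

theorem exists_hom_on_comp (m : ∀ X : Comod H, Dual K X.V →ₗ[K] X.V →ₗ[K] M)
    (hm : ∀ {X Y : Comod H} (f : X ⟶ Y) (ξ : Dual K Y.V) (v : X.V),
      m Y ξ (f.f.hom v) = m X (ξ ∘ₗ f.f.hom) v) (α : G) :
    ∃ t : H.comp α →ₗ[K] M, ∀ (X : Comod H) (hX : X.deg = α) (ξ : Dual K X.V) (v : X.V),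
      t ⟨coefR X.ρ ξ v, hX ▸ coefR_mem X ξ v⟩ = m X ξ v := by
  have mono : ∀ {W W' : Submodule K H.carrier} (hW : H.IsSubcomod α W) (hW' : H.IsSubcomod α W')
      (hle : W ≤ W') (w : W), m hW'.comod hW'.ε (Submodule.inclusion hle w) =
        m hW.comod hW.ε w := by
    intro W W' hW hW' hle w
    refine hm (hW'.homMk (X := hW.comod) rfl (Submodule.inclusion hle) ?_) hW'.ε w
    intro v
    exact (hW.lTensor_ρ v).symm
  have indep : ∀ {W W' : Submodule K H.carrier} (hW : H.IsSubcomod α W) (hW' : H.IsSubcomod α W')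
      (x : H.carrier) (h : x ∈ W) (h' : x ∈ W'),
      m hW.comod hW.ε (⟨x, h⟩ : W) = m hW'.comod hW'.ε (⟨x, h'⟩ : W') := by
    intro W W' hW hW' x h h'
    rw [← mono hW (hW.sup hW') le_sup_left ⟨x, h⟩, ← mono hW' (hW.sup hW') le_sup_right ⟨x, h'⟩]
    rfl
  choose W hW hmem using fun h : H.comp α => exists_isSubcomod h.2
  refine ⟨{ toFun := fun h => m (hW h).comod (hW h).ε (⟨h, hmem h⟩ : W h)
            map_add' := fun x y => ?_, map_smul' := fun r x => ?_ }, fun X hX ξ v => ?_⟩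
  · let U := hW x |>.sup (hW y)
    have hx : (x : H.carrier) ∈ W x ⊔ W y := Submodule.mem_sup_left (hmem x)
    have hy : (y : H.carrier) ∈ W x ⊔ W y := Submodule.mem_sup_right (hmem y)
    rw [indep (hW x) U x (hmem x) hx, indep (hW y) U y (hmem y) hy,
      indep (hW (x + y)) U _ (hmem (x + y)) (add_mem hx hy), ← map_add]
    rfl
  · rw [indep (hW (r • x)) (hW x) _ (hmem (r • x)) (Submodule.smul_mem _ r (hmem x)),
      RingHom.id_apply, ← map_smul]
    rfl
  · subst hX
    have hr := isSubcomod_range X ξ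
    refine (indep _ hr _ _ ⟨v, rfl⟩).trans ?_
    refine (hm (hr.homMk (X := X) rfl (coefR X.ρ ξ).rangeRestrict fun v => ?_) hr.ε v).trans ?_
    · exact coefR_comm ξ v
    · congr 1
      congr 1
      ext w
      change Coalgebra.counit (R := K) (sliceR H.carrier ξ (X.ρ w)) = ξ w
      rw [← sliceR_rTensor]
      have e : ∀ x : K ⊗[K] X.V, sliceR K ξ x = ξ (TensorProduct.lid K X.V x) := by
        intro x
        induction x with
        | zero => simp
        | add x y hx hy => simp only [map_add, hx, hy]
        | tmul a v => simp [mul_comm]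
      rw [e, X.isCoaction.counit]

variable (H) in
theorem exists_hom (m : ∀ X : Comod H, Dual K X.V →ₗ[K] X.V →ₗ[K] M)
    (hm : ∀ {X Y : Comod H} (f : X ⟶ Y) (ξ : Dual K Y.V) (v : X.V),
      m Y ξ (f.f.hom v) = m X (ξ ∘ₗ f.f.hom) v) :
    ∃ t : H.carrier →ₗ[K] M, ∀ (X : Comod H) (ξ : Dual K X.V) (v : X.V),
      t (coefR X.ρ ξ v) = m X ξ v := by
  classical
  choose t ht using exists_hom_on_comp m hm
  have hint := DirectSum.isInternal_submodule_of_iSupIndep_of_iSup_eq_top H.indep H.iSup_comp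
  let e := LinearEquiv.ofBijective (DirectSum.coeLinearMap H.comp) hint
  refine ⟨DirectSum.toModule K G M t ∘ₗ e.symm.toLinearMap, fun X ξ v => ?_⟩
  have he : e.symm (coefR X.ρ ξ v) =
      DirectSum.lof K G (fun α => H.comp α) X.deg ⟨coefR X.ρ ξ v, coefR_mem X ξ v⟩ := by
    rw [LinearEquiv.symm_apply_eq]
    exact (DirectSum.coeLinearMap_lof H.comp X.deg ⟨coefR X.ρ ξ v, coefR_mem X ξ v⟩).symm
  rw [LinearMap.comp_apply, LinearEquiv.coe_coe, he, DirectSum.toModule_lof]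
  exact ht X.deg X rfl ξ v

end CrossedHopfAlgebra

end UniversalProperty

/-! ### Crossed families of structures on finite-dimensional vector spaces, and their coends -/

section Theory

open TensorProduct Coalgebra Module

/-- Structures of some kind on finite-dimensional vector spaces, with their homomorphisms, tensor
products, conjugates and dual structures: a concrete crossed `G`-category whose fiber functor
is an isofibration with discrete fibers. -/
structure CrossedTheory (K : Type u) [Field K] (G : Type u) [Group G] where
  Str : (V : Type u) → [AddCommGroup V] → [Module K V] → [Module.Finite K V] → Type u
  deg : ∀ {V : Type u} [AddCommGroup V] [Module K V] [Module.Finite K V], Str V → G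
  Hom : ∀ {V W : Type u} [AddCommGroup V] [Module K V] [Module.Finite K V] [AddCommGroup W]
    [Module K W] [Module.Finite K W], Str V → Str W → (V →ₗ[K] W) → Prop
  deg_eq : ∀ {V W : Type u} [AddCommGroup V] [Module K V] [Module.Finite K V] [AddCommGroup W]
    [Module K W] [Module.Finite K W] {s : Str V} {t : Str W} {f : V →ₗ[K] W}, Hom s t f →
    deg s = deg t
  comp : ∀ {V W U : Type u} [AddCommGroup V] [Module K V] [Module.Finite K V] [AddCommGroup W]
    [Module K W] [Module.Finite K W] [AddCommGroup U] [Module K U] [Module.Finite K U]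
    {s : Str V} {t : Str W} {r : Str U} {f : V →ₗ[K] W} {g : W →ₗ[K] U},
    Hom s t f → Hom t r g → Hom s r (g ∘ₗ f)
  transport : ∀ {V W : Type u} [AddCommGroup V] [Module K V] [Module.Finite K V] [AddCommGroup W]
    [Module K W] [Module.Finite K W], (V ≃ₗ[K] W) → Str V → Str W
  transport_hom : ∀ {V W : Type u} [AddCommGroup V] [Module K V] [Module.Finite K V]
    [AddCommGroup W] [Module K W] [Module.Finite K W] (e : V ≃ₗ[K] W) (s : Str V),
    Hom s (transport e s) e.toLinearMap
  transport_hom_symm : ∀ {V W : Type u} [AddCommGroup V] [Module K V] [Module.Finite K V]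
    [AddCommGroup W] [Module K W] [Module.Finite K W] (e : V ≃ₗ[K] W) (s : Str V),
    Hom (transport e s) s e.symm.toLinearMap
  tensor : ∀ {V W : Type u} [AddCommGroup V] [Module K V] [Module.Finite K V] [AddCommGroup W]
    [Module K W] [Module.Finite K W], Str V → Str W → Str (V ⊗[K] W)
  tensor_hom : ∀ {V W V' W' : Type u} [AddCommGroup V] [Module K V] [Module.Finite K V]
    [AddCommGroup W] [Module K W] [Module.Finite K W] [AddCommGroup V'] [Module K V']
    [Module.Finite K V'] [AddCommGroup W'] [Module K W'] [Module.Finite K W']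
    {s : Str V} {t : Str W} {s' : Str V'} {t' : Str W'} {f : V →ₗ[K] V'} {g : W →ₗ[K] W'},
    Hom s s' f → Hom t t' g → Hom (tensor s t) (tensor s' t') (TensorProduct.map f g)
  deg_tensor : ∀ {V W : Type u} [AddCommGroup V] [Module K V] [Module.Finite K V] [AddCommGroup W]
    [Module K W] [Module.Finite K W] (s : Str V) (t : Str W), deg (tensor s t) = deg s * deg t
  unit : Str K
  deg_unit : deg unit = 1
  assoc_hom : ∀ {V W U : Type u} [AddCommGroup V] [Module K V] [Module.Finite K V]
    [AddCommGroup W] [Module K W] [Module.Finite K W] [AddCommGroup U] [Module K U]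
    [Module.Finite K U] (s : Str V) (t : Str W) (r : Str U),
    Hom (tensor (tensor s t) r) (tensor s (tensor t r)) (TensorProduct.assoc K V W U).toLinearMap
  lid_hom : ∀ {V : Type u} [AddCommGroup V] [Module K V] [Module.Finite K V] (s : Str V),
    Hom (tensor unit s) s (TensorProduct.lid K V).toLinearMap
  rid_hom : ∀ {V : Type u} [AddCommGroup V] [Module K V] [Module.Finite K V] (s : Str V),
    Hom (tensor s unit) s (TensorProduct.rid K V).toLinearMap
  conj : ∀ {V : Type u} [AddCommGroup V] [Module K V] [Module.Finite K V], G → Str V → Str V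
  conj_hom : ∀ {V W : Type u} [AddCommGroup V] [Module K V] [Module.Finite K V] [AddCommGroup W]
    [Module K W] [Module.Finite K W] (β : G) {s : Str V} {t : Str W} {f : V →ₗ[K] W}, Hom s t f →
    Hom (conj β s) (conj β t) f
  deg_conj : ∀ {V : Type u} [AddCommGroup V] [Module K V] [Module.Finite K V] (β : G) (s : Str V),
    deg (conj β s) = β * deg s * β⁻¹
  conj_one : ∀ {V : Type u} [AddCommGroup V] [Module K V] [Module.Finite K V] (s : Str V),
    conj 1 s = s
  conj_mul : ∀ {V : Type u} [AddCommGroup V] [Module K V] [Module.Finite K V] (β γ : G)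
    (s : Str V), conj (β * γ) s = conj β (conj γ s)
  conj_tensor : ∀ {V W : Type u} [AddCommGroup V] [Module K V] [Module.Finite K V]
    [AddCommGroup W] [Module K W] [Module.Finite K W] (β : G) (s : Str V) (t : Str W),
    conj β (tensor s t) = tensor (conj β s) (conj β t)
  conj_unit : ∀ β : G, conj β unit = unit
  rdual : ∀ {V : Type u} [AddCommGroup V] [Module K V] [Module.Finite K V],
    Str V → Str (Dual K V)
  rdual_hom : ∀ {V W : Type u} [AddCommGroup V] [Module K V] [Module.Finite K V] [AddCommGroup W]
    [Module K W] [Module.Finite K W] {s : Str V} {t : Str W} {f : V →ₗ[K] W}, Hom s t f →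
    Hom (rdual t) (rdual s) f.dualMap
  deg_rdual : ∀ {V : Type u} [AddCommGroup V] [Module K V] [Module.Finite K V] (s : Str V),
    deg (rdual s) = (deg s)⁻¹
  ev_hom : ∀ {V : Type u} [AddCommGroup V] [Module K V] [Module.Finite K V] (s : Str V),
    Hom (tensor s (rdual s)) unit (TensorProduct.lift (Dual.eval K V))
  coev_hom : ∀ {V : Type u} [AddCommGroup V] [Module K V] [Module.Finite K V] (s : Str V),
    Hom unit (tensor (rdual s) s)
      ((TensorProduct.comm K V (Dual K V)).toLinearMap ∘ₗ coevaluation K V)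
  ldual : ∀ {V : Type u} [AddCommGroup V] [Module K V] [Module.Finite K V],
    Str V → Str (Dual K V)
  ldual_hom : ∀ {V W : Type u} [AddCommGroup V] [Module K V] [Module.Finite K V] [AddCommGroup W]
    [Module K W] [Module.Finite K W] {s : Str V} {t : Str W} {f : V →ₗ[K] W}, Hom s t f →
    Hom (ldual t) (ldual s) f.dualMap
  eval_rdual_ldual : ∀ {V : Type u} [AddCommGroup V] [Module K V] [Module.Finite K V] (s : Str V),
    Hom s (rdual (ldual s)) (Dual.eval K V)
  eval_ldual_rdual : ∀ {V : Type u} [AddCommGroup V] [Module K V] [Module.Finite K V] (s : Str V),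
    Hom s (ldual (rdual s)) (Dual.eval K V)

namespace CrossedTheory

variable {K : Type u} [Field K] {G : Type u} [Group G] (T : CrossedTheory K G)

/-- The structures on coordinate spaces. -/
abbrev Index : Type u := Σ n : ℕ, T.Str (Fin n → K)

/-- The free vector space on formal coefficients. -/
abbrev PreCoend : Type u := (Σ i : T.Index, Dual K (Fin i.1 → K) × (Fin i.1 → K)) →₀ K

/-- A formal coefficient. -/
noncomputable def preCoef (i : T.Index) (ξ : Dual K (Fin i.1 → K)) (v : Fin i.1 → K) : T.PreCoend :=
  Finsupp.single ⟨i, ξ, v⟩ 1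

/-- The relations between formal coefficients. -/
inductive Rel : T.PreCoend → Prop
  | add_left (i ξ ξ' v) : Rel (T.preCoef i (ξ + ξ') v - (T.preCoef i ξ v + T.preCoef i ξ' v))
  | smul_left (i) (r : K) (ξ v) : Rel (T.preCoef i (r • ξ) v - r • T.preCoef i ξ v)
  | add_right (i ξ v v') : Rel (T.preCoef i ξ (v + v') - (T.preCoef i ξ v + T.preCoef i ξ v'))
  | smul_right (i) (r : K) (ξ v) : Rel (T.preCoef i ξ (r • v) - r • T.preCoef i ξ v)
  | hom (i j : T.Index) (f : (Fin i.1 → K) →ₗ[K] (Fin j.1 → K)) (_ : T.Hom i.2 j.2 f) (ξ v) :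
    Rel (T.preCoef j ξ (f v) - T.preCoef i (ξ ∘ₗ f) v)

/-- The span of the relations between formal coefficients. -/
noncomputable def rel : Submodule K T.PreCoend := Submodule.span K {x | T.Rel x}

/-- The coend of the fiber functor. -/
def Coend : Type u := T.PreCoend ⧸ T.rel

noncomputable instance : AddCommGroup T.Coend := inferInstanceAs (AddCommGroup (T.PreCoend ⧸ T.rel))
noncomputable instance : Module K T.Coend := inferInstanceAs (Module K (T.PreCoend ⧸ T.rel))

section

variable {V W U : Type u} [AddCommGroup V] [Module K V] [Module.Finite K V] [AddCommGroup W]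
  [Module K W] [Module.Finite K W] [AddCommGroup U] [Module K U] [Module.Finite K U]

/-- The structure on a coordinate space which corresponds to `s`. -/
noncomputable def index (s : T.Str V) : T.Index :=
  ⟨_, T.transport (finBasis K V).equivFun s⟩

theorem mk_eq {x y : T.PreCoend} (h : T.Rel (x - y)) : T.rel.mkQ x = T.rel.mkQ y :=
  (Submodule.Quotient.eq T.rel).mpr (Submodule.subset_span h)

/-- The class of a formal coefficient. -/
noncomputable def indexCoef (i : T.Index) :
    Dual K (Fin i.1 → K) →ₗ[K] (Fin i.1 → K) →ₗ[K] T.Coend :=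
  LinearMap.mk₂ K (fun ξ v => T.rel.mkQ (T.preCoef i ξ v))
    (fun _ _ _ => (T.mk_eq (.add_left _ _ _ _)).trans (map_add _ _ _))
    (fun _ _ _ => (T.mk_eq (.smul_left _ _ _ _)).trans (map_smul _ _ _))
    (fun _ _ _ => (T.mk_eq (.add_right _ _ _ _)).trans (map_add _ _ _))
    (fun _ _ _ => (T.mk_eq (.smul_right _ _ _ _)).trans (map_smul _ _ _))

theorem indexCoef_hom {i j : T.Index} {f : (Fin i.1 → K) →ₗ[K] (Fin j.1 → K)}
    (h : T.Hom i.2 j.2 f) (ξ : Dual K (Fin j.1 → K)) (v : Fin i.1 → K) :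
    T.indexCoef j ξ (f v) = T.indexCoef i (ξ ∘ₗ f) v := T.mk_eq (.hom i j f h ξ v)

/-- The coefficients `(ξ, v) ↦ ξ(v'') v'`. -/
noncomputable def coef (s : T.Str V) : Dual K V →ₗ[K] V →ₗ[K] T.Coend :=
  (T.indexCoef (T.index s)).compl₁₂ (finBasis K V).equivFun.symm.toLinearMap.dualMap
    (finBasis K V).equivFun.toLinearMap

variable {T}

theorem coef_hom {s : T.Str V} {t : T.Str W} {f : V →ₗ[K] W} (h : T.Hom s t f) (ξ : Dual K W)
    (v : V) : T.coef t ξ (f v) = T.coef s (ξ ∘ₗ f) v := by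
  refine Eq.trans ?_ ((T.indexCoef_hom (i := T.index s) (j := T.index t) (T.comp (T.comp (T.transport_hom_symm _ s) h)
    (T.transport_hom (finBasis K W).equivFun t))
    (ξ ∘ₗ (finBasis K W).equivFun.symm.toLinearMap) ((finBasis K V).equivFun v)).trans ?_)
  · conv_lhs => rw [← (finBasis K V).equivFun.symm_apply_apply v]
    rfl
  · exact congrArg (fun η => T.indexCoef (T.index s) η ((finBasis K V).equivFun v))
      (LinearMap.ext fun x => congrArg ξ ((finBasis K W).equivFun.symm_apply_apply _))

theorem indexCoef_eq (i : T.Index) (ξ : Dual K (Fin i.1 → K)) (v : Fin i.1 → K) :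
    T.indexCoef i ξ v = T.coef i.2 ξ v := by
  refine Eq.symm ((T.indexCoef_hom (i := i) (j := T.index i.2)
    (T.transport_hom (finBasis K (Fin i.1 → K)).equivFun i.2)
    (ξ ∘ₗ (finBasis K (Fin i.1 → K)).equivFun.symm.toLinearMap) v).trans ?_)
  congr 2
  exact LinearMap.ext fun x => congrArg ξ ((finBasis K (Fin i.1 → K)).equivFun.symm_apply_apply x)

theorem induction {P : T.Coend → Prop} (add : ∀ x y, P x → P y → P (x + y))
    (coef : ∀ {V : Type u} [AddCommGroup V] [Module K V] [Module.Finite K V] (s : T.Str V)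
      (ξ : Dual K V) (v : V), P (T.coef s ξ v)) (x : T.Coend) : P x := by
  obtain ⟨y, rfl⟩ := T.rel.mkQ_surjective x
  induction y using Finsupp.induction_linear with
  | zero => 
    have e : T.coef T.unit 0 0 = 0 := map_zero _
    exact Eq.mp (congrArg P e) (coef T.unit 0 0)
  | add x y hx hy => rw [map_add]; exact add _ _ hx hy
  | single i c =>
    obtain ⟨i, ξ, v⟩ := i
    have e : T.rel.mkQ (Finsupp.single ⟨i, ξ, v⟩ c) = T.coef i.2 (c • ξ) v := by
      rw [← indexCoef_eq, map_smul, LinearMap.smul_apply]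
      refine Eq.trans ?_ (map_smul T.rel.mkQ c _)
      rw [preCoef, Finsupp.smul_single, smul_eq_mul, mul_one]
    rw [e]
    exact coef _ _ _

theorem coend_ext {M : Type*} [AddCommGroup M] [Module K M] {f g : T.Coend →ₗ[K] M}
    (h : ∀ {V : Type u} [AddCommGroup V] [Module K V] [Module.Finite K V] (s : T.Str V)
      (ξ : Dual K V) (v : V), f (T.coef s ξ v) = g (T.coef s ξ v)) : f = g :=
  LinearMap.ext (induction (fun x y hx hy => by rw [map_add, map_add, hx, hy]) h)

variable (T) in
theorem exists_lift {M : Type*} [AddCommGroup M] [Module K M]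
    (m : ∀ {V : Type u} [AddCommGroup V] [Module K V] [Module.Finite K V], T.Str V →
      Dual K V →ₗ[K] V →ₗ[K] M)
    (hm : ∀ {V W : Type u} [AddCommGroup V] [Module K V] [Module.Finite K V] [AddCommGroup W]
      [Module K W] [Module.Finite K W] {s : T.Str V} {t : T.Str W} {f : V →ₗ[K] W}, T.Hom s t f →
      ∀ (ξ : Dual K W) (v : V), m t ξ (f v) = m s (ξ ∘ₗ f) v) :
    ∃ t : T.Coend →ₗ[K] M, ∀ {V : Type u} [AddCommGroup V] [Module K V] [Module.Finite K V]
      (s : T.Str V) (ξ : Dual K V) (v : V), t (T.coef s ξ v) = m s ξ v := by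
  let t₀ : T.PreCoend →ₗ[K] M := Finsupp.linearCombination K fun i => m i.1.2 i.2.1 i.2.2
  have ht₀ : ∀ i ξ v, t₀ (T.preCoef i ξ v) = m i.2 ξ v := fun i ξ v => by
    simp [t₀, preCoef]
  have hle : T.rel ≤ LinearMap.ker t₀ := by
    refine Submodule.span_le.mpr ?_
    rintro x (hx : T.Rel x)
    change t₀ _ = 0
    cases hx with
    | hom i j f hf ξ v => rw [map_sub, ht₀, ht₀, hm hf, sub_self]
    | _ => simp [ht₀]
  refine ⟨T.rel.liftQ t₀ hle, fun {V} _ _ _ s ξ v => ?_⟩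
  change t₀ _ = _
  rw [ht₀]
  refine (hm (T.transport_hom (finBasis K V).equivFun s) _ v).trans ?_
  congr 2
  exact LinearMap.ext fun x => congrArg ξ ((finBasis K V).equivFun.symm_apply_apply x)

theorem exists_lift₂ {M : Type*} [AddCommGroup M] [Module K M]
    (m : ∀ {V W : Type u} [AddCommGroup V] [Module K V] [Module.Finite K V] [AddCommGroup W]
      [Module K W] [Module.Finite K W], T.Str V → T.Str W →
      Dual K V →ₗ[K] V →ₗ[K] Dual K W →ₗ[K] W →ₗ[K] M)
    (hm : ∀ {V V' W : Type u} [AddCommGroup V] [Module K V] [Module.Finite K V] [AddCommGroup V']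
      [Module K V'] [Module.Finite K V'] [AddCommGroup W] [Module K W] [Module.Finite K W]
      {s : T.Str V} {s' : T.Str V'} (t : T.Str W) {f : V →ₗ[K] V'}, T.Hom s s' f →
      ∀ (ξ : Dual K V') (v : V) (η : Dual K W) (w : W), m s' t ξ (f v) η w = m s t (ξ ∘ₗ f) v η w)
    (hm' : ∀ {V W W' : Type u} [AddCommGroup V] [Module K V] [Module.Finite K V] [AddCommGroup W]
      [Module K W] [Module.Finite K W] [AddCommGroup W'] [Module K W'] [Module.Finite K W']
      (s : T.Str V) {t : T.Str W} {t' : T.Str W'} {f : W →ₗ[K] W'}, T.Hom t t' f →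
      ∀ (ξ : Dual K V) (v : V) (η : Dual K W') (w : W), m s t' ξ v η (f w) = m s t ξ v (η ∘ₗ f) w) :
    ∃ g : T.Coend →ₗ[K] T.Coend →ₗ[K] M, ∀ {V W : Type u} [AddCommGroup V] [Module K V]
      [Module.Finite K V] [AddCommGroup W] [Module K W] [Module.Finite K W] (s : T.Str V)
      (t : T.Str W) (ξ : Dual K V) (v : V) (η : Dual K W) (w : W),
      g (T.coef s ξ v) (T.coef t η w) = m s t ξ v η w := by
  have h₁ : ∀ {V : Type u} [AddCommGroup V] [Module K V] [Module.Finite K V] (s : T.Str V),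
      ∃ g : Dual K V →ₗ[K] V →ₗ[K] T.Coend →ₗ[K] M, ∀ {W : Type u} [AddCommGroup W] [Module K W]
        [Module.Finite K W] (t : T.Str W) (ξ : Dual K V) (v : V) (η : Dual K W) (w : W),
        g ξ v (T.coef t η w) = m s t ξ v η w := by
    intro V _ _ _ s
    have h₂ : ∀ (ξ : Dual K V) (v : V), ∃ g : T.Coend →ₗ[K] M, ∀ {W : Type u} [AddCommGroup W]
        [Module K W] [Module.Finite K W] (t : T.Str W) (η : Dual K W) (w : W),
        g (T.coef t η w) = m s t ξ v η w :=
      fun ξ v => T.exists_lift (fun t => m s t ξ v) (fun h η w => hm' s h ξ v η w)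
    choose g hg using h₂
    refine ⟨LinearMap.mk₂ K g ?_ ?_ ?_ ?_, fun t ξ v η w => hg ξ v t η w⟩ <;>
    · intros
      refine coend_ext fun t η w => ?_
      simp [hg]
  choose g hg using @h₁
  obtain ⟨g', hg'⟩ := T.exists_lift (fun s => g s) (fun {V W} _ _ _ _ _ _ s t f h ξ v => by
    refine coend_ext fun r η w => ?_
    rw [hg, hg, hm _ h])
  exact ⟨g', fun s t ξ v η w => by rw [hg', hg]⟩

/-! ### The coalgebra -/

/-- The coaction of the coend. -/
noncomputable def coaction (s : T.Str V) : V →ₗ[K] T.Coend ⊗[K] V := ofCoefR (T.coef s)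

theorem coaction_apply {ι : Type*} [Fintype ι] (b : Basis ι K V) (s : T.Str V) (v : V) :
    coaction s v = ∑ i, T.coef s (b.coord i) v ⊗ₜ b i := ofCoefR_apply _ b v

@[simp] theorem sliceR_coaction (s : T.Str V) (ξ : Dual K V) (v : V) :
    sliceR T.Coend ξ (coaction s v) = T.coef s ξ v := sliceR_ofCoefR _ _ _

theorem coaction_hom {s : T.Str V} {t : T.Str W} {f : V →ₗ[K] W} (h : T.Hom s t f) (v : V) :
    coaction t (f v) = f.lTensor T.Coend (coaction s v) :=
  sliceR_ext fun ξ => by rw [sliceR_coaction, sliceR_lTensor, sliceR_coaction, coef_hom h]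

theorem exists_comul : ∃ Δ : T.Coend →ₗ[K] T.Coend ⊗[K] T.Coend, ∀ {V : Type u} [AddCommGroup V]
    [Module K V] [Module.Finite K V] (s : T.Str V) (ξ : Dual K V) (v : V),
    Δ (T.coef s ξ v) = (T.coef s ξ).lTensor T.Coend (coaction s v) :=
  T.exists_lift
    (fun {V} _ _ _ s => LinearMap.mk₂ K (fun ξ v => (T.coef s ξ).lTensor T.Coend (coaction s v))
      (by simp [LinearMap.lTensor_add]) (by simp [LinearMap.lTensor_smul]) (by simp) (by simp))
    (fun h ξ v => by
      simp only [LinearMap.mk₂_apply]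
      rw [coaction_hom h, ← LinearMap.lTensor_comp_apply]
      congr 2
      ext w
      exact coef_hom h ξ w)

theorem exists_counit : ∃ e : T.Coend →ₗ[K] K, ∀ {V : Type u} [AddCommGroup V]
    [Module K V] [Module.Finite K V] (s : T.Str V) (ξ : Dual K V) (v : V),
    e (T.coef s ξ v) = ξ v :=
  T.exists_lift (fun _ => LinearMap.id) (fun _ _ _ => rfl)

noncomputable instance : CoalgebraStruct K T.Coend where
  comul := exists_comul.choose
  counit := exists_counit.choose

theorem comul_coef (s : T.Str V) (ξ : Dual K V) (v : V) :
    comul (R := K) (T.coef s ξ v) = (T.coef s ξ).lTensor T.Coend (coaction s v) :=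
  exists_comul.choose_spec s ξ v

theorem comul_coef_sum {ι : Type*} [Fintype ι] (b : Basis ι K V) (s : T.Str V) (ξ : Dual K V)
    (v : V) : comul (R := K) (T.coef s ξ v) = ∑ i, T.coef s (b.coord i) v ⊗ₜ T.coef s ξ (b i) := by
  rw [comul_coef, coaction_apply b, map_sum]; rfl

@[simp] theorem counit_coef (s : T.Str V) (ξ : Dual K V) (v : V) :
    counit (R := K) (T.coef s ξ v) = ξ v := exists_counit.choose_spec s ξ v

theorem coassoc_coaction (s : T.Str V) (v : V) :
    TensorProduct.assoc K _ _ V ((comul (R := K) (A := T.Coend)).rTensor V (coaction s v)) =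
      (coaction s).lTensor T.Coend (coaction s v) := by
  let b := finBasis K V
  rw [coaction_apply b]
  simp only [map_sum, LinearMap.rTensor_tmul, LinearMap.lTensor_tmul, comul_coef_sum b,
    coaction_apply b s, sum_tmul, tmul_sum, TensorProduct.assoc_tmul]
  rw [Finset.sum_comm]

noncomputable instance : Coalgebra K T.Coend where
  coassoc := coend_ext fun {V} _ _ _ s ξ v => by
    have e : ∀ x : T.Coend ⊗[K] V,
        TensorProduct.assoc K _ _ _ ((comul (R := K) (A := T.Coend)).rTensor T.Coend
          ((T.coef s ξ).lTensor T.Coend x)) =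
        ((T.coef s ξ).lTensor T.Coend).lTensor T.Coend
          (TensorProduct.assoc K _ _ V ((comul (R := K) (A := T.Coend)).rTensor V x)) := by
      intro x
      induction x with
      | zero => simp
      | add x y hx hy => simp only [map_add, hx, hy]
      | tmul a v =>
        simp only [LinearMap.rTensor_tmul, LinearMap.lTensor_tmul]
        generalize comul (R := K) a = y
        induction y with
        | zero => simp
        | add x y hx hy => simp only [map_add, add_tmul, hx, hy]
        | tmul b c => simp
    simp only [LinearMap.comp_apply, LinearEquiv.coe_coe]
    rw [comul_coef, e, coassoc_coaction, ← LinearMap.lTensor_comp_apply,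
      ← LinearMap.lTensor_comp_apply]
    congr 2
    ext w
    exact (comul_coef s ξ w).symm
  rTensor_counit_comp_comul := coend_ext fun {V} _ _ _ s ξ v => by
    let b := finBasis K V
    rw [LinearMap.comp_apply, comul_coef_sum b]
    simp only [map_sum, LinearMap.rTensor_tmul, counit_coef]
    have : T.coef s ξ v = ∑ i, b.coord i v • T.coef s ξ (b i) := by
      conv_lhs => rw [← b.sum_repr v]
      simp only [map_sum, map_smul, Basis.coord_apply]
    rw [TensorProduct.mk_apply, this, tmul_sum]
    exact Finset.sum_congr rfl fun i _ => by rw [tmul_smul, smul_tmul', smul_eq_mul, mul_one]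
  lTensor_counit_comp_comul := coend_ext fun {V} _ _ _ s ξ v => by
    rw [LinearMap.comp_apply, comul_coef, ← LinearMap.lTensor_comp_apply]
    have : counit (R := K) (A := T.Coend) ∘ₗ T.coef s ξ = ξ := LinearMap.ext (counit_coef s ξ)
    rw [this]
    apply (TensorProduct.rid K _).injective
    change sliceR T.Coend ξ (coaction s v) = _
    simp

theorem isCoaction_coaction (s : T.Str V) : IsCoaction T.Coend (coaction s) where
  coassoc := coassoc_coaction s
  counit v := by
    let b := finBasis K V
    rw [coaction_apply b]
    simp only [map_sum, LinearMap.rTensor_tmul, TensorProduct.lid_tmul, counit_coef]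
    exact b.sum_repr v

end

end CrossedTheory

end Theory

section TheoryHopf

open TensorProduct Coalgebra Module

variable {K : Type u} [Field K] {G : Type u} [Group G]

section

variable {V W : Type*} [AddCommGroup V] [Module K V] [AddCommGroup W] [Module K W] {M : Type*} [AddCommGroup M] [Module K M]

/-- A bilinear map on `(V* ⊗ W*) × (V ⊗ W)` as a map of four variables. -/
noncomputable def LinearMap.curryDual (c : Dual K V ⊗[K] Dual K W →ₗ[K] V ⊗[K] W →ₗ[K] M) :
    Dual K V →ₗ[K] V →ₗ[K] Dual K W →ₗ[K] W →ₗ[K] M :=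
  LinearMap.mk₂ K (fun ξ v => LinearMap.mk₂ K
      (fun η w => c (ξ ⊗ₜ η) (v ⊗ₜ w))
      (fun _ _ _ => by simp only [tmul_add, map_add, LinearMap.add_apply])
      (fun _ _ _ => by simp only [tmul_smul, map_smul, LinearMap.smul_apply])
      (fun _ _ _ => by simp only [tmul_add, map_add])
      (fun _ _ _ => by simp only [tmul_smul, map_smul]))
    (fun _ _ _ => LinearMap.ext₂ fun _ _ => by
      simp only [LinearMap.mk₂_apply, add_tmul, map_add, LinearMap.add_apply])
    (fun _ _ _ => LinearMap.ext₂ fun _ _ => by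
      simp only [LinearMap.mk₂_apply, ← smul_tmul', map_smul, LinearMap.smul_apply])
    (fun _ _ _ => LinearMap.ext₂ fun _ _ => by
      simp only [LinearMap.mk₂_apply, add_tmul, map_add, LinearMap.add_apply])
    (fun _ _ _ => LinearMap.ext₂ fun _ _ => by
      simp only [LinearMap.mk₂_apply, ← smul_tmul', map_smul, LinearMap.smul_apply])

@[simp] theorem LinearMap.curryDual_apply (c : Dual K V ⊗[K] Dual K W →ₗ[K] V ⊗[K] W →ₗ[K] M)
    (ξ : Dual K V) (v : V) (η : Dual K W) (w : W) :
    c.curryDual ξ v η w = c (ξ ⊗ₜ η) (v ⊗ₜ w) := rfl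

end

namespace CrossedTheory

variable {T : CrossedTheory K G}
  {V W U : Type u} [AddCommGroup V] [Module K V] [Module.Finite K V] [AddCommGroup W]
  [Module K W] [Module.Finite K W] [AddCommGroup U] [Module K U] [Module.Finite K U]

theorem id_hom (s : T.Str V) : T.Hom s s LinearMap.id := by
  have e := T.comp (T.transport_hom (LinearEquiv.refl K V) s)
    (T.transport_hom_symm (LinearEquiv.refl K V) s)
  exact e

theorem exists_mul : ∃ g : T.Coend →ₗ[K] T.Coend →ₗ[K] T.Coend, ∀ {V W : Type u} [AddCommGroup V]
    [Module K V] [Module.Finite K V] [AddCommGroup W] [Module K W] [Module.Finite K W]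
    (s : T.Str V) (t : T.Str W) (ξ : Dual K V) (v : V) (η : Dual K W) (w : W),
    g (T.coef s ξ v) (T.coef t η w) =
      T.coef (T.tensor s t) (dualDistrib K V W (ξ ⊗ₜ η)) (v ⊗ₜ w) :=
  exists_lift₂ (fun {V W} _ _ _ _ _ _ s t => (T.coef (T.tensor s t) ∘ₗ dualDistrib K V W).curryDual)
    (fun {V V' W} _ _ _ _ _ _ _ _ _ s s' t f h ξ v η w => by
      have e := coef_hom (T.tensor_hom h (id_hom t)) (dualDistrib K V' W (ξ ⊗ₜ η)) (v ⊗ₜ w)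
      refine e.trans ?_
      rw [LinearMap.curryDual_apply, LinearMap.comp_apply]
      congr 2
      ext; simp)
    (fun {V W W'} _ _ _ _ _ _ _ _ _ s t t' f h ξ v η w => by
      have e := coef_hom (T.tensor_hom (id_hom s) h) (dualDistrib K V W' (ξ ⊗ₜ η)) (v ⊗ₜ w)
      refine e.trans ?_
      rw [LinearMap.curryDual_apply, LinearMap.comp_apply]
      congr 2
      ext; simp)

noncomputable instance : Mul T.Coend := ⟨fun x y => exists_mul.choose x y⟩
noncomputable instance : One T.Coend := ⟨T.coef T.unit LinearMap.id 1⟩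

theorem mul_eq (x y : T.Coend) : x * y = exists_mul.choose x y := rfl

theorem one_eq : (1 : T.Coend) = T.coef T.unit LinearMap.id 1 := rfl

theorem coef_mul_coef (s : T.Str V) (t : T.Str W) (ξ : Dual K V) (v : V) (η : Dual K W) (w : W) :
    T.coef s ξ v * T.coef t η w = T.coef (T.tensor s t) (dualDistrib K V W (ξ ⊗ₜ η)) (v ⊗ₜ w) :=
  exists_mul.choose_spec s t ξ v η w

theorem coef_unit (ξ : Dual K K) (c : K) : T.coef T.unit ξ c = ξ c • 1 := by
  have e : ξ = ξ 1 • LinearMap.id := by ext; simp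
  have e' : ξ c = ξ 1 * c := by conv_lhs => rw [e, LinearMap.smul_apply, LinearMap.id_apply, smul_eq_mul]
  have e'' : T.coef T.unit LinearMap.id c = c • T.coef T.unit LinearMap.id 1 := by
    rw [← map_smul, smul_eq_mul, mul_one]
  rw [one_eq, e', mul_smul, ← e'']
  conv_lhs => rw [e]
  simp

protected theorem add_mul' (x y z : T.Coend) : (x + y) * z = x * z + y * z := by simp [mul_eq]
protected theorem mul_add' (x y z : T.Coend) : x * (y + z) = x * y + x * z := by simp [mul_eq]

noncomputable instance : Ring T.Coend :=
  { (inferInstance : AddCommGroup T.Coend) with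
    mul := (· * ·)
    one := 1
    left_distrib := CrossedTheory.mul_add'
    right_distrib := CrossedTheory.add_mul'
    zero_mul := fun x => by simp [mul_eq]
    mul_zero := fun x => by simp [mul_eq]
    mul_assoc := fun x y z => by
      induction x using induction with
      | add x x' h h' => rw [CrossedTheory.add_mul', CrossedTheory.add_mul', CrossedTheory.add_mul', h, h']
      | @coef V _ _ _ s ξ v =>
      induction y using induction with
      | add x x' h h' => rw [CrossedTheory.mul_add', CrossedTheory.add_mul', CrossedTheory.add_mul', CrossedTheory.mul_add', h, h']
      | @coef W _ _ _ t η w =>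
      induction z using induction with
      | add x x' h h' => rw [CrossedTheory.mul_add', CrossedTheory.mul_add', CrossedTheory.mul_add', h, h']
      | @coef U _ _ _ r ζ x =>
      simp only [coef_mul_coef]
      have e := coef_hom (T.assoc_hom s t r)
        (dualDistrib K V (W ⊗[K] U) (ξ ⊗ₜ dualDistrib K W U (η ⊗ₜ ζ))) ((v ⊗ₜ w) ⊗ₜ x)
      refine Eq.trans ?_ e.symm
      congr 2
      ext; simp [mul_assoc]
    one_mul := fun x => by
      induction x using induction with
      | add x x' h h' => rw [CrossedTheory.mul_add', h, h']
      | @coef V _ _ _ s ξ v =>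
      rw [one_eq, coef_mul_coef]
      have e := coef_hom (T.lid_hom s) ξ (1 ⊗ₜ v)
      refine Eq.trans ?_ (e.symm.trans (by simp))
      congr 2
      ext; simp
    mul_one := fun x => by
      induction x using induction with
      | add x x' h h' => rw [CrossedTheory.add_mul', h, h']
      | @coef V _ _ _ s ξ v =>
      rw [one_eq, coef_mul_coef]
      have e := coef_hom (T.rid_hom s) ξ (v ⊗ₜ 1)
      refine Eq.trans ?_ (e.symm.trans (by simp))
      congr 2
      ext; simp }

noncomputable instance : Algebra K T.Coend :=
  Algebra.ofModule (fun r x y => by simp [mul_eq]) (fun r x y => by simp [mul_eq])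

omit [Module.Finite K V] [Module.Finite K W] in
theorem coord_tensorProduct {ι κ : Type*} [Fintype ι] [Fintype κ] (b : Basis ι K V)
    (c : Basis κ K W) (i : ι × κ) :
    (b.tensorProduct c).coord i = dualDistrib K V W (b.coord i.1 ⊗ₜ c.coord i.2) := by
  ext v w
  change (b.tensorProduct c).repr (v ⊗ₜ w) (i.1, i.2) = _
  rw [Basis.tensorProduct_repr_tmul_apply]
  simp [mul_comm]

theorem coaction_tensor (s : T.Str V) (t : T.Str W) (x : V ⊗[K] W) :
    coaction (T.tensor s t) x =
      ((LinearMap.mul' K T.Coend).rTensor (V ⊗[K] W)) (prodCoaction (coaction s) (coaction t) x) := by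
  induction x with
  | zero => simp
  | add x y hx hy => simp only [map_add, hx, hy]
  | tmul v w =>
  let b := finBasis K V
  let c := finBasis K W
  rw [prodCoaction_tmul, coaction_apply (b.tensorProduct c), coaction_apply b, coaction_apply c]
  simp only [sum_tmul, tmul_sum, map_sum, tensorTensorTensorComm_tmul, LinearMap.rTensor_tmul,
    LinearMap.mul'_apply, coef_mul_coef, coord_tensorProduct, Basis.tensorProduct_apply,
    Fintype.sum_prod_type]
  exact Finset.sum_comm

theorem coaction_unit (c : K) : coaction T.unit c = (1 : T.Coend) ⊗ₜ c := by
  refine sliceR_ext fun ξ => ?_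
  rw [sliceR_coaction, coef_unit, sliceR_tmul]

noncomputable instance : Bialgebra K T.Coend :=
  Bialgebra.mk' K T.Coend
    (by rw [one_eq, counit_coef]; rfl)
    (fun {x y} => by
      induction x using induction with
      | add x x' h h' => rw [add_mul, map_add, map_add, h, h', add_mul]
      | @coef V _ _ _ s ξ v =>
      induction y using induction with
      | add x x' h h' => rw [mul_add, map_add, map_add, h, h', mul_add]
      | @coef W _ _ _ t η w =>
      rw [coef_mul_coef, counit_coef, counit_coef, counit_coef, dualDistrib_apply])
    (by rw [one_eq, comul_coef, coaction_unit]; rfl)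
    (fun {x y} => by
      induction x using induction with
      | add x x' h h' => rw [add_mul, map_add, map_add, h, h', add_mul]
      | @coef V _ _ _ s ξ v =>
      induction y using induction with
      | add x x' h h' => rw [mul_add, map_add, map_add, h, h', mul_add]
      | @coef W _ _ _ t η w =>
      rw [coef_mul_coef, comul_coef_sum ((finBasis K V).tensorProduct (finBasis K W)),
        comul_coef_sum (finBasis K V), comul_coef_sum (finBasis K W), Finset.sum_mul_sum,
        Fintype.sum_prod_type]
      simp only [Algebra.TensorProduct.tmul_mul_tmul, coef_mul_coef, coord_tensorProduct,
        Basis.tensorProduct_apply])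

/-! ### The antipode -/

theorem exists_antipode : ∃ S : T.Coend →ₗ[K] T.Coend, ∀ {V : Type u} [AddCommGroup V] [Module K V]
    [Module.Finite K V] (s : T.Str V) (ξ : Dual K V) (v : V),
    S (T.coef s ξ v) = T.coef (T.rdual s) (Dual.eval K V v) ξ :=
  T.exists_lift (fun {V} _ _ _ s => ((T.coef (T.rdual s)) ∘ₗ Dual.eval K V).flip)
    (fun {V _} _ _ _ _ _ _ _ _ _ h ξ v =>
      (coef_hom (T.rdual_hom h) (Dual.eval K V v) ξ).symm)

theorem exists_antipode_inv : ∃ S : T.Coend →ₗ[K] T.Coend, ∀ {V : Type u} [AddCommGroup V]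
    [Module K V] [Module.Finite K V] (s : T.Str V) (ξ : Dual K V) (v : V),
    S (T.coef s ξ v) = T.coef (T.ldual s) (Dual.eval K V v) ξ :=
  T.exists_lift (fun {V} _ _ _ s => ((T.coef (T.ldual s)) ∘ₗ Dual.eval K V).flip)
    (fun {V _} _ _ _ _ _ _ _ _ _ h ξ v =>
      (coef_hom (T.ldual_hom h) (Dual.eval K V v) ξ).symm)

noncomputable instance : HopfAlgebraStruct K T.Coend where
  antipode := exists_antipode.choose

theorem antipode_coef (s : T.Str V) (ξ : Dual K V) (v : V) :
    HopfAlgebra.antipode K (T.coef s ξ v) = T.coef (T.rdual s) (Dual.eval K V v) ξ :=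
  exists_antipode.choose_spec s ξ v

theorem algebraMap_eq (r : K) : algebraMap K T.Coend r = r • 1 := Algebra.algebraMap_eq_smul_one r

noncomputable instance : HopfAlgebra K T.Coend where
  mul_antipode_rTensor_comul := coend_ext fun {V} _ _ _ s ξ v => by
    let b := Basis.ofVectorSpace K V
    simp only [LinearMap.comp_apply, comul_coef_sum b, map_sum, LinearMap.rTensor_tmul,
      antipode_coef, LinearMap.mul'_apply, coef_mul_coef, counit_coef, Algebra.linearMap_apply,
      algebraMap_eq]
    have h := coef_hom (T.coev_hom s) (dualDistrib K (Dual K V) V (Dual.eval K V v ⊗ₜ ξ)) 1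
    rw [coef_unit] at h
    simp only [LinearMap.comp_apply, coevaluation_apply_one, map_sum, LinearEquiv.coe_coe,
      TensorProduct.comm_tmul, dualDistrib_apply, Dual.eval_apply] at h
    refine h.trans ?_
    congr 1
    conv_rhs => rw [← b.sum_repr v]
    simp only [map_sum, map_smul, smul_eq_mul]
    rfl
  mul_antipode_lTensor_comul := coend_ext fun {V} _ _ _ s ξ v => by
    let b := finBasis K V
    simp only [LinearMap.comp_apply, comul_coef_sum b, map_sum, LinearMap.lTensor_tmul,
      antipode_coef, LinearMap.mul'_apply, coef_mul_coef, counit_coef, Algebra.linearMap_apply,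
      algebraMap_eq]
    have h := coef_hom (T.ev_hom s) LinearMap.id (v ⊗ₜ ξ)
    rw [coef_unit] at h
    simp only [TensorProduct.lift.tmul, Dual.eval_apply, LinearMap.id_apply] at h
    rw [h, ← LinearMap.sum_apply, ← map_sum]
    congr 2
    ext w η
    have e : dualDistrib K V (Dual K V) (∑ i, b.coord i ⊗ₜ Dual.eval K V (b i)) (w ⊗ₜ η) =
        η w := by
      conv_rhs => rw [← b.sum_repr w]
      simp only [map_sum, LinearMap.sum_apply, dualDistrib_apply, map_smul, smul_eq_mul]
      rfl
    rw [map_sum] at e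
    exact e

end CrossedTheory

end TheoryHopf

section TheoryCrossedHopf

open TensorProduct Coalgebra Module

variable {K : Type u} [Field K] {G : Type u} [Group G]

namespace CrossedTheory

variable {T : CrossedTheory K G}
  {V W U : Type u} [AddCommGroup V] [Module K V] [Module.Finite K V] [AddCommGroup W]
  [Module K W] [Module.Finite K W] [AddCommGroup U] [Module K U] [Module.Finite K U]

theorem exists_antipode_inverse : ∃ S' : T.Coend →ₗ[K] T.Coend,
    (∀ x, S' (HopfAlgebra.antipode K x) = x) ∧ ∀ x, HopfAlgebra.antipode K (S' x) = x := by
  obtain ⟨S', hS'⟩ := exists_antipode_inv (T := T)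
  refine ⟨S', fun x => ?_, fun x => ?_⟩
  · induction x using induction with
    | add x y hx hy => rw [map_add, map_add, hx, hy]
    | @coef V _ _ _ s ξ v =>
      rw [antipode_coef, hS', coef_hom (T.eval_ldual_rdual s)]
      rfl
  · induction x using induction with
    | add x y hx hy => rw [map_add, map_add, hx, hy]
    | @coef V _ _ _ s ξ v =>
      rw [hS', antipode_coef, coef_hom (T.eval_rdual_ldual s)]
      rfl

/-! ### The action of `G` -/

theorem exists_φ (β : G) : ∃ f : T.Coend →ₗ[K] T.Coend, ∀ {V : Type u} [AddCommGroup V]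
    [Module K V] [Module.Finite K V] (s : T.Str V) (ξ : Dual K V) (v : V),
    f (T.coef s ξ v) = T.coef (T.conj β s) ξ v :=
  T.exists_lift (fun s => T.coef (T.conj β s)) (fun h ξ v => coef_hom (T.conj_hom β h) ξ v)

variable (T) in
/-- The linear map underlying `φ_β`. -/
noncomputable def phiLin (β : G) : T.Coend →ₗ[K] T.Coend := (exists_φ β).choose

theorem phiLin_coef (β : G) (s : T.Str V) (ξ : Dual K V) (v : V) :
    T.phiLin β (T.coef s ξ v) = T.coef (T.conj β s) ξ v := (exists_φ β).choose_spec s ξ v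

theorem phiLin_mul (β : G) (x y : T.Coend) : T.phiLin β (x * y) = T.phiLin β x * T.phiLin β y := by
  induction x using induction with
  | add x x' h h' => rw [add_mul, map_add, map_add, h, h', add_mul]
  | @coef V _ _ _ s ξ v =>
  induction y using induction with
  | add x x' h h' => rw [mul_add, map_add, map_add, h, h', mul_add]
  | @coef W _ _ _ t η w =>
  rw [coef_mul_coef, phiLin_coef, phiLin_coef, phiLin_coef, coef_mul_coef, T.conj_tensor]

theorem phiLin_one (β : G) : T.phiLin β 1 = 1 := by
  rw [one_eq, phiLin_coef, T.conj_unit]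

theorem phiLin_comul (β : G) (x : T.Coend) :
    comul (R := K) (T.phiLin β x) = TensorProduct.map (T.phiLin β) (T.phiLin β) (comul (R := K) x) := by
  induction x using induction with
  | add x x' h h' => simp only [map_add, h, h']
  | @coef V _ _ _ s ξ v =>
  rw [phiLin_coef, comul_coef_sum (finBasis K V), comul_coef_sum (finBasis K V), map_sum]
  simp only [TensorProduct.map_tmul, phiLin_coef]

theorem phiLin_counit (β : G) (x : T.Coend) :
    counit (R := K) (T.phiLin β x) = counit (R := K) x := by
  induction x using induction with
  | add x x' h h' => simp only [map_add, h, h']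
  | @coef V _ _ _ s ξ v => rw [phiLin_coef, counit_coef, counit_coef]

theorem phiLin_phiLin (β γ : G) (x : T.Coend) : T.phiLin (β * γ) x = T.phiLin β (T.phiLin γ x) := by
  induction x using induction with
  | add x x' h h' => simp only [map_add, h, h']
  | @coef V _ _ _ s ξ v => rw [phiLin_coef, phiLin_coef, phiLin_coef, T.conj_mul]

theorem phiLin_id (x : T.Coend) : T.phiLin 1 x = x := by
  induction x using induction with
  | add x x' h h' => simp only [map_add, h, h']
  | @coef V _ _ _ s ξ v => rw [phiLin_coef, T.conj_one]

variable (T) in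
/-- The algebra automorphism `φ_β`. -/
noncomputable def phiAlg (β : G) : T.Coend ≃ₐ[K] T.Coend :=
  AlgEquiv.ofLinearEquiv
    { T.phiLin β with
      invFun := T.phiLin β⁻¹
      left_inv := fun x => by
        change T.phiLin β⁻¹ (T.phiLin β x) = x
        rw [← phiLin_phiLin, inv_mul_cancel, phiLin_id]
      right_inv := fun x => by
        change T.phiLin β (T.phiLin β⁻¹ x) = x
        rw [← phiLin_phiLin, mul_inv_cancel, phiLin_id] }
    (phiLin_one β) (phiLin_mul β)

variable (T) in
/-- The automorphism `φ_β`. -/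
noncomputable def phi (β : G) : T.Coend ≃ₐc[K] T.Coend :=
  BialgEquiv.ofAlgEquiv (T.phiAlg β)
    (AlgHom.ext (phiLin_counit β))
    (AlgHom.ext fun x => (phiLin_comul β x).symm)

/-! ### The components -/

variable (T) in
/-- The span of the coefficients of degree `α`. -/
noncomputable def comps (α : G) : Submodule K T.Coend :=
  Submodule.span K {x | ∃ n : T.Index, T.deg n.2 = α ∧ ∃ ξ v, x = T.coef n.2 ξ v}

theorem coef_mem (s : T.Str V) (ξ : Dual K V) (v : V) : T.coef s ξ v ∈ T.comps (T.deg s) := by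
  refine Submodule.subset_span ⟨T.index s, (T.deg_eq (T.transport_hom _ s)).symm,
    ξ ∘ₗ (finBasis K V).equivFun.symm.toLinearMap, (finBasis K V).equivFun v, ?_⟩
  refine Eq.trans ?_ (coef_hom (T.transport_hom (finBasis K V).equivFun s) _ v).symm
  congr 2
  exact LinearMap.ext fun x => congrArg ξ ((finBasis K V).equivFun.symm_apply_apply x).symm

theorem comps_induction {α : G} {P : T.Coend → Prop} (zero : P 0)
    (add : ∀ x y, P x → P y → P (x + y))
    (coef : ∀ {V : Type u} [AddCommGroup V] [Module K V] [Module.Finite K V] (s : T.Str V)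
      (ξ : Dual K V) (v : V), T.deg s = α → P (T.coef s ξ v)) {x : T.Coend} (hx : x ∈ T.comps α) :
    P x := by
  have h : ∀ (r : K), P (r • x) := by
    induction hx using Submodule.span_induction with
    | mem x h =>
      obtain ⟨n, hn, ξ, v, rfl⟩ := h
      intro r
      rw [← map_smul]
      exact coef n.2 ξ _ hn
    | zero => simpa using zero
    | add x y _ _ hx hy => intro r; rw [smul_add]; exact add _ _ (hx r) (hy r)
    | smul c x _ hx => intro r; rw [smul_smul]; exact hx _
  simpa using h 1

open Classical in
theorem exists_proj (α : G) : ∃ p : T.Coend →ₗ[K] T.Coend, ∀ {V : Type u} [AddCommGroup V]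
    [Module K V] [Module.Finite K V] (s : T.Str V) (ξ : Dual K V) (v : V),
    p (T.coef s ξ v) = if T.deg s = α then T.coef s ξ v else 0 := by
  obtain ⟨p, hp⟩ := T.exists_lift (fun s => if T.deg s = α then T.coef s else 0)
    (fun {V W} _ _ _ _ _ _ s t f h ξ v => by
      rw [T.deg_eq h]
      split_ifs
      · exact coef_hom h ξ v
      · rfl)
  refine ⟨p, fun s ξ v => ?_⟩
  rw [hp]
  split_ifs <;> rfl

theorem iSupIndep_comps : iSupIndep T.comps := by
  intro α
  obtain ⟨p, hp⟩ := exists_proj (T := T) α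
  rw [Submodule.disjoint_def]
  intro x hx hx'
  have h₁ : p x = x := by
    refine comps_induction (P := fun x => p x = x) (map_zero p) ?_ ?_ hx
    · intro x y hx hy; rw [map_add, hx, hy]
    · intro V _ _ _ s ξ v h; rw [hp, if_pos h]
  have h₂ : (⨆ j, ⨆ (_ : j ≠ α), T.comps j) ≤ LinearMap.ker p := by
    refine iSup₂_le fun β hβ x hx => ?_
    refine comps_induction (P := fun x => p x = 0) (map_zero p) ?_ ?_ hx
    · intro x y hx hy; rw [map_add, hx, hy, add_zero]
    · intro V _ _ _ s ξ v h
      rw [hp, if_neg (by rw [h]; exact hβ)]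
  rw [← h₁]
  exact h₂ hx'

variable (T) in
/-- The crossed Hopf algebra which is reconstructed from the fiber functor. -/
noncomputable def hopf : CrossedHopfAlgebra K G where
  carrier := T.Coend
  comp := T.comps
  indep := iSupIndep_comps
  iSup_comp := eq_top_iff.mpr fun x _ => by
    induction x using induction with
    | add x y hx hy => exact add_mem (hx trivial) (hy trivial)
    | coef s ξ v => exact Submodule.mem_iSup_of_mem (T.deg s) (coef_mem s ξ v)
  comul_mem α x hx := by
    refine comps_induction (P := fun x => comul (R := K) x ∈ LinearMap.range
      (TensorProduct.mapIncl (T.comps α) (T.comps α))) ?_ ?_ ?_ hx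
    · rw [map_zero]; exact zero_mem _
    · intro x y hx hy; rw [map_add]; exact add_mem hx hy
    · intro V _ _ _ s ξ v h
      subst h
      rw [comul_coef_sum (finBasis K V)]
      exact sum_mem fun i _ => ⟨⟨_, coef_mem s _ v⟩ ⊗ₜ ⟨_, coef_mem s ξ _⟩, rfl⟩
  one_mem := by
    rw [← T.deg_unit]; exact coef_mem _ _ _
  mul_mem {α β x y} hx hy := by
    refine comps_induction (P := fun x => x * y ∈ T.comps (α * β)) ?_ ?_ ?_ hx
    · rw [zero_mul]; exact zero_mem _
    · intro x x' hx hx'; rw [add_mul]; exact add_mem hx hx'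
    intro V _ _ _ s ξ v h
    refine comps_induction (P := fun y => _ * y ∈ T.comps (α * β)) ?_ ?_ ?_ hy
    · rw [mul_zero]; exact zero_mem _
    · intro x x' hx hx'; rw [mul_add]; exact add_mem hx hx'
    intro W _ _ _ t η w h'
    rw [coef_mul_coef, ← h, ← h', ← T.deg_tensor]
    exact coef_mem _ _ _
  antipode_mem {α x} hx := by
    refine comps_induction (P := fun x => HopfAlgebra.antipode K x ∈ T.comps α⁻¹) ?_ ?_ ?_ hx
    · rw [map_zero]; exact zero_mem _
    · intro x x' hx hx'; rw [map_add]; exact add_mem hx hx'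
    intro V _ _ _ s ξ v h
    rw [antipode_coef, ← h, ← T.deg_rdual]
    exact coef_mem _ _ _
  antipode_bijective := by
    obtain ⟨S', h, h'⟩ := exists_antipode_inverse (T := T)
    exact ⟨Function.LeftInverse.injective h, Function.RightInverse.surjective h'⟩
  φ := T.phi
  φ_one := phiLin_id
  φ_mul := phiLin_phiLin
  φ_mem β {α x} hx := by
    refine comps_induction (P := fun x => T.phiLin β x ∈ T.comps (β * α * β⁻¹)) ?_ ?_ ?_ hx
    · rw [map_zero]; exact zero_mem _
    · intro x x' hx hx'; rw [map_add]; exact add_mem hx hx'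
    intro V _ _ _ s ξ v h
    rw [phiLin_coef, ← h, ← T.deg_conj]
    exact coef_mem _ _ _

/-- The coefficients of a structure, as elements of the crossed Hopf algebra. -/
noncomputable def cf (s : T.Str V) : Dual K V →ₗ[K] V →ₗ[K] T.hopf.carrier := T.coef s

/-- The coaction of the crossed Hopf algebra on a structure. -/
noncomputable def act (s : T.Str V) : V →ₗ[K] T.hopf.carrier ⊗[K] V := coaction s

@[simp] theorem sliceR_act (s : T.Str V) (ξ : Dual K V) (v : V) :
    sliceR T.hopf.carrier ξ (act s v) = cf s ξ v := sliceR_coaction s ξ v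

theorem coefR_act (s : T.Str V) : coefR (act s) = cf s := coefR_ofCoefR _

theorem act_apply {ι : Type*} [Fintype ι] (b : Basis ι K V) (s : T.Str V) (v : V) :
    act s v = ∑ i, cf s (b.coord i) v ⊗ₜ b i := coaction_apply b s v

theorem hopf_induction {P : T.hopf.carrier → Prop} (add : ∀ x y, P x → P y → P (x + y))
    (cf : ∀ {V : Type u} [AddCommGroup V] [Module K V] [Module.Finite K V] (s : T.Str V)
      (ξ : Dual K V) (v : V), P (cf s ξ v)) (x : T.hopf.carrier) : P x :=
  induction add cf x

theorem comp_induction {α : G} {P : T.hopf.carrier → Prop} (zero : P 0)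
    (add : ∀ x y, P x → P y → P (x + y))
    (cf : ∀ {V : Type u} [AddCommGroup V] [Module K V] [Module.Finite K V] (s : T.Str V)
      (ξ : Dual K V) (v : V), T.deg s = α → P (cf s ξ v)) {x : T.hopf.carrier}
    (hx : x ∈ T.hopf.comp α) : P x :=
  comps_induction zero add cf hx

theorem hopf_ext {M : Type*} [AddCommGroup M] [Module K M] {f g : T.hopf.carrier →ₗ[K] M}
    (h : ∀ {V : Type u} [AddCommGroup V] [Module K V] [Module.Finite K V] (s : T.Str V)
      (ξ : Dual K V) (v : V), f (cf s ξ v) = g (cf s ξ v)) : f = g :=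
  coend_ext (T := T) h

theorem cf_hom {s : T.Str V} {t : T.Str W} {f : V →ₗ[K] W} (h : T.Hom s t f) (ξ : Dual K W)
    (v : V) : cf t ξ (f v) = cf s (ξ ∘ₗ f) v := coef_hom h ξ v

theorem cf_mul_cf (s : T.Str V) (t : T.Str W) (ξ : Dual K V) (v : V) (η : Dual K W) (w : W) :
    cf s ξ v * cf t η w = cf (T.tensor s t) (dualDistrib K V W (ξ ⊗ₜ η)) (v ⊗ₜ w) :=
  coef_mul_coef s t ξ v η w

theorem comul_cf_sum {ι : Type*} [Fintype ι] (b : Basis ι K V) (s : T.Str V) (ξ : Dual K V)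
    (v : V) : comul (R := K) (cf s ξ v) = ∑ i, cf s (b.coord i) v ⊗ₜ cf s ξ (b i) :=
  comul_coef_sum b s ξ v

theorem counit_cf (s : T.Str V) (ξ : Dual K V) (v : V) : counit (R := K) (cf s ξ v) = ξ v :=
  counit_coef s ξ v

theorem antipode_cf (s : T.Str V) (ξ : Dual K V) (v : V) :
    HopfAlgebra.antipode K (cf s ξ v) = cf (T.rdual s) (Dual.eval K V v) ξ :=
  antipode_coef s ξ v

theorem φ_cf (β : G) (s : T.Str V) (ξ : Dual K V) (v : V) :
    T.hopf.φ β (cf s ξ v) = cf (T.conj β s) ξ v := phiLin_coef β s ξ v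

theorem φl_cf (β : G) (s : T.Str V) (ξ : Dual K V) (v : V) :
    T.hopf.φl β (cf s ξ v) = cf (T.conj β s) ξ v := phiLin_coef β s ξ v

theorem push_act (β : G) (s : T.Str V) :
    pushCoaction (T.hopf.φl β) (act s) = act (T.conj β s) := by
  refine LinearMap.ext fun v => sliceR_ext fun ξ => ?_
  rw [sliceR_act, pushCoaction_apply, sliceR_rTensor, sliceR_act, φl_cf]

theorem tensor_act (s : T.Str V) (t : T.Str W) :
    tensorCoaction (act s) (act t) = act (T.tensor s t) :=
  LinearMap.ext fun x => (coaction_tensor s t x).symm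

theorem unit_act : TensorProduct.mk K T.hopf.carrier K 1 = act T.unit :=
  LinearMap.ext fun x => (coaction_unit x).symm

/-- The comodule of a structure. -/
noncomputable abbrev comod (s : T.Str V) : Comod T.hopf where
  deg := T.deg s
  V := ModuleCat.of K V
  finite := ‹_›
  ρ := act s
  isCoaction := isCoaction_coaction s
  mem v := by
    change coaction s v ∈ LinearMap.range ((T.comps (T.deg s)).subtype.rTensor V)
    rw [coaction_apply (finBasis K V)]
    exact sum_mem fun i _ => ⟨⟨_, coef_mem s _ v⟩ ⊗ₜ finBasis K V i, rfl⟩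

/-- The morphism of comodules of a homomorphism of structures. -/
noncomputable def comodMap {s : T.Str V} {t : T.Str W} {f : V →ₗ[K] W} (h : T.Hom s t f) :
    comod s ⟶ comod t where
  f := ModuleCat.ofHom f
  deg_eq := T.deg_eq h
  comm := coaction_hom h

end CrossedTheory

end TheoryCrossedHopf

section TheoryBraiding

open TensorProduct Coalgebra Module

variable {K : Type u} [Field K] {G : Type u} [Group G]

theorem sum_dualDistrib_smul {V W : Type u} {N : Type*} [AddCommGroup V] [Module K V] [AddCommGroup W]
    [Module K W] [AddCommGroup N] [Module K N] {ι κ : Type*} [Fintype ι] [Fintype κ]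
    (b : Basis ι K V) (c : Basis κ K W) (f : V ⊗[K] W →ₗ[K] N) (x : V ⊗[K] W) :
    ∑ i, ∑ j, dualDistrib K V W (b.coord i ⊗ₜ c.coord j) x • f (b i ⊗ₜ c j) = f x := by
  conv_rhs => rw [← (b.tensorProduct c).sum_repr x, map_sum, Fintype.sum_prod_type]
  refine Finset.sum_congr rfl fun i _ => Finset.sum_congr rfl fun j _ => ?_
  rw [map_smul, Basis.tensorProduct_apply]
  congr 1
  exact (LinearMap.congr_fun (CrossedTheory.coord_tensorProduct b c (i, j)) x).symm

namespace CrossedTheory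

/-- A braiding of the structures of a crossed theory. -/
structure Braiding (T : CrossedTheory K G) where
  c : ∀ {V W : Type u} [AddCommGroup V] [Module K V] [Module.Finite K V] [AddCommGroup W]
    [Module K W] [Module.Finite K W], T.Str V → T.Str W → (V ⊗[K] W ≃ₗ[K] W ⊗[K] V)
  hom : ∀ {V W : Type u} [AddCommGroup V] [Module K V] [Module.Finite K V] [AddCommGroup W]
    [Module K W] [Module.Finite K W] (s : T.Str V) (t : T.Str W),
    T.Hom (T.tensor s t) (T.tensor (T.conj (T.deg s) t) s) (c s t).toLinearMap
  natural : ∀ {V W V' W' : Type u} [AddCommGroup V] [Module K V] [Module.Finite K V]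
    [AddCommGroup W] [Module K W] [Module.Finite K W] [AddCommGroup V'] [Module K V']
    [Module.Finite K V'] [AddCommGroup W'] [Module K W'] [Module.Finite K W']
    {s : T.Str V} {t : T.Str W} {s' : T.Str V'} {t' : T.Str W'} {f : V →ₗ[K] V'} {g : W →ₗ[K] W'},
    T.Hom s s' f → T.Hom t t' g → ∀ x, TensorProduct.map g f (c s t x) =
      c s' t' (TensorProduct.map f g x)
  tensor_left : ∀ {V W U : Type u} [AddCommGroup V] [Module K V] [Module.Finite K V]
    [AddCommGroup W] [Module K W] [Module.Finite K W] [AddCommGroup U] [Module K U]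
    [Module.Finite K U] (s : T.Str V) (t : T.Str W) (r : T.Str U) (v : V) (w : W) (u : U),
    c (T.tensor s t) r ((v ⊗ₜ w) ⊗ₜ u) =
      TensorProduct.assoc K U V W ((c s (T.conj (T.deg t) r)).toLinearMap.rTensor W
        ((TensorProduct.assoc K V U W).symm (v ⊗ₜ c t r (w ⊗ₜ u))))
  tensor_right : ∀ {V W U : Type u} [AddCommGroup V] [Module K V] [Module.Finite K V]
    [AddCommGroup W] [Module K W] [Module.Finite K W] [AddCommGroup U] [Module K U]
    [Module.Finite K U] (s : T.Str V) (t : T.Str W) (r : T.Str U) (v : V) (w : W) (u : U),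
    c s (T.tensor t r) (v ⊗ₜ (w ⊗ₜ u)) =
      (TensorProduct.assoc K W U V).symm ((c s r).toLinearMap.lTensor W
        (TensorProduct.assoc K W V U (c s t (v ⊗ₜ w) ⊗ₜ u)))
  conj : ∀ {V W : Type u} [AddCommGroup V] [Module K V] [Module.Finite K V] [AddCommGroup W]
    [Module K W] [Module.Finite K W] (β : G) (s : T.Str V) (t : T.Str W),
    c (T.conj β s) (T.conj β t) = c s t

variable {T : CrossedTheory K G}
  {V W U : Type u} [AddCommGroup V] [Module K V] [Module.Finite K V] [AddCommGroup W]
  [Module K W] [Module.Finite K W] [AddCommGroup U] [Module K U] [Module.Finite K U]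

namespace Braiding

variable (B : T.Braiding)

theorem natural_symm {V' W' : Type u} [AddCommGroup V'] [Module K V']
    [Module.Finite K V'] [AddCommGroup W'] [Module K W'] [Module.Finite K W']
    {s : T.Str V} {t : T.Str W} {s' : T.Str V'} {t' : T.Str W'} {f : V →ₗ[K] V'} {g : W →ₗ[K] W'}
    (h : T.Hom s s' f) (h' : T.Hom t t' g) (x : W ⊗[K] V) :
    TensorProduct.map f g ((B.c s t).symm x) = (B.c s' t').symm (TensorProduct.map g f x) := by
  rw [LinearEquiv.eq_symm_apply, ← B.natural h h', LinearEquiv.apply_symm_apply]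

theorem exists_γ : ∃ γ : T.hopf.carrier →ₗ[K] T.hopf.carrier →ₗ[K] K,
    ∀ {V W : Type u} [AddCommGroup V]
      [Module K V] [Module.Finite K V] [AddCommGroup W] [Module K W] [Module.Finite K W]
      (t : T.Str V) (s : T.Str W) (η : Dual K V) (w : V) (ξ : Dual K W) (v : W),
      γ (cf t η w) (cf s ξ v) = dualDistrib K V W (η ⊗ₜ ξ) (B.c s t (v ⊗ₜ w)) :=
  exists_lift₂ (T := T)
    (fun {V W} _ _ _ _ _ _ t s =>
      ((dualDistrib K V W).compl₂ ((B.c s t).toLinearMap ∘ₗ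
        (TensorProduct.comm K V W).toLinearMap)).curryDual)
    (fun {V V' W} _ _ _ _ _ _ _ _ _ t t' s f h η w ξ v => by
      have e := congrArg (dualDistrib K V' W (η ⊗ₜ ξ)) (B.natural (id_hom s) h (v ⊗ₜ w))
      refine e.symm.trans ?_
      change ((dualDistrib K V' W (η ⊗ₜ ξ)) ∘ₗ TensorProduct.map f LinearMap.id) _ =
        (dualDistrib K V W ((η ∘ₗ f) ⊗ₜ ξ)) _
      congr 1
      ext; simp)
    (fun {V W W'} _ _ _ _ _ _ _ _ _ t s s' f h η w ξ v => by
      have e := congrArg (dualDistrib K V W' (η ⊗ₜ ξ)) (B.natural h (id_hom t) (v ⊗ₜ w))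
      refine e.symm.trans ?_
      change ((dualDistrib K V W' (η ⊗ₜ ξ)) ∘ₗ TensorProduct.map LinearMap.id f) _ =
        (dualDistrib K V W (η ⊗ₜ (ξ ∘ₗ f))) _
      congr 1
      ext; simp)

theorem exists_γ_inv : ∃ γ : T.hopf.carrier →ₗ[K] T.hopf.carrier →ₗ[K] K,
    ∀ {V W : Type u} [AddCommGroup V]
      [Module K V] [Module.Finite K V] [AddCommGroup W] [Module K W] [Module.Finite K W]
      (t : T.Str V) (s : T.Str W) (η : Dual K V) (w : V) (ξ : Dual K W) (v : W),
      γ (cf t η w) (cf s ξ v) = dualDistrib K W V (ξ ⊗ₜ η) ((B.c s t).symm (w ⊗ₜ v)) :=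
  exists_lift₂ (T := T)
    (fun {V W} _ _ _ _ _ _ t s =>
      ((dualDistrib K W V ∘ₗ (TensorProduct.comm K (Dual K V) (Dual K W)).toLinearMap).compl₂
        (B.c s t).symm.toLinearMap).curryDual)
    (fun {V V' W} _ _ _ _ _ _ _ _ _ t t' s f h η w ξ v => by
      have e := congrArg (dualDistrib K W V' (ξ ⊗ₜ η)) (B.natural_symm (id_hom s) h (w ⊗ₜ v))
      refine e.symm.trans ?_
      change ((dualDistrib K W V' (ξ ⊗ₜ η)) ∘ₗ TensorProduct.map LinearMap.id f) _ =
        (dualDistrib K W V (ξ ⊗ₜ (η ∘ₗ f))) _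
      congr 1
      ext; simp)
    (fun {V W W'} _ _ _ _ _ _ _ _ _ t s s' f h η w ξ v => by
      have e := congrArg (dualDistrib K W' V (ξ ⊗ₜ η)) (B.natural_symm h (id_hom t) (w ⊗ₜ v))
      refine e.symm.trans ?_
      change ((dualDistrib K W' V (ξ ⊗ₜ η)) ∘ₗ TensorProduct.map f LinearMap.id) _ =
        (dualDistrib K W V ((ξ ∘ₗ f) ⊗ₜ η)) _
      congr 1
      ext; simp)

/-- The cobraiding of the crossed Hopf algebra. -/
noncomputable def γ : T.hopf.carrier ⊗[K] T.hopf.carrier →ₗ[K] K :=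
  TensorProduct.lift B.exists_γ.choose

theorem γ_cf (t : T.Str V) (s : T.Str W) (η : Dual K V) (w : V) (ξ : Dual K W) (v : W) :
    B.γ (cf t η w ⊗ₜ cf s ξ v) = dualDistrib K V W (η ⊗ₜ ξ) (B.c s t (v ⊗ₜ w)) :=
  B.exists_γ.choose_spec t s η w ξ v

theorem tmul_ext {M : Type*} [AddCommGroup M] [Module K M]
    {f g : T.hopf.carrier ⊗[K] T.hopf.carrier →ₗ[K] M}
    (h : ∀ {V W : Type u} [AddCommGroup V] [Module K V] [Module.Finite K V] [AddCommGroup W]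
      [Module K W] [Module.Finite K W] (s : T.Str V) (t : T.Str W) (ξ : Dual K V) (v : V)
      (η : Dual K W) (w : W), f (cf s ξ v ⊗ₜ cf t η w) = g (cf s ξ v ⊗ₜ cf t η w)) : f = g :=
  TensorProduct.ext (hopf_ext fun s ξ v => hopf_ext fun t η w => h s t ξ v η w)

theorem comul_cf_tmul (t : T.Str V) (s : T.Str W) (η : Dual K V) (w : V) (ξ : Dual K W) (v : W) :
    comul (R := K) (cf t η w ⊗ₜ[K] cf s ξ v) = ∑ j, ∑ i,
      (cf t ((finBasis K V).coord j) w ⊗ₜ[K] cf s ((finBasis K W).coord i) v) ⊗ₜ[K]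
        (cf t η (finBasis K V j) ⊗ₜ[K] cf s ξ (finBasis K W i)) := by
  rw [TensorProduct.comul_tmul, comul_cf_sum (finBasis K V), comul_cf_sum (finBasis K W)]
  simp only [sum_tmul, tmul_sum, map_sum]
  rw [Finset.sum_comm]
  rfl

/-- The cobraiding of the crossed Hopf algebra. -/
noncomputable def cobraiding : T.hopf.Cobraiding where
  γ := B.γ
  invertible := by
    refine ⟨TensorProduct.lift B.exists_γ_inv.choose, ?_, ?_⟩
    · refine tmul_ext fun {V W} _ _ _ _ _ _ t s η w ξ v => ?_
      simp only [convProd, LinearMap.comp_apply, comul_cf_tmul, map_sum, TensorProduct.map_tmul,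
        LinearEquiv.coe_coe, TensorProduct.lid_tmul, TensorProduct.lift.tmul,
        B.exists_γ_inv.choose_spec, γ_cf]
      have e := sum_dualDistrib_smul (finBasis K W) (finBasis K V)
        (dualDistrib K V W (η ⊗ₜ ξ) ∘ₗ (B.c s t).toLinearMap) ((B.c s t).symm (w ⊗ₜ v))
      rw [Finset.sum_comm]
      refine e.trans ?_
      simp [counit_cf, mul_comm]
    · refine tmul_ext fun {V W} _ _ _ _ _ _ t s η w ξ v => ?_
      simp only [convProd, LinearMap.comp_apply, comul_cf_tmul, map_sum, TensorProduct.map_tmul,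
        LinearEquiv.coe_coe, TensorProduct.lid_tmul, TensorProduct.lift.tmul,
        B.exists_γ_inv.choose_spec, γ_cf]
      have e := sum_dualDistrib_smul (finBasis K V) (finBasis K W)
        (dualDistrib K W V (ξ ⊗ₜ η) ∘ₗ (B.c s t).symm.toLinearMap) (B.c s t (v ⊗ₜ w))
      refine e.trans ?_
      simp [counit_cf, mul_comm]
  mul_comm' β h k hk := by
    refine comp_induction (P := fun k => TensorProduct.rid K T.hopf.carrier
        (TensorProduct.map
          (LinearMap.mul' K T.hopf.carrier ∘ₗ (TensorProduct.comm K T.hopf.carrier T.hopf.carrier).toLinearMap) B.γ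
          (comul (R := K) (h ⊗ₜ[K] k))) =
      TensorProduct.lid K T.hopf.carrier
        (TensorProduct.map B.γ (LinearMap.mul' K T.hopf.carrier ∘ₗ (T.hopf.φl β).rTensor T.hopf.carrier)
          (comul (R := K) (h ⊗ₜ[K] k)))) (by simp) ?_ ?_ hk
    · intro x y hx hy; simp only [tmul_add, map_add, hx, hy]
    intro W _ _ _ s ξ v hs
    subst hs
    induction h using hopf_induction with
    | add x y hx hy => simp only [add_tmul, map_add, hx, hy]
    | @cf V _ _ _ t η w =>
    simp only [comul_cf_tmul, map_sum, TensorProduct.map_tmul, LinearMap.comp_apply,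
      LinearEquiv.coe_coe, TensorProduct.comm_tmul, LinearMap.mul'_apply, TensorProduct.rid_tmul,
      TensorProduct.lid_tmul, LinearMap.rTensor_tmul, φl_cf, γ_cf, cf_mul_cf]
    have e₁ := sum_dualDistrib_smul (finBasis K V) (finBasis K W)
      (cf (T.tensor (T.conj (T.deg s) t) s) (dualDistrib K V W (η ⊗ₜ ξ))) (B.c s t (v ⊗ₜ w))
    rw [e₁]
    have e₂ := cf_hom (B.hom s t) (dualDistrib K V W (η ⊗ₜ ξ)) (v ⊗ₜ w)
    refine Eq.trans ?_ e₂.symm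
    have e₃ := sum_dualDistrib_smul (finBasis K W) (finBasis K V)
      (dualDistrib K V W (η ⊗ₜ ξ) ∘ₗ (B.c s t).toLinearMap)
    have e₄ : dualDistrib K V W (η ⊗ₜ ξ) ∘ₗ (B.c s t).toLinearMap =
      ∑ i, ∑ j, (dualDistrib K V W (η ⊗ₜ ξ) (B.c s t (finBasis K W i ⊗ₜ finBasis K V j))) •
        dualDistrib K W V ((finBasis K W).coord i ⊗ₜ (finBasis K V).coord j) :=
      LinearMap.ext fun x => by
        rw [← e₃ x]
        simp only [LinearMap.sum_apply, LinearMap.smul_apply, smul_eq_mul, LinearMap.comp_apply,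
          LinearEquiv.coe_coe]
        simp only [mul_comm]
    rw [e₄]
    simp only [map_sum, map_smul, LinearMap.sum_apply, LinearMap.smul_apply]
    exact Finset.sum_comm
  mul_left h₁ h₂ k := by
    induction k using hopf_induction with
    | add x y hx hy => simp only [tmul_add, map_add, hx, hy]
    | @cf W _ _ _ s ξ v =>
    induction h₁ using hopf_induction with
    | add x y hx hy =>
      simp only [add_tmul, add_mul, map_add, TensorProduct.map_add_left, LinearMap.add_apply, hx, hy]
    | @cf V _ _ _ t η w =>
    induction h₂ using hopf_induction with
    | add x y hx hy =>
      simp only [add_tmul, mul_add, map_add, TensorProduct.map_add_right, LinearMap.add_apply, hx, hy]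
    | @cf U _ _ _ r ζ u =>
    rw [cf_mul_cf, γ_cf, B.tensor_right, comul_cf_sum (finBasis K W)]
    simp only [map_sum, TensorProduct.map_tmul, TensorProduct.curry_apply, γ_cf,
      LinearMap.mul'_apply]
    generalize B.c s t (v ⊗ₜ w) = z
    induction z with
    | zero => simp
    | add x y hx hy =>
      simp only [add_tmul, map_add, hx, hy, add_mul, Finset.sum_add_distrib]
    | tmul a b =>
      have e : ∀ y : U ⊗[K] W, dualDistrib K (V ⊗[K] U) W (dualDistrib K V U (η ⊗ₜ ζ) ⊗ₜ ξ)
          ((TensorProduct.assoc K V U W).symm (a ⊗ₜ y)) = η a * dualDistrib K U W (ζ ⊗ₜ ξ) y := by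
        intro y
        induction y with
        | zero => simp
        | add x y hx hy => simp only [tmul_add, map_add, hx, hy, mul_add]
        | tmul x y => simp [mul_assoc]
      rw [TensorProduct.assoc_tmul, LinearMap.lTensor_tmul, e, LinearEquiv.coe_coe]
      conv_lhs => rw [← (finBasis K W).sum_repr b]
      simp only [sum_tmul, map_sum, ← smul_tmul', map_smul, Finset.mul_sum, dualDistrib_apply,
        smul_eq_mul, Basis.coord_apply, mul_assoc]
  mul_right β h k₁ k₂ hk := by
    refine comp_induction (P := fun k₂ => B.γ (h ⊗ₜ (k₁ * k₂)) =
      LinearMap.mul' K K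
        (TensorProduct.map ((TensorProduct.curry B.γ).flip k₂)
          ((TensorProduct.curry B.γ).flip k₁ ∘ₗ T.hopf.φl β) (comul (R := K) h))) (by simp) ?_ ?_ hk
    · intro x y hx hy
      simp only [tmul_add, mul_add, map_add, TensorProduct.map_add_left, LinearMap.add_apply, hx, hy]
    intro W _ _ _ t η w ht
    subst ht
    induction k₁ using hopf_induction with
    | add x y hx hy =>
      simp only [tmul_add, add_mul, map_add, LinearMap.add_comp, TensorProduct.map_add_right,
        LinearMap.add_apply, hx, hy]
    | @cf V _ _ _ s ξ v =>
    induction h using hopf_induction with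
    | add x y hx hy => simp only [add_tmul, map_add, hx, hy]
    | @cf U _ _ _ r ζ u =>
    rw [cf_mul_cf, γ_cf, B.tensor_left, comul_cf_sum (finBasis K U)]
    simp only [map_sum, TensorProduct.map_tmul, TensorProduct.curry_apply, γ_cf,
      LinearMap.mul'_apply, LinearMap.flip_apply, LinearMap.comp_apply, φl_cf]
    generalize B.c t r (w ⊗ₜ u) = z
    induction z with
    | zero => simp
    | add x y hx hy =>
      simp only [tmul_add, map_add, hx, hy, add_mul, Finset.sum_add_distrib]
    | tmul a b =>
      have e : ∀ y : U ⊗[K] V, dualDistrib K U (V ⊗[K] W) (ζ ⊗ₜ dualDistrib K V W (ξ ⊗ₜ η))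
          (TensorProduct.assoc K U V W (y ⊗ₜ b)) = η b * dualDistrib K U V (ζ ⊗ₜ ξ) y := by
        intro y
        induction y with
        | zero => simp
        | add x y hx hy => simp only [add_tmul, map_add, hx, hy, mul_add]
        | tmul x y => simp only [TensorProduct.assoc_tmul, dualDistrib_apply]; ring
      rw [TensorProduct.assoc_symm_tmul, LinearMap.rTensor_tmul, e, LinearEquiv.coe_coe]
      conv_lhs => rw [← (finBasis K U).sum_repr a]
      simp only [tmul_sum, map_sum, tmul_smul, map_smul, Finset.mul_sum, dualDistrib_apply,
        smul_eq_mul, Basis.coord_apply]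
      exact Finset.sum_congr rfl fun i _ => by ring
  φ_invariant β h k := by
    induction h using hopf_induction with
    | add x y hx hy => simp only [add_tmul, map_add, hx, hy]
    | @cf V _ _ _ t η w =>
    induction k using hopf_induction with
    | add x y hx hy => simp only [tmul_add, map_add, hx, hy]
    | @cf W _ _ _ s ξ v =>
    rw [φ_cf, φ_cf, γ_cf, γ_cf, B.conj]

theorem braidMap_act (s : T.Str V) (t : T.Str W) :
    B.cobraiding.braidMap (act s) (act t) = (B.c s t).toLinearMap := by
  ext v w
  have e := sum_dualDistrib_smul (finBasis K W) (finBasis K V) LinearMap.id (B.c s t (v ⊗ₜ w))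
  refine Eq.trans ?_ e
  change B.cobraiding.bl (act s v) (act t w) = _
  rw [act_apply (finBasis K V), act_apply (finBasis K W)]
  have h : ∀ x : T.hopf.carrier ⊗[K] V, B.cobraiding.bl x (∑ j, cf t ((finBasis K W).coord j) w ⊗ₜ[K] finBasis K W j) =
      ∑ j, B.cobraiding.bl x (cf t ((finBasis K W).coord j) w ⊗ₜ[K] finBasis K W j) := fun x => by
    simp only [CrossedHopfAlgebra.Cobraiding.bl, tmul_sum, map_sum]
  have h' : ∀ y : T.hopf.carrier ⊗[K] W, B.cobraiding.bl (∑ j, cf s ((finBasis K V).coord j) v ⊗ₜ[K] finBasis K V j) y =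
      ∑ j, B.cobraiding.bl (cf s ((finBasis K V).coord j) v ⊗ₜ[K] finBasis K V j) y := fun x => by
    simp only [CrossedHopfAlgebra.Cobraiding.bl, sum_tmul, map_sum]
  rw [h]
  refine Finset.sum_congr rfl fun j _ => ?_
  rw [h']
  refine Finset.sum_congr rfl fun i _ => ?_
  rw [CrossedHopfAlgebra.Cobraiding.bl_tmul]
  exact congrArg (· • _) (B.γ_cf _ _ _ _ _ _)

end Braiding

/-- A twist of the structures of a crossed theory. -/
structure Twist (B : T.Braiding) where
  θ : ∀ {V : Type u} [AddCommGroup V] [Module K V] [Module.Finite K V], T.Str V → (V ≃ₗ[K] V)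
  hom : ∀ {V : Type u} [AddCommGroup V] [Module K V] [Module.Finite K V] (s : T.Str V),
    T.Hom s (T.conj (T.deg s) s) (θ s).toLinearMap
  natural : ∀ {V W : Type u} [AddCommGroup V] [Module K V] [Module.Finite K V]
    [AddCommGroup W] [Module K W] [Module.Finite K W] {s : T.Str V} {t : T.Str W} {f : V →ₗ[K] W},
    T.Hom s t f → ∀ x, f (θ s x) = θ t (f x)
  tensor : ∀ {V W : Type u} [AddCommGroup V] [Module K V] [Module.Finite K V]
    [AddCommGroup W] [Module K W] [Module.Finite K W] (s : T.Str V) (t : T.Str W) (x : V ⊗[K] W),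
    θ (T.tensor s t) x = B.c (T.conj (T.deg s) (T.conj (T.deg t) t)) (T.conj (T.deg s) s)
      (B.c (T.conj (T.deg s) s) (T.conj (T.deg t) t)
        (TensorProduct.map (θ s).toLinearMap (θ t).toLinearMap x))
  conj : ∀ {V : Type u} [AddCommGroup V] [Module K V] [Module.Finite K V] (β : G) (s : T.Str V),
    θ (T.conj β s) = θ s
  rdual : ∀ {V : Type u} [AddCommGroup V] [Module K V] [Module.Finite K V] (s : T.Str V)
    (ξ : Dual K V), θ (T.rdual s) ξ = ξ ∘ₗ (θ s).toLinearMap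

namespace Twist

variable {B : T.Braiding} (R : Twist B)

theorem natural_symm {s : T.Str V} {t : T.Str W} {f : V →ₗ[K] W} (h : T.Hom s t f) (x : V) :
    f ((R.θ s).symm x) = (R.θ t).symm (f x) := by
  rw [LinearEquiv.eq_symm_apply, ← R.natural h, LinearEquiv.apply_symm_apply]

theorem exists_τ : ∃ τ : T.hopf.carrier →ₗ[K] K, ∀ {V : Type u} [AddCommGroup V]
    [Module K V] [Module.Finite K V] (s : T.Str V) (ξ : Dual K V) (v : V),
    τ (cf s ξ v) = ξ (R.θ s v) :=
  T.exists_lift (fun s => LinearMap.id.compl₂ (R.θ s).toLinearMap)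
    (fun h ξ v => congrArg ξ (R.natural h v).symm)

theorem exists_τ_inv : ∃ τ : T.hopf.carrier →ₗ[K] K, ∀ {V : Type u} [AddCommGroup V]
    [Module K V] [Module.Finite K V] (s : T.Str V) (ξ : Dual K V) (v : V),
    τ (cf s ξ v) = ξ ((R.θ s).symm v) :=
  T.exists_lift (fun s => LinearMap.id.compl₂ (R.θ s).symm.toLinearMap)
    (fun h ξ v => congrArg ξ (R.natural_symm h v).symm)

/-- The cotwist of the crossed Hopf algebra. -/
noncomputable def τ : T.hopf.carrier →ₗ[K] K := R.exists_τ.choose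

theorem τ_cf (s : T.Str V) (ξ : Dual K V) (v : V) : R.τ (cf s ξ v) = ξ (R.θ s v) :=
  R.exists_τ.choose_spec s ξ v

omit [Module.Finite K V] in
theorem sum_coord_smul {N ι : Type*} [AddCommGroup N] [Module K N] [Fintype ι] (b : Basis ι K V)
    (f : V →ₗ[K] N) (x : V) : ∑ i, b.coord i x • f (b i) = f x := by
  conv_rhs => rw [← b.sum_repr x]
  simp only [map_sum, map_smul, Basis.coord_apply]

theorem double_conj (s : T.Str V) (t : T.Str W) (x : V ⊗[K] W) :
    B.c (T.conj (T.deg s) (T.conj (T.deg t) t)) (T.conj (T.deg s) s)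
      (B.c (T.conj (T.deg s) s) (T.conj (T.deg t) t)
        (TensorProduct.map (R.θ s).toLinearMap (R.θ t).toLinearMap x)) =
    B.c (T.conj (T.deg t) t) s
      (TensorProduct.map (R.θ t).toLinearMap (R.θ s).toLinearMap (B.c s t x)) := by
  rw [B.conj, ← B.natural (R.hom s) (R.hom t)]

/-- The cotwist of the crossed Hopf algebra. -/
noncomputable def cotwist : T.hopf.Cotwist B.cobraiding where
  τ := R.τ
  invertible := by
    refine ⟨R.exists_τ_inv.choose, ?_, ?_⟩
    · refine hopf_ext fun {V} _ _ _ s ξ v => ?_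
      simp only [convProd, LinearMap.comp_apply, comul_cf_sum (finBasis K V), map_sum,
        TensorProduct.map_tmul, LinearEquiv.coe_coe, TensorProduct.lid_tmul, τ_cf,
        R.exists_τ_inv.choose_spec]
      refine (sum_coord_smul (finBasis K V) (ξ ∘ₗ (R.θ s).symm.toLinearMap) _).trans ?_
      simp [counit_cf]
    · refine hopf_ext fun {V} _ _ _ s ξ v => ?_
      simp only [convProd, LinearMap.comp_apply, comul_cf_sum (finBasis K V), map_sum,
        TensorProduct.map_tmul, LinearEquiv.coe_coe, TensorProduct.lid_tmul, τ_cf,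
        R.exists_τ_inv.choose_spec]
      refine (sum_coord_smul (finBasis K V) (ξ ∘ₗ (R.θ s).toLinearMap) _).trans ?_
      simp [counit_cf]
  central α h hh := by
    refine comp_induction (P := fun h => TensorProduct.lid K T.hopf.carrier
        (TensorProduct.map R.τ (T.hopf.φl α) (comul (R := K) h)) =
      TensorProduct.rid K T.hopf.carrier
        (TensorProduct.map LinearMap.id R.τ (comul (R := K) h))) (by simp) ?_ ?_ hh
    · intro x y hx hy; simp only [map_add, hx, hy]
    intro V _ _ _ s ξ v hs
    subst hs
    simp only [comul_cf_sum (finBasis K V), map_sum, TensorProduct.map_tmul,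
      TensorProduct.lid_tmul, TensorProduct.rid_tmul, τ_cf, φl_cf, LinearMap.id_apply]
    refine (sum_coord_smul (finBasis K V) (cf (T.conj (T.deg s) s) ξ) _).trans ?_
    refine (cf_hom (R.hom s) ξ v).trans ?_
    have e : ξ ∘ₗ (R.θ s).toLinearMap =
        ∑ i, ξ (R.θ s (finBasis K V i)) • (finBasis K V).coord i := by
      refine LinearMap.ext fun x => ?_
      rw [← sum_coord_smul (finBasis K V) (ξ ∘ₗ (R.θ s).toLinearMap)]
      simp only [LinearMap.sum_apply, LinearMap.smul_apply, smul_eq_mul, LinearMap.comp_apply,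
        LinearEquiv.coe_coe, mul_comm]
    rw [e]
    simp only [map_sum, map_smul, LinearMap.sum_apply, LinearMap.smul_apply]
  mul α β h k hh hk := by
    refine comp_induction (P := fun h => R.τ (h * k) =
      convProd (B.cobraiding.γ ∘ₗ (TensorProduct.comm K T.hopf.carrier T.hopf.carrier).toLinearMap)
        (T.hopf.twistTail B.cobraiding R.τ α β) (h ⊗ₜ k)) (by simp) ?_ ?_ hh
    · intro x y hx hy; simp only [add_mul, add_tmul, map_add, hx, hy]
    intro V _ _ _ s ξ v hs
    subst hs
    refine comp_induction (P := fun k => R.τ (_ * k) =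
      convProd (B.cobraiding.γ ∘ₗ (TensorProduct.comm K T.hopf.carrier T.hopf.carrier).toLinearMap)
        (T.hopf.twistTail B.cobraiding R.τ (T.deg s) β) (_ ⊗ₜ k)) (by simp) ?_ ?_ hk
    · intro x y hx hy; simp only [mul_add, tmul_add, map_add, hx, hy]
    intro W _ _ _ t η w ht
    subst ht
    have tail : ∀ (ξ : Dual K V) (v : V) (η : Dual K W) (w : W),
        T.hopf.twistTail B.cobraiding R.τ (T.deg s) (T.deg t) (cf s ξ v ⊗ₜ cf t η w) =
        dualDistrib K V W (ξ ⊗ₜ η)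
          (B.c (T.conj (T.deg t) t) s (R.θ t w ⊗ₜ R.θ s v)) := by
      intro ξ v η w
      have e := sum_dualDistrib_smul (finBasis K V) (finBasis K W)
        (dualDistrib K V W (ξ ⊗ₜ η) ∘ₗ (B.c (T.conj (T.deg t) t) s).toLinearMap ∘ₗ
          (TensorProduct.comm K V W).toLinearMap) (R.θ s v ⊗ₜ R.θ t w)
      refine Eq.trans ?_ e
      simp only [CrossedHopfAlgebra.twistTail, convProd, LinearMap.comp_apply,
        Braiding.comul_cf_tmul, map_sum, TensorProduct.map_tmul, LinearEquiv.coe_coe,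
        TensorProduct.lid_tmul, LinearMap.mul'_apply, LinearMap.lTensor_tmul, φl_cf, τ_cf, R.conj]
      refine Finset.sum_congr rfl fun i _ => Finset.sum_congr rfl fun j _ => ?_
      rw [dualDistrib_apply, TensorProduct.comm_tmul]
      exact congrArg _ (B.γ_cf _ _ _ _ _ _)
    rw [cf_mul_cf, τ_cf, R.tensor, double_conj]
    have e := sum_dualDistrib_smul (finBasis K W) (finBasis K V)
        (dualDistrib K V W (ξ ⊗ₜ η) ∘ₗ (B.c (T.conj (T.deg t) t) s).toLinearMap ∘ₗ
          TensorProduct.map (R.θ t).toLinearMap (R.θ s).toLinearMap) (B.c s t (v ⊗ₜ w))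
    refine e.symm.trans ?_
    rw [Finset.sum_comm]
    simp only [convProd, LinearMap.comp_apply,
        Braiding.comul_cf_tmul, map_sum, TensorProduct.map_tmul, LinearEquiv.coe_coe,
        TensorProduct.lid_tmul, tail, TensorProduct.comm_tmul]
    refine Finset.sum_congr rfl fun i _ => Finset.sum_congr rfl fun j _ => ?_
    exact congrArg (· • _) (B.γ_cf _ _ _ _ _ _).symm
  antipode h := by
    induction h using hopf_induction with
    | add x y hx hy => simp only [map_add, hx, hy]
    | cf s ξ v =>
      rw [antipode_cf, τ_cf, R.rdual, τ_cf]
      rfl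
  φ_invariant β h := by
    induction h using hopf_induction with
    | add x y hx hy => simp only [map_add, hx, hy]
    | cf s ξ v => rw [φ_cf, τ_cf, τ_cf, R.conj]

theorem coact_act (s : T.Str V) : coact R.cotwist.τ (act s) = (R.θ s).toLinearMap := by
  ext v
  refine Eq.trans ?_ (sum_coord_smul (finBasis K V) LinearMap.id (R.θ s v))
  rw [coact_apply, act_apply (finBasis K V)]
  simp only [map_sum, LinearMap.rTensor_tmul, TensorProduct.lid_tmul]
  exact Finset.sum_congr rfl fun i _ => congrArg (· • _) (R.τ_cf _ _ _)

end Twist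

end CrossedTheory

end TheoryBraiding

section TheoryRecovery

open TensorProduct Coalgebra Module

variable {K : Type u} [Field K] {G : Type u} [Group G]

namespace CrossedTheory

variable {T : CrossedTheory K G}

theorem coefR_hom {H : CrossedHopfAlgebra K G} {X Y : Comod H} (f : X ⟶ Y) (ξ : Dual K Y.V)
    (v : X.V) : coefR Y.ρ ξ (f.f.hom v) = coefR X.ρ (ξ ∘ₗ f.f.hom) v := by
  rw [coefR_apply, f.comm, sliceR_lTensor, coefR_apply]

/-- Natural families of linear maps which agree on the comodules of the structures of
degree `α` agree on all comodules of degree `α`. -/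
theorem transfer {M : Type*} [AddCommGroup M] [Module K M] {α : G}
    (m m' : ∀ X : Comod T.hopf, Dual K X.V →ₗ[K] X.V →ₗ[K] M)
    (hm : ∀ {X Y : Comod T.hopf} (f : X ⟶ Y) (ξ : Dual K Y.V) (v : X.V),
      m Y ξ (f.f.hom v) = m X (ξ ∘ₗ f.f.hom) v)
    (hm' : ∀ {X Y : Comod T.hopf} (f : X ⟶ Y) (ξ : Dual K Y.V) (v : X.V),
      m' Y ξ (f.f.hom v) = m' X (ξ ∘ₗ f.f.hom) v)
    (h : ∀ {V : Type u} [AddCommGroup V] [Module K V] [Module.Finite K V] (s : T.Str V),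
      T.deg s = α → ∀ ξ v, m (comod s) ξ v = m' (comod s) ξ v)
    (X : Comod T.hopf) (hX : X.deg = α) (ξ : Dual K X.V) (v : X.V) : m X ξ v = m' X ξ v := by
  obtain ⟨t, ht⟩ := T.hopf.exists_hom m hm
  obtain ⟨t', ht'⟩ := T.hopf.exists_hom m' hm'
  rw [← ht, ← ht']
  have hc : coefR X.ρ ξ v ∈ T.hopf.comp α := hX ▸ CrossedHopfAlgebra.coefR_mem X ξ v
  refine comp_induction (P := fun x => t x = t' x) (by simp) ?_ ?_ hc
  · intro x y hx hy; rw [map_add, map_add, hx, hy]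
  · intro V _ _ _ s η w hs
    have e := ht (comod s) η w
    have e' := ht' (comod s) η w
    rw [coefR_act] at e e'
    rw [e, e', h s hs]

/-- The structure on the underlying space of a comodule. -/
structure Recovery (T : CrossedTheory K G) where
  str : ∀ X : Comod T.hopf, T.Str X.V
  deg_str : ∀ X, T.deg (str X) = X.deg
  hom : ∀ {X Y : Comod T.hopf} (f : X ⟶ Y), T.Hom (str X) (str Y) f.f.hom
  str_comod : ∀ {V : Type u} [AddCommGroup V] [Module K V] [Module.Finite K V] (s : T.Str V),
    str (comod s) = s

namespace Recovery

variable (R : Recovery T)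

theorem act_str (X : Comod T.hopf) : act (R.str X) = X.ρ := by
  obtain ⟨t, ht⟩ := T.hopf.exists_hom (fun X => cf (R.str X)) (fun f ξ v => cf_hom (R.hom f) ξ v)
  have e : t = LinearMap.id := hopf_ext fun s ξ v => by
    have e := ht (comod s) ξ v
    rw [coefR_act] at e
    rw [e, R.str_comod]
    rfl
  rw [← ofCoefR_coefR X.ρ, ← ofCoefR_coefR (act _), coefR_act]
  congr 1
  ext ξ v
  rw [← ht, e]
  rfl

theorem comod_str (X : Comod T.hopf) : comod (R.str X) = X :=
  Comod.obj_ext (R.deg_str X) rfl (heq_of_eq (R.act_str X))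

theorem str_eq (X : Comod T.hopf) (t : T.Str X.V) (hd : T.deg t = X.deg) (h : act t = X.ρ) :
    R.str X = t := by
  have e : comod t = X := Comod.obj_ext hd rfl (heq_of_eq h)
  have e' : HEq (R.str (comod t)) (R.str X) := by rw [e]
  exact (eq_of_heq (((heq_of_eq (R.str_comod t)).symm).trans e')).symm

theorem str_tensor (X Y : Comod T.hopf) :
    R.str (X ⊗ Y) = T.tensor (V := X.V) (W := Y.V) (R.str X) (R.str Y) :=
  R.str_eq (X ⊗ Y) (T.tensor (V := X.V) (W := Y.V) (R.str X) (R.str Y))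
    ((T.deg_tensor _ _).trans (by rw [R.deg_str, R.deg_str]; rfl))
    ((tensor_act _ _).symm.trans (by rw [R.act_str, R.act_str]; rfl))

theorem str_unit : R.str (𝟙_ (Comod T.hopf)) = T.unit :=
  R.str_eq (𝟙_ (Comod T.hopf)) T.unit T.deg_unit unit_act.symm

theorem str_conj (β : G) (X : Comod T.hopf) :
    R.str (CrossedCategory.conj β X) = T.conj (V := X.V) β (R.str X) :=
  R.str_eq (CrossedCategory.conj β X) (T.conj (V := X.V) β (R.str X))
    ((T.deg_conj _ _).trans (by rw [R.deg_str]; rfl))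
    ((push_act _ _).symm.trans (by rw [R.act_str]; rfl))

end Recovery

end CrossedTheory

end TheoryRecovery

section Correspondence

open TensorProduct Coalgebra Module

variable {K : Type u} [Field K] {G : Type u} [Group G]

/-- A correspondence between the comodules of two crossed Hopf algebras which is induced by an
equivalence of Tannakian crossed categories. -/
structure ComodCorrespondence (H H' : CrossedHopfAlgebra K G) where
  R : ∀ (X : Comod H) (X' : Comod H'), (X.V ≃ₗ[K] X'.V) → Prop
  left : ∀ X, ∃ X' f, R X X' f
  right : ∀ X', ∃ X f, R X X' f
  deg_eq : ∀ {X X' f}, R X X' f → X.deg = X'.deg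
  hom : ∀ {X X' f Y Y' g}, R X X' f → R Y Y' g → ∀ k : X ⟶ Y, ∃ k' : X' ⟶ Y', ∀ v,
    k'.f.hom (f v) = g (k.f.hom v)
  hom_symm : ∀ {X X' f Y Y' g}, R X X' f → R Y Y' g → ∀ k' : X' ⟶ Y', ∃ k : X ⟶ Y, ∀ v,
    k'.f.hom (f v) = g (k.f.hom v)
  tensor : ∀ {X X' f Y Y' g}, R X X' f → R Y Y' g →
    R (X ⊗ Y) (X' ⊗ Y') (TensorProduct.congr f g)
  unit : R (𝟙_ _) (𝟙_ _) (LinearEquiv.refl K K)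
  conj : ∀ {X X' f}, R X X' f → ∀ β : G, R (CrossedCategory.conj β X) (CrossedCategory.conj β X') f

namespace ComodCorrespondence

variable {H H' : CrossedHopfAlgebra K G} (C : ComodCorrespondence H H')

/-- The inverse correspondence. -/
def symm : ComodCorrespondence H' H where
  R X' X f := C.R X X' f.symm
  left X' := by
    obtain ⟨X, f, h⟩ := C.right X'
    exact ⟨X, f.symm, h⟩
  right X := by
    obtain ⟨X', f, h⟩ := C.left X
    exact ⟨X', f.symm, h⟩
  deg_eq h := (C.deg_eq h).symm
  hom {X X' f Y Y' g} h h' k := by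
    obtain ⟨k', hk⟩ := C.hom_symm h h' k
    refine ⟨k', fun v => ?_⟩
    have := hk (f v)
    rw [LinearEquiv.symm_apply_apply] at this
    rw [this, LinearEquiv.apply_symm_apply]
  hom_symm {X X' f Y Y' g} h h' k := by
    obtain ⟨k', hk⟩ := C.hom h h' k
    refine ⟨k', fun v => ?_⟩
    have := hk (f v)
    rw [LinearEquiv.symm_apply_apply] at this
    rw [this, LinearEquiv.apply_symm_apply]
  tensor h h' := C.tensor h h'
  unit := C.unit
  conj h β := C.conj h β

theorem exists_map : ∃ i : H.carrier →ₗ[K] H'.carrier, ∀ {X X' f}, C.R X X' f → ∀ ξ v,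
    i (coefR X.ρ (ξ ∘ₗ f.toLinearMap) v) = coefR X'.ρ ξ (f v) := by
  choose X' f hf using C.left
  obtain ⟨i, hi⟩ := H.exists_hom
    (fun X => (coefR (X' X).ρ).compl₁₂ (f X).symm.toLinearMap.dualMap (f X).toLinearMap)
    (fun {X Y} k ξ v => by
      obtain ⟨k', hk⟩ := C.hom (hf X) (hf Y) k
      change coefR (X' Y).ρ (ξ ∘ₗ (f Y).symm.toLinearMap) (f Y (k.f.hom v)) =
        coefR (X' X).ρ ((ξ ∘ₗ k.f.hom) ∘ₗ (f X).symm.toLinearMap) (f X v)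
      rw [← hk, CrossedTheory.coefR_hom]
      congr 2
      refine LinearMap.ext fun x => congrArg ξ ?_
      change (f Y).symm (k'.f.hom x) = k.f.hom ((f X).symm x)
      rw [LinearEquiv.symm_apply_eq, ← hk, LinearEquiv.apply_symm_apply])
  refine ⟨i, fun {X Z g} hg ξ v => ?_⟩
  rw [hi]
  obtain ⟨k, hk⟩ := C.hom (hf X) hg (𝟙 X)
  have hk' : ∀ v, k.f.hom (f X v) = g v := hk
  rw [← hk', CrossedTheory.coefR_hom]
  change coefR (X' X).ρ ((ξ ∘ₗ g.toLinearMap) ∘ₗ (f X).symm.toLinearMap) (f X v) = _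
  congr 2
  refine LinearMap.ext fun x => congrArg ξ ?_
  change g ((f X).symm x) = k.f.hom x
  rw [← hk', LinearEquiv.apply_symm_apply]

/-- The linear map which is induced by a correspondence. -/
noncomputable def map : H.carrier →ₗ[K] H'.carrier := C.exists_map.choose

theorem map_coefR {X X' f} (h : C.R X X' f) (ξ : Dual K X'.V) (v : X.V) :
    C.map (coefR X.ρ (ξ ∘ₗ f.toLinearMap) v) = coefR X'.ρ ξ (f v) :=
  C.exists_map.choose_spec h ξ v

theorem map_coefR' {X X' f} (h : C.R X X' f) (ξ : Dual K X.V) (v : X.V) :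
    C.map (coefR X.ρ ξ v) = coefR X'.ρ (ξ ∘ₗ f.symm.toLinearMap) (f v) := by
  rw [← C.map_coefR h]
  congr 3
  exact LinearMap.ext fun x => congrArg ξ (f.symm_apply_apply x).symm

theorem map_ρ {X X' f} (h : C.R X X' f) (v : X.V) :
    TensorProduct.map C.map f.toLinearMap (X.ρ v) = X'.ρ (f v) := by
  refine sliceR_ext fun ξ => ?_
  rw [← coefR_apply, ← C.map_coefR h, coefR_apply]
  generalize X.ρ v = x
  induction x with
  | zero => simp
  | add x y hx hy => simp only [map_add, hx, hy]
  | tmul a v => simp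

theorem map_map_symm (x : H'.carrier) : C.map (C.symm.map x) = x := by
  have e : C.map ∘ₗ C.symm.map = LinearMap.id := CrossedHopfAlgebra.hom_ext_of_coefR fun X' ξ v => by
    obtain ⟨X, f, h⟩ := C.right X'
    have h' : C.symm.R X' X f.symm := h
    rw [LinearMap.comp_apply, C.symm.map_coefR' h', C.map_coefR' h, LinearMap.id_apply,
      LinearEquiv.apply_symm_apply]
    congr 2
    exact LinearMap.ext fun x => congrArg ξ (f.apply_symm_apply x)
  exact LinearMap.congr_fun e x

/-- The linear equivalence which is induced by a correspondence. -/
noncomputable def equiv : H.carrier ≃ₗ[K] H'.carrier :=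
  { C.map with
    invFun := C.symm.map
    left_inv := fun x => C.symm.map_map_symm x
    right_inv := C.map_map_symm }

theorem hopf_induction {P : H.carrier → Prop} (add : ∀ x y, P x → P y → P (x + y))
    (coef : ∀ {X X' f}, C.R X X' f → ∀ ξ v, P (coefR X.ρ ξ v)) (x : H.carrier) : P x := by
  have h : ∀ α, ∀ a ∈ H.comp α, P a := fun α a ha => by
    obtain ⟨X, -, ξ, v, rfl⟩ := CrossedHopfAlgebra.exists_coefR ha
    obtain ⟨X', f, h⟩ := C.left X
    exact coef h ξ v
  exact CrossedHopfAlgebra.induction_comp add (h 1 0 (zero_mem _)) h x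

theorem sliceR_mulT {A : Type u} [Ring A] [Bialgebra K A] {V W : Type u} [AddCommGroup V]
    [Module K V] [AddCommGroup W] [Module K W] (x : A ⊗[K] V) (y : A ⊗[K] W) (ξ : Dual K V)
    (η : Dual K W) :
    sliceR A (dualDistrib K V W (ξ ⊗ₜ η)) (mulT x y) = sliceR A ξ x * sliceR A η y := by
  induction x with
  | zero => simp
  | add x x' hx hx' => simp only [map_add, mulT_add_left, add_mul, hx, hx']
  | tmul a v =>
  induction y with
  | zero => simp
  | add x x' hx hx' => simp only [map_add, mulT_add_right, mul_add, hx, hx']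
  | tmul b w => simp [smul_smul, mul_comm]

theorem coefR_mul (X Y : Comod H) (ξ : Dual K X.V) (η : Dual K Y.V) (v : X.V) (w : Y.V) :
    coefR X.ρ ξ v * coefR Y.ρ η w =
      coefR (V := X.V ⊗[K] Y.V) (X ⊗ Y).ρ (dualDistrib K X.V Y.V (ξ ⊗ₜ η)) (v ⊗ₜ w) :=
  (sliceR_mulT _ _ _ _).symm

theorem map_mul (x y : H.carrier) : C.map (x * y) = C.map x * C.map y := by
  induction x using C.hopf_induction with
  | add x x' h h' => rw [add_mul, map_add, map_add, h, h', add_mul]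
  | @coef X X' f hf ξ v =>
  induction y using C.hopf_induction with
  | add x x' h h' => rw [mul_add, map_add, map_add, h, h', mul_add]
  | @coef Y Y' g hg η w =>
  rw [coefR_mul, C.map_coefR' hf, C.map_coefR' hg, coefR_mul]
  refine (C.map_coefR' (C.tensor hf hg) _ _).trans ?_
  congr 2
  refine TensorProduct.ext' fun x y => ?_
  rfl

theorem map_one : C.map 1 = 1 := by
  have e : ∀ H : CrossedHopfAlgebra K G,
      coefR (V := K) (𝟙_ (Comod H)).ρ LinearMap.id 1 = 1 := fun H => by
    change sliceR H.carrier LinearMap.id ((1 : H.carrier) ⊗ₜ[K] (1 : K)) = 1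
    simp
  rw [← e H]
  exact (C.map_coefR C.unit LinearMap.id 1).trans (e H')

theorem map_comul (x : H.carrier) :
    TensorProduct.map C.map C.map (comul (R := K) x) = comul (R := K) (C.map x) := by
  induction x using C.hopf_induction with
  | add x x' h h' => simp only [map_add, h, h']
  | @coef X X' f hf ξ v =>
  rw [C.map_coefR' hf, CrossedHopfAlgebra.coefR_comm, CrossedHopfAlgebra.coefR_comm, ← C.map_ρ hf]
  generalize X.ρ v = x
  induction x with
  | zero => simp
  | add x y hx hy => simp only [map_add, hx, hy]
  | tmul a v =>
    simp only [LinearMap.lTensor_tmul, TensorProduct.map_tmul]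
    rw [C.map_coefR' hf]
    rfl

theorem counit_coefR (X : Comod H) (ξ : Dual K X.V) (v : X.V) :
    counit (R := K) (coefR X.ρ ξ v) = ξ v := by
  have e := congrArg ξ (X.isCoaction.counit v)
  rw [← e, coefR_apply]
  generalize X.ρ v = x
  induction x with
  | zero => simp
  | add x y hx hy => simp only [map_add, hx, hy]
  | tmul a v => simp [mul_comm]

theorem counit_map (x : H.carrier) : counit (R := K) (C.map x) = counit (R := K) x := by
  induction x using C.hopf_induction with
  | add x x' h h' => simp only [map_add, h, h']
  | @coef X X' f hf ξ v =>
  rw [C.map_coefR' hf, counit_coefR, counit_coefR]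
  exact congrArg ξ (f.symm_apply_apply v)

theorem coefR_conj (β : G) (X : Comod H) (ξ : Dual K X.V) (v : X.V) :
    coefR (V := X.V) (CrossedCategory.conj β X).ρ ξ v = H.φ β (coefR X.ρ ξ v) :=
  sliceR_rTensor _ _ _

theorem map_φ (β : G) (x : H.carrier) : C.map (H.φ β x) = H'.φ β (C.map x) := by
  induction x using C.hopf_induction with
  | add x x' h h' => simp only [map_add, h, h']
  | @coef X X' f hf ξ v =>
  rw [← coefR_conj, C.map_coefR' hf, ← coefR_conj]
  exact C.map_coefR' (C.conj hf β) ξ v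

theorem map_mem {α : G} {x : H.carrier} (hx : x ∈ H.comp α) : C.map x ∈ H'.comp α := by
  obtain ⟨X, hX, ξ, v, rfl⟩ := CrossedHopfAlgebra.exists_coefR hx
  obtain ⟨X', f, h⟩ := C.left X
  rw [C.map_coefR' h, ← hX, C.deg_eq h]
  exact CrossedHopfAlgebra.coefR_mem _ _ _

/-- The isomorphism of crossed Hopf algebras which is induced by a correspondence. -/
noncomputable def iso : CrossedHopfAlgebra.Iso H H' where
  e := BialgEquiv.ofAlgEquiv (AlgEquiv.ofLinearEquiv C.equiv C.map_one C.map_mul)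
    (AlgHom.ext C.counit_map) (AlgHom.ext C.map_comul)
  map_comp α := by
    ext x
    constructor
    · rintro ⟨y, hy, rfl⟩
      exact C.map_mem hy
    · intro hx
      exact ⟨C.symm.map x, C.symm.map_mem hx, C.map_map_symm x⟩
  map_φ := C.map_φ

theorem iso_apply (x : H.carrier) : C.iso.e x = C.map x := rfl

theorem γ_coefR (c : H.Cobraiding) (X Y : Comod H) (ξ : Dual K X.V) (v : X.V) (η : Dual K Y.V)
    (w : Y.V) : c.γ (coefR Y.ρ η w ⊗ₜ coefR X.ρ ξ v) =
      dualDistrib K Y.V X.V (η ⊗ₜ ξ) (c.braidMap X.ρ Y.ρ (v ⊗ₜ w)) := by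
  rw [c.braidMap_tmul, coefR_apply, coefR_apply]
  generalize X.ρ v = x
  generalize Y.ρ w = y
  induction x with
  | zero => simp
  | add x y hx hy => simp only [map_add, tmul_add, c.bl_add_left, hx, hy]
  | tmul a v =>
  induction y with
  | zero => simp
  | add x y hx hy => simp only [map_add, add_tmul, c.bl_add_right, hx, hy]
  | tmul b w =>
    simp only [sliceR_tmul, ← smul_tmul', tmul_smul, map_smul,
      CrossedHopfAlgebra.Cobraiding.bl_tmul, dualDistrib_apply, smul_eq_mul]
    ring

theorem preservesCobraiding (c : H.Cobraiding) (c' : H'.Cobraiding)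
    (h : ∀ {X X' f Y Y' g}, C.R X X' f → C.R Y Y' g → ∀ x : X.V ⊗[K] Y.V,
      TensorProduct.congr g f (c.braidMap X.ρ Y.ρ x) =
        c'.braidMap X'.ρ Y'.ρ (TensorProduct.congr f g x)) :
    C.iso.PreservesCobraiding c c' := by
  intro y x
  rw [iso_apply, iso_apply]
  induction x using C.hopf_induction with
  | add x x' h h' => simp only [map_add, tmul_add, h, h']
  | @coef X X' f hf ξ v =>
  induction y using C.hopf_induction with
  | add x x' h h' => simp only [map_add, add_tmul, h, h']
  | @coef Y Y' g hg η w =>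
  rw [C.map_coefR' hf, C.map_coefR' hg, γ_coefR, γ_coefR]
  have e := h hf hg (v ⊗ₜ w)
  rw [TensorProduct.congr_tmul] at e
  rw [← e]
  generalize c.braidMap X.ρ Y.ρ (v ⊗ₜ w) = z
  induction z with
  | zero => simp
  | add x y hx hy => simp only [map_add, hx, hy]
  | tmul a b => simp

theorem τ_coefR (τ : H.carrier →ₗ[K] K) (X : Comod H) (ξ : Dual K X.V) (v : X.V) :
    τ (coefR X.ρ ξ v) = ξ (coact τ X.ρ v) := by
  rw [coact_apply, coefR_apply]
  generalize X.ρ v = x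
  induction x with
  | zero => simp
  | add x y hx hy => simp only [map_add, hx, hy]
  | tmul a v => simp [mul_comm]

theorem preservesCotwist {c : H.Cobraiding} {c' : H'.Cobraiding} (t : H.Cotwist c)
    (t' : H'.Cotwist c')
    (h : ∀ {X X' f}, C.R X X' f → ∀ x : X.V, f (coact t.τ X.ρ x) = coact t'.τ X'.ρ (f x)) :
    C.iso.PreservesCotwist t t' := by
  intro x
  rw [iso_apply]
  induction x using C.hopf_induction with
  | add x x' h h' => simp only [map_add, h, h']
  | @coef X X' f hf ξ v =>
  rw [C.map_coefR' hf, τ_coefR, τ_coefR, ← h hf]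
  exact congrArg ξ (f.symm_apply_apply _)

end ComodCorrespondence

end Correspondence

section FiberMaps

variable {K : Type u} [Field K] {G : Type u} [Group G] {C : Type*} [Category* C]
  [MonoidalCategory C] [CrossedCategory G C] {Y : CrossedFiberFunctor K C}

namespace FiberMaps

variable {H₁ H₂ H₃ : CrossedHopfAlgebra K G} {F₁ : CrossedFunctor (Comod H₁) C}
  {F₂ : CrossedFunctor (Comod H₂) C} {F₃ : CrossedFunctor (Comod H₃) C}
  (p₁ : F₁.PreservesFiber (Comod.fiber H₁) Y) (p₂ : F₂.PreservesFiber (Comod.fiber H₂) Y)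
  (p₃ : F₃.PreservesFiber (Comod.fiber H₃) Y)
  {X₁ Z₁ : Comod H₁} {X₂ Z₂ : Comod H₂} {X₃ : Comod H₃} {A₁ B₁ A₂ B₂ A₃ : C}

theorem V_eq (p : F₁.PreservesFiber (Comod.fiber H₁) Y) (h : F₁.F.obj X₁ = A₁) : X₁.V = Y.F.obj A₁ := (p.obj X₁).trans (congrArg _ h)

/-- The linear map which underlies a morphism between images of comodules. -/
def fib (h₁ : F₁.F.obj X₁ = A₁) (h₂ : F₂.F.obj X₂ = A₂) (f : A₁ ⟶ A₂) : X₁.V ⟶ X₂.V :=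
  eqToHom (V_eq p₁ h₁) ≫ Y.F.map f ≫ eqToHom (V_eq p₂ h₂).symm

theorem fib_comp (h₁ : F₁.F.obj X₁ = A₁) (h₂ : F₂.F.obj X₂ = A₂) (h₃ : F₃.F.obj X₃ = A₃)
    (f : A₁ ⟶ A₂) (g : A₂ ⟶ A₃) :
    fib p₁ p₂ h₁ h₂ f ≫ fib p₂ p₃ h₂ h₃ g = fib p₁ p₃ h₁ h₃ (f ≫ g) := by
  simp [fib]

theorem fib_id (h₁ : F₁.F.obj X₁ = A₁) : fib p₁ p₁ h₁ h₁ (𝟙 A₁) = 𝟙 X₁.V := by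
  simp [fib]

theorem fib_map (k : X₁ ⟶ Z₁) (h₁ : F₁.F.obj X₁ = A₁) (h₂ : F₁.F.obj Z₁ = B₁) :
    fib p₁ p₁ h₁ h₂ (eqToHom h₁.symm ≫ F₁.F.map k ≫ eqToHom h₂) = k.f := by
  subst h₁ h₂
  simp only [eqToHom_refl, Category.id_comp, Category.comp_id]
  exact (p₁.map k).symm

theorem fib_tensor (h₁ : F₁.F.obj X₁ = A₁) (h₂ : F₂.F.obj X₂ = A₂) (h₁' : F₁.F.obj Z₁ = B₁)
    (h₂' : F₂.F.obj Z₂ = B₂) (f : A₁ ⟶ A₂) (g : B₁ ⟶ B₂)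
    (e₁ : F₁.F.obj (X₁ ⊗ Z₁) = A₁ ⊗ B₁) (e₂ : F₂.F.obj (X₂ ⊗ Z₂) = A₂ ⊗ B₂) :
    fib p₁ p₂ e₁ e₂ (f ⊗ₘ g) = fib p₁ p₂ h₁ h₂ f ⊗ₘ fib p₁ p₂ h₁' h₂' g := by
  subst h₁ h₂ h₁' h₂'
  have t₁ := p₁.tensor X₁ Z₁
  have t₂ := p₂.tensor X₂ Z₂
  have u₁ : Functor.LaxMonoidal.μ (Comod.fiber H₁).F X₁ Z₁ = 𝟙 (X₁.V ⊗ Z₁.V) := rfl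
  have u₂ : Functor.LaxMonoidal.μ (Comod.fiber H₂).F X₂ Z₂ = 𝟙 (X₂.V ⊗ Z₂.V) := rfl
  rw [u₁] at t₁
  rw [u₂] at t₂
  have s₁ : eqToHom (V_eq p₁ e₁) = (eqToHom (V_eq p₁ rfl) ⊗ₘ eqToHom (V_eq p₁ rfl)) ≫
      Functor.LaxMonoidal.μ Y.F (F₁.F.obj X₁) (F₁.F.obj Z₁) := by
    rw [← cancel_mono (eqToHom (V_eq p₁ e₁).symm)]
    refine (eqToHom_trans _ _).trans (Eq.trans ?_ (t₁.trans ?_))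
    · rfl
    · simp only [eqToHom_map, eqToHom_trans, Category.assoc]
      rfl
  have s₂ : Functor.LaxMonoidal.μ Y.F (F₂.F.obj X₂) (F₂.F.obj Z₂) ≫ eqToHom (V_eq p₂ e₂).symm =
      (eqToHom (V_eq p₂ rfl).symm ⊗ₘ eqToHom (V_eq p₂ rfl).symm) := by
    rw [← cancel_epi (eqToHom (V_eq p₂ rfl) ⊗ₘ eqToHom (V_eq p₂ rfl))]
    refine Eq.trans ?_ (t₂.symm.trans ?_)
    · simp only [eqToHom_map, eqToHom_trans]
      rfl
    · simp; rfl
  simp only [fib]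
  rw [s₁, Category.assoc, ← Functor.LaxMonoidal.μ_natural_assoc, s₂]
  simp

theorem fib_unit (e : 𝟙_ C = 𝟙_ C) (e₁ : F₁.F.obj (𝟙_ (Comod H₁)) = 𝟙_ C)
    (e₂ : F₂.F.obj (𝟙_ (Comod H₂)) = 𝟙_ C) :
    fib p₁ p₂ e₁ e₂ (eqToHom e) = 𝟙 (𝟙_ (ModuleCat.{u} K)) := by
  have t₁ := p₁.unit
  have t₂ := p₂.unit
  have u₁ : Functor.LaxMonoidal.ε (Comod.fiber H₁).F = 𝟙 (𝟙_ (ModuleCat.{u} K)) := rfl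
  have u₂ : Functor.LaxMonoidal.ε (Comod.fiber H₂).F = 𝟙 (𝟙_ (ModuleCat.{u} K)) := rfl
  rw [u₁] at t₁
  rw [u₂] at t₂
  have s₁ : eqToHom (V_eq p₁ e₁) = Functor.LaxMonoidal.ε Y.F := by
    rw [← cancel_mono (eqToHom (V_eq p₁ e₁).symm)]
    refine (eqToHom_trans _ _).trans (Eq.trans ?_ (t₁.trans ?_))
    · rfl
    · simp only [eqToHom_map, eqToHom_trans]
      rfl
  simp only [fib]
  rw [s₁]
  refine Eq.trans ?_ t₂.symm
  simp [eqToHom_map]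
  rfl

theorem fib_conj (β : G) (h₁ : F₁.F.obj X₁ = A₁) (h₂ : F₂.F.obj X₂ = A₂) (f : A₁ ⟶ A₂)
    {A₁' A₂' : C} (k₁ : A₁' = conj β A₁) (k₂ : A₂' = conj β A₂)
    (e₁ : F₁.F.obj (conj β X₁) = A₁') (e₂ : F₂.F.obj (conj β X₂) = A₂') :
    fib p₁ p₂ (X₁ := conj β X₁) (X₂ := conj β X₂) e₁ e₂ (conjMap β f k₁ k₂) =
      fib p₁ p₂ h₁ h₂ f := by
  subst h₁ h₂ k₁ k₂
  rw [conjMap_rfl]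
  have t₁ := p₁.conj β X₁
  have t₂ := p₂.conj β X₂
  have u₁ : ((Comod.fiber H₁).φ β).hom.app X₁ = 𝟙 X₁.V := rfl
  have u₂ : ((Comod.fiber H₂).φ β).hom.app X₂ = 𝟙 X₂.V := rfl
  rw [u₁] at t₁
  rw [u₂] at t₂
  have s₁ : eqToHom (V_eq p₁ e₁) = eqToHom (V_eq p₁ rfl) ≫ (Y.φ β).hom.app (F₁.F.obj X₁) := by
    rw [← cancel_mono (eqToHom (V_eq p₁ e₁).symm)]
    refine (eqToHom_trans _ _).trans (Eq.trans ?_ (t₁.trans ?_))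
    · rfl
    · simp only [eqToHom_map, eqToHom_trans, Category.assoc]
      rfl
  have s₂ : (Y.φ β).hom.app (F₂.F.obj X₂) ≫ eqToHom (V_eq p₂ e₂).symm =
      eqToHom (V_eq p₂ rfl).symm := by
    rw [← cancel_epi (eqToHom (V_eq p₂ rfl))]
    refine Eq.trans ?_ (t₂.symm.trans ?_)
    · simp only [eqToHom_map, eqToHom_trans]
      rfl
    · simp; rfl
  simp only [fib]
  rw [s₁, Category.assoc]
  have n := (Y.φ β).hom.naturality_assoc f (eqToHom (V_eq p₂ e₂).symm)
  refine congrArg (_ ≫ ·) (n.symm.trans ?_)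
  rw [s₂]

theorem fib_conj' (β : G) {β₁ β₂ : G} (h : β₁ = β) (h' : β₂ = β) (h₁ : F₁.F.obj X₁ = A₁)
    (h₂ : F₂.F.obj X₂ = A₂) (f : A₁ ⟶ A₂) {A₁' A₂' : C} (k₁ : A₁' = conj β A₁)
    (k₂ : A₂' = conj β A₂) (e₁ : F₁.F.obj (conj β₁ X₁) = A₁')
    (e₂ : F₂.F.obj (conj β₂ X₂) = A₂') :
    fib p₁ p₂ (X₁ := conj β₁ X₁) (X₂ := conj β₂ X₂) e₁ e₂ (conjMap β f k₁ k₂) =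
      fib p₁ p₂ h₁ h₂ f := by
  obtain rfl := h
  obtain rfl := h'
  exact fib_conj p₁ p₂ _ h₁ h₂ f k₁ k₂ e₁ e₂

end FiberMaps

open FiberMaps

variable {H₁ H₂ : CrossedHopfAlgebra K G} {F₁ : CrossedFunctor (Comod H₁) C}
  {F₂ : CrossedFunctor (Comod H₂) C}
  (p₁ : F₁.PreservesFiber (Comod.fiber H₁) Y) (p₂ : F₂.PreservesFiber (Comod.fiber H₂) Y)

/-- The relation between comodules with isomorphic images. -/
def FiberRel (X₁ : Comod H₁) (X₂ : Comod H₂) (f : X₁.V ≃ₗ[K] X₂.V) : Prop :=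
  ∃ g : F₁.F.obj X₁ ≅ F₂.F.obj X₂, ModuleCat.ofHom f.toLinearMap = fib p₁ p₂ rfl rfl g.hom

variable {p₁ p₂}

theorem FiberRel.symm {X₁ X₂ f} (h : FiberRel p₁ p₂ X₁ X₂ f) : FiberRel p₂ p₁ X₂ X₁ f.symm := by
  obtain ⟨g, hg⟩ := h
  refine ⟨g.symm, ?_⟩
  have e : ModuleCat.ofHom f.symm.toLinearMap ≫ ModuleCat.ofHom f.toLinearMap = 𝟙 X₂.V := by
    ext x
    exact f.apply_symm_apply x
  have e' : fib p₂ p₁ rfl rfl g.symm.hom ≫ ModuleCat.ofHom f.toLinearMap = 𝟙 X₂.V := by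
    rw [hg, fib_comp, Iso.symm_hom, Iso.inv_hom_id, fib_id]
  have : IsIso (ModuleCat.ofHom f.toLinearMap) :=
    ⟨ModuleCat.ofHom f.symm.toLinearMap, by ext x; exact f.symm_apply_apply x, e⟩
  rw [← cancel_mono (ModuleCat.ofHom f.toLinearMap)]
  exact e.trans e'.symm

theorem FiberRel.of_iso {X₁ : Comod H₁} {X₂ : Comod H₂} (g : F₁.F.obj X₁ ≅ F₂.F.obj X₂) :
    ∃ f, FiberRel p₁ p₂ X₁ X₂ f := by
  let e : X₁.V ≅ X₂.V :=
    { hom := fib p₁ p₂ rfl rfl g.hom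
      inv := fib p₂ p₁ rfl rfl g.inv
      hom_inv_id := by rw [fib_comp, Iso.hom_inv_id, fib_id]
      inv_hom_id := by rw [fib_comp, Iso.inv_hom_id, fib_id] }
  exact ⟨e.toLinearEquiv, g, rfl⟩

theorem FiberRel.exists_of_isEquivOnto {P : ObjectProperty C} (e₁ : F₁.IsEquivOnto P)
    (e₂ : F₂.IsEquivOnto P) (X₁ : Comod H₁) : ∃ X₂ f, FiberRel p₁ p₂ X₁ X₂ f := by
  obtain ⟨X₂, ⟨i⟩⟩ := e₂.essSurj _ (e₁.prop_obj X₁)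
  exact ⟨X₂, FiberRel.of_iso i.symm⟩

theorem FiberRel.map {X₁ X₂ f Z₁ Z₂ g} (h : FiberRel p₁ p₂ X₁ X₂ f)
    (h' : FiberRel p₁ p₂ Z₁ Z₂ g) (full : F₂.F.Full) (k : X₁ ⟶ Z₁) :
    ∃ k' : X₂ ⟶ Z₂, ModuleCat.ofHom f.toLinearMap ≫ k'.f = k.f ≫ ModuleCat.ofHom g.toLinearMap := by
  obtain ⟨i, hi⟩ := h
  obtain ⟨j, hj⟩ := h'
  obtain ⟨k', hk⟩ := full.map_surjective (i.inv ≫ F₁.F.map k ≫ j.hom)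
  refine ⟨k', ?_⟩
  have e₁ := fib_map p₁ k rfl rfl
  have e₂ := fib_map p₂ k' rfl rfl
  simp only [eqToHom_refl, Category.id_comp, Category.comp_id] at e₁ e₂
  rw [hi, hj, ← e₁, ← e₂, fib_comp, fib_comp, hk]
  simp

theorem FiberRel.tensor {X₁ X₂ f Z₁ Z₂ g} (h : FiberRel p₁ p₂ X₁ X₂ f)
    (h' : FiberRel p₁ p₂ Z₁ Z₂ g) :
    FiberRel p₁ p₂ (X₁ ⊗ Z₁) (X₂ ⊗ Z₂) (TensorProduct.congr f g) := by
  obtain ⟨i, hi⟩ := h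
  obtain ⟨j, hj⟩ := h'
  refine ⟨eqToIso (F₁.obj_tensor X₁ Z₁) ≪≫ (i ⊗ᵢ j) ≪≫ eqToIso (F₂.obj_tensor X₂ Z₂).symm, ?_⟩
  have e := fib_tensor p₁ p₂ rfl rfl rfl rfl i.hom j.hom (F₁.obj_tensor X₁ Z₁) (F₂.obj_tensor X₂ Z₂)
  rw [← hi, ← hj] at e
  refine Eq.trans ?_ (e.symm.trans ?_)
  · rfl
  · simp [fib, eqToHom_map]

theorem FiberRel.unit : FiberRel p₁ p₂ (𝟙_ _) (𝟙_ _) (LinearEquiv.refl K K) := by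
  refine ⟨eqToIso (F₁.obj_unit.trans F₂.obj_unit.symm), ?_⟩
  refine Eq.trans ?_ ((fib_unit p₁ p₂ rfl F₁.obj_unit F₂.obj_unit).symm.trans ?_)
  · rfl
  · simp [fib, eqToHom_map]

theorem FiberRel.conj {X₁ X₂ f} (h : FiberRel p₁ p₂ X₁ X₂ f) (β : G) :
    FiberRel p₁ p₂ (CrossedCategory.conj β X₁) (CrossedCategory.conj β X₂) f := by
  obtain ⟨i, hi⟩ := h
  refine ⟨eqToIso (F₁.obj_conj β X₁) ≪≫ (Φ β).mapIso i ≪≫ eqToIso (F₂.obj_conj β X₂).symm, ?_⟩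
  have e := fib_conj p₁ p₂ β rfl rfl i.hom rfl rfl (F₁.obj_conj β X₁) (F₂.obj_conj β X₂)
  refine Eq.trans ?_ ((hi.trans e.symm).trans ?_)
  · rfl
  · simp [fib, eqToHom_map, conjMap]

/-- The correspondence between comodules which is induced by two equivalences of Tannakian
crossed categories with the same target. -/
def FiberRel.correspondence {P : ObjectProperty C} (e₁ : F₁.IsEquivOnto P)
    (e₂ : F₂.IsEquivOnto P) (p₁ : F₁.PreservesFiber (Comod.fiber H₁) Y)
    (p₂ : F₂.PreservesFiber (Comod.fiber H₂) Y) : ComodCorrespondence H₁ H₂ where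
  R := FiberRel p₁ p₂
  left := FiberRel.exists_of_isEquivOnto e₁ e₂
  right X₂ := by
    obtain ⟨X₁, f, h⟩ := FiberRel.exists_of_isEquivOnto (p₁ := p₂) (p₂ := p₁) e₂ e₁ X₂
    exact ⟨X₁, f.symm, h.symm⟩
  deg_eq {X₁ X₂ _} h := by
    obtain ⟨i, -⟩ := h
    exact (F₁.deg_obj X₁).symm.trans ((deg_eq_of_hom i.hom).trans (F₂.deg_obj X₂))
  hom h h' k := by
    obtain ⟨k', hk⟩ := h.map h' e₂.full k
    exact ⟨k', fun v => LinearMap.congr_fun (congrArg ModuleCat.Hom.hom hk) v⟩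
  hom_symm {X X' f Z Z' g} h h' k := by
    obtain ⟨k', hk⟩ := h.symm.map h'.symm e₁.full k
    refine ⟨k', fun v => ?_⟩
    have := LinearMap.congr_fun (congrArg ModuleCat.Hom.hom hk) (f v)
    change k'.f.hom (f.symm (f v)) = g.symm (k.f.hom (f v)) at this
    rw [LinearEquiv.symm_apply_apply, LinearEquiv.eq_symm_apply] at this
    exact this.symm
  tensor h h' := h.tensor h'
  unit := FiberRel.unit
  conj h β := h.conj β

end FiberMaps

section Uniqueness

variable {K : Type u} [Field K] {G : Type u} [Group G] {C : Type*} [Category* C]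
  [MonoidalCategory C] [CrossedCategory G C] [CrossedBraiding C] {Y : CrossedFiberFunctor K C}
  {P : ObjectProperty C}

open FiberMaps

omit [CrossedBraiding C] in
theorem CrossedFunctor.IsIsoOnto.isEquivOnto {D : Type*} [Category* D]
    [MonoidalCategory D] [CrossedCategory G D] {F : CrossedFunctor D C} (h : F.IsIsoOnto P) :
    F.IsEquivOnto P where
  full := h.full
  faithful := h.faithful
  prop_obj X := (h.range _).mpr ⟨X, rfl⟩
  essSurj Z hZ := by
    obtain ⟨X, hX⟩ := (h.range Z).mp hZ
    exact ⟨X, ⟨eqToIso hX⟩⟩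

theorem FiberRel.braidMap {D₁ D₂ : CoquasitriangularHopfAlgebra K G}
    {F₁ : CrossedFunctor (Comod D₁.toCrossedHopfAlgebra) C}
    {F₂ : CrossedFunctor (Comod D₂.toCrossedHopfAlgebra) C}
    {p₁ : F₁.PreservesFiber (Comod.fiber _) Y} {p₂ : F₂.PreservesFiber (Comod.fiber _) Y}
    (b₁ : F₁.IsBraided) (b₂ : F₂.IsBraided) {X₁ X₂ f Z₁ Z₂ g} (h : FiberRel p₁ p₂ X₁ X₂ f)
    (h' : FiberRel p₁ p₂ Z₁ Z₂ g) :
    ModuleCat.ofHom (D₁.cobraiding.braidMap X₁.ρ Z₁.ρ) ≫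
        (ModuleCat.ofHom g.toLinearMap ⊗ₘ ModuleCat.ofHom f.toLinearMap) =
      (ModuleCat.ofHom f.toLinearMap ⊗ₘ ModuleCat.ofHom g.toLinearMap) ≫
        ModuleCat.ofHom (D₂.cobraiding.braidMap X₂.ρ Z₂.ρ) := by
  obtain ⟨i, hi⟩ := h
  obtain ⟨j, hj⟩ := h'
  have hd : deg (F₁.F.obj X₁) = deg X₁ := F₁.deg_obj X₁
  have hd' : deg (F₂.F.obj X₂) = deg X₁ :=
    (deg_eq_of_hom i.hom).symm.trans (F₁.deg_obj X₁)
  have hd'' : deg X₁ = deg X₂ := hd'.symm.trans (F₂.deg_obj X₂)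
  have k₁ := F₁.obj_conj_deg (X := X₁) (Y := Z₁) rfl
  have k₂ := F₂.obj_conj_deg (X := X₂) (Y := Z₂) rfl
  have k₂' : F₂.F.obj (CrossedCategory.conj (deg X₂) Z₂) = CrossedCategory.conj (deg (F₁.F.obj X₁)) (F₂.F.obj Z₂) := by
    rw [hd, hd'', F₂.obj_conj]
  have n := CrossedBraiding.c_natural i.hom j.hom k₁ k₂ k₂'
  have c₁ : fib p₁ p₁ (F₁.obj_tensor X₁ Z₁) (F₁.obj_tensor (CrossedCategory.conj (deg X₁) Z₁) X₁)
      (CrossedBraiding.c (F₁.F.obj X₁) (F₁.F.obj Z₁) k₁).hom =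
      ModuleCat.ofHom (D₁.cobraiding.braidMap X₁.ρ Z₁.ρ) := by
    have e := fib_map p₁ (CrossedBraiding.c X₁ Z₁ rfl).hom (F₁.obj_tensor X₁ Z₁)
      (F₁.obj_tensor (CrossedCategory.conj (deg X₁) Z₁) X₁)
    rw [b₁ X₁ Z₁ rfl] at e
    simp only [eqToHom_trans_assoc, eqToHom_trans, eqToHom_refl, Category.id_comp,
      Category.assoc, Category.comp_id] at e
    rw [e, Comod.c_hom_f]
    exact Category.comp_id _
  have c₂ : fib p₂ p₂ (F₂.obj_tensor X₂ Z₂) (F₂.obj_tensor (CrossedCategory.conj (deg X₂) Z₂) X₂)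
      (CrossedBraiding.c (F₂.F.obj X₂) (F₂.F.obj Z₂) k₂).hom =
      ModuleCat.ofHom (D₂.cobraiding.braidMap X₂.ρ Z₂.ρ) := by
    have e := fib_map p₂ (CrossedBraiding.c X₂ Z₂ rfl).hom (F₂.obj_tensor X₂ Z₂)
      (F₂.obj_tensor (CrossedCategory.conj (deg X₂) Z₂) X₂)
    rw [b₂ X₂ Z₂ rfl] at e
    simp only [eqToHom_trans_assoc, eqToHom_trans, eqToHom_refl, Category.id_comp,
      Category.assoc, Category.comp_id] at e
    rw [e, Comod.c_hom_f]
    exact Category.comp_id _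
  have t₁ := fib_tensor p₁ p₂ rfl rfl rfl rfl i.hom j.hom (F₁.obj_tensor X₁ Z₁)
    (F₂.obj_tensor X₂ Z₂)
  have t₂ := fib_tensor p₁ p₂ (X₁ := CrossedCategory.conj (deg X₁) Z₁) (X₂ := CrossedCategory.conj (deg X₂) Z₂) rfl rfl rfl rfl
    (conjMap (deg (F₁.F.obj X₁)) j.hom k₁ k₂') i.hom (F₁.obj_tensor (CrossedCategory.conj (deg X₁) Z₁) X₁)
    (F₂.obj_tensor (CrossedCategory.conj (deg X₂) Z₂) X₂)
  have t₃ : fib p₁ p₂ (X₁ := CrossedCategory.conj (deg X₁) Z₁) (X₂ := CrossedCategory.conj (deg X₂) Z₂) rfl rfl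
      (conjMap (deg (F₁.F.obj X₁)) j.hom k₁ k₂') = ModuleCat.ofHom g.toLinearMap := by
    rw [hj]
    exact fib_conj' p₁ p₂ _ hd.symm (hd''.symm.trans hd.symm) rfl rfl j.hom k₁ k₂' rfl rfl
  rw [t₃, ← hi] at t₂
  rw [← hi, ← hj] at t₁
  have r := congrArg (fib p₁ p₂ (F₁.obj_tensor X₁ Z₁) (F₂.obj_tensor (CrossedCategory.conj (deg X₂) Z₂) X₂)) n
  rw [← fib_comp p₁ p₂ p₂ _ (F₂.obj_tensor X₂ Z₂), c₂, t₁,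
    ← fib_comp p₁ p₁ p₂ _ (F₁.obj_tensor (CrossedCategory.conj (deg X₁) Z₁) X₁), c₁, t₂] at r
  exact r.symm

theorem Comod.θ_hom_f (R : CoribbonHopfAlgebra K G) (X : Comod R.toCrossedHopfAlgebra)
    {X' : Comod R.toCrossedHopfAlgebra} (h : X' = conj (CrossedCategory.deg X) X) :
    (CrossedTwist.θ X h).hom.f =
      ModuleCat.ofHom (_root_.coact R.cotwist.τ X.ρ) ≫
        eqToHom (X := X.V) (Y := X'.V) (by subst h; rfl) := by
  subst h
  change (Comod.twist R.cotwist X ≪≫ eqToIso _).hom.f = _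
  simp only [Comod.comp_f, Comod.eqToHom_f, Iso.trans_hom, eqToIso.hom]
  simp only [Comod.twist_hom_f, eqToHom_refl, Category.comp_id]

theorem FiberRel.coact [CrossedTwist C] {D₁ D₂ : CoribbonHopfAlgebra K G}
    {F₁ : CrossedFunctor (Comod D₁.toCrossedHopfAlgebra) C}
    {F₂ : CrossedFunctor (Comod D₂.toCrossedHopfAlgebra) C}
    {p₁ : F₁.PreservesFiber (Comod.fiber _) Y} {p₂ : F₂.PreservesFiber (Comod.fiber _) Y}
    (b₁ : F₁.IsBalanced) (b₂ : F₂.IsBalanced) {X₁ X₂ f} (h : FiberRel p₁ p₂ X₁ X₂ f) :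
    ModuleCat.ofHom (_root_.coact D₁.cotwist.τ X₁.ρ) ≫ ModuleCat.ofHom f.toLinearMap =
      ModuleCat.ofHom f.toLinearMap ≫ ModuleCat.ofHom (_root_.coact D₂.cotwist.τ X₂.ρ) := by
  obtain ⟨i, hi⟩ := h
  have hd : deg (F₁.F.obj X₁) = deg X₁ := F₁.deg_obj X₁
  have hd' : deg (F₂.F.obj X₂) = deg X₁ :=
    (deg_eq_of_hom i.hom).symm.trans (F₁.deg_obj X₁)
  have hd'' : deg X₁ = deg X₂ := hd'.symm.trans (F₂.deg_obj X₂)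
  have k₁ := F₁.obj_conj_deg (X := X₁) (Y := X₁) rfl
  have k₂ := F₂.obj_conj_deg (X := X₂) (Y := X₂) rfl
  have k₂' : F₂.F.obj (CrossedCategory.conj (deg X₂) X₂) =
      CrossedCategory.conj (deg (F₁.F.obj X₁)) (F₂.F.obj X₂) := by
    rw [hd, hd'', F₂.obj_conj]
  have n := CrossedTwist.θ_natural i.hom k₁ k₂ k₂'
  have c₁ : fib p₁ p₁ (X₁ := X₁) (X₂ := CrossedCategory.conj (deg X₁) X₁) rfl rfl
      (CrossedTwist.θ (F₁.F.obj X₁) k₁).hom = ModuleCat.ofHom (_root_.coact D₁.cotwist.τ X₁.ρ) := by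
    have e := fib_map p₁ (CrossedTwist.θ X₁ (X' := CrossedCategory.conj (deg X₁) X₁) rfl).hom rfl rfl
    rw [b₁ X₁ rfl] at e
    simp only [eqToHom_refl, Category.id_comp, Category.comp_id] at e
    rw [e, Comod.θ_hom_f]
    exact Category.comp_id _
  have c₂ : fib p₂ p₂ (X₁ := X₂) (X₂ := CrossedCategory.conj (deg X₂) X₂) rfl rfl
      (CrossedTwist.θ (F₂.F.obj X₂) k₂).hom = ModuleCat.ofHom (_root_.coact D₂.cotwist.τ X₂.ρ) := by
    have e := fib_map p₂ (CrossedTwist.θ X₂ (X' := CrossedCategory.conj (deg X₂) X₂) rfl).hom rfl rfl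
    rw [b₂ X₂ rfl] at e
    simp only [eqToHom_refl, Category.id_comp, Category.comp_id] at e
    rw [e, Comod.θ_hom_f]
    exact Category.comp_id _
  have t₃ : fib p₁ p₂ (X₁ := CrossedCategory.conj (deg X₁) X₁)
      (X₂ := CrossedCategory.conj (deg X₂) X₂) rfl rfl
      (conjMap (deg (F₁.F.obj X₁)) i.hom k₁ k₂') = ModuleCat.ofHom f.toLinearMap := by
    rw [hi]
    exact fib_conj' p₁ p₂ _ hd.symm (hd''.symm.trans hd.symm) rfl rfl i.hom k₁ k₂' rfl rfl
  have r := congrArg (fib p₁ p₂ (X₁ := X₁) (X₂ := CrossedCategory.conj (deg X₂) X₂) rfl rfl) n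
  rw [← fib_comp p₁ p₂ p₂ rfl rfl rfl, c₂, ← hi, ← fib_comp p₁ p₁ p₂ _ rfl, c₁, t₃] at r
  exact r.symm

theorem BraidedTannakianIso.unique {D₁ D₂ : CoquasitriangularHopfAlgebra K G}
    (h₁ : BraidedTannakianIso (Comod.fiber D₁.toCrossedHopfAlgebra) Y P)
    (h₂ : BraidedTannakianEquiv (Comod.fiber D₂.toCrossedHopfAlgebra) Y P) :
    ∃ i : CrossedHopfAlgebra.Iso D₁.toCrossedHopfAlgebra D₂.toCrossedHopfAlgebra,
      i.PreservesCobraiding D₁.cobraiding D₂.cobraiding := by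
  obtain ⟨F₁, e₁, b₁, p₁⟩ := h₁
  obtain ⟨F₂, e₂, b₂, p₂⟩ := h₂
  refine ⟨_, (FiberRel.correspondence e₁.isEquivOnto e₂ p₁ p₂).preservesCobraiding _ _
    fun h h' x => ?_⟩
  exact LinearMap.congr_fun (congrArg ModuleCat.Hom.hom (FiberRel.braidMap b₁ b₂ h h')) x

theorem RibbonTannakianIso.unique [CrossedTwist C] {D₁ D₂ : CoribbonHopfAlgebra K G}
    (h₁ : RibbonTannakianIso (Comod.fiber D₁.toCrossedHopfAlgebra) Y P)
    (h₂ : RibbonTannakianEquiv (Comod.fiber D₂.toCrossedHopfAlgebra) Y P) :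
    ∃ i : CrossedHopfAlgebra.Iso D₁.toCrossedHopfAlgebra D₂.toCrossedHopfAlgebra,
      i.PreservesCobraiding D₁.cobraiding D₂.cobraiding ∧
        i.PreservesCotwist D₁.cotwist D₂.cotwist := by
  obtain ⟨-, F₁, e₁, b₁, t₁, p₁⟩ := h₁
  obtain ⟨-, F₂, e₂, b₂, t₂, p₂⟩ := h₂
  refine ⟨_, (FiberRel.correspondence e₁.isEquivOnto e₂ p₁ p₂).preservesCobraiding _ _
    fun h h' x => ?_, (FiberRel.correspondence e₁.isEquivOnto e₂ p₁ p₂).preservesCotwist _ _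
    fun h x => ?_⟩
  · exact LinearMap.congr_fun (congrArg ModuleCat.Hom.hom (FiberRel.braidMap b₁ b₂ h h')) x
  · exact LinearMap.congr_fun (congrArg ModuleCat.Hom.hom (FiberRel.coact t₁ t₂ h)) x

end Uniqueness

/-! ### The antipode as an anti-automorphism -/

section AntiAutomorphism

open TensorProduct Coalgebra Module HopfAlgebra

variable {K : Type u} [Field K] {G : Type u} [Group G]

namespace CrossedHopfAlgebra

variable {H : CrossedHopfAlgebra K G}

/-- The matrix of the coaction of a comodule. -/
noncomputable def coefMatrix {ι : Type*} (X : Comod H) (b : Basis ι K X.V) :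
    Matrix ι ι H.carrier := fun i j => coefR X.ρ (b.coord j) (b i)

theorem comul_coefR {ι : Type*} [Fintype ι] {X : Comod H} (b : Basis ι K X.V) (ξ : Dual K X.V)
    (v : X.V) : comul (R := K) (coefR X.ρ ξ v) =
      ∑ i, coefR X.ρ (b.coord i) v ⊗ₜ[K] coefR X.ρ ξ (b i) := by
  rw [coefR_comm]
  conv_lhs => rw [eq_sum_sliceR b (X.ρ v), map_sum]
  simp only [LinearMap.lTensor_tmul]
  rfl

theorem counit_coefR' {X : Comod H} (ξ : Dual K X.V) (v : X.V) :
    counit (R := K) (coefR X.ρ ξ v) = ξ v := by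
  conv_rhs => rw [← X.isCoaction.counit v]
  rw [coefR_apply]
  generalize X.ρ v = x
  induction x with
  | zero => simp
  | add x y hx hy => simp only [map_add, hx, hy]
  | tmul a w => simp [mul_comm]

theorem coefMatrix_mul_antipode {ι : Type*} [Fintype ι] [DecidableEq ι] (X : Comod H)
    (b : Basis ι K X.V) :
    coefMatrix X b * (coefMatrix X b).map (antipode K) = 1 := by
  ext i j
  have e := mul_antipode_lTensor_comul_apply (R := K) (coefMatrix X b i j)
  rw [coefMatrix, comul_coefR b, counit_coefR'] at e
  simp only [map_sum, LinearMap.lTensor_tmul, LinearMap.mul'_apply] at e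
  rw [Matrix.mul_apply]
  refine e.trans ?_
  rw [Basis.coord_apply, Basis.repr_self, Matrix.one_apply, Finsupp.single_apply]
  split_ifs <;> simp

theorem antipode_mul_coefMatrix {ι : Type*} [Fintype ι] [DecidableEq ι] (X : Comod H)
    (b : Basis ι K X.V) :
    (coefMatrix X b).map (antipode K) * coefMatrix X b = 1 := by
  ext i j
  have e := mul_antipode_rTensor_comul_apply (R := K) (coefMatrix X b i j)
  rw [coefMatrix, comul_coefR b, counit_coefR'] at e
  simp only [map_sum, LinearMap.rTensor_tmul, LinearMap.mul'_apply] at e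
  rw [Matrix.mul_apply]
  refine e.trans ?_
  rw [Basis.coord_apply, Basis.repr_self, Matrix.one_apply, Finsupp.single_apply]
  split_ifs <;> simp

theorem hom_ext_of_coefMatrix {M : Type*} [AddCommGroup M] [Module K M] {t t' : H.carrier →ₗ[K] M}
    (h : ∀ {n : ℕ} (X : Comod H) (b : Basis (Fin n) K X.V),
      (coefMatrix X b).map t = (coefMatrix X b).map t') : t = t' := by
  refine hom_ext_of_coefR fun X ξ v => ?_
  have e := (finBasis K X.V).sum_dual_apply_smul_coord ξ
  have e' := (finBasis K X.V).sum_repr v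
  rw [← e, ← e']
  simp only [map_sum, map_smul, LinearMap.sum_apply, LinearMap.smul_apply]
  refine Finset.sum_congr rfl fun i _ => congrArg _ (Finset.sum_congr rfl fun j _ => congrArg _ ?_)
  exact congrFun (congrFun (h X (finBasis K X.V)) i) j

theorem comul_antipode (h : H.carrier) :
    comul (R := K) (antipode K h) = TensorProduct.map (antipode K) (antipode K)
      (TensorProduct.comm K H.carrier H.carrier (comul (R := K) h)) := by
  refine LinearMap.congr_fun (f := comul ∘ₗ antipode K)
    (g := TensorProduct.map (antipode K) (antipode K) ∘ₗ
      (TensorProduct.comm K H.carrier H.carrier).toLinearMap ∘ₗ comul)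
    (hom_ext_of_coefMatrix fun {n} X b => ?_) h
  let Δ := Bialgebra.comulAlgHom K H.carrier
  let i₁ : H.carrier →ₐ[K] H.carrier ⊗[K] H.carrier := Algebra.TensorProduct.includeLeft
  let i₂ : H.carrier →ₐ[K] H.carrier ⊗[K] H.carrier := Algebra.TensorProduct.includeRight
  let N := coefMatrix X b
  let N' := N.map (antipode K)
  have mm : ∀ (f : H.carrier →ₐ[K] H.carrier ⊗[K] H.carrier)
      (A B : Matrix (Fin n) (Fin n) H.carrier), (A * B).map f = A.map f * B.map f :=
    fun f A B => by
      ext i j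
      simp [Matrix.mul_apply]
  have m1 : ∀ (f : H.carrier →ₐ[K] H.carrier ⊗[K] H.carrier),
      (1 : Matrix (Fin n) (Fin n) H.carrier).map f = 1 := fun f =>
    Matrix.map_one _ (map_zero f) (map_one f)
  have hΔ : N.map Δ = N.map i₁ * N.map i₂ := by
    ext i j
    rw [Matrix.map_apply, Matrix.mul_apply]
    refine (comul_coefR b _ _).trans (Finset.sum_congr rfl fun k _ => ?_)
    simp [i₁, i₂, N, coefMatrix]
  have hr : (N'.map i₂ * N'.map i₁) * N.map Δ = 1 := by
    rw [hΔ, Matrix.mul_assoc, ← Matrix.mul_assoc (N'.map i₁), ← mm, antipode_mul_coefMatrix, m1,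
      Matrix.one_mul, ← mm, antipode_mul_coefMatrix, m1]
  have hl : N.map Δ * N'.map Δ = 1 := by
    rw [← mm, coefMatrix_mul_antipode, m1]
  have e := left_inv_eq_right_inv hr hl
  ext i j
  have e := congrFun (congrFun e i) j
  rw [Matrix.map_apply, Matrix.map_apply, LinearMap.comp_apply, LinearMap.comp_apply,
    LinearMap.comp_apply]
  refine e.symm.trans ?_
  rw [Matrix.mul_apply]
  have := comul_coefR b (b.coord j) (b i)
  rw [coefMatrix, this]
  simp [i₁, i₂, N', N, coefMatrix]

theorem φ_antipode (β : G) (h : H.carrier) : H.φ β (antipode K h) = antipode K (H.φ β h) := by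
  refine LinearMap.congr_fun (f := H.φl β ∘ₗ antipode K) (g := antipode K ∘ₗ H.φl β)
    (hom_ext_of_coefMatrix fun {n} X b => ?_) h
  let N := coefMatrix X b
  have hN : coefMatrix (conj β X) b = N.map (H.φ β) := by
    ext i j
    exact sliceR_rTensor (b.coord j) (H.φl β) (X.ρ (b i))
  have hl : (N.map (antipode K)).map (H.φ β) * N.map (H.φ β) = 1 := by
    have mm : ∀ (A B : Matrix (Fin n) (Fin n) H.carrier),
        (A * B).map (H.φ β) = A.map (H.φ β) * B.map (H.φ β) := fun A B => by
      ext i j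
      simp [Matrix.mul_apply]
    rw [← mm, antipode_mul_coefMatrix, Matrix.map_one _ (map_zero _) (map_one _)]
  have hr := coefMatrix_mul_antipode (conj β X) b
  rw [hN] at hr
  exact left_inv_eq_right_inv hl hr

variable (H) in
/-- The antipode as a linear automorphism. -/
noncomputable def S : H.carrier ≃ₗ[K] H.carrier :=
  LinearEquiv.ofBijective (antipode K) H.antipode_bijective

@[simp] theorem S_apply (h : H.carrier) : H.S h = antipode K h := rfl

/-- Anti-automorphisms of a crossed Hopf algebra. -/
structure IsAnti (κ : H.carrier ≃ₗ[K] H.carrier) : Prop where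
  mul : ∀ h k, κ (h * k) = κ k * κ h
  one : κ 1 = 1
  comul : ∀ h, comul (R := K) (κ h) = TensorProduct.map κ.toLinearMap κ.toLinearMap
    (TensorProduct.comm K H.carrier H.carrier (comul (R := K) h))
  counit : ∀ h, counit (R := K) (κ h) = counit (R := K) h
  φ : ∀ β h, H.φ β (κ h) = κ (H.φ β h)
  mem : ∀ {α h}, h ∈ H.comp α → κ h ∈ H.comp α⁻¹

theorem isAnti_S : IsAnti H.S where
  mul := antipode_mul_antidistrib
  one := antipode_one
  comul := comul_antipode
  counit := counit_antipode
  φ := φ_antipode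
  mem := H.antipode_mem

theorem IsAnti.symm {κ : H.carrier ≃ₗ[K] H.carrier} (hκ : IsAnti κ) : IsAnti κ.symm where
  mul h k := by rw [LinearEquiv.symm_apply_eq, hκ.mul]; simp
  one := by rw [LinearEquiv.symm_apply_eq, hκ.one]
  comul h := by
    obtain ⟨k, rfl⟩ := κ.surjective h
    rw [hκ.comul, LinearEquiv.symm_apply_apply]
    generalize Coalgebra.comul (R := K) k = x
    induction x with
    | zero => simp
    | add x y hx hy => simp only [map_add, ← hx, ← hy]
    | tmul a b => simp
  counit h := by
    obtain ⟨k, rfl⟩ := κ.surjective h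
    rw [hκ.counit, LinearEquiv.symm_apply_apply]
  φ β h := by
    rw [LinearEquiv.eq_symm_apply, ← hκ.φ, LinearEquiv.apply_symm_apply]
  mem {α h} hh := by
    let A : G → Submodule K H.carrier := fun α => (H.comp α⁻¹).map κ.toLinearMap
    have hA : ∀ α, A α ≤ H.comp α := by
      rintro α _ ⟨x, hx, rfl⟩
      simpa using hκ.mem hx
    have hs : ⨆ α, A α = ⊤ := by
      have e : ⨆ i, H.comp i⁻¹ = ⨆ i, H.comp i := (Equiv.inv G).iSup_comp (g := H.comp)
      rw [← Submodule.map_iSup, e, H.iSup_comp, Submodule.map_top]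
      exact LinearEquiv.range κ
    have hle : H.comp α ≤ A α := by
      have h₁ : A α ⊔ ⨆ (β) (_ : β ≠ α), A β = ⊤ := by
        rw [← hs]
        refine le_antisymm (sup_le (le_iSup A α) (iSup₂_le fun β _ => le_iSup A β)) ?_
        refine iSup_le fun β => ?_
        by_cases hβ : β = α
        · subst hβ; exact le_sup_left
        · exact le_trans (le_iSup₂_of_le β hβ le_rfl) le_sup_right
      have h₂ : (⨆ (β) (_ : β ≠ α), A β) ⊓ H.comp α = ⊥ := by
        rw [eq_bot_iff]
        refine le_trans ?_ (disjoint_iff.mp (H.indep α)).le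
        rw [inf_comm]
        exact inf_le_inf_left _ (iSup₂_mono fun β _ => hA β)
      calc H.comp α = (A α ⊔ ⨆ (β) (_ : β ≠ α), A β) ⊓ H.comp α := by rw [h₁, top_inf_eq]
        _ = A α ⊔ (⨆ (β) (_ : β ≠ α), A β) ⊓ H.comp α := (sup_inf_assoc_of_le _ (hA α)).symm ▸ rfl
        _ ≤ A α := by rw [h₂, sup_bot_eq]
    obtain ⟨x, hx, rfl⟩ := hle hh
    simpa using hx

end CrossedHopfAlgebra

end AntiAutomorphism

section DualCoaction

open TensorProduct Coalgebra Module HopfAlgebra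

variable {K : Type u} [Field K] {G : Type u} [Group G] {H : CrossedHopfAlgebra K G}
  {V : Type u} [AddCommGroup V] [Module K V] [Module.Finite K V]

/-- The coaction on the dual space with coefficients `κ(ξ(v'') v')`. -/
noncomputable def dualCoaction (κ : H.carrier ≃ₗ[K] H.carrier) (ρ : V →ₗ[K] H.carrier ⊗[K] V) :
    Dual K V →ₗ[K] H.carrier ⊗[K] Dual K V :=
  ofCoefR (((coefR ρ).compr₂ κ.toLinearMap).flip ∘ₗ (evalEquiv K V).symm.toLinearMap)

theorem coefR_dualCoaction (κ : H.carrier ≃ₗ[K] H.carrier) (ρ : V →ₗ[K] H.carrier ⊗[K] V)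
    (v : V) (ξ : Dual K V) :
    coefR (dualCoaction κ ρ) (Dual.eval K V v) ξ = κ (coefR ρ ξ v) := by
  have e : (evalEquiv K V).symm (Dual.eval K V v) = v := (evalEquiv K V).symm_apply_apply v
  rw [dualCoaction, coefR_ofCoefR]
  simp [e]

theorem sliceR_ext_eval {M : Type*} [AddCommGroup M] [Module K M] {x y : M ⊗[K] Dual K V}
    (h : ∀ v, sliceR M (Dual.eval K V v) x = sliceR M (Dual.eval K V v) y) : x = y :=
  sliceR_ext fun ξ => by
    obtain ⟨v, rfl⟩ : ∃ v, Dual.eval K V v = ξ := (evalEquiv K V).surjective ξ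
    exact h v

theorem dualCoaction_apply (κ : H.carrier ≃ₗ[K] H.carrier) (ρ : V →ₗ[K] H.carrier ⊗[K] V)
    {ι : Type*} [Fintype ι] (b : Basis ι K V) (ξ : Dual K V) :
    dualCoaction κ ρ ξ = ∑ i, κ (coefR ρ ξ (b i)) ⊗ₜ[K] b.coord i := by
  classical
  refine sliceR_ext_eval fun v => ?_
  rw [← coefR_apply, coefR_dualCoaction, map_sum]
  simp only [sliceR_tmul]
  conv_lhs => rw [← b.sum_repr v]
  simp only [map_sum, map_smul]
  rfl

/-- Coactions in terms of coefficients. -/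
theorem isCoaction_iff {ρ : V →ₗ[K] H.carrier ⊗[K] V} {ι : Type*} [Fintype ι] (b : Basis ι K V) :
    IsCoaction H.carrier ρ ↔
      (∀ ξ v, comul (R := K) (coefR ρ ξ v) = ∑ i, coefR ρ (b.coord i) v ⊗ₜ[K] coefR ρ ξ (b i)) ∧
        ∀ ξ v, counit (R := K) (coefR ρ ξ v) = ξ v := by
  have e₁ : ∀ (ξ : Dual K V) (x : H.carrier ⊗[K] V),
      sliceR _ ξ ((TensorProduct.assoc K _ _ _).symm (ρ.lTensor H.carrier x)) =
        (coefR ρ ξ).lTensor H.carrier x := by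
    intro ξ x
    induction x with
    | zero => simp
    | add x y hx hy => simp only [map_add, hx, hy]
    | tmul a v =>
      rw [LinearMap.lTensor_tmul, LinearMap.lTensor_tmul, coefR_apply]
      generalize ρ v = y
      induction y with
      | zero => simp
      | add x y hx hy => simp only [map_add, tmul_add, hx, hy]
      | tmul b w => simp [tmul_smul]
  have e₂ : ∀ ξ v, ∑ i, coefR ρ (b.coord i) v ⊗ₜ[K] coefR ρ ξ (b i) =
      (coefR ρ ξ).lTensor H.carrier (ρ v) := by
    intro ξ v
    conv_rhs => rw [eq_sum_sliceR b (ρ v), map_sum]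
    simp only [LinearMap.lTensor_tmul]
    rfl
  have e₃ : ∀ (ξ : Dual K V) (x : H.carrier ⊗[K] V), counit (R := K) (sliceR _ ξ x) =
      ξ (TensorProduct.lid K V ((counit (R := K) (A := H.carrier)).rTensor V x)) := by
    intro ξ x
    induction x with
    | zero => simp
    | add x y hx hy => simp only [map_add, hx, hy]
    | tmul a w => simp [mul_comm]
  constructor
  · intro h
    refine ⟨fun ξ v => ?_, fun ξ v => ?_⟩
    · rw [e₂, ← e₁, ← h.coassoc, LinearEquiv.symm_apply_apply, sliceR_rTensor]
      rfl
    · rw [coefR_apply, e₃, h.counit]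
  · rintro ⟨h, h'⟩
    refine ⟨fun v => ?_, fun v => ?_⟩
    · rw [← LinearEquiv.eq_symm_apply]
      refine sliceR_ext fun ξ => ?_
      rw [e₁, sliceR_rTensor, ← e₂, ← h]
      rfl
    · refine (forall_dual_apply_eq_zero_iff K _).mp ?_ |> sub_eq_zero.mp
      intro ξ
      rw [map_sub, ← e₃, sub_eq_zero]
      exact h' ξ v

theorem CrossedHopfAlgebra.IsAnti.isCoaction {κ : H.carrier ≃ₗ[K] H.carrier} (hκ : IsAnti κ)
    {ρ : V →ₗ[K] H.carrier ⊗[K] V} (h : IsCoaction H.carrier ρ) :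
    IsCoaction H.carrier (dualCoaction κ ρ) := by
  classical
  let b := finBasis K V
  obtain ⟨h₁, h₂⟩ := (isCoaction_iff b).mp h
  have hb : ∀ i, b.dualBasis.coord i = Dual.eval K V (b i) := fun i => by
    refine b.dualBasis.ext fun j => ?_
    rw [Basis.coord_apply, Basis.repr_self, Dual.eval_apply, Basis.dualBasis_apply_self,
      Finsupp.single_apply]
    simp only [eq_comm]
  refine (isCoaction_iff b.dualBasis).mpr ⟨fun ξ η => ?_, fun ξ η => ?_⟩
  · obtain ⟨v, rfl⟩ : ∃ v, Dual.eval K V v = ξ := (evalEquiv K V).surjective ξ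
    simp only [hb]
    rw [coefR_dualCoaction, hκ.comul, h₁]
    simp only [map_sum, TensorProduct.comm_tmul, TensorProduct.map_tmul, LinearEquiv.coe_coe]
    refine Finset.sum_congr rfl fun i _ => ?_
    rw [coefR_dualCoaction, coefR_dualCoaction, Basis.coe_dualBasis]
  · obtain ⟨v, rfl⟩ : ∃ v, Dual.eval K V v = ξ := (evalEquiv K V).surjective ξ
    rw [coefR_dualCoaction, hκ.counit, h₂]
    rfl

theorem CrossedHopfAlgebra.IsAnti.dualCoaction_mem {κ : H.carrier ≃ₗ[K] H.carrier}
    (hκ : IsAnti κ) {α : G} {ρ : V →ₗ[K] H.carrier ⊗[K] V}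
    (h : ∀ v, ρ v ∈ LinearMap.range ((H.comp α).subtype.rTensor V)) (ξ : Dual K V) :
    dualCoaction κ ρ ξ ∈ LinearMap.range ((H.comp α⁻¹).subtype.rTensor (Dual K V)) := by
  rw [dualCoaction_apply κ ρ (finBasis K V)]
  refine sum_mem fun i _ => ?_
  exact ⟨⟨κ (coefR ρ ξ (finBasis K V i)), hκ.mem (sliceR_mem ξ (h _))⟩ ⊗ₜ
    (finBasis K V).coord i, rfl⟩

theorem dualCoaction_push {κ : H.carrier ≃ₗ[K] H.carrier} (hκ : CrossedHopfAlgebra.IsAnti κ)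
    (β : G) (ρ : V →ₗ[K] H.carrier ⊗[K] V) :
    dualCoaction κ (pushCoaction (H.φl β) ρ) = pushCoaction (H.φl β) (dualCoaction κ ρ) := by
  ext ξ
  refine sliceR_ext_eval fun v => ?_
  rw [pushCoaction_apply, sliceR_rTensor, ← coefR_apply, ← coefR_apply, coefR_dualCoaction,
    coefR_dualCoaction, coefR_apply, pushCoaction_apply, sliceR_rTensor]
  exact (hκ.φ β _).symm

end DualCoaction

/-! ### Yetter-Drinfeld modules -/

section HalfBraidingMap

open TensorProduct Coalgebra Module

variable {K : Type u} [Field K]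

section

variable {A : Type u} [AddCommGroup A] [Module K A]
  {V W X Y : Type u} [AddCommGroup V] [Module K V] [AddCommGroup W] [Module K W]
  [AddCommGroup X] [Module K X] [AddCommGroup Y] [Module K Y]

theorem sliceR_sum {M : Type*} [AddCommGroup M] [Module K M] {ι : Type*} (s : Finset ι)
    (ξ : ι → Dual K V) (x : M ⊗[K] V) :
    sliceR M (∑ i ∈ s, ξ i) x = ∑ i ∈ s, sliceR M (ξ i) x := by
  classical
  induction s using Finset.induction_on with
  | empty => simp [sliceR]
  | insert i s hi h => rw [Finset.sum_insert hi, Finset.sum_insert hi, sliceR_add, h]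

/-- The map `u ⊗ x ↦ x'' ⊗ a(x') u`. -/
noncomputable def halfBraidingMap (a : A →ₗ[K] V →ₗ[K] V) (σ : X →ₗ[K] A ⊗[K] X) :
    V ⊗[K] X →ₗ[K] X ⊗[K] V :=
  (TensorProduct.comm K V X).toLinearMap ∘ₗ
    TensorProduct.lift (LinearMap.mk₂ K (fun u x => (a.flip u).rTensor X (σ x))
      (by simp [LinearMap.rTensor_add]) (by simp [LinearMap.rTensor_smul]) (by simp) (by simp))

theorem halfBraidingMap_tmul (a : A →ₗ[K] V →ₗ[K] V) (σ : X →ₗ[K] A ⊗[K] X) (u : V) (x : X) :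
    halfBraidingMap a σ (u ⊗ₜ x) = TensorProduct.comm K V X ((a.flip u).rTensor X (σ x)) := by
  simp [halfBraidingMap]

theorem sliceR_halfBraidingMap (a : A →ₗ[K] V →ₗ[K] V) (σ : X →ₗ[K] A ⊗[K] X) (ξ : Dual K X)
    (u : V) (x : X) :
    sliceR V ξ (TensorProduct.comm K X V (halfBraidingMap a σ (u ⊗ₜ x))) = a (coefR σ ξ x) u := by
  rw [halfBraidingMap_tmul, TensorProduct.comm_comm, sliceR_rTensor]
  rfl

theorem halfBraidingMap_eq_sum {ι : Type*} [Fintype ι] (b : Basis ι K X)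
    (a : A →ₗ[K] V →ₗ[K] V) (σ : X →ₗ[K] A ⊗[K] X) (u : V) (x : X) :
    halfBraidingMap a σ (u ⊗ₜ x) = ∑ i, b i ⊗ₜ[K] a (coefR σ (b.coord i) x) u := by
  rw [halfBraidingMap_tmul, eq_sum_sliceR b (σ x)]
  simp

theorem halfBraidingMap_natural (a : A →ₗ[K] V →ₗ[K] V) {σ : X →ₗ[K] A ⊗[K] X}
    {σ' : Y →ₗ[K] A ⊗[K] Y} (f : X →ₗ[K] Y) (hf : ∀ x, σ' (f x) = f.lTensor A (σ x))
    (p : V ⊗[K] X) :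
    halfBraidingMap a σ' (f.lTensor V p) = f.rTensor V (halfBraidingMap a σ p) := by
  induction p with
  | zero => simp
  | add x y hx hy => simp only [map_add, hx, hy]
  | tmul u x =>
  rw [LinearMap.lTensor_tmul, halfBraidingMap_tmul, halfBraidingMap_tmul, hf]
  generalize σ x = y
  induction y with
  | zero => simp
  | add x y hx hy => simp only [map_add, hx, hy]
  | tmul h x => simp

theorem comm_tensor_ext [Module.Finite K X] {p q : X ⊗[K] V}
    (h : ∀ ξ : Dual K X, sliceR V ξ (TensorProduct.comm K X V p) =
      sliceR V ξ (TensorProduct.comm K X V q)) : p = q :=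
  (TensorProduct.comm K X V).injective (sliceR_ext h)

end

section

variable {A : Type u} [Ring A] [Bialgebra K A]
  {V W X Y : Type u} [AddCommGroup V] [Module K V] [AddCommGroup W] [Module K W]
  [AddCommGroup X] [Module K X] [AddCommGroup Y] [Module K Y]

theorem sliceR_mulT (ξ : Dual K V) (η : Dual K W) (x : A ⊗[K] V) (y : A ⊗[K] W) :
    sliceR A (dualDistrib K V W (ξ ⊗ₜ η)) (mulT x y) = sliceR A ξ x * sliceR A η y := by
  induction x with
  | zero => simp
  | add x x' hx hx' => simp only [map_add, mulT_add_left, add_mul, hx, hx']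
  | tmul a v =>
  induction y with
  | zero => simp
  | add x x' hx hx' => simp only [map_add, mulT_add_right, mul_add, hx, hx']
  | tmul b w => simp [smul_smul, mul_comm]

theorem sliceR_ext_tensor [Module.Finite K V] [Module.Finite K W] {M : Type*} [AddCommGroup M]
    [Module K M] {x y : M ⊗[K] (V ⊗[K] W)}
    (h : ∀ (ξ : Dual K V) (η : Dual K W), sliceR M (dualDistrib K V W (ξ ⊗ₜ η)) x =
      sliceR M (dualDistrib K V W (ξ ⊗ₜ η)) y) : x = y := by
  let b := (finBasis K V).tensorProduct (finBasis K W)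
  rw [eq_sum_sliceR b x, eq_sum_sliceR b y]
  refine Finset.sum_congr rfl fun i _ => ?_
  have e : b.coord i =
      dualDistrib K V W ((finBasis K V).coord i.1 ⊗ₜ (finBasis K W).coord i.2) :=
    CrossedTheory.coord_tensorProduct _ _ _
  rw [e, h]

theorem sliceR_assoc_halfBraidingMap (a : A →ₗ[K] V →ₗ[K] V) (σ : Y →ₗ[K] A ⊗[K] Y)
    (ξ : Dual K X) (η : Dual K Y) (p : X ⊗[K] V) (y : Y) :
    sliceR V (dualDistrib K X Y (ξ ⊗ₜ η)) (TensorProduct.comm K (X ⊗[K] Y) V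
      ((TensorProduct.assoc K X Y V).symm ((halfBraidingMap a σ).lTensor X
        (TensorProduct.assoc K X V Y (p ⊗ₜ y))))) =
      a (coefR σ η y) (sliceR V ξ (TensorProduct.comm K X V p)) := by
  induction p with
  | zero => simp
  | add x y hx hy => simp only [map_add, add_tmul, hx, hy]
  | tmul x u =>
  rw [TensorProduct.assoc_tmul, LinearMap.lTensor_tmul, TensorProduct.comm_tmul, sliceR_tmul,
    map_smul, ← sliceR_halfBraidingMap]
  generalize halfBraidingMap a σ (u ⊗ₜ[K] y) = q
  induction q with
  | zero => simp
  | add x y hx hy => simp only [map_add, tmul_add, smul_add, hx, hy]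
  | tmul y u => simp [smul_smul]

theorem halfBraidingMap_tensor [Module.Finite K X] [Module.Finite K Y]
    (a : A →ₗ[K] V →ₗ[K] V) (ha : ∀ h k, a (h * k) = a k ∘ₗ a h)
    (σ : X →ₗ[K] A ⊗[K] X) (σ' : Y →ₗ[K] A ⊗[K] Y) (u : V) (x : X) (y : Y) :
    halfBraidingMap a (tensorCoaction σ σ') (u ⊗ₜ (x ⊗ₜ y)) =
      (TensorProduct.assoc K X Y V).symm ((halfBraidingMap a σ').lTensor X
        (TensorProduct.assoc K X V Y (halfBraidingMap a σ (u ⊗ₜ x) ⊗ₜ y))) := by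
  refine (TensorProduct.comm K _ V).injective (sliceR_ext_tensor fun ξ η => ?_)
  rw [sliceR_halfBraidingMap, sliceR_assoc_halfBraidingMap, sliceR_halfBraidingMap, coefR_apply,
    tensorCoaction_tmul, sliceR_mulT, ha]
  rfl

end

end HalfBraidingMap

section YetterDrinfeld

open TensorProduct Coalgebra Module

variable {K : Type u} [Field K] {G : Type u} [Group G]

section

variable {A : Type u} [Ring A] [Algebra K A] {V : Type u} [AddCommGroup V] [Module K V]

/-- The map `h ⊗ k ↦ u' h ⊗ a(k) u''`, followed by `ζ`. -/
noncomputable def ydLeft (ρ : V →ₗ[K] A ⊗[K] V) (a : A →ₗ[K] V →ₗ[K] V) (ζ : Dual K V) (u : V) :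
    A ⊗[K] A →ₗ[K] A :=
  TensorProduct.lift (LinearMap.mk₂ K (fun h k => coefR ρ (ζ ∘ₗ a k) u * h)
    (by simp [mul_add]) (by simp) (by simp [LinearMap.comp_add, add_mul])
    (by simp [LinearMap.comp_smul]))

/-- The map `h ⊗ k ↦ φ(k) (a(h) u)' ⊗ (a(h) u)''`, followed by `ζ`. -/
noncomputable def ydRight (φ : A →ₗ[K] A) (ρ : V →ₗ[K] A ⊗[K] V) (a : A →ₗ[K] V →ₗ[K] V)
    (ζ : Dual K V) (u : V) : A ⊗[K] A →ₗ[K] A :=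
  TensorProduct.lift (LinearMap.mk₂ K (fun h k => φ k * coefR ρ ζ (a h u))
    (by simp [mul_add]) (by simp) (by simp [add_mul]) (by simp))

@[simp] theorem ydLeft_tmul (ρ : V →ₗ[K] A ⊗[K] V) (a : A →ₗ[K] V →ₗ[K] V) (ζ : Dual K V) (u : V)
    (h k : A) : ydLeft ρ a ζ u (h ⊗ₜ k) = coefR ρ (ζ ∘ₗ a k) u * h := by simp [ydLeft]

@[simp] theorem ydRight_tmul (φ : A →ₗ[K] A) (ρ : V →ₗ[K] A ⊗[K] V) (a : A →ₗ[K] V →ₗ[K] V)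
    (ζ : Dual K V) (u : V) (h k : A) :
    ydRight φ ρ a ζ u (h ⊗ₜ k) = φ k * coefR ρ ζ (a h u) := by simp [ydRight]

end

/-- Structures of a (crossed) Yetter-Drinfeld module on `V`. -/
@[ext]
structure YetterDrinfeld (H : CrossedHopfAlgebra K G) (V : Type u) [AddCommGroup V]
    [Module K V] where
  deg : G
  ρ : V →ₗ[K] H.carrier ⊗[K] V
  isCoaction : IsCoaction H.carrier ρ
  mem : ∀ m : V, ρ m ∈ LinearMap.range ((H.comp deg).subtype.rTensor V)
  a : H.carrier →ₗ[K] V →ₗ[K] V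
  one : a 1 = LinearMap.id
  mul : ∀ h k, a (h * k) = a k ∘ₗ a h
  yd : ∀ ζ u h, ydLeft ρ a ζ u (comul (R := K) h) = ydRight (H.φl deg) ρ a ζ u (comul (R := K) h)

variable {H : CrossedHopfAlgebra K G} {V W : Type u} [AddCommGroup V] [Module K V]
  [Module.Finite K V] [AddCommGroup W] [Module K W] [Module.Finite K W]

omit [Module.Finite K V] in
theorem sliceR_tensorCoaction_halfBraidingMap (φ : H.carrier →ₗ[K] H.carrier)
    (ρ : V →ₗ[K] H.carrier ⊗[K] V) (a : H.carrier →ₗ[K] V →ₗ[K] V) (X : Comod H)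
    (ξ : Dual K X.V) (ζ : Dual K V) (u : V) (x : X.V) :
    sliceR H.carrier (dualDistrib K X.V V (ξ ⊗ₜ ζ))
        (tensorCoaction (pushCoaction φ X.ρ) ρ (halfBraidingMap a X.ρ (u ⊗ₜ x))) =
      ydRight φ ρ a ζ u (comul (R := K) (coefR X.ρ ξ x)) := by
  rw [halfBraidingMap_eq_sum (finBasis K X.V), CrossedHopfAlgebra.comul_coefR (finBasis K X.V)]
  simp only [map_sum, tensorCoaction_tmul, sliceR_mulT, ydRight_tmul, pushCoaction_apply,
    sliceR_rTensor]
  rfl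

omit [Module.Finite K V] in
theorem sliceR_lTensor_halfBraidingMap (ρ : V →ₗ[K] H.carrier ⊗[K] V)
    (a : H.carrier →ₗ[K] V →ₗ[K] V) (X : Comod H) (ξ : Dual K X.V) (ζ : Dual K V) (u : V)
    (x : X.V) :
    sliceR H.carrier (dualDistrib K X.V V (ξ ⊗ₜ ζ))
        ((halfBraidingMap a X.ρ).lTensor H.carrier (tensorCoaction ρ X.ρ (u ⊗ₜ x))) =
      ydLeft ρ a ζ u (comul (R := K) (coefR X.ρ ξ x)) := by
  have e : dualDistrib K X.V V (ξ ⊗ₜ ζ) ∘ₗ halfBraidingMap a X.ρ =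
      ∑ i, dualDistrib K V X.V ((ζ ∘ₗ a (coefR X.ρ ξ (finBasis K X.V i))) ⊗ₜ
        (finBasis K X.V).coord i) := by
    refine TensorProduct.ext' fun u x => ?_
    have e₁ : ∀ p : X.V ⊗[K] V, dualDistrib K X.V V (ξ ⊗ₜ ζ) p =
        ζ (sliceR V ξ (TensorProduct.comm K X.V V p)) := by
      intro p
      induction p with
      | zero => simp
      | add x y hx hy => simp only [map_add, hx, hy]
      | tmul x u => simp
    rw [LinearMap.comp_apply, e₁, sliceR_halfBraidingMap]
    conv_lhs => rw [← (finBasis K X.V).sum_repr x]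
    simp only [map_sum, map_smul, LinearMap.sum_apply, LinearMap.smul_apply, dualDistrib_apply,
      LinearMap.comp_apply, Basis.coord_apply, smul_eq_mul, mul_comm]
  rw [sliceR_lTensor, e, CrossedHopfAlgebra.comul_coefR (finBasis K X.V), tensorCoaction_tmul]
  rw [sliceR_sum]
  simp only [map_sum, sliceR_mulT, ydLeft_tmul]
  rfl

theorem halfBraidingMap_comm_iff (φ : H.carrier →ₗ[K] H.carrier)
    (ρ : V →ₗ[K] H.carrier ⊗[K] V) (a : H.carrier →ₗ[K] V →ₗ[K] V) :
    (∀ (X : Comod H) (p : V ⊗[K] X.V),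
      tensorCoaction (pushCoaction φ X.ρ) ρ (halfBraidingMap a X.ρ p) =
        (halfBraidingMap a X.ρ).lTensor H.carrier (tensorCoaction ρ X.ρ p)) ↔
    ∀ ζ u h, ydLeft ρ a ζ u (comul (R := K) h) = ydRight φ ρ a ζ u (comul (R := K) h) := by
  constructor
  · intro h ζ u k
    refine LinearMap.congr_fun (f := ydLeft ρ a ζ u ∘ₗ comul) (g := ydRight φ ρ a ζ u ∘ₗ comul)
      (CrossedHopfAlgebra.hom_ext_of_coefR fun X ξ x => ?_) k
    rw [LinearMap.comp_apply, LinearMap.comp_apply, ← sliceR_tensorCoaction_halfBraidingMap, h,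
      sliceR_lTensor_halfBraidingMap]
  · intro h X p
    induction p with
    | zero => simp
    | add x y hx hy => simp only [map_add, hx, hy]
    | tmul u x =>
    refine sliceR_ext_tensor fun ξ ζ => ?_
    rw [sliceR_tensorCoaction_halfBraidingMap, sliceR_lTensor_halfBraidingMap, h]

theorem halfBraidingMap_bijective {a : H.carrier →ₗ[K] V →ₗ[K] V} (one : a 1 = LinearMap.id)
    (mul : ∀ h k, a (h * k) = a k ∘ₗ a h) (X : Comod H) :
    Function.Bijective (halfBraidingMap a X.ρ) := by
  let i : X.V ⊗[K] V →ₗ[K] V ⊗[K] X.V :=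
    (TensorProduct.comm K _ _).toLinearMap ∘ₗ
      halfBraidingMap (a ∘ₗ HopfAlgebra.antipode K) X.ρ ∘ₗ (TensorProduct.comm K _ _).toLinearMap
  have hi : Function.LeftInverse i (halfBraidingMap a X.ρ) := by
    intro p
    induction p with
    | zero => simp
    | add x y hx hy => simp only [map_add, hx, hy]
    | tmul u x =>
    classical
    let b := finBasis K X.V
    rw [halfBraidingMap_eq_sum b]
    simp only [i, map_sum, LinearMap.comp_apply, LinearEquiv.coe_coe, TensorProduct.comm_tmul,
      halfBraidingMap_eq_sum b]
    rw [Finset.sum_comm]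
    have e : ∀ j, ∑ k, a (HopfAlgebra.antipode K (coefR X.ρ (b.coord j) (b k)))
        (a (coefR X.ρ (b.coord k) x) u) = b.coord j x • u := by
      intro j
      have e := HopfAlgebra.mul_antipode_lTensor_comul_apply (R := K) (coefR X.ρ (b.coord j) x)
      rw [CrossedHopfAlgebra.comul_coefR b, CrossedHopfAlgebra.counit_coefR'] at e
      simp only [map_sum, LinearMap.lTensor_tmul, LinearMap.mul'_apply] at e
      have e := congrArg (fun h => a h u) e
      simpa [map_sum, mul, Algebra.algebraMap_eq_smul_one, one] using e
    simp only [← sum_tmul, e]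
    simp only [Basis.coord_apply, smul_tmul, ← tmul_sum]
    rw [b.sum_repr]
  have hd : finrank K (V ⊗[K] X.V) = finrank K (X.V ⊗[K] V) := by
    rw [finrank_tensorProduct, finrank_tensorProduct, mul_comm]
  exact ⟨hi.injective, (LinearMap.injective_iff_surjective_of_finrank_eq_finrank hd).mp
    hi.injective⟩

end YetterDrinfeld

section CenterComod

open TensorProduct Coalgebra Module

variable {K : Type u} [Field K] {G : Type u} [Group G] {H : CrossedHopfAlgebra K G}
  {V W U : Type u} [AddCommGroup V] [Module K V] [Module.Finite K V] [AddCommGroup W] [Module K W]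
  [Module.Finite K W] [AddCommGroup U] [Module K U] [Module.Finite K U]

namespace YetterDrinfeld

/-- The comodule which underlies a Yetter-Drinfeld module. -/
abbrev obj (s : YetterDrinfeld H V) : Comod H where
  deg := s.deg
  V := ModuleCat.of K V
  finite := inferInstance
  ρ := s.ρ
  isCoaction := s.isCoaction
  mem := s.mem

/-- The half-braiding `u ⊗ x ↦ x'' ⊗ a(x') u`. -/
noncomputable def braid (s : YetterDrinfeld H V) (X : Comod H) :
    s.obj ⊗ X ≅ conj s.deg X ⊗ s.obj :=
  Comod.isoMk (LinearEquiv.ofBijective _ (halfBraidingMap_bijective s.one s.mul X)).toModuleIso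
    (by change s.deg * X.deg = s.deg * X.deg * s.deg⁻¹ * s.deg; group)
    ((halfBraidingMap_comm_iff (H.φl s.deg) s.ρ s.a).mpr s.yd X)

/-- The object of the center which is given by a Yetter-Drinfeld module. -/
noncomputable def center (s : YetterDrinfeld H V) : CrossedCenter (Comod H) where
  obj := s.obj
  hb :=
    { c := fun X _ h => s.braid X ≪≫ eqToIso (congrArg (· ⊗ s.obj) h.symm)
      natural := by
        intro X Y X' Y' f hX hY
        subst hX hY
        ext1
        simp only [Comod.comp_f, Comod.eqToHom_f, conjMap, Iso.trans_hom, eqToIso.hom,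
          Comod.whiskerLeft_f, Comod.whiskerRight_f]
        simp
        ext1
        exact LinearMap.ext (halfBraidingMap_natural s.a f.f.hom f.comm)
      tensor := by
        intro X Y X' Y' hX hY h
        subst hX hY
        ext1
        simp only [Comod.comp_f, Comod.eqToHom_f, Iso.trans_hom, eqToIso.hom, Comod.whiskerLeft_f,
          Comod.whiskerRight_f, Comod.associator_hom_f, Comod.associator_inv_f]
        simp
        apply ModuleCat.MonoidalCategory.tensor_ext₃
        intro u x y
        exact halfBraidingMap_tensor s.a s.mul X.ρ Y.ρ u x y }

end YetterDrinfeld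

namespace CrossedCenter

variable (Z : CrossedCenter (Comod H))

/-- The linear map of a half-braiding. -/
def cmap (X : Comod H) : Z.obj.V ⊗[K] X.V →ₗ[K] X.V ⊗[K] Z.obj.V :=
  (Z.hb.c X (V' := conj (CrossedCategory.deg Z.obj) X) rfl).hom.f.hom

theorem c_hom_f (X : Comod H) {X' : Comod H} (h : X' = conj (CrossedCategory.deg Z.obj) X) :
    (Z.hb.c X h).hom.f = ModuleCat.ofHom (cmap Z X) ≫
      eqToHom (X := X.V ⊗ Z.obj.V) (Y := X'.V ⊗ Z.obj.V) (by subst h; rfl) := by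
  subst h
  rw [eqToHom_refl]
  exact (Category.comp_id _).symm

theorem hb_ext {U : Comod H} {b b' : CrossedHalfBraiding U}
    (h : ∀ X, cmap ⟨U, b⟩ X = cmap ⟨U, b'⟩ X) : b = b' := by
  ext X X' hX : 5
  ext1
  have e := c_hom_f ⟨U, b⟩ X hX
  have e' := c_hom_f ⟨U, b'⟩ X hX
  rw [h] at e
  exact e.trans e'.symm

theorem comm_iff {Z Z' : CrossedCenter (Comod H)} {X X' : Comod H}
    (h : X' = conj (CrossedCategory.deg Z.obj) X) (h' : X' = conj (CrossedCategory.deg Z'.obj) X)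
    (k : Z.obj ⟶ Z'.obj) :
    (Z.hb.c X h).hom ≫ X' ◁ k = k ▷ X ≫ (Z'.hb.c X h').hom ↔
      ∀ p, k.f.hom.lTensor X.V (cmap Z X p) = cmap Z' X (k.f.hom.rTensor X.V p) := by
  subst h
  rw [Comod.hom_ext_iff]
  simp only [Comod.comp_f, c_hom_f, eqToHom_refl, Comod.whiskerLeft_f, Comod.whiskerRight_f]
  constructor
  · intro e p
    exact LinearMap.congr_fun (congrArg ModuleCat.Hom.hom e) p
  · intro e
    ext1
    exact LinearMap.ext e

theorem cmap_natural {X Y : Comod H} (f : X ⟶ Y) (u : Z.obj.V) (x : X.V) :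
    cmap Z Y (u ⊗ₜ f.f.hom x) = f.f.hom.rTensor Z.obj.V (cmap Z X (u ⊗ₜ x)) := by
  have e := Z.hb.natural f rfl rfl
  rw [conjMap_rfl] at e
  exact LinearMap.congr_fun (congrArg (fun k => k.f.hom) e) (u ⊗ₜ[K] x)

theorem cmap_tensor (X Y : Comod H) (u : Z.obj.V) (x : X.V) (y : Y.V) :
    cmap Z (X ⊗ Y) (u ⊗ₜ[K] (x ⊗ₜ[K] y) : Z.obj.V ⊗[K] (X.V ⊗[K] Y.V)) =
      (TensorProduct.assoc K X.V Y.V Z.obj.V).symm ((cmap Z Y).lTensor X.V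
        (TensorProduct.assoc K X.V Z.obj.V Y.V (cmap Z X (u ⊗ₜ x) ⊗ₜ y))) := by
  have e := Z.hb.tensor X Y rfl rfl (Φ_tensor _ X Y).symm
  have e' : (Z.hb.c (X ⊗ Y) (Φ_tensor _ X Y).symm).hom =
      (Z.hb.c (X ⊗ Y) rfl).hom ≫ eqToHom (by rw [← Φ_tensor]) := by
    have : ∀ {X' : Comod H} (h : X' = conj (CrossedCategory.deg Z.obj) (X ⊗ Y)),
        (Z.hb.c (X ⊗ Y) h).hom = (Z.hb.c (X ⊗ Y) rfl).hom ≫ eqToHom (by rw [h]) := by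
      intro X' h
      subst h
      simp
    exact this _
  rw [e'] at e
  have e := congrArg Comod.Hom.f e
  rw [Comod.comp_f, Comod.eqToHom_f, eqToHom_refl] at e
  exact LinearMap.congr_fun (congrArg (fun k => k.hom) e) (u ⊗ₜ[K] (x ⊗ₜ[K] y))

theorem cmap_comm (X : Comod H) (p : Z.obj.V ⊗[K] X.V) :
    tensorCoaction (pushCoaction (H.φl Z.obj.deg) X.ρ) Z.obj.ρ (cmap Z X p) =
      (cmap Z X).lTensor H.carrier (tensorCoaction Z.obj.ρ X.ρ p) :=
  (Z.hb.c X rfl).hom.comm p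

theorem cmap_injective (X : Comod H) : Function.Injective (cmap Z X) := by
  have e : ∀ p, (Z.hb.c X (V' := conj (CrossedCategory.deg Z.obj) X) rfl).inv.f.hom
      (cmap Z X p) = p := fun p => by
    have e := (Z.hb.c X (V' := conj (CrossedCategory.deg Z.obj) X) rfl).hom_inv_id
    exact LinearMap.congr_fun (congrArg (fun k => k.f.hom) e) p
  exact Function.LeftInverse.injective e

theorem exists_action : ∃ a : H.carrier →ₗ[K] Z.obj.V →ₗ[K] Z.obj.V, ∀ X : Comod H,
    cmap Z X = halfBraidingMap a X.ρ := by
  obtain ⟨a, ha⟩ := H.exists_hom (M := Z.obj.V →ₗ[K] Z.obj.V)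
    (fun X => LinearMap.mk₂ K
      (fun ξ x => sliceR Z.obj.V ξ ∘ₗ (TensorProduct.comm K X.V Z.obj.V).toLinearMap ∘ₗ cmap Z X ∘ₗ
        (TensorProduct.mk K Z.obj.V X.V).flip x)
      (fun _ _ _ => by ext; simp [sliceR_add]) (fun _ _ _ => by ext; simp [sliceR_smul])
      (fun _ _ _ => by ext; simp) (fun _ _ _ => by ext; simp))
    (fun {X Y} f ξ x => by
      ext u
      simp only [LinearMap.mk₂_apply, LinearMap.comp_apply, LinearMap.flip_apply,
        TensorProduct.mk_apply, LinearEquiv.coe_coe, cmap_natural]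
      generalize cmap Z X (u ⊗ₜ x) = p
      induction p with
      | zero => simp
      | add x y hx hy => simp only [map_add, hx, hy]
      | tmul x u => simp)
  refine ⟨a, fun X => TensorProduct.ext' fun u x => comm_tensor_ext fun ξ => ?_⟩
  rw [sliceR_halfBraidingMap, ha]
  rfl

/-- The action of `H` which is given by a half-braiding. -/
noncomputable def action : H.carrier →ₗ[K] Z.obj.V →ₗ[K] Z.obj.V := Z.exists_action.choose

theorem cmap_eq (X : Comod H) : cmap Z X = halfBraidingMap Z.action X.ρ :=
  Z.exists_action.choose_spec X

theorem action_mul (h k : H.carrier) : Z.action (h * k) = Z.action k ∘ₗ Z.action h := by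
  have e : ∀ (X Y : Comod H) (ξ : Dual K X.V) (x : X.V) (η : Dual K Y.V) (y : Y.V),
      Z.action (coefR X.ρ ξ x * coefR Y.ρ η y) =
        Z.action (coefR Y.ρ η y) ∘ₗ Z.action (coefR X.ρ ξ x) := by
    intro X Y ξ x η y
    ext u
    have e := cmap_tensor Z X Y u x y
    rw [cmap_eq, cmap_eq, cmap_eq] at e
    have e' := congrArg (fun p => sliceR Z.obj.V (dualDistrib K X.V Y.V (ξ ⊗ₜ η))
      (TensorProduct.comm K (X.V ⊗[K] Y.V) Z.obj.V p)) e
    beta_reduce at e'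
    rw [sliceR_assoc_halfBraidingMap, sliceR_halfBraidingMap Z.action X.ρ] at e'
    refine Eq.trans ?_ e'
    refine Eq.trans ?_ (sliceR_halfBraidingMap Z.action (tensorCoaction X.ρ Y.ρ)
      (dualDistrib K X.V Y.V (ξ ⊗ₜ η)) u (x ⊗ₜ y)).symm
    rw [coefR_apply (tensorCoaction X.ρ Y.ρ), tensorCoaction_tmul, sliceR_mulT]
    rfl
  revert k
  refine H.induction_comp (P := fun h => ∀ k, Z.action (h * k) = Z.action k ∘ₗ Z.action h)
    (fun x y hx hy k => by rw [add_mul, map_add, hx, hy, map_add, LinearMap.comp_add])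
    (fun k => by simp) (fun α h hh => ?_) h
  obtain ⟨X, -, ξ, x, rfl⟩ := CrossedHopfAlgebra.exists_coefR hh
  refine H.induction_comp
    (fun x y hx hy => by rw [mul_add, map_add, hx, hy, map_add, LinearMap.add_comp])
    (by simp) (fun β k hk => ?_)
  obtain ⟨Y, -, η, y, rfl⟩ := CrossedHopfAlgebra.exists_coefR hk
  exact e X Y ξ x η y

theorem action_one : Z.action 1 = LinearMap.id := by
  have i := cmap_injective Z (𝟙_ (Comod H))
  rw [cmap_eq] at i
  have e : ∀ (u : Z.obj.V), halfBraidingMap Z.action (𝟙_ (Comod H)).ρ (u ⊗ₜ[K] (1 : K)) =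
      (1 : K) ⊗ₜ[K] Z.action 1 u := fun u => by
    refine (halfBraidingMap_tmul Z.action (𝟙_ (Comod H)).ρ u (1 : K)).trans ?_
    rfl
  ext u
  have h : Z.action 1 (Z.action 1 u) = Z.action 1 u := by
    conv_rhs => rw [← one_mul (1 : H.carrier), action_mul]
    rfl
  have h' : Z.action 1 u ⊗ₜ[K] (1 : K) = u ⊗ₜ[K] (1 : K) :=
    i (by rw [e, e, h])
  exact (TensorProduct.rid K Z.obj.V).symm.injective h'

/-- The Yetter-Drinfeld module which is given by an object of the center. -/
noncomputable def yetterDrinfeld : YetterDrinfeld H Z.obj.V where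
  deg := Z.obj.deg
  ρ := Z.obj.ρ
  isCoaction := Z.obj.isCoaction
  mem := Z.obj.mem
  a := Z.action
  one := Z.action_one
  mul := Z.action_mul
  yd := (halfBraidingMap_comm_iff _ _ _).mp fun X p => by
    rw [← cmap_eq]; exact cmap_comm Z X p

end CrossedCenter

theorem YetterDrinfeld.cmap_center (s : YetterDrinfeld H V) (X : Comod H) :
    s.center.cmap X = halfBraidingMap s.a X.ρ :=
  congrArg (fun k => k.f.hom) (Category.comp_id (s.braid X).hom)

theorem CrossedCenter.yetterDrinfeld_center (Z : CrossedCenter (Comod H)) :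
    Z.yetterDrinfeld.center = Z :=
  congrArg (CrossedCenter.mk Z.obj)
    (hb_ext fun X => (Z.yetterDrinfeld.cmap_center X).trans (Z.cmap_eq X).symm)

namespace YetterDrinfeld

theorem action_center (s : YetterDrinfeld H V) : s.center.action = s.a := by
  refine CrossedHopfAlgebra.hom_ext_of_coefR fun X ξ x => LinearMap.ext fun u => ?_
  have e := (s.cmap_center X).symm.trans (s.center.cmap_eq X)
  have e₁ := sliceR_halfBraidingMap s.a X.ρ ξ u x
  have e₂ := sliceR_halfBraidingMap (V := V) s.center.action X.ρ ξ u x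
  refine e₂.symm.trans (Eq.trans ?_ e₁)
  exact congrArg (fun c => sliceR V ξ (TensorProduct.comm K X.V V (c (u ⊗ₜ[K] x)))) e.symm

theorem center_yetterDrinfeld (s : YetterDrinfeld H V) : s.center.yetterDrinfeld = s :=
  YetterDrinfeld.ext rfl rfl s.action_center

theorem center_injective {s t : YetterDrinfeld H V} (h : s.center = t.center) : s = t := by
  have e : HEq s.center.yetterDrinfeld t.center.yetterDrinfeld := by rw [h]
  rw [center_yetterDrinfeld, center_yetterDrinfeld] at e
  exact eq_of_heq e

/-- Linear maps which underlie arrows of the center. -/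
def Hom (s : YetterDrinfeld H V) (t : YetterDrinfeld H W) (f : V →ₗ[K] W) : Prop :=
  ∃ k : s.center ⟶ t.center, k.f.f.hom = f

theorem Hom.deg_eq {s : YetterDrinfeld H V} {t : YetterDrinfeld H W} {f} (h : Hom s t f) :
    s.deg = t.deg := by
  obtain ⟨k, -⟩ := h
  exact k.f.deg_eq

theorem Hom.comp {s : YetterDrinfeld H V} {t : YetterDrinfeld H W} {r : YetterDrinfeld H U} {f g}
    (h : Hom s t f) (h' : Hom t r g) : Hom s r (g ∘ₗ f) := by
  obtain ⟨k, rfl⟩ := h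
  obtain ⟨l, rfl⟩ := h'
  exact ⟨k ≫ l, rfl⟩

theorem hom_iff {s : YetterDrinfeld H V} {t : YetterDrinfeld H W} {f : V →ₗ[K] W} :
    Hom s t f ↔ s.deg = t.deg ∧ (∀ v, t.ρ (f v) = f.lTensor H.carrier (s.ρ v)) ∧
      ∀ h v, f (s.a h v) = t.a h (f v) := by
  constructor
  · rintro ⟨k, rfl⟩
    refine ⟨k.f.deg_eq, k.f.comm, fun h v => ?_⟩
    have hd : CrossedCategory.deg s.center.obj = CrossedCategory.deg t.center.obj :=
      deg_eq_of_hom k.f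
    have key : ∀ (f : V →ₗ[K] W), (∀ (X : Comod H) (p : V ⊗[K] X.V),
        f.lTensor X.V (halfBraidingMap s.a X.ρ p) = halfBraidingMap t.a X.ρ (f.rTensor X.V p)) →
        f ∘ₗ s.a.flip v = t.a.flip (f v) := fun f e =>
      CrossedHopfAlgebra.hom_ext_of_coefR fun X ξ x => by
        have e₁ := sliceR_halfBraidingMap t.a X.ρ ξ (f v) x
        have e₂ := sliceR_halfBraidingMap s.a X.ρ ξ v x
        have e := e X (v ⊗ₜ x)
        rw [LinearMap.rTensor_tmul] at e
        rw [LinearMap.comp_apply, LinearMap.flip_apply, LinearMap.flip_apply, ← e₁, ← e₂, ← e]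
        generalize halfBraidingMap s.a X.ρ (v ⊗ₜ x) = p
        induction p with
        | zero => simp
        | add x y hx hy => simp only [map_add, hx, hy]
        | tmul x u => simp
    refine LinearMap.congr_fun (key k.f.f.hom fun X p => ?_) h
    have e := (CrossedCenter.comm_iff rfl (by rw [← hd]) k.f).mp
      (k.comm X rfl (by rw [← hd])) p
    rw [cmap_center, cmap_center] at e
    exact e
  · rintro ⟨hd, hc, ha⟩
    have key : ∀ (X : Comod H) (p : V ⊗[K] X.V),
        f.lTensor X.V (halfBraidingMap s.a X.ρ p) = halfBraidingMap t.a X.ρ (f.rTensor X.V p) := by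
      intro X p
      induction p with
      | zero => simp
      | add x y hx hy => simp only [map_add, hx, hy]
      | tmul u x =>
      rw [LinearMap.rTensor_tmul, halfBraidingMap_tmul, halfBraidingMap_tmul]
      generalize X.ρ x = y
      induction y with
      | zero => simp
      | add x y hx hy => simp only [map_add, hx, hy]
      | tmul h x => simp [ha]
    refine ⟨⟨⟨ModuleCat.ofHom f, hd, hc⟩, fun X X' h h' =>
      (CrossedCenter.comm_iff h h' _).mpr fun p => ?_⟩, rfl⟩
    rw [cmap_center, cmap_center]
    exact key X p

end YetterDrinfeld

end CenterComod

section DualPairing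

open TensorProduct Coalgebra Module

variable {K : Type u} [Field K] {G : Type u} [Group G] {H : CrossedHopfAlgebra K G}
  {V W : Type u} [AddCommGroup V] [Module K V] [AddCommGroup W] [Module K W]

theorem mulT_sum_left {ι : Type*} (s : Finset ι) (x : ι → H.carrier ⊗[K] V)
    (y : H.carrier ⊗[K] W) : mulT (∑ i ∈ s, x i) y = ∑ i ∈ s, mulT (x i) y := by
  classical
  induction s using Finset.induction_on with
  | empty => simp
  | insert i s hi h => rw [Finset.sum_insert hi, Finset.sum_insert hi, mulT_add_left, h]

theorem mulT_sum_right {ι : Type*} (s : Finset ι) (x : H.carrier ⊗[K] V)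
    (y : ι → H.carrier ⊗[K] W) : mulT x (∑ i ∈ s, y i) = ∑ i ∈ s, mulT x (y i) := by
  classical
  induction s using Finset.induction_on with
  | empty => simp
  | insert i s hi h => rw [Finset.sum_insert hi, Finset.sum_insert hi, mulT_add_right, h]

variable [Module.Finite K V] {κ : H.carrier ≃ₗ[K] H.carrier} {ρ : V →ₗ[K] H.carrier ⊗[K] V}

theorem mulT_dualCoaction {ι : Type*} [Fintype ι] (b : Basis ι K V) (v : V) (ξ : Dual K V) :
    mulT (ρ v) (dualCoaction κ ρ ξ) =
      ∑ i, ∑ j, (coefR ρ (b.coord i) v * κ (coefR ρ ξ (b j))) ⊗ₜ[K] (b i ⊗ₜ[K] b.coord j) := by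
  rw [eq_sum_sliceR b (ρ v), dualCoaction_apply κ ρ b, mulT_sum_left]
  simp only [mulT_sum_right, mulT_tmul]
  rfl

theorem dualCoaction_mulT {ι : Type*} [Fintype ι] (b : Basis ι K V) (v : V) (ξ : Dual K V) :
    mulT (dualCoaction κ ρ ξ) (ρ v) =
      ∑ j, ∑ i, (κ (coefR ρ ξ (b j)) * coefR ρ (b.coord i) v) ⊗ₜ[K] (b.coord j ⊗ₜ[K] b i) := by
  rw [eq_sum_sliceR b (ρ v), dualCoaction_apply κ ρ b, mulT_sum_left]
  simp only [mulT_sum_right, mulT_tmul]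
  rfl

/-- The evaluation `V ⊗ V* → K` is colinear if `h' κ(h'') = ε(h)`. -/
theorem lift_eval_colinear (hρ : IsCoaction H.carrier ρ)
    (hκ : ∀ h, LinearMap.mul' K H.carrier (κ.toLinearMap.lTensor _ (comul (R := K) h)) =
      algebraMap K H.carrier (counit (R := K) h)) (p : V ⊗[K] Dual K V) :
    (TensorProduct.lift (Dual.eval K V)).lTensor H.carrier
        (tensorCoaction ρ (dualCoaction κ ρ) p) =
      (1 : H.carrier) ⊗ₜ[K] TensorProduct.lift (Dual.eval K V) p := by
  classical
  induction p with
  | zero => simp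
  | add x y hx hy => simp only [map_add, tmul_add, hx, hy]
  | tmul v ξ =>
  obtain ⟨h₁, h₂⟩ := (isCoaction_iff (finBasis K V)).mp hρ
  have e := hκ (coefR ρ ξ v)
  rw [h₁, h₂] at e
  rw [tensorCoaction_tmul, mulT_dualCoaction (finBasis K V)]
  simp only [map_sum, LinearMap.lTensor_tmul, TensorProduct.lift.tmul, Dual.eval_apply,
    Basis.coord_apply, Basis.repr_self, Finsupp.single_apply, LinearMap.mul'_apply,
    LinearEquiv.coe_coe] at e ⊢
  simp only [tmul_ite, Finset.sum_ite_eq, Finset.mem_univ, if_true]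
  rw [← TensorProduct.sum_tmul, e, Algebra.algebraMap_eq_smul_one, TensorProduct.smul_tmul,
    smul_eq_mul, mul_one]

/-- The evaluation `V* ⊗ V → K` is colinear if `κ(h'') h' = ε(h)`. -/
theorem lift_id_colinear (hρ : IsCoaction H.carrier ρ)
    (hκ : ∀ h, LinearMap.mul' K H.carrier (κ.toLinearMap.rTensor _
      (TensorProduct.comm K H.carrier H.carrier (comul (R := K) h))) =
      algebraMap K H.carrier (counit (R := K) h)) (p : Dual K V ⊗[K] V) :
    (TensorProduct.lift (LinearMap.id : Dual K V →ₗ[K] Dual K V)).lTensor H.carrier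
        (tensorCoaction (dualCoaction κ ρ) ρ p) =
      (1 : H.carrier) ⊗ₜ[K] TensorProduct.lift (LinearMap.id : Dual K V →ₗ[K] Dual K V) p := by
  classical
  induction p with
  | zero => simp
  | add x y hx hy => simp only [map_add, tmul_add, hx, hy]
  | tmul ξ v =>
  obtain ⟨h₁, h₂⟩ := (isCoaction_iff (finBasis K V)).mp hρ
  have e := hκ (coefR ρ ξ v)
  rw [h₁, h₂] at e
  rw [tensorCoaction_tmul, dualCoaction_mulT (finBasis K V)]
  simp only [map_sum, LinearMap.lTensor_tmul, TensorProduct.lift.tmul, LinearMap.id_apply,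
    Basis.coord_apply, Basis.repr_self, Finsupp.single_apply, LinearMap.mul'_apply,
    LinearEquiv.coe_coe, TensorProduct.comm_tmul, LinearMap.rTensor_tmul] at e ⊢
  simp only [tmul_ite, Finset.sum_ite_eq', Finset.mem_univ, if_true]
  rw [← TensorProduct.sum_tmul, e, Algebra.algebraMap_eq_smul_one, TensorProduct.smul_tmul,
    smul_eq_mul, mul_one]

theorem sum_one_tmul {ι : Type*} [Fintype ι] [DecidableEq ι] {M N : Type*} [AddCommGroup M]
    [Module K M] [AddCommGroup N] [Module K N] (c : ι → ι → H.carrier)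
    (hc : ∀ i j, c i j = if i = j then 1 else 0) (b : ι → ι → M ⊗[K] N) :
    ∑ i, ∑ j, c i j ⊗ₜ[K] b i j = (1 : H.carrier) ⊗ₜ[K] ∑ i, b i i := by
  simp only [hc, ite_tmul, Finset.sum_ite_eq, Finset.mem_univ, if_true]
  rw [TensorProduct.tmul_sum]

/-- The coevaluation `K → V* ⊗ V` is colinear if `κ(h') h'' = ε(h)`. -/
theorem comm_coevaluation_colinear (hρ : IsCoaction H.carrier ρ)
    (hκ : ∀ h, LinearMap.mul' K H.carrier (κ.toLinearMap.rTensor _ (comul (R := K) h)) =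
      algebraMap K H.carrier (counit (R := K) h)) :
    tensorCoaction (dualCoaction κ ρ) ρ
        (TensorProduct.comm K V (Dual K V) (coevaluation K V 1)) =
      (1 : H.carrier) ⊗ₜ[K] TensorProduct.comm K V (Dual K V) (coevaluation K V 1) := by
  classical
  let b := Basis.ofVectorSpace K V
  obtain ⟨h₁, h₂⟩ := (isCoaction_iff b).mp hρ
  rw [coevaluation_apply_one]
  simp only [map_sum, TensorProduct.comm_tmul, tensorCoaction_tmul, dualCoaction_mulT b]
  rw [Finset.sum_comm]
  simp only [Finset.sum_comm (s := Finset.univ) (t := Finset.univ) (f := fun i k => _ ⊗ₜ[K]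
    (_ ⊗ₜ[K] b k))]
  simp only [← TensorProduct.sum_tmul]
  refine sum_one_tmul _ (fun j k => ?_) fun j k => b.coord j ⊗ₜ[K] b k
  have e := hκ (coefR ρ (b.coord k) (b j))
  rw [h₁, h₂] at e
  simp only [map_sum, LinearMap.rTensor_tmul, LinearMap.mul'_apply, LinearEquiv.coe_coe] at e
  refine e.trans ?_
  simp [Finsupp.single_apply]

/-- The coevaluation `K → V ⊗ V*` is colinear if `h'' κ(h') = ε(h)`. -/
theorem coevaluation_colinear (hρ : IsCoaction H.carrier ρ)
    (hκ : ∀ h, LinearMap.mul' K H.carrier (κ.toLinearMap.lTensor _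
      (TensorProduct.comm K H.carrier H.carrier (comul (R := K) h))) =
      algebraMap K H.carrier (counit (R := K) h)) :
    tensorCoaction ρ (dualCoaction κ ρ) (coevaluation K V 1) =
      (1 : H.carrier) ⊗ₜ[K] coevaluation K V 1 := by
  classical
  let b := Basis.ofVectorSpace K V
  obtain ⟨h₁, h₂⟩ := (isCoaction_iff b).mp hρ
  rw [coevaluation_apply_one]
  simp only [map_sum, tensorCoaction_tmul, mulT_dualCoaction b]
  rw [Finset.sum_comm]
  simp only [Finset.sum_comm (s := Finset.univ) (t := Finset.univ) (f := fun i k => _ ⊗ₜ[K]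
    (_ ⊗ₜ[K] b.coord k))]
  simp only [← TensorProduct.sum_tmul]
  refine sum_one_tmul _ (fun j k => ?_) fun j k => b j ⊗ₜ[K] b.coord k
  have e := hκ (coefR ρ (b.coord j) (b k))
  rw [h₁, h₂] at e
  simp only [map_sum, LinearMap.lTensor_tmul, LinearMap.mul'_apply, LinearEquiv.coe_coe,
    TensorProduct.comm_tmul] at e
  refine e.trans ?_
  simp [Finsupp.single_apply, eq_comm]

end DualPairing

section Antipode

open TensorProduct Coalgebra Module HopfAlgebra

variable {K : Type u} [Field K] {G : Type u} [Group G] {H : CrossedHopfAlgebra K G}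

namespace CrossedHopfAlgebra

theorem mul_S (h : H.carrier) :
    LinearMap.mul' K H.carrier (H.S.toLinearMap.lTensor _ (comul (R := K) h)) =
      algebraMap K H.carrier (counit (R := K) h) :=
  mul_antipode_lTensor_comul_apply h

theorem S_mul (h : H.carrier) :
    LinearMap.mul' K H.carrier (H.S.toLinearMap.rTensor _ (comul (R := K) h)) =
      algebraMap K H.carrier (counit (R := K) h) :=
  mul_antipode_rTensor_comul_apply h

theorem mul'_comm_S (x : H.carrier ⊗[K] H.carrier) :
    H.S (LinearMap.mul' K H.carrier (H.S.symm.toLinearMap.rTensor _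
      (TensorProduct.comm K H.carrier H.carrier x))) =
      LinearMap.mul' K H.carrier (H.S.toLinearMap.rTensor _ x) := by
  induction x with
  | zero => simp
  | add x y hx hy => simp only [map_add, hx, hy]
  | tmul x y =>
    have e := isAnti_S.mul (H.S.symm y) x
    simpa using e

theorem mul'_comm_S' (x : H.carrier ⊗[K] H.carrier) :
    H.S (LinearMap.mul' K H.carrier (H.S.symm.toLinearMap.lTensor _
      (TensorProduct.comm K H.carrier H.carrier x))) =
      LinearMap.mul' K H.carrier (H.S.toLinearMap.lTensor _ x) := by
  induction x with
  | zero => simp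
  | add x y hx hy => simp only [map_add, hx, hy]
  | tmul x y =>
    have e := isAnti_S.mul y (H.S.symm x)
    simpa using e

theorem S_algebraMap (c : K) : H.S (algebraMap K H.carrier c) = algebraMap K H.carrier c := by
  rw [Algebra.algebraMap_eq_smul_one, map_smul]
  exact congrArg _ isAnti_S.one

theorem S_symm_mul (h : H.carrier) :
    LinearMap.mul' K H.carrier (H.S.symm.toLinearMap.rTensor _
      (TensorProduct.comm K H.carrier H.carrier (comul (R := K) h))) =
      algebraMap K H.carrier (counit (R := K) h) :=
  H.S.injective (by rw [mul'_comm_S, S_mul, S_algebraMap])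

theorem mul_S_symm (h : H.carrier) :
    LinearMap.mul' K H.carrier (H.S.symm.toLinearMap.lTensor _
      (TensorProduct.comm K H.carrier H.carrier (comul (R := K) h))) =
      algebraMap K H.carrier (counit (R := K) h) :=
  H.S.injective (by rw [mul'_comm_S', mul_S, S_algebraMap])

end CrossedHopfAlgebra

end Antipode

section CenterTheory

open TensorProduct Coalgebra Module

variable {K : Type u} [Field K] {G : Type u} [Group G] {H : CrossedHopfAlgebra K G}
  {V W U : Type u} [AddCommGroup V] [Module K V] [Module.Finite K V] [AddCommGroup W] [Module K W]
  [Module.Finite K W] [AddCommGroup U] [Module K U] [Module.Finite K U]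

namespace CrossedCenter

theorem cmap_tensorObj (Z Z' : CrossedCenter (Comod H)) (X : Comod H) (u : Z.obj.V) (v : Z'.obj.V)
    (x : X.V) : cmap (Z ⊗ Z') X ((u ⊗ₜ[K] v : Z.obj.V ⊗[K] Z'.obj.V) ⊗ₜ[K] x) =
      TensorProduct.assoc K X.V Z.obj.V Z'.obj.V
        ((cmap Z (conj (CrossedCategory.deg Z'.obj) X)).rTensor Z'.obj.V
          ((TensorProduct.assoc K Z.obj.V X.V Z'.obj.V).symm (u ⊗ₜ cmap Z' X (v ⊗ₜ x)))) := by
  have e := tensorObj_c Z Z' X rfl rfl (conj_comp _ _ _).symm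
  have e' : ((tensorObj Z Z').hb.c X (conj_comp _ _ _).symm).hom.f.hom = cmap (Z ⊗ Z') X := by
    rw [c_hom_f]
    rfl
  rw [e] at e'
  exact (LinearMap.congr_fun e' _).symm

theorem cmap_conj (β : G) (Z : CrossedCenter (Comod H)) (X : Comod H) :
    cmap (conj β Z) (conj β X) = cmap Z X := by
  have h := conj_conj_eq (β := β) (U := conj β Z.obj) (V := Z.obj) (W := X) rfl rfl rfl rfl
  have e := congrArg Comod.Hom.f (conjObj_c β Z (V := X) rfl rfl rfl h)
  rw [c_hom_f] at e
  simp only [conjMap, Comod.comp_f, Comod.eqToHom_f] at e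
  exact congrArg ModuleCat.Hom.hom e

end CrossedCenter

namespace YetterDrinfeld

theorem Hom.of_arrow {s : YetterDrinfeld H V} {t : YetterDrinfeld H W}
    {Z Z' : CrossedCenter (Comod H)} (hs : s.center = Z) (ht : t.center = Z') (k : Z ⟶ Z')
    {f : V →ₗ[K] W}
    (hf : ∀ v : V, (eqToHom (congrArg CrossedCenter.obj ht.symm)).f.hom
      (k.f.f.hom ((eqToHom (congrArg CrossedCenter.obj hs)).f.hom v)) = f v) : Hom s t f := by
  refine ⟨eqToHom hs ≫ k ≫ eqToHom ht.symm, LinearMap.ext fun v => ?_⟩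
  rw [CrossedCenter.comp_f, CrossedCenter.comp_f, CrossedCenter.eqToHom_f, CrossedCenter.eqToHom_f]
  exact hf v

/-- The tensor product of Yetter-Drinfeld modules. -/
noncomputable def tensor (s : YetterDrinfeld H V) (t : YetterDrinfeld H W) :
    YetterDrinfeld H (V ⊗[K] W) := (s.center ⊗ t.center).yetterDrinfeld

theorem tensor_center (s : YetterDrinfeld H V) (t : YetterDrinfeld H W) :
    (s.tensor t).center = s.center ⊗ t.center := CrossedCenter.yetterDrinfeld_center _

variable (H) in
/-- The trivial Yetter-Drinfeld module. -/
noncomputable def unit : YetterDrinfeld H K := (𝟙_ (CrossedCenter (Comod H))).yetterDrinfeld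

theorem unit_center : (unit H).center = 𝟙_ (CrossedCenter (Comod H)) :=
  CrossedCenter.yetterDrinfeld_center _

/-- The conjugates of a Yetter-Drinfeld module. -/
noncomputable def conj (β : G) (s : YetterDrinfeld H V) : YetterDrinfeld H V :=
  (CrossedCategory.conj β s.center).yetterDrinfeld

theorem conj_center (β : G) (s : YetterDrinfeld H V) :
    (s.conj β).center = CrossedCategory.conj β s.center := CrossedCenter.yetterDrinfeld_center _

theorem conj_one (s : YetterDrinfeld H V) : s.conj 1 = s :=
  center_injective ((conj_center _ _).trans (conj_id _))

theorem conj_mul (β γ : G) (s : YetterDrinfeld H V) : s.conj (β * γ) = (s.conj γ).conj β :=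
  center_injective (by
    rw [conj_center, conj_center]
    exact (conj_comp β γ s.center).trans
      (congrArg (CrossedCategory.conj β) (conj_center γ s).symm))

theorem conj_tensor (β : G) (s : YetterDrinfeld H V) (t : YetterDrinfeld H W) :
    (s.tensor t).conj β = (s.conj β).tensor (t.conj β) :=
  center_injective (by
    rw [conj_center, tensor_center, tensor_center, conj_center, conj_center]
    exact Φ_tensor β s.center t.center)

theorem conj_unit (β : G) : (unit H).conj β = unit H :=
  center_injective (by
    rw [conj_center, unit_center]
    exact Φ_unit β)

theorem tensor_hom {V' W' : Type u} [AddCommGroup V'] [Module K V'] [Module.Finite K V']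
    [AddCommGroup W'] [Module K W'] [Module.Finite K W'] {s : YetterDrinfeld H V}
    {t : YetterDrinfeld H W} {s' : YetterDrinfeld H V'} {t' : YetterDrinfeld H W'}
    {f : V →ₗ[K] V'} {g : W →ₗ[K] W'} (h : Hom s s' f) (h' : Hom t t' g) :
    Hom (s.tensor t) (s'.tensor t') (TensorProduct.map f g) := by
  obtain ⟨k, rfl⟩ := h
  obtain ⟨l, rfl⟩ := h'
  exact Hom.of_arrow (tensor_center s t) (tensor_center s' t') (k ⊗ₘ l) fun _ => rfl

theorem assoc_hom (s : YetterDrinfeld H V) (t : YetterDrinfeld H W) (r : YetterDrinfeld H U) :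
    Hom ((s.tensor t).tensor r) (s.tensor (t.tensor r))
      (TensorProduct.assoc K V W U).toLinearMap :=
  Hom.of_arrow ((tensor_center _ r).trans (congrArg (· ⊗ r.center) (tensor_center s t)))
    ((tensor_center s _).trans (congrArg (s.center ⊗ ·) (tensor_center t r)))
    (α_ s.center t.center r.center).hom fun _ => rfl

theorem lid_hom (s : YetterDrinfeld H V) :
    Hom ((unit H).tensor s) s (TensorProduct.lid K V).toLinearMap :=
  Hom.of_arrow ((tensor_center _ s).trans (congrArg (· ⊗ s.center) unit_center)) rfl
    (λ_ s.center).hom fun _ => rfl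

theorem rid_hom (s : YetterDrinfeld H V) :
    Hom (s.tensor (unit H)) s (TensorProduct.rid K V).toLinearMap :=
  Hom.of_arrow ((tensor_center s _).trans (congrArg (s.center ⊗ ·) unit_center)) rfl
    (ρ_ s.center).hom fun _ => rfl

theorem conj_hom (β : G) {s : YetterDrinfeld H V} {t : YetterDrinfeld H W} {f : V →ₗ[K] W}
    (h : Hom s t f) : Hom (s.conj β) (t.conj β) f := by
  obtain ⟨k, rfl⟩ := h
  exact Hom.of_arrow (conj_center β s) (conj_center β t) ((Φ β).map k) fun _ => rfl

/-- The braiding of Yetter-Drinfeld modules. -/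
noncomputable def braiding (s : YetterDrinfeld H V) (t : YetterDrinfeld H W) :
    V ⊗[K] W ≃ₗ[K] W ⊗[K] V :=
  LinearEquiv.ofBijective (halfBraidingMap s.a t.ρ)
    (halfBraidingMap_bijective s.one s.mul t.obj)

theorem braiding_hom (s : YetterDrinfeld H V) (t : YetterDrinfeld H W) :
    Hom (s.tensor t) ((t.conj s.deg).tensor s) (s.braiding t).toLinearMap :=
  Hom.of_arrow (tensor_center s t)
    ((tensor_center _ s).trans (congrArg (· ⊗ s.center) (conj_center s.deg t)))
    (CrossedBraiding.c s.center t.center rfl).hom fun p => by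
      exact LinearMap.congr_fun (s.cmap_center t.obj) p

theorem halfBraidingMap_conj (β : G) (s : YetterDrinfeld H V) (X : Comod H) :
    halfBraidingMap (s.conj β).a (CrossedCategory.conj β X).ρ = halfBraidingMap s.a X.ρ := by
  have e := (CrossedCenter.cmap_conj β s.center X).trans (s.cmap_center X)
  have e' := (s.conj β).cmap_center (CrossedCategory.conj β X)
  have : CrossedCenter.cmap (s.conj β).center (CrossedCategory.conj β X) =
      CrossedCenter.cmap (CrossedCategory.conj β s.center) (CrossedCategory.conj β X) := by
    have : ∀ {b : CrossedHalfBraiding (s.conj β).obj}, b = (s.conj β).center.hb →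
        CrossedCenter.cmap (s.conj β).center (CrossedCategory.conj β X) =
          CrossedCenter.cmap ⟨_, b⟩ (CrossedCategory.conj β X) := by
      rintro b rfl
      rfl
    refine this (b := (CrossedCategory.conj β s.center).hb) ?_
    have e := conj_center β s
    injection e with _ e
    exact e.symm
  exact e'.symm.trans (this.trans e)

/-- The map `h ⊗ k ↦ a(φ(h)) u ⊗ b(k) v`. -/
noncomputable def tensorAction (φ : H.carrier →ₗ[K] H.carrier) (a : H.carrier →ₗ[K] V →ₗ[K] V)
    (b : H.carrier →ₗ[K] W →ₗ[K] W) (u : V) (v : W) :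
    H.carrier ⊗[K] H.carrier →ₗ[K] V ⊗[K] W :=
  TensorProduct.map (a.flip u ∘ₗ φ) (b.flip v) ∘ₗ
    (TensorProduct.comm K H.carrier H.carrier).toLinearMap

theorem halfBraidingMap_tensor_left (s : YetterDrinfeld H V) (t : YetterDrinfeld H W)
    (X : Comod H) (u : V) (v : W) (x : X.V) :
    halfBraidingMap (s.tensor t).a X.ρ ((u ⊗ₜ v) ⊗ₜ x) =
      TensorProduct.assoc K X.V V W
        ((halfBraidingMap s.a (CrossedCategory.conj t.deg X).ρ).rTensor W
          ((TensorProduct.assoc K V X.V W).symm (u ⊗ₜ halfBraidingMap t.a X.ρ (v ⊗ₜ x)))) := by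
  have e := CrossedCenter.cmap_tensorObj s.center t.center X u v x
  rw [cmap_center, cmap_center] at e
  refine Eq.trans ?_ e
  exact (LinearMap.congr_fun (CrossedCenter.cmap_eq (s.center ⊗ t.center) X) ((u ⊗ₜ v) ⊗ₜ x)).symm

theorem tensor_a (s : YetterDrinfeld H V) (t : YetterDrinfeld H W) (h : H.carrier) (u : V)
    (v : W) : (s.tensor t).a h (u ⊗ₜ v) =
      tensorAction (H.φl t.deg) s.a t.a u v (comul (R := K) h) := by
  refine LinearMap.congr_fun (f := (s.tensor t).a.flip (u ⊗ₜ v))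
    (g := tensorAction (H.φl t.deg) s.a t.a u v ∘ₗ comul)
    (CrossedHopfAlgebra.hom_ext_of_coefR fun X ξ x => ?_) h
  have e := congrArg (fun p => sliceR _ ξ (TensorProduct.comm K X.V (V ⊗[K] W) p))
    (halfBraidingMap_tensor_left s t X u v x)
  beta_reduce at e
  rw [sliceR_halfBraidingMap] at e
  refine e.trans ?_
  rw [LinearMap.comp_apply, CrossedHopfAlgebra.comul_coefR (finBasis K X.V),
    halfBraidingMap_eq_sum (finBasis K X.V)]
  simp only [tmul_sum, map_sum]
  refine Finset.sum_congr rfl fun i _ => ?_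
  rw [TensorProduct.assoc_symm_tmul, LinearMap.rTensor_tmul, tensorAction, LinearMap.comp_apply,
    LinearEquiv.coe_coe, TensorProduct.comm_tmul, TensorProduct.map_tmul, LinearMap.comp_apply,
    LinearMap.flip_apply, LinearMap.flip_apply]
  have e' : H.φl t.deg (coefR X.ρ ξ (finBasis K X.V i)) =
      coefR (V := X.V) (CrossedCategory.conj t.deg X).ρ ξ (finBasis K X.V i) :=
    (sliceR_rTensor _ _ _).symm
  rw [e']
  have key : ∀ (p : X.V ⊗[K] V) (w : W), sliceR (V ⊗[K] W) ξ (TensorProduct.comm K X.V (V ⊗[K] W)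
      (TensorProduct.assoc K X.V V W (p ⊗ₜ w))) =
      sliceR V ξ (TensorProduct.comm K X.V V p) ⊗ₜ w := fun p w => by
    induction p with
    | zero => simp
    | add x y hx hy => simp only [map_add, add_tmul, hx, hy]
    | tmul x u => simp [TensorProduct.smul_tmul']
  refine (key _ _).trans (congrArg₂ (· ⊗ₜ ·) ?_ ?_)
  · exact sliceR_halfBraidingMap (X := X.V) s.a (CrossedCategory.conj t.deg X).ρ ξ u _
  · rfl

end YetterDrinfeld

end CenterTheory

section DualNatural

open TensorProduct Coalgebra Module

variable {K : Type u} [Field K] {G : Type u} [Group G] {H : CrossedHopfAlgebra K G}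
  {V W : Type u} [AddCommGroup V] [Module K V] [Module.Finite K V] [AddCommGroup W] [Module K W]
  [Module.Finite K W]

omit [Module.Finite K V] [Module.Finite K W] in
theorem coefR_natural {ρ : V →ₗ[K] H.carrier ⊗[K] V} {σ : W →ₗ[K] H.carrier ⊗[K] W}
    {f : V →ₗ[K] W} (hf : ∀ v, σ (f v) = f.lTensor H.carrier (ρ v)) (ξ : Dual K W) (v : V) :
    coefR σ ξ (f v) = coefR ρ (ξ ∘ₗ f) v := by
  rw [coefR_apply, hf, sliceR_lTensor, coefR_apply]

theorem dualCoaction_natural (κ : H.carrier ≃ₗ[K] H.carrier) {ρ : V →ₗ[K] H.carrier ⊗[K] V}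
    {σ : W →ₗ[K] H.carrier ⊗[K] W} {f : V →ₗ[K] W}
    (hf : ∀ v, σ (f v) = f.lTensor H.carrier (ρ v)) (ξ : Dual K W) :
    dualCoaction κ ρ (f.dualMap ξ) = f.dualMap.lTensor H.carrier (dualCoaction κ σ ξ) := by
  refine sliceR_ext_eval fun v => ?_
  rw [← coefR_apply, coefR_dualCoaction, sliceR_lTensor, ← coefR_apply]
  have e := coefR_dualCoaction κ σ (f v) ξ
  rw [coefR_natural hf] at e
  exact e.symm

theorem dualCoaction_eval (κ : H.carrier ≃ₗ[K] H.carrier) (ρ : V →ₗ[K] H.carrier ⊗[K] V) (v : V) :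
    dualCoaction κ (dualCoaction κ.symm ρ) (Dual.eval K V v) =
      (Dual.eval K V).lTensor H.carrier (ρ v) := by
  refine sliceR_ext_eval fun ξ => ?_
  rw [← coefR_apply, coefR_dualCoaction, coefR_dualCoaction, sliceR_lTensor,
    LinearEquiv.apply_symm_apply]
  rfl

omit [Module.Finite K V] in
theorem sum_coord_comp_tmul {ι : Type*} [Fintype ι] (b : Basis ι K V) (f : V →ₗ[K] V)
    (g : V →ₗ[K] W) :
    ∑ i, (b.coord i ∘ₗ f) ⊗ₜ[K] g (b i) = ∑ i, b.coord i ⊗ₜ[K] g (f (b i)) := by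
  refine sliceR_ext fun ξ => LinearMap.ext fun x => ?_
  have e := congrArg (fun y => ξ (g y)) (b.sum_repr (f x))
  have e' := congrArg (fun y => ξ (g (f y))) (b.sum_repr x)
  simp only [map_sum, map_smul, smul_eq_mul] at e e'
  simp only [map_sum, sliceR_tmul, LinearMap.sum_apply, LinearMap.smul_apply,
    LinearMap.comp_apply, Basis.coord_apply, smul_eq_mul]
  rw [← e'] at e
  simpa only [mul_comm] using e

/-- Structure transport for coactions. -/
noncomputable def transportCoaction (e : V ≃ₗ[K] W) (ρ : V →ₗ[K] H.carrier ⊗[K] V) :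
    W →ₗ[K] H.carrier ⊗[K] W :=
  e.toLinearMap.lTensor H.carrier ∘ₗ ρ ∘ₗ e.symm.toLinearMap

omit [Module.Finite K V] [Module.Finite K W] in
theorem transportCoaction_apply (e : V ≃ₗ[K] W) (ρ : V →ₗ[K] H.carrier ⊗[K] V) (v : V) :
    transportCoaction e ρ (e v) = e.toLinearMap.lTensor H.carrier (ρ v) := by
  simp [transportCoaction]

omit [Module.Finite K V] [Module.Finite K W] in
theorem transportCoaction_symm (e : V ≃ₗ[K] W) (ρ : V →ₗ[K] H.carrier ⊗[K] V) (w : W) :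
    ρ (e.symm w) = e.symm.toLinearMap.lTensor H.carrier (transportCoaction e ρ w) := by
  obtain ⟨v, rfl⟩ := e.surjective w
  rw [transportCoaction_apply, ← LinearMap.lTensor_comp_apply]
  simp

omit [Module.Finite K V] [Module.Finite K W] in
theorem coefR_transportCoaction (e : V ≃ₗ[K] W) (ρ : V →ₗ[K] H.carrier ⊗[K] V) (ζ : Dual K W)
    (w : W) : coefR (transportCoaction e ρ) ζ w = coefR ρ (ζ ∘ₗ e.toLinearMap) (e.symm w) := by
  obtain ⟨v, rfl⟩ := e.surjective w
  rw [e.symm_apply_apply]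
  exact coefR_natural (f := e.toLinearMap) (transportCoaction_apply e ρ) ζ v

theorem isCoaction_transport (e : V ≃ₗ[K] W) {ρ : V →ₗ[K] H.carrier ⊗[K] V}
    (h : IsCoaction H.carrier ρ) : IsCoaction H.carrier (transportCoaction e ρ) := by
  obtain ⟨h₁, h₂⟩ := (isCoaction_iff (finBasis K V)).mp h
  refine (isCoaction_iff ((finBasis K V).map e)).mpr ⟨fun ξ w => ?_, fun ξ w => ?_⟩
  · obtain ⟨v, rfl⟩ := e.surjective w
    simp only [coefR_transportCoaction, h₁, Basis.map_apply, e.symm_apply_apply]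
    refine Finset.sum_congr rfl fun i _ => ?_
    congr 3
    ext; simp
  · rw [coefR_transportCoaction, h₂]
    simp

omit [Module.Finite K V] [Module.Finite K W] in
theorem transportCoaction_mem (e : V ≃ₗ[K] W) {ρ : V →ₗ[K] H.carrier ⊗[K] V} {S : Submodule K H.carrier}
    (h : ∀ v, ρ v ∈ LinearMap.range (S.subtype.rTensor V)) (w : W) :
    transportCoaction e ρ w ∈ LinearMap.range (S.subtype.rTensor W) := by
  obtain ⟨v, rfl⟩ := e.surjective w
  obtain ⟨x, hx⟩ := h v
  refine ⟨e.toLinearMap.lTensor S x, ?_⟩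
  rw [transportCoaction_apply, ← hx, ← LinearMap.comp_apply, ← LinearMap.comp_apply,
    LinearMap.rTensor_comp_lTensor, LinearMap.lTensor_comp_rTensor]

end DualNatural

section CenterTheory

open TensorProduct Coalgebra Module

variable {K : Type u} [Field K] {G : Type u} [Group G] {H : CrossedHopfAlgebra K G}
  {V W U : Type u} [AddCommGroup V] [Module K V] [Module.Finite K V] [AddCommGroup W] [Module K W]
  [Module.Finite K W] [AddCommGroup U] [Module K U] [Module.Finite K U]

namespace YetterDrinfeld

/-- Structure transport for Yetter-Drinfeld modules. -/
noncomputable def transport (e : V ≃ₗ[K] W) (s : YetterDrinfeld H V) : YetterDrinfeld H W where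
  deg := s.deg
  ρ := transportCoaction e s.ρ
  isCoaction := isCoaction_transport e s.isCoaction
  mem := transportCoaction_mem e s.mem
  a := e.conj.toLinearMap ∘ₗ s.a
  one := by ext; simp [s.one]
  mul h k := by ext; simp [s.mul, LinearEquiv.conj_apply_apply]
  yd ζ u h := by
    have e₁ := s.yd (ζ ∘ₗ e.toLinearMap) (e.symm u) h
    generalize comul (R := K) h = x at e₁ ⊢
    have e₂ : ydLeft (transportCoaction e s.ρ) (e.conj.toLinearMap ∘ₗ s.a) ζ u x =
        ydLeft s.ρ s.a (ζ ∘ₗ e.toLinearMap) (e.symm u) x := by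
      clear e₁
      induction x with
      | zero => simp
      | add x y hx hy => simp only [map_add, hx, hy]
      | tmul h k =>
        rw [ydLeft_tmul, ydLeft_tmul, coefR_transportCoaction]
        congr 3
        ext; simp [LinearEquiv.conj_apply_apply]
    have e₃ : ydRight (H.φl s.deg) (transportCoaction e s.ρ) (e.conj.toLinearMap ∘ₗ s.a) ζ u x =
        ydRight (H.φl s.deg) s.ρ s.a (ζ ∘ₗ e.toLinearMap) (e.symm u) x := by
      clear e₁ e₂
      induction x with
      | zero => simp
      | add x y hx hy => simp only [map_add, hx, hy]
      | tmul h k =>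
        rw [ydRight_tmul, ydRight_tmul, coefR_transportCoaction]
        simp [LinearEquiv.conj_apply_apply]
    rw [e₂, e₃, e₁]

theorem transport_hom (e : V ≃ₗ[K] W) (s : YetterDrinfeld H V) :
    Hom s (s.transport e) e.toLinearMap :=
  hom_iff.mpr ⟨rfl, transportCoaction_apply e s.ρ, fun h v => by
    simp [transport, LinearEquiv.conj_apply_apply]⟩

theorem transport_hom_symm (e : V ≃ₗ[K] W) (s : YetterDrinfeld H V) :
    Hom (s.transport e) s e.symm.toLinearMap :=
  hom_iff.mpr ⟨rfl, transportCoaction_symm e s.ρ, fun h v => by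
    simp [transport, LinearEquiv.conj_apply_apply]⟩

variable {κ : H.carrier ≃ₗ[K] H.carrier}

/-- The action of the anti-automorphism `κ` on the dual space. -/
noncomputable def dualAction (κ : H.carrier ≃ₗ[K] H.carrier) (g : G)
    (a : H.carrier →ₗ[K] V →ₗ[K] V) : H.carrier →ₗ[K] Dual K V →ₗ[K] Dual K V :=
  Dual.transpose (R := K) ∘ₗ a ∘ₗ κ.symm.toLinearMap ∘ₗ H.φl g⁻¹

omit [Module.Finite K V] in
theorem dualAction_apply (g : G) (a : H.carrier →ₗ[K] V →ₗ[K] V) (h : H.carrier) (ξ : Dual K V) :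
    dualAction κ g a h ξ = ξ ∘ₗ a (κ.symm (H.φ g⁻¹ h)) := rfl

theorem φ_φ_inv (g : G) (h : H.carrier) : H.φ g (H.φ g⁻¹ h) = h := by
  rw [← H.φ_mul, mul_inv_cancel, H.φ_one]

theorem comul_φ (g : G) (h : H.carrier) : comul (R := K) (H.φ g h) =
    TensorProduct.map (H.φl g) (H.φl g) (comul (R := K) h) :=
  (CoalgHomClass.map_comp_comul_apply (H.φ g) h).symm

/-- The dual of a Yetter-Drinfeld module. -/
noncomputable def dual (hκ : CrossedHopfAlgebra.IsAnti κ) (s : YetterDrinfeld H V) :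
    YetterDrinfeld H (Dual K V) where
  deg := s.deg⁻¹
  ρ := dualCoaction κ s.ρ
  isCoaction := hκ.isCoaction s.isCoaction
  mem := hκ.dualCoaction_mem s.mem
  a := dualAction κ s.deg s.a
  one := by
    ext ξ v
    rw [dualAction_apply, map_one, hκ.symm.one, s.one]
    rfl
  mul h k := by
    ext ξ v
    rw [dualAction_apply, map_mul, hκ.symm.mul, s.mul]
    rfl
  yd ζ ξ h := by
    obtain ⟨v, rfl⟩ : ∃ v, Dual.eval K V v = ζ := (evalEquiv K V).surjective ζ
    have e := congrArg κ (s.yd ξ v (κ.symm (H.φ s.deg⁻¹ h)))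
    have e' : comul (R := K) (κ.symm (H.φ s.deg⁻¹ h)) =
        TensorProduct.map (κ.symm.toLinearMap ∘ₗ H.φl s.deg⁻¹) (κ.symm.toLinearMap ∘ₗ H.φl s.deg⁻¹)
          (TensorProduct.comm K _ _ (comul (R := K) h)) := by
      rw [hκ.symm.comul, comul_φ, TensorProduct.map_comp]
      generalize comul (R := K) h = x
      induction x with
      | zero => simp
      | add x y hx hy => simp only [map_add, hx, hy]
      | tmul h k => rfl
    rw [e'] at e
    generalize comul (R := K) h = x at e ⊢
    refine Eq.trans ?_ (e.symm.trans ?_)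
    · clear e e'
      induction x with
      | zero => simp
      | add x y hx hy => simp only [map_add, hx, hy]
      | tmul h k =>
        rw [TensorProduct.comm_tmul, TensorProduct.map_tmul, ydLeft_tmul, ydRight_tmul, hκ.mul]
        have e₁ : Dual.eval K V v ∘ₗ dualAction κ s.deg s.a k =
            Dual.eval K V (s.a (κ.symm (H.φ s.deg⁻¹ k)) v) := rfl
        rw [e₁, coefR_dualCoaction]
        congr 1
        change h = κ (H.φ s.deg (κ.symm (H.φ s.deg⁻¹ h)))
        rw [← hκ.φ, LinearEquiv.apply_symm_apply, φ_φ_inv]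
    · clear e e'
      induction x with
      | zero => simp
      | add x y hx hy => simp only [map_add, hx, hy]
      | tmul h k =>
        rw [TensorProduct.comm_tmul, TensorProduct.map_tmul, ydLeft_tmul, ydRight_tmul, hκ.mul,
          coefR_dualCoaction]
        congr 1
        exact κ.apply_symm_apply _

theorem dual_hom (hκ : CrossedHopfAlgebra.IsAnti κ) {s : YetterDrinfeld H V}
    {t : YetterDrinfeld H W} {f : V →ₗ[K] W} (h : Hom s t f) :
    Hom (t.dual hκ) (s.dual hκ) f.dualMap := by
  obtain ⟨h₁, h₂, h₃⟩ := hom_iff.mp h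
  refine hom_iff.mpr ⟨congrArg _ h₁.symm, dualCoaction_natural κ h₂, fun x ξ => ?_⟩
  refine LinearMap.ext fun v => congrArg ξ ?_
  change t.a (κ.symm (H.φ t.deg⁻¹ x)) (f v) = f (s.a (κ.symm (H.φ s.deg⁻¹ x)) v)
  rw [h₃, h₁]

theorem eval_hom (hκ : CrossedHopfAlgebra.IsAnti κ) (s : YetterDrinfeld H V) :
    Hom s ((s.dual hκ.symm).dual hκ) (Dual.eval K V) := by
  refine hom_iff.mpr ⟨(inv_inv _).symm, dualCoaction_eval κ s.ρ, fun x v => ?_⟩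
  refine LinearMap.ext fun ξ => congrArg ξ ?_
  change s.a x v = s.a (κ.symm.symm (H.φ s.deg⁻¹ (κ.symm (H.φ s.deg⁻¹⁻¹ x)))) v
  rw [LinearEquiv.symm_symm, ← hκ.φ, LinearEquiv.apply_symm_apply, inv_inv, ← H.φ_mul,
    inv_mul_cancel, H.φ_one]

theorem unit_a (h : H.carrier) (c : K) : (unit H).a h c = counit (R := K) h • c := by
  refine LinearMap.congr_fun (f := (unit H).a.flip c) (g := counit.smulRight c)
    (CrossedHopfAlgebra.hom_ext_of_coefR fun X ξ x => ?_) h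
  have e : halfBraidingMap (unit H).a X.ρ (c ⊗ₜ x) = x ⊗ₜ c := by
    have e := LinearMap.congr_fun (CrossedCenter.cmap_eq (𝟙_ (CrossedCenter (Comod H))) X)
      (c ⊗ₜ[K] x)
    refine e.symm.trans ?_
    have h : X = CrossedCategory.conj (CrossedCategory.deg (𝟙_ (Comod H))) X := by
      rw [CrossedCategory.deg_unit, conj_id]
    have e₁ := congrArg (fun k => k.f.hom (c ⊗ₜ[K] x)) (CrossedCenter.tensorUnit_c X h)
    have e₂ := congrArg (fun k => ModuleCat.Hom.hom k (c ⊗ₜ[K] x))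
      (CrossedCenter.c_hom_f (𝟙_ (CrossedCenter (Comod H))) X h)
    have e₃ := e₂.symm.trans e₁
    refine Eq.trans ?_ (e₃.trans ?_)
    · rfl
    · change (c • x) ⊗ₜ[K] (1 : K) = x ⊗ₜ c
      rw [TensorProduct.smul_tmul, smul_eq_mul, mul_one]
  have e' := sliceR_halfBraidingMap (unit H).a X.ρ ξ c x
  rw [e] at e'
  refine e'.symm.trans ?_
  rw [LinearMap.smulRight_apply, CrossedHopfAlgebra.counit_coefR']
  simp

theorem ev_hom (s : YetterDrinfeld H V) :
    Hom (s.tensor (s.dual CrossedHopfAlgebra.isAnti_S)) (unit H)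
      (TensorProduct.lift (Dual.eval K V)) := by
  refine hom_iff.mpr ⟨mul_inv_cancel _, fun p =>
    (lift_eval_colinear s.isCoaction CrossedHopfAlgebra.mul_S p).symm, fun h p => ?_⟩
  induction p with
  | zero => simp
  | add x y hx hy => simp only [map_add, hx, hy]
  | tmul v ξ =>
  rw [tensor_a, unit_a, TensorProduct.lift.tmul]
  have key : ∀ x, TensorProduct.lift (Dual.eval K V) (tensorAction (H.φl s.deg⁻¹) s.a
      (dualAction H.S s.deg s.a) v ξ x) = ξ (s.a (H.φ s.deg⁻¹ (LinearMap.mul' K H.carrier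
        (H.S.symm.toLinearMap.lTensor _ (TensorProduct.comm K H.carrier H.carrier x)))) v) := by
    intro x
    induction x with
    | zero => simp
    | add x y hx hy => simp only [map_add, hx, hy, LinearMap.add_apply]
    | tmul h k =>
      change ξ (s.a (H.S.symm (H.φ s.deg⁻¹ h)) (s.a (H.φ s.deg⁻¹ k) v)) =
        ξ (s.a (H.φ s.deg⁻¹ (k * H.S.symm h)) v)
      rw [map_mul, s.mul, CrossedHopfAlgebra.isAnti_S.symm.φ]
      rfl
  refine (key _).trans ?_
  rw [CrossedHopfAlgebra.mul_S_symm, AlgHomClass.commutes, Algebra.algebraMap_eq_smul_one,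
    map_smul, s.one]
  simp

theorem coev_hom (s : YetterDrinfeld H V) :
    Hom (unit H) ((s.dual CrossedHopfAlgebra.isAnti_S).tensor s)
      ((TensorProduct.comm K V (Dual K V)).toLinearMap ∘ₗ coevaluation K V) := by
  refine hom_iff.mpr ⟨(inv_mul_cancel _).symm, fun c => ?_, fun h c => ?_⟩
  · obtain ⟨c, rfl⟩ : ∃ d : K, c = d • 1 := ⟨c, by simp⟩
    rw [map_smul, map_smul, map_smul, map_smul]
    congr 1
    exact comm_coevaluation_colinear s.isCoaction CrossedHopfAlgebra.S_mul
  · obtain ⟨c, rfl⟩ : ∃ d : K, c = d • 1 := ⟨c, by simp⟩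
    rw [map_smul, map_smul, map_smul, map_smul]
    congr 1
    rw [unit_a, map_smul, LinearMap.comp_apply, LinearEquiv.coe_coe, coevaluation_apply_one]
    simp only [map_sum, TensorProduct.comm_tmul, tensor_a]
    have key : ∀ x, ∑ i, tensorAction (H.φl s.deg) (dualAction H.S s.deg s.a) s.a
        ((Basis.ofVectorSpace K V).coord i) (Basis.ofVectorSpace K V i) x =
        ∑ i, (Basis.ofVectorSpace K V).coord i ⊗ₜ[K] s.a (LinearMap.mul' K H.carrier
          (H.S.symm.toLinearMap.rTensor _ (TensorProduct.comm K H.carrier H.carrier x)))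
            (Basis.ofVectorSpace K V i) := by
      intro x
      induction x with
      | zero => simp
      | add x y hx hy =>
        simp only [map_add, LinearMap.add_apply, tmul_add, Finset.sum_add_distrib, hx, hy]
      | tmul h k =>
        refine Eq.trans ?_ 
          ((sum_coord_comp_tmul (Basis.ofVectorSpace K V) (s.a (H.S.symm k)) (s.a h)).trans ?_)
        · refine Finset.sum_congr rfl fun i _ => ?_
          change ((Basis.ofVectorSpace K V).coord i ∘ₗ
            s.a (H.S.symm (H.φ s.deg⁻¹ (H.φ s.deg k)))) ⊗ₜ[K] _ = _
          rw [← H.φ_mul, inv_mul_cancel, H.φ_one]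
          rfl
        · refine Finset.sum_congr rfl fun i _ => ?_
          change _ = _ ⊗ₜ[K] s.a (H.S.symm k * h) _
          rw [s.mul]
          rfl
    refine Eq.symm ((key (comul (R := K) h)).trans ?_)
    · rw [CrossedHopfAlgebra.S_symm_mul, Finset.smul_sum]
      refine Finset.sum_congr rfl fun i _ => ?_
      rw [Algebra.algebraMap_eq_smul_one, map_smul, s.one]
      simp

end YetterDrinfeld

variable (H) in
/-- The crossed theory of Yetter-Drinfeld modules. -/
noncomputable def centerTheory : CrossedTheory K G where
  Str V := YetterDrinfeld H V
  deg s := s.deg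
  Hom := YetterDrinfeld.Hom
  deg_eq h := h.deg_eq
  comp h h' := h.comp h'
  transport e s := s.transport e
  transport_hom := YetterDrinfeld.transport_hom
  transport_hom_symm := YetterDrinfeld.transport_hom_symm
  tensor s t := s.tensor t
  tensor_hom := YetterDrinfeld.tensor_hom
  deg_tensor _ _ := rfl
  unit := YetterDrinfeld.unit H
  deg_unit := rfl
  assoc_hom := YetterDrinfeld.assoc_hom
  lid_hom := YetterDrinfeld.lid_hom
  rid_hom := YetterDrinfeld.rid_hom
  conj β s := s.conj β
  conj_hom := YetterDrinfeld.conj_hom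
  deg_conj _ _ := rfl
  conj_one := YetterDrinfeld.conj_one
  conj_mul := YetterDrinfeld.conj_mul
  conj_tensor := YetterDrinfeld.conj_tensor
  conj_unit := YetterDrinfeld.conj_unit
  rdual s := s.dual CrossedHopfAlgebra.isAnti_S
  rdual_hom := YetterDrinfeld.dual_hom _
  deg_rdual _ := rfl
  ev_hom := YetterDrinfeld.ev_hom
  coev_hom := YetterDrinfeld.coev_hom
  ldual s := s.dual CrossedHopfAlgebra.isAnti_S.symm
  ldual_hom := YetterDrinfeld.dual_hom _
  eval_rdual_ldual := YetterDrinfeld.eval_hom _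
  eval_ldual_rdual := YetterDrinfeld.eval_hom CrossedHopfAlgebra.isAnti_S.symm

end CenterTheory

section Underlying

open TensorProduct Coalgebra Module

variable {K : Type u} [Field K] {G : Type u} [Group G]

theorem coef_coact {H : CrossedHopfAlgebra K G} {V : Type u} [AddCommGroup V] [Module K V]
    (f : H.carrier →ₗ[K] K) (ρ : V →ₗ[K] H.carrier ⊗[K] V) (ξ : Dual K V) (v : V) :
    ξ (coact f ρ v) = f (coefR ρ ξ v) := by
  rw [coact_apply, coefR_apply]
  generalize ρ v = x
  induction x with
  | zero => simp
  | add x y hx hy => simp only [map_add, hx, hy]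
  | tmul a v => simp [mul_comm]

theorem eq_of_dual_eq (K : Type u) [Field K] {V : Type u} [AddCommGroup V] [Module K V] {v w : V}
    (h : ∀ ξ : Dual K V, ξ v = ξ w) : v = w :=
  sub_eq_zero.mp ((Module.forall_dual_apply_eq_zero_iff K _).mp fun ξ => by
    rw [map_sub, h, sub_self])

namespace CrossedTheory

/-- Coactions of a crossed Hopf algebra which underlie the structures of a crossed theory. -/
structure Underlying (T : CrossedTheory K G) (H : CrossedHopfAlgebra K G) where
  ρ : ∀ {V : Type u} [AddCommGroup V] [Module K V] [Module.Finite K V], T.Str V →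
    V →ₗ[K] H.carrier ⊗[K] V
  isCoaction : ∀ {V : Type u} [AddCommGroup V] [Module K V] [Module.Finite K V] (s : T.Str V),
    IsCoaction H.carrier (ρ s)
  mem : ∀ {V : Type u} [AddCommGroup V] [Module K V] [Module.Finite K V] (s : T.Str V) (v : V),
    ρ s v ∈ LinearMap.range ((H.comp (T.deg s)).subtype.rTensor V)
  hom : ∀ {V W : Type u} [AddCommGroup V] [Module K V] [Module.Finite K V] [AddCommGroup W]
    [Module K W] [Module.Finite K W] {s : T.Str V} {t : T.Str W} {f : V →ₗ[K] W}, T.Hom s t f →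
    ∀ v, ρ t (f v) = f.lTensor H.carrier (ρ s v)

variable {T : CrossedTheory K G}

/-- Linear families of natural endomorphisms are given by functionals on the coend. -/
theorem exists_functional {M : Type u} [AddCommGroup M] [Module K M]
    (e : ∀ {V : Type u} [AddCommGroup V] [Module K V] [Module.Finite K V], T.Str V →
      M →ₗ[K] V →ₗ[K] V)
    (he : ∀ {V W : Type u} [AddCommGroup V] [Module K V] [Module.Finite K V] [AddCommGroup W]
      [Module K W] [Module.Finite K W] {s : T.Str V} {t : T.Str W} {f : V →ₗ[K] W}, T.Hom s t f →
      ∀ m v, e t m (f v) = f (e s m v)) :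
    ∃ A : M →ₗ[K] T.hopf.carrier →ₗ[K] K, ∀ {V : Type u} [AddCommGroup V] [Module K V]
      [Module.Finite K V] (s : T.Str V) (m : M) (ξ : Dual K V) (v : V),
      A m (cf s ξ v) = ξ (e s m v) := by
  obtain ⟨t, ht⟩ := T.exists_lift (M := M →ₗ[K] K)
    (fun s => LinearMap.mk₂ K (fun ξ v => ξ ∘ₗ (e s).flip v) (fun _ _ _ => rfl) (fun _ _ _ => rfl)
      (fun _ _ _ => by ext; simp) (fun _ _ _ => by ext; simp))
    (fun h ξ v => LinearMap.ext fun m => congrArg ξ (he h m v))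
  exact ⟨t.flip, fun s m ξ v => LinearMap.congr_fun (ht s ξ v) m⟩

namespace Underlying

variable {H : CrossedHopfAlgebra K G} (Y : T.Underlying H)
  {V W : Type u} [AddCommGroup V] [Module K V] [Module.Finite K V] [AddCommGroup W]
  [Module K W] [Module.Finite K W]

theorem exists_map : ∃ p : T.hopf.carrier →ₗ[K] H.carrier, ∀ {V : Type u} [AddCommGroup V]
    [Module K V] [Module.Finite K V] (s : T.Str V) (ξ : Dual K V) (v : V),
    p (cf s ξ v) = coefR (Y.ρ s) ξ v :=
  T.exists_lift (fun s => coefR (Y.ρ s)) (fun h ξ v => coefR_natural (Y.hom h) ξ v)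

/-- The map of coalgebras which is given by the underlying coactions. -/
noncomputable def map : T.hopf.carrier →ₗ[K] H.carrier := Y.exists_map.choose

theorem map_cf (s : T.Str V) (ξ : Dual K V) (v : V) : Y.map (cf s ξ v) = coefR (Y.ρ s) ξ v :=
  Y.exists_map.choose_spec s ξ v

theorem push_act (s : T.Str V) : pushCoaction Y.map (act s) = Y.ρ s := by
  refine LinearMap.ext fun v => sliceR_ext fun ξ => ?_
  rw [pushCoaction_apply, sliceR_rTensor, sliceR_act, map_cf, coefR_apply]

/-- The map of coalgebras which is given by the underlying coactions. -/
noncomputable def coalgMap : T.hopf.carrier →ₗc[K] H.carrier where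
  toLinearMap := Y.map
  counit_comp := hopf_ext fun s ξ v => by
    rw [LinearMap.comp_apply, map_cf, counit_cf,
      ((isCoaction_iff (finBasis K _)).mp (Y.isCoaction s)).2]
  map_comp_comul := hopf_ext fun {V} _ _ _ s ξ v => by
    rw [LinearMap.comp_apply, LinearMap.comp_apply, map_cf,
      ((isCoaction_iff (finBasis K V)).mp (Y.isCoaction s)).1, comul_cf_sum (finBasis K V), map_sum]
    simp only [TensorProduct.map_tmul, map_cf]

theorem isCoaction_push (X : Comod T.hopf) : IsCoaction H.carrier (pushCoaction Y.map X.ρ) :=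
  X.isCoaction.push Y.coalgMap

theorem map_mem {α : G} {x : T.hopf.carrier} (hx : x ∈ T.hopf.comp α) : Y.map x ∈ H.comp α := by
  refine comp_induction (P := fun x => Y.map x ∈ H.comp α) (by rw [map_zero]; exact zero_mem _)
    (fun x y hx hy => by rw [map_add]; exact add_mem hx hy) (fun {V} _ _ _ s ξ v hs => ?_) hx
  rw [map_cf, coefR_apply]
  subst hs
  exact CrossedHopfAlgebra.sliceR_mem ξ (Y.mem s v)

theorem push_mem (X : Comod T.hopf) (v : X.V) :
    pushCoaction Y.map X.ρ v ∈ LinearMap.range ((H.comp X.deg).subtype.rTensor X.V) := by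
  obtain ⟨x, hx⟩ := X.mem v
  rw [pushCoaction_apply, ← hx]
  clear hx
  induction x with
  | zero => simp
  | add x y hx hy => rw [map_add, map_add]; exact add_mem hx hy
  | tmul a v => exact ⟨⟨_, Y.map_mem a.2⟩ ⊗ₜ v, by simp⟩

theorem push_hom {X X' : Comod T.hopf} (f : X ⟶ X') (v : X.V) :
    pushCoaction Y.map X'.ρ (f.f.hom v) = f.f.hom.lTensor H.carrier (pushCoaction Y.map X.ρ v) := by
  rw [pushCoaction_apply, f.comm, pushCoaction_apply]
  generalize X.ρ v = x
  induction x with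
  | zero => simp
  | add x y hx hy => simp only [map_add, hx, hy]
  | tmul a v => simp

end Underlying

end CrossedTheory

end Underlying

section CenterRecovery

open TensorProduct Coalgebra Module

variable {K : Type u} [Field K] {G : Type u} [Group G] {H : CrossedHopfAlgebra K G}
  {V W : Type u} [AddCommGroup V] [Module K V] [Module.Finite K V] [AddCommGroup W]
  [Module K W] [Module.Finite K W]

namespace CenterTheory

variable (H) in
/-- The coactions which underlie Yetter-Drinfeld modules. -/
noncomputable def underlying : (centerTheory H).Underlying H where
  ρ s := YetterDrinfeld.ρ s
  isCoaction s := YetterDrinfeld.isCoaction s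
  mem s := YetterDrinfeld.mem s
  hom h := (YetterDrinfeld.hom_iff.mp h).2.1

theorem exists_functional : ∃ A : H.carrier →ₗ[K] (centerTheory H).hopf.carrier →ₗ[K] K,
    ∀ {V : Type u} [AddCommGroup V] [Module K V] [Module.Finite K V] (s : YetterDrinfeld H V)
      (h : H.carrier) (ξ : Dual K V) (v : V),
      A h (CrossedTheory.cf (T := centerTheory H) s ξ v) = ξ (s.a h v) :=
  CrossedTheory.exists_functional (T := centerTheory H) (fun s => YetterDrinfeld.a s)
    (fun h x v => ((YetterDrinfeld.hom_iff.mp h).2.2 x v).symm)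

variable (H) in
/-- The functionals which give the actions of `H`. -/
noncomputable def functional : H.carrier →ₗ[K] (centerTheory H).hopf.carrier →ₗ[K] K :=
  exists_functional.choose

theorem functional_cf (s : YetterDrinfeld H V) (h : H.carrier) (ξ : Dual K V) (v : V) :
    functional H h (CrossedTheory.cf (T := centerTheory H) s ξ v) = ξ (s.a h v) :=
  exists_functional.choose_spec s h ξ v

/-- The action of `H` on a comodule over the coend. -/
noncomputable def strAction (X : Comod (centerTheory H).hopf) : H.carrier →ₗ[K] X.V →ₗ[K] X.V where
  toFun h := coact (functional H h) X.ρ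
  map_add' h k := LinearMap.ext fun v => eq_of_dual_eq K fun ξ => by
    simp [coef_coact]
  map_smul' c h := LinearMap.ext fun v => eq_of_dual_eq K fun ξ => by
    simp [coef_coact]

theorem strAction_comod (s : YetterDrinfeld H V) :
    strAction (CrossedTheory.comod (T := centerTheory H) s) = s.a :=
  LinearMap.ext fun h => LinearMap.ext fun v => eq_of_dual_eq K fun ξ => by
    refine (coef_coact (functional H h) (CrossedTheory.act (T := centerTheory H) s) ξ v).trans ?_
    refine Eq.trans ?_ (functional_cf s h ξ v)
    exact congrArg (fun c => functional H h (c ξ v)) (CrossedTheory.coefR_act (T := centerTheory H) s)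

theorem strAction_natural {X Y : Comod (centerTheory H).hopf} (f : X ⟶ Y) (h : H.carrier)
    (v : X.V) : strAction Y h (f.f.hom v) = f.f.hom (strAction X h v) :=
  coact_natural (functional H h) f.f.hom f.comm v

omit [Module.Finite K V] in
theorem ydLeft_bilinear (ρ : V →ₗ[K] H.carrier ⊗[K] V) (a : H.carrier →ₗ[K] V →ₗ[K] V)
    (x : H.carrier ⊗[K] H.carrier) : ∃ m : Dual K V →ₗ[K] V →ₗ[K] H.carrier,
      ∀ ζ u, m ζ u = ydLeft ρ a ζ u x := by
  induction x with
  | zero => exact ⟨0, by simp⟩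
  | add x y hx hy =>
    obtain ⟨m, hm⟩ := hx
    obtain ⟨m', hm'⟩ := hy
    exact ⟨m + m', fun ζ u => by simp [hm, hm']⟩
  | tmul h k =>
    exact ⟨((coefR ρ).compr₂ (LinearMap.mulRight K h)) ∘ₗ (a k).dualMap, fun ζ u => by simp; rfl⟩

omit [Module.Finite K V] in
theorem ydRight_bilinear (φ : H.carrier →ₗ[K] H.carrier) (ρ : V →ₗ[K] H.carrier ⊗[K] V)
    (a : H.carrier →ₗ[K] V →ₗ[K] V)
    (x : H.carrier ⊗[K] H.carrier) : ∃ m : Dual K V →ₗ[K] V →ₗ[K] H.carrier,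
      ∀ ζ u, m ζ u = ydRight φ ρ a ζ u x := by
  induction x with
  | zero => exact ⟨0, by simp⟩
  | add x y hx hy =>
    obtain ⟨m, hm⟩ := hx
    obtain ⟨m', hm'⟩ := hy
    exact ⟨m + m', fun ζ u => by simp [hm, hm']⟩
  | tmul h k =>
    exact ⟨((coefR ρ).compr₂ (LinearMap.mulLeft K (φ k))).compl₂ (a h), fun ζ u => by simp⟩

omit [Module.Finite K V] [Module.Finite K W] in
theorem ydLeft_natural {ρ : V →ₗ[K] H.carrier ⊗[K] V} {a : H.carrier →ₗ[K] V →ₗ[K] V}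
    {σ : W →ₗ[K] H.carrier ⊗[K] W} {b : H.carrier →ₗ[K] W →ₗ[K] W} {f : V →ₗ[K] W}
    (hf : ∀ v, σ (f v) = f.lTensor H.carrier (ρ v)) (hf' : ∀ h v, b h (f v) = f (a h v))
    (ζ : Dual K W) (u : V) (x : H.carrier ⊗[K] H.carrier) :
    ydLeft σ b ζ (f u) x = ydLeft ρ a (ζ ∘ₗ f) u x := by
  induction x with
  | zero => simp
  | add x y hx hy => simp only [map_add, hx, hy]
  | tmul h k =>
    rw [ydLeft_tmul, ydLeft_tmul, coefR_natural hf]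
    congr 3
    exact LinearMap.ext fun v => congrArg ζ (hf' k v)

omit [Module.Finite K V] [Module.Finite K W] in
theorem ydRight_natural {φ : H.carrier →ₗ[K] H.carrier} {ρ : V →ₗ[K] H.carrier ⊗[K] V}
    {a : H.carrier →ₗ[K] V →ₗ[K] V}
    {σ : W →ₗ[K] H.carrier ⊗[K] W} {b : H.carrier →ₗ[K] W →ₗ[K] W} {f : V →ₗ[K] W}
    (hf : ∀ v, σ (f v) = f.lTensor H.carrier (ρ v)) (hf' : ∀ h v, b h (f v) = f (a h v))
    (ζ : Dual K W) (u : V) (x : H.carrier ⊗[K] H.carrier) :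
    ydRight φ σ b ζ (f u) x = ydRight φ ρ a (ζ ∘ₗ f) u x := by
  induction x with
  | zero => simp
  | add x y hx hy => simp only [map_add, hx, hy]
  | tmul h k => rw [ydRight_tmul, ydRight_tmul, hf', coefR_natural hf]

theorem str_mul (X : Comod (centerTheory H).hopf) (h k : H.carrier) :
    strAction X (h * k) = strAction X k ∘ₗ strAction X h := by
  refine LinearMap.ext fun v => eq_of_dual_eq K fun ξ => ?_
  refine CrossedTheory.transfer (T := centerTheory H) (M := K)
    (fun X => (LinearMap.id : Dual K X.V →ₗ[K] X.V →ₗ[K] K).compl₂ (strAction X (h * k)))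
    (fun X => (LinearMap.id : Dual K X.V →ₗ[K] X.V →ₗ[K] K).compl₂
      (strAction X k ∘ₗ strAction X h))
    (fun f ξ v => congrArg ξ (strAction_natural f _ v))
    (fun {X Y} f ξ v => congrArg ξ (show strAction Y k (strAction Y h _) = _ by
      rw [strAction_natural, strAction_natural]; rfl))
    (fun s _ ξ v => ?_) X rfl ξ v
  change ξ (strAction _ (h * k) v) = ξ (strAction _ k (strAction _ h v))
  have e : strAction (CrossedTheory.comod s) = YetterDrinfeld.a s := strAction_comod s
  rw [e]
  exact congrArg ξ (LinearMap.congr_fun (YetterDrinfeld.mul s h k) v)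

theorem str_one (X : Comod (centerTheory H).hopf) : strAction X 1 = LinearMap.id := by
  refine LinearMap.ext fun v => eq_of_dual_eq K fun ξ => ?_
  refine CrossedTheory.transfer (T := centerTheory H) (M := K)
    (fun X => (LinearMap.id : Dual K X.V →ₗ[K] X.V →ₗ[K] K).compl₂ (strAction X 1))
    (fun X => LinearMap.id)
    (fun f ξ v => congrArg ξ (strAction_natural f _ v)) (fun f ξ v => rfl)
    (fun s _ ξ v => ?_) X rfl ξ v
  change ξ (strAction _ 1 v) = ξ v
  have e : strAction (CrossedTheory.comod s) = YetterDrinfeld.a s := strAction_comod s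
  rw [e]
  exact congrArg ξ (LinearMap.congr_fun (YetterDrinfeld.one s) v)

theorem str_yd (X : Comod (centerTheory H).hopf) (ζ : Dual K X.V) (u : X.V) (h : H.carrier) :
    ydLeft (pushCoaction (underlying H).map X.ρ) (strAction X) ζ u (comul (R := K) h) =
      ydRight (H.φl X.deg) (pushCoaction (underlying H).map X.ρ) (strAction X) ζ u
        (comul (R := K) h) := by
  choose m hm using fun X : Comod (centerTheory H).hopf => ydLeft_bilinear
    (pushCoaction (underlying H).map X.ρ) (strAction X) (comul (R := K) h)
  choose m' hm' using fun X' : Comod (centerTheory H).hopf => ydRight_bilinear (H.φl X.deg)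
    (pushCoaction (underlying H).map X'.ρ) (strAction X') (comul (R := K) h)
  rw [← hm, ← hm']
  refine CrossedTheory.transfer m m'
    (fun {X Y} f ξ v => by
      rw [hm, hm]
      exact ydLeft_natural ((underlying H).push_hom f) (strAction_natural f) _ _ _)
    (fun {X Y} f ξ v => by
      rw [hm', hm']
      exact ydRight_natural ((underlying H).push_hom f) (strAction_natural f) _ _ _)
    (fun {V} _ _ _ s hs ξ v => ?_) X rfl ζ u
  rw [hm, hm', ← hs]
  have e : pushCoaction (underlying H).map (CrossedTheory.comod s).ρ = YetterDrinfeld.ρ s :=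
    (underlying H).push_act s
  have e' : strAction (CrossedTheory.comod s) = YetterDrinfeld.a s := strAction_comod s
  rw [e, e']
  exact YetterDrinfeld.yd s ξ v h

variable (H) in
/-- Comodules over the coend are Yetter-Drinfeld modules. -/
noncomputable def recovery : (centerTheory H).Recovery where
  str X :=
    { deg := X.deg
      ρ := pushCoaction (underlying H).map X.ρ
      isCoaction := (underlying H).isCoaction_push X
      mem := (underlying H).push_mem X
      a := strAction X
      one := str_one X
      mul := str_mul X
      yd := str_yd X }
  deg_str _ := rfl
  hom f := YetterDrinfeld.hom_iff.mpr ⟨f.deg_eq, (underlying H).push_hom f,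
    fun h v => (strAction_natural f h v).symm⟩
  str_comod s := YetterDrinfeld.ext rfl ((underlying H).push_act s) (strAction_comod s)

variable (H) in
/-- The braiding of Yetter-Drinfeld modules. -/
noncomputable def braiding : (centerTheory H).Braiding where
  c s t := YetterDrinfeld.braiding s t
  hom s t := YetterDrinfeld.braiding_hom s t
  natural {V W V' W'} _ _ _ _ _ _ _ _ _ _ _ _ s t s' t' f g h h' x := by
    obtain ⟨-, -, h₁⟩ := YetterDrinfeld.hom_iff.mp h
    obtain ⟨-, h₂, -⟩ := YetterDrinfeld.hom_iff.mp h'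
    change TensorProduct.map g f (halfBraidingMap (YetterDrinfeld.a s) (YetterDrinfeld.ρ t) x) =
      halfBraidingMap (YetterDrinfeld.a s') (YetterDrinfeld.ρ t') (TensorProduct.map f g x)
    induction x with
    | zero => simp
    | add x y hx hy => simp only [map_add, hx, hy]
    | tmul u x =>
    rw [TensorProduct.map_tmul, halfBraidingMap_tmul, halfBraidingMap_tmul, h₂]
    generalize YetterDrinfeld.ρ t x = y
    induction y with
    | zero => simp
    | add x y hx hy => simp only [map_add, hx, hy]
    | tmul h x => simp [h₁]
  tensor_left s t r v w u := YetterDrinfeld.halfBraidingMap_tensor_left s t r.obj v w u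
  tensor_right s t r v w u :=
    halfBraidingMap_tensor (YetterDrinfeld.a s) (YetterDrinfeld.mul s) t.ρ r.ρ v w u
  conj β s t := LinearEquiv.toLinearMap_injective (YetterDrinfeld.halfBraidingMap_conj β s t.obj)

end CenterTheory

end CenterRecovery

section CenterFunctor

open TensorProduct Coalgebra Module

variable {K : Type u} [Field K] {G : Type u} [Group G] {H : CrossedHopfAlgebra K G}

namespace CrossedTheory.Recovery

variable {T : CrossedTheory K G} (R : T.Recovery)

/-- Homomorphisms of structures are arrows of comodules. -/
noncomputable def ofHom {X Y : Comod T.hopf} {f : X.V →ₗ[K] Y.V}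
    (h : T.Hom (R.str X) (R.str Y) f) : X ⟶ Y where
  f := ModuleCat.ofHom f
  deg_eq := (R.deg_str X).symm.trans ((T.deg_eq h).trans (R.deg_str Y))
  comm := by
    have e := (CrossedTheory.comodMap h).comm
    intro v
    have e := e v
    change CrossedTheory.act (R.str Y) (f v) =
      f.lTensor T.hopf.carrier (CrossedTheory.act (R.str X) v) at e
    rw [R.act_str, R.act_str] at e
    exact e

end CrossedTheory.Recovery

theorem CrossedCenter.hom_ext_lin {Z Z' : CrossedCenter (Comod H)} {k l : Z ⟶ Z'}
    (h : ∀ v, k.f.f.hom v = l.f.f.hom v) : k = l := by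
  ext1
  ext1
  ext1
  exact LinearMap.ext h

theorem CrossedCenter.eq_eqToHom_comp {Z Z' Y Y' : CrossedCenter (Comod H)} (h : Z = Y)
    (h' : Z' = Y') {k : Z ⟶ Z'} {l : Y ⟶ Y'} (e : HEq k.f.f l.f.f) :
    k = eqToHom h ≫ l ≫ eqToHom h'.symm := by
  subst h h'
  rw [eqToHom_refl, eqToHom_refl, Category.id_comp, Category.comp_id]
  ext1
  ext1
  exact eq_of_heq e

theorem CrossedCenter.c_f_heq {X Y Y' : CrossedCenter (Comod H)} (h : Y' = conj (deg X) Y) :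
    HEq (CrossedBraiding.c X Y h).hom.f.f (ModuleCat.ofHom (CrossedCenter.cmap X Y.obj)) := by
  subst h
  exact heq_of_eq ((CrossedCenter.c_hom_f X Y.obj rfl).trans (Category.comp_id _))

theorem Comod.c_rfl_f {Q : CoquasitriangularHopfAlgebra K G} (X Y : Comod Q.toCrossedHopfAlgebra) :
    (CrossedBraiding.c X Y rfl).hom.f = ModuleCat.ofHom (Q.cobraiding.braidMap X.ρ Y.ρ) :=
  (Comod.c_hom_f Q X Y rfl).trans (Category.comp_id _)

/-- The coquasitriangular crossed Hopf algebra whose comodules are the objects of the center. -/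
noncomputable def CrossedHopfAlgebra.centerDual (H : CrossedHopfAlgebra K G) :
    CoquasitriangularHopfAlgebra K G where
  toCrossedHopfAlgebra := (centerTheory H).hopf
  cobraiding := (CenterTheory.braiding H).cobraiding

namespace CenterTheory

/-- The functor from the comodules over the coend to the center. -/
noncomputable def functor : Comod (centerTheory H).hopf ⥤ CrossedCenter (Comod H) where
  obj X := YetterDrinfeld.center ((recovery H).str X)
  map {X Y} f :=
    { f := ⟨f.f, f.deg_eq, (underlying H).push_hom f⟩
      comm := by
        obtain ⟨k, hk⟩ := (recovery H).hom f
        have e : k.f = (⟨f.f, f.deg_eq, (underlying H).push_hom f⟩ :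
            (YetterDrinfeld.center ((recovery H).str X)).obj ⟶
              (YetterDrinfeld.center ((recovery H).str Y)).obj) := by
          ext1
          ext1
          exact hk
        rw [← e]
        exact k.comm }

theorem obj_tensor (X Y : Comod (centerTheory H).hopf) :
    functor.obj (X ⊗ Y) = functor.obj X ⊗ functor.obj Y := by
  have e := (recovery H).str_tensor X Y
  have e' := YetterDrinfeld.tensor_center (V := X.V) (W := Y.V) ((recovery H).str X)
    ((recovery H).str Y)
  exact (congrArg (YetterDrinfeld.center (V := X.V ⊗[K] Y.V)) e).trans e'

theorem obj_unit : functor.obj (𝟙_ (Comod (centerTheory H).hopf)) =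
    𝟙_ (CrossedCenter (Comod H)) :=
  (congrArg (YetterDrinfeld.center (V := K)) (recovery H).str_unit).trans YetterDrinfeld.unit_center

theorem obj_conj (β : G) (X : Comod (centerTheory H).hopf) :
    functor.obj (conj β X) = conj β (functor.obj X) :=
  (congrArg (YetterDrinfeld.center (V := X.V)) ((recovery H).str_conj β X)).trans
    (YetterDrinfeld.conj_center β _)

variable (H) in
/-- The crossed functor from the comodules over the coend to the center. -/
noncomputable def crossedFunctor :
    CrossedFunctor (Comod (centerTheory H).hopf) (CrossedCenter (Comod H)) where
  F := functor
  deg_obj _ := rfl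
  obj_tensor := obj_tensor
  obj_unit := obj_unit
  map_tensor f g := CrossedCenter.hom_ext_lin fun v => by
    simp only [CrossedCenter.comp_f, CrossedCenter.eqToHom_f, Comod.comp_f, Comod.eqToHom_f]
    rfl
  map_associator X Y Z := CrossedCenter.hom_ext_lin fun v => by
    simp only [CrossedCenter.comp_f, CrossedCenter.eqToHom_f, Comod.comp_f, Comod.eqToHom_f]
    rfl
  map_leftUnitor X := CrossedCenter.hom_ext_lin fun v => by
    simp only [CrossedCenter.comp_f, CrossedCenter.eqToHom_f, Comod.comp_f, Comod.eqToHom_f]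
    rfl
  map_rightUnitor X := CrossedCenter.hom_ext_lin fun v => by
    simp only [CrossedCenter.comp_f, CrossedCenter.eqToHom_f, Comod.comp_f, Comod.eqToHom_f]
    rfl
  obj_conj := obj_conj
  map_conj β X Y f := CrossedCenter.hom_ext_lin fun v => by
    simp only [CrossedCenter.comp_f, CrossedCenter.eqToHom_f, Comod.comp_f, Comod.eqToHom_f]
    rfl

theorem comod_yetterDrinfeld (X : Comod (centerTheory H).hopf) :
    CrossedTheory.comod (T := centerTheory H) (functor.obj X).yetterDrinfeld = X := by
  have e := YetterDrinfeld.center_yetterDrinfeld ((recovery H).str X)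
  exact (congrArg (CrossedTheory.comod (T := centerTheory H) (V := X.V)) e).trans
    ((recovery H).comod_str X)

theorem functor_comod (Z : CrossedCenter (Comod H)) :
    functor.obj (CrossedTheory.comod (T := centerTheory H) Z.yetterDrinfeld) = Z :=
  (congrArg (YetterDrinfeld.center (V := Z.obj.V))
    ((recovery H).str_comod Z.yetterDrinfeld)).trans Z.yetterDrinfeld_center

theorem isIsoOnto : (crossedFunctor H).IsIsoOnto ⊤ where
  full := ⟨fun {X Y} k => ⟨(recovery H).ofHom (f := k.f.f.hom) ⟨k, rfl⟩, rfl⟩⟩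
  faithful := ⟨fun {X Y} f g h => by
    ext1
    exact congrArg (fun k => k.f.f) h⟩
  injective X Y h := by
    rw [← comod_yetterDrinfeld X, ← comod_yetterDrinfeld Y]
    have h : functor.obj X = functor.obj Y := h
    rw [h]
  range Z := ⟨fun _ => ⟨_, functor_comod Z⟩, fun _ => trivial⟩

end CenterTheory

namespace CenterTheory

variable (H) in
/-- The crossed functor from the comodules over the dual of the center to the center. -/
noncomputable def braidedFunctor :
    CrossedFunctor (Comod H.centerDual.toCrossedHopfAlgebra) (CrossedCenter (Comod H)) :=
  crossedFunctor H

theorem braidMap_eq_cmap (X Y : Comod (centerTheory H).hopf) :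
    (CenterTheory.braiding H).cobraiding.braidMap X.ρ Y.ρ =
      CrossedCenter.cmap (functor.obj X) (functor.obj Y).obj := by
  refine Eq.trans ?_ (YetterDrinfeld.cmap_center ((recovery H).str X) (functor.obj Y).obj).symm
  rw [← (recovery H).act_str X, ← (recovery H).act_str Y]
  exact (CenterTheory.braiding H).braidMap_act _ _

theorem isBraided : (braidedFunctor H).IsBraided := by
  intro X Y Y' h
  subst h
  refine CrossedCenter.eq_eqToHom_comp ((braidedFunctor H).obj_tensor X Y)
    ((braidedFunctor H).obj_tensor _ X) ?_
  refine HEq.trans (heq_of_eq ?_)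
    (CrossedCenter.c_f_heq ((braidedFunctor H).obj_conj_deg rfl)).symm
  refine (Comod.c_rfl_f (Q := H.centerDual) X Y).trans ?_
  exact congrArg ModuleCat.ofHom (braidMap_eq_cmap X Y)

theorem preservesFiber : (crossedFunctor H).PreservesFiber (Comod.fiber (centerTheory H).hopf)
    (Comod.fiber H).center where
  obj _ := rfl
  map f := by
    ext v
    rfl
  unit := by
    rw [eqToHom_map, eqToHom_trans]
    ext
    rfl
  tensor A B := by
    rw [eqToHom_map, eqToHom_trans]
    apply ModuleCat.MonoidalCategory.tensor_ext
    intro a b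
    rfl
  conj β A := by
    rw [eqToHom_map, eqToHom_trans]
    ext v
    rfl

end CenterTheory

theorem CrossedHopfAlgebra.braidedTannakianIso_centerDual (H : CrossedHopfAlgebra K G) :
    BraidedTannakianIso (Comod.fiber H.centerDual.toCrossedHopfAlgebra) (Comod.fiber H).center ⊤ :=
  ⟨CenterTheory.braidedFunctor H, CenterTheory.isIsoOnto, CenterTheory.isBraided,
    CenterTheory.preservesFiber⟩

end CenterFunctor

section LeftDuals

open TensorProduct Coalgebra Module

variable {K : Type u} [Field K] {G : Type u} [Group G] {H : CrossedHopfAlgebra K G}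

variable {V W : Type u} [AddCommGroup V] [Module K V] [Module.Finite K V] [AddCommGroup W]
  [Module K W] [Module.Finite K W]

theorem map_coevaluation (f : V →ₗ[K] W) :
    f.rTensor (Dual K V) (coevaluation K V 1) = f.dualMap.lTensor W (coevaluation K W 1) := by
  refine sliceR_ext_eval fun v => ?_
  rw [sliceR_rTensor, sliceR_lTensor, coevaluation_apply_one, coevaluation_apply_one]
  have e : Dual.eval K V v ∘ₗ f.dualMap = Dual.eval K W (f v) := rfl
  rw [e]
  simp only [map_sum, sliceR_tmul, Dual.eval_apply, Basis.coord_apply, Basis.sum_repr]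

theorem coact_dualCoaction {κ : H.carrier ≃ₗ[K] H.carrier} {τ : H.carrier →ₗ[K] K}
    (hτ : ∀ h, τ (κ h) = τ h) (ρ : V →ₗ[K] H.carrier ⊗[K] V) :
    coact τ (dualCoaction κ ρ) = (coact τ ρ).dualMap := by
  refine LinearMap.ext fun ξ => LinearMap.ext fun v => ?_
  refine (coef_coact τ (dualCoaction κ ρ) (Dual.eval K V v) ξ).trans ?_
  rw [coefR_dualCoaction, hτ]
  exact (coef_coact τ ρ ξ v).symm

namespace Comod

/-- The dual space of a comodule, with the coaction given by an anti-automorphism. -/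
noncomputable def dual {κ : H.carrier ≃ₗ[K] H.carrier} (hκ : CrossedHopfAlgebra.IsAnti κ)
    (X : Comod H) : Comod H where
  deg := X.deg⁻¹
  V := ModuleCat.of K (Dual K X.V)
  finite := inferInstanceAs (Module.Finite K (Dual K X.V))
  ρ := dualCoaction κ X.ρ
  isCoaction := hκ.isCoaction X.isCoaction
  mem := hκ.dualCoaction_mem X.mem

theorem dual_conj {κ : H.carrier ≃ₗ[K] H.carrier} (hκ : CrossedHopfAlgebra.IsAnti κ) (β : G)
    (X : Comod H) : dual hκ (conj β X) = conj β (dual hκ X) := by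
  refine obj_ext ?_ rfl (heq_of_eq (dualCoaction_push hκ β X.ρ))
  change (β * X.deg * β⁻¹)⁻¹ = β * X.deg⁻¹ * β⁻¹
  group

/-- The left dual of a comodule. -/
noncomputable abbrev leftDual (X : Comod H) : Comod H := dual CrossedHopfAlgebra.isAnti_S.symm X

/-- The right dual of a comodule. -/
noncomputable abbrev rightDual (X : Comod H) : Comod H := dual CrossedHopfAlgebra.isAnti_S X

/-- The evaluation of the left dual. -/
noncomputable def leftEv (X : Comod H) : X.leftDual ⊗ X ⟶ 𝟙_ (Comod H) where
  f := ModuleCat.ofHom (contractLeft K X.V)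
  deg_eq := inv_mul_cancel _
  comm p := (lift_id_colinear X.isCoaction CrossedHopfAlgebra.S_symm_mul p).symm

/-- The coevaluation of the left dual. -/
noncomputable def leftCoev (X : Comod H) : 𝟙_ (Comod H) ⟶ X ⊗ X.leftDual where
  f := ModuleCat.ofHom (coevaluation K X.V)
  deg_eq := (mul_inv_cancel _).symm
  comm c := by
    obtain ⟨c, rfl⟩ : ∃ d : K, c = d • 1 := ⟨c, by simp⟩
    rw [map_smul, map_smul, map_smul, map_smul]
    congr 1
    exact coevaluation_colinear X.isCoaction CrossedHopfAlgebra.mul_S_symm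

noncomputable instance (X : Comod H) : ExactPairing X X.leftDual where
  coevaluation' := leftCoev X
  evaluation' := leftEv X
  coevaluation_evaluation' := by
    ext1
    ext1
    exact contractLeft_assoc_coevaluation K X.V
  evaluation_coevaluation' := by
    ext1
    ext1
    exact contractLeft_assoc_coevaluation' K X.V

variable (H) in
/-- The choice of left duals of the category of comodules. -/
noncomputable def leftDuals : CrossedLeftDuals (G := G) (Comod H) where
  dual := leftDual
  pairing X := inferInstance
  dual_conj β X := dual_conj _ β X
  coev_conj β X := by
    ext1
    simp only [conjMap, comp_f, eqToHom_f]
    ext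
    rfl
  ev_conj β X := by
    ext1
    simp only [conjMap, comp_f, eqToHom_f]
    ext
    rfl

theorem isRibbonCategory (R : CoribbonHopfAlgebra K G) :
    IsRibbonCategory (G := G) (Comod R.toCrossedHopfAlgebra) := by
  refine ⟨leftDuals _, fun X => ?_⟩
  intro U₁ V₁ hU hV
  subst hU hV
  ext1
  simp only [conjMap, comp_f, eqToHom_f, whiskerLeft_f, whiskerRight_f, θ_hom_f]
  ext
  have e := map_coevaluation (coact R.cotwist.τ X.ρ)
  have e' : coact R.cotwist.τ (pushCoaction (R.φl X.deg) (dualCoaction R.S.symm X.ρ)) =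
      (coact R.cotwist.τ X.ρ).dualMap := by
    rw [coact_push, R.cotwist.τ_φ]
    refine coact_dualCoaction (fun h => ?_) X.ρ
    conv_rhs => rw [← R.S.apply_symm_apply h]
    exact (R.cotwist.antipode _).symm
  rw [← e'] at e
  exact e.symm

end Comod

end LeftDuals

section SquareTwist

variable {C : Type u} [Category.{v} C] [MonoidalCategory C]

/-- The inverse square of a twist, in a monoidal category. -/
theorem square_twist_comp {U U₁ U₂ V₂ : C} {b₂ : 𝟙_ C ⟶ U₂ ⊗ V₂} {d₂ : V₂ ⊗ U₂ ⟶ 𝟙_ C}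
    {T : U ⟶ U₂} {y : 𝟙_ C ⟶ V₂ ⊗ U₁} (k : V₂ ⊗ U₁ ⟶ U ⊗ V₂) (l : U₂ ⊗ U ≅ U₁ ⊗ U₂)
    (hz : (λ_ U₂).inv ≫ b₂ ▷ U₂ ≫ (α_ U₂ V₂ U₂).hom ≫ U₂ ◁ d₂ ≫ (ρ_ U₂).hom = 𝟙 U₂)
    (hy : y ≫ k ≫ T ▷ V₂ = b₂)
    (hd : (α_ V₂ U₂ U).hom ≫ V₂ ◁ l.hom ≫ (α_ V₂ U₁ U₂).inv ≫ k ▷ U₂ ≫ (α_ U V₂ U₂).hom ≫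
      U ◁ d₂ = d₂ ▷ U ≫ (λ_ U).hom ≫ (ρ_ U).inv) :
    ((λ_ U₂).inv ≫ y ▷ U₂ ≫ (α_ V₂ U₁ U₂).hom ≫ V₂ ◁ l.inv ≫ (α_ V₂ U₂ U).inv ≫ d₂ ▷ U ≫
      (λ_ U).hom) ≫ T = 𝟙 U₂ := by
  have e : d₂ ▷ U ≫ (λ_ U).hom = (α_ V₂ U₂ U).hom ≫ V₂ ◁ l.hom ≫ (α_ V₂ U₁ U₂).inv ≫ k ▷ U₂ ≫
      (α_ U V₂ U₂).hom ≫ U ◁ d₂ ≫ (ρ_ U).hom := by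
    have e := congrArg (· ≫ (ρ_ U).hom) hd
    simp only [Category.assoc, Iso.inv_hom_id, Category.comp_id] at e
    exact e.symm
  rw [e, ← hz, ← hy]
  simp only [Category.assoc, Iso.inv_hom_id_assoc, Iso.hom_inv_id_assoc, comp_whiskerRight,
    whiskerLeft_inv_hom_assoc]
  congr 3
  rw [← rightUnitor_naturality, whisker_exchange_assoc]
  simp

/-- The zigzag identity for the right dual of an object with a twist, in a monoidal category. -/
theorem right_zigzag {U U₁ U₂ V V₁ V₂ : C} {d₁ : V₁ ⊗ U₁ ⟶ 𝟙_ C} {d₂ : V₂ ⊗ U₂ ⟶ 𝟙_ C}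
    {t : U ⟶ U₁} {T : U ⟶ U₂} {y : 𝟙_ C ⟶ V₁ ⊗ U} {y₁ : 𝟙_ C ⟶ V₂ ⊗ U₁} {s : V₁ ⟶ V}
    {s₂ : V₂ ⟶ V₁} {kA : U₁ ⊗ V ⟶ V₁ ⊗ U₁} {kB : U ⊗ V₁ ⟶ V₂ ⊗ U} (kC : U ⊗ U ≅ U₁ ⊗ U)
    (l : U₂ ⊗ U ≅ U₁ ⊗ U₂) (h₁ : (t ⊗ₘ s) ≫ kA = kB ≫ (s₂ ⊗ₘ t))
    (h₂ : (s₂ ⊗ₘ t) ≫ d₁ = V₂ ◁ T ≫ d₂)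
    (h₃ : U ◁ y ≫ (α_ U V₁ U).inv ≫ kB ▷ U ≫ (α_ V₂ U U).hom ≫ V₂ ◁ kC.hom ≫
      (α_ V₂ U₁ U).inv = (ρ_ U).hom ≫ (λ_ U).inv ≫ y₁ ▷ U)
    (h₄ : kC.hom ≫ U₁ ◁ T = T ▷ U ≫ l.hom)
    (h₅ : T ≫ (λ_ U₂).inv ≫ y₁ ▷ U₂ ≫ (α_ V₂ U₁ U₂).hom ≫ V₂ ◁ l.inv ≫ (α_ V₂ U₂ U).inv ≫
      d₂ ▷ U ≫ (λ_ U).hom = 𝟙 U) :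
    (ρ_ U).inv ≫ U ◁ (y ≫ s ▷ U) ≫ (α_ U V U).inv ≫ (t ▷ V ≫ kA ≫ d₁) ▷ U ≫ (λ_ U).hom =
      𝟙 U := by
  have e₁ : U ◁ (s ▷ U) ≫ (α_ U V U).inv ≫ (t ▷ V ≫ kA ≫ d₁) ▷ U =
      (α_ U V₁ U).inv ≫ kB ▷ U ≫ (V₂ ◁ T) ▷ U ≫ d₂ ▷ U := by
    rw [← comp_whiskerRight (V₂ ◁ T), ← h₂, ← comp_whiskerRight, ← Category.assoc kB, ← h₁,
      tensorHom_def']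
    simp
  have e₂ : U ◁ y ≫ (α_ U V₁ U).inv ≫ kB ▷ U = (ρ_ U).hom ≫ (λ_ U).inv ≫ y₁ ▷ U ≫
      (α_ V₂ U₁ U).hom ≫ V₂ ◁ kC.inv ≫ (α_ V₂ U U).inv := by
    have e := congrArg (· ≫ (α_ V₂ U₁ U).hom ≫ V₂ ◁ kC.inv ≫ (α_ V₂ U U).inv) h₃
    simpa using e
  have e₃ : kC.inv ≫ T ▷ U = U₁ ◁ T ≫ l.inv := by
    rw [Iso.inv_comp_eq, ← Category.assoc, h₄, Category.assoc, Iso.hom_inv_id, Category.comp_id]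
  have e₄ : V₂ ◁ kC.inv ≫ (α_ V₂ U U).inv ≫ (V₂ ◁ T) ▷ U = 
      V₂ ◁ (U₁ ◁ T) ≫ V₂ ◁ l.inv ≫ (α_ V₂ U₂ U).inv := by
    rw [← whiskerLeft_comp_assoc, ← e₃]
    simp
  calc _ = (ρ_ U).inv ≫ (U ◁ y ≫ (α_ U V₁ U).inv ≫ kB ▷ U) ≫ (V₂ ◁ T) ▷ U ≫ d₂ ▷ U ≫
        (λ_ U).hom := by
        rw [whiskerLeft_comp]
        simp only [Category.assoc]
        congr 2
        simpa using congrArg (· ≫ (λ_ U).hom) e₁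
    _ = (λ_ U).inv ≫ y₁ ▷ U ≫ (α_ V₂ U₁ U).hom ≫ (V₂ ◁ kC.inv ≫ (α_ V₂ U U).inv ≫
        (V₂ ◁ T) ▷ U) ≫ d₂ ▷ U ≫ (λ_ U).hom := by
        rw [e₂]
        simp
    _ = _ := by
        rw [e₄, ← h₅]
        simp only [Category.assoc]
        rw [leftUnitor_inv_naturality_assoc, whisker_exchange_assoc]
        simp

end SquareTwist

section CrossedSquareTwist

variable {G : Type w} [Group G] {C : Type u} [Category.{v} C] [MonoidalCategory C]
  [CrossedCategory G C] [CrossedBraiding C] [CrossedTwist C]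

namespace CrossedCategory

open CrossedBraiding CrossedTwist

omit [CrossedBraiding C] [CrossedTwist C] in
theorem conj_deg_unit (X : C) : X = conj (deg (𝟙_ C)) X := by rw [deg_unit, conj_id]

theorem θ_unit : (θ (𝟙_ C) (conj_deg_unit _)).hom = 𝟙 (𝟙_ C) := by
  have h : 𝟙_ C ⊗ 𝟙_ C = conj (deg (𝟙_ C ⊗ 𝟙_ C)) (𝟙_ C ⊗ 𝟙_ C) := by
    rw [deg_tensor, deg_unit, one_mul, conj_id]
  have h' : 𝟙_ C = conj (deg (𝟙_ C ⊗ 𝟙_ C)) (𝟙_ C) := by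
    rw [deg_tensor, deg_unit, one_mul, conj_id]
  have e := θ_natural (λ_ (𝟙_ C)).hom h (conj_deg_unit _) h'
  rw [θ_tensor _ _ (conj_deg_unit _) (conj_deg_unit _) (conj_deg_unit _) (conj_deg_unit _),
    conjMap_one _ _ (by rw [deg_tensor, deg_unit, one_mul]), c_unit_right, unitors_equal] at e
  simp only [unitors_inv_equal, Iso.hom_inv_id, Category.comp_id] at e
  rw [MonoidalCategory.tensorHom_def, Category.assoc, ← unitors_equal, leftUnitor_naturality,
    unitors_equal, rightUnitor_naturality_assoc, cancel_epi] at e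
  rw [← cancel_mono (θ (𝟙_ C) (conj_deg_unit _)).hom, ← e, Category.id_comp]

/-- The twist is trivial on arrows from the unit object. -/
theorem comp_θ_of_unit {Z : C} (f : 𝟙_ C ⟶ Z) (h : Z = conj (deg Z) Z) :
    f ≫ (θ Z h).hom = f := by
  have d := (deg_eq_of_hom f).symm
  rw [θ_natural f (conj_deg_unit _) h (by rw [← d]; exact h), θ_unit, Category.id_comp,
    conjMap_one _ _ deg_unit]

variable {U V : C} [ExactPairing U V]

omit [CrossedBraiding C] [CrossedTwist C] in
theorem conj_zigzag (β : G) {U' V' : C} (hU : U' = conj β U) (hV : V' = conj β V) :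
    (λ_ U').inv ≫ conjMap β (η_ U V) (Φ_unit β).symm (conj_tensor hU hV) ▷ U' ≫
      (α_ U' V' U').hom ≫ U' ◁ conjMap β (ε_ U V) (conj_tensor hV hU) (Φ_unit β).symm ≫
        (ρ_ U').hom = 𝟙 U' := by
  have u := (Φ_unit (C := C) β).symm
  have e := congrArg (fun k => conjMap β k (conj_tensor u hU) hU)
    (show (η_ U V ▷ U ≫ (α_ U V U).hom ≫ U ◁ ε_ U V) ≫ (ρ_ U).hom = (λ_ U).hom by
      rw [ExactPairing.evaluation_coevaluation U V]; simp)
  beta_reduce at e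
  rw [conjMap_comp β _ _ _ (conj_tensor hU u), conjMap_rightUnitor_hom β hU,
    conjMap_comp β _ _ _ (conj_tensor (conj_tensor hU hV) hU),
    conjMap_comp β _ _ _ (conj_tensor hU (conj_tensor hV hU)), conjMap_whiskerRight β _ _ u (conj_tensor hU hV) hU,
    conjMap_whiskerLeft β _ _ hU (conj_tensor hV hU) u, conjMap_associator_hom β hU hV hU,
    conjMap_leftUnitor_hom β hU] at e
  rw [Iso.inv_comp_eq, Category.comp_id, ← e]
  simp only [Category.assoc]

/-- The coevaluations of the conjugates of `U` are fixed by the double braiding and the square of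
the twist. -/
theorem Tortile.coev_double (h : Tortile U V) {U₁ V₁ U₂ V₂ : C} (hU : U₁ = conj (deg U) U)
    (hV : V₁ = conj (deg U) V) (hU₁ : U₂ = conj (deg U) U₁) (hV₁ : V₂ = conj (deg U) V₁)
    (k₁ : V₂ = conj (deg U₁) V₁) (k₂ : U = conj (deg V₂) U₁) (k₃ : U₂ ⊗ V₂ = conj (deg U * deg U) (U ⊗ V)) :
    (conjMap (deg U) (η_ U V) (Φ_unit (deg U)).symm (conj_tensor hU hV) ≫ (c U₁ V₁ k₁).hom) ≫
      (c V₂ U₁ k₂).hom ≫ ((θ U hU).hom ≫ conjMap (deg U) (θ U hU).hom hU hU₁) ▷ V₂ =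
    conjMap (deg U * deg U) (η_ U V) (Φ_unit _).symm k₃ := by
  have dV₂ : deg V₂ = (deg U)⁻¹ := by
    rw [hV₁, hV, deg_conj, deg_conj, deg_dual U V]; group
  have hs : V₁ = conj (deg V₂) V₂ := by rw [dV₂, hV₁, ← conj_comp, inv_mul_cancel, conj_id]
  have hf : U ⊗ V₂ = conj (deg (U ⊗ V₂)) (U ⊗ V₂) := by
    rw [deg_tensor, dV₂, mul_inv_cancel, conj_id]
  have hb : U₂ ⊗ V₂ = conj (deg U) (U₁ ⊗ V₁) := conj_tensor hU₁ hV₁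
  have ht := congrArg (fun k => conjMap (deg U) k (Φ_unit (deg U)).symm
    (conj_tensor hU₁ hV)) (h hU hV)
  beta_reduce at ht
  rw [conjMap_comp _ _ _ _ hb, conjMap_comp _ _ _ _ (conj_tensor hU hV),
    conjMap_conjMap _ _ _ _ _ _ _ (deg U * deg U) rfl (Φ_unit _).symm k₃,
    conjMap_whiskerLeft _ _ _ hU₁ hV₁ hV, conjMap_whiskerRight _ _ _ hU hU₁ hV,
    θ_conj _ _ _ hV₁ hV hs] at ht
  have e : conjMap (deg U) (η_ U V) (Φ_unit (deg U)).symm (conj_tensor hU hV) =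
      (conjMap (deg U * deg U) (η_ U V) (Φ_unit _).symm k₃ ≫
        (conjIso (deg U) (θ U hU) hU hU₁).inv ▷ V₂ ≫ (θ U hU).inv ▷ V₂) ≫
          ((θ U hU).hom ⊗ₘ (θ V₂ hs).hom) := by
    rw [MonoidalCategory.tensorHom_def]
    simp only [Category.assoc, inv_hom_whiskerRight_assoc]
    rw [← whisker_exchange, reassoc_of% ht, conjIso_inv, ← comp_whiskerRight, conjMap_iso_inv,
      id_whiskerRight, Category.comp_id]
  have key := comp_θ_of_unit (conjMap (deg U * deg U) (η_ U V) (Φ_unit _).symm k₃ ≫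
        (conjIso (deg U) (θ U hU) hU hU₁).inv ▷ V₂ ≫ (θ U hU).inv ▷ V₂) hf
  rw [θ_tensor U V₂ hU hs k₁ k₂, ← Category.assoc, ← e] at key
  rw [comp_whiskerRight, ← conjIso_hom]
  simp only [Category.assoc] at key ⊢
  rw [reassoc_of% key, inv_hom_whiskerRight_assoc, conjIso_inv, conjIso_hom, ← comp_whiskerRight,
    conjMap_inv_iso, id_whiskerRight, Category.comp_id]

/-- The tortility equation implies the equation for the inverse square of the twist. -/
theorem Tortile.squareTwist (h : Tortile U V) : SquareTwist U V := by
  intro U₁ V₁ U₂ V₂ hU hV hU₁ hV₁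
  have k₁ : V₂ = conj (deg U₁) V₁ := by rw [deg_conj_self hU, hV₁]
  have dV₂ : deg V₂ = (deg U)⁻¹ := by
    rw [hV₁, hV, deg_conj, deg_conj, deg_dual U V]; group
  have dU₂ : deg U₂ = deg U := by rw [hU₁, hU, deg_conj, deg_conj]; group
  have k₂ : U = conj (deg V₂) U₁ := by rw [dV₂, hU, ← conj_comp, inv_mul_cancel, conj_id]
  have hU₂ : U₂ = conj (deg U * deg U) U := by rw [hU₁, hU, conj_comp]
  have hV₂ : V₂ = conj (deg U * deg U) V := by rw [hV₁, hV, conj_comp]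
  have k₄ : U = conj (deg (V₂ ⊗ U₂)) U := by
    rw [deg_tensor, dV₂, dU₂, inv_mul_cancel, conj_id]
  have e := square_twist_comp (T := (θ U hU ≪≫ conjIso (deg U) (θ U hU) hU hU₁).hom)
    (c V₂ U₁ k₂).hom (c U₂ U (eq_conj_deg hU hU₁)) (conj_zigzag (deg U * deg U) hU₂ hV₂)
    (h.coev_double hU hV hU₁ hV₁ k₁ k₂ (conj_tensor hU₂ hV₂)) (by
      have e := natural_left (Y := U) (Y' := U) (conjMap (deg U * deg U) (ε_ U V)
        (conj_tensor hV₂ hU₂) (Φ_unit _).symm) k₄ (conj_deg_unit _)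
      rw [c_unit_left, c_tensor_left V₂ U₂ U (eq_conj_deg hU hU₁) k₂] at e
      rw [e]
      simp only [Category.assoc])
  rw [← cancel_mono (θ U hU ≪≫ conjIso (deg U) (θ U hU) hU hU₁).hom, Iso.inv_hom_id, ← e]

variable (U V) in
/-- The coevaluation which turns the left dual `V` of `U` into a right dual. -/
def rightCoev : 𝟙_ C ⟶ V ⊗ U :=
  η_ U V ≫ (c U V rfl).hom ≫ (θ (conj (deg U) V) (dual_eq_conj rfl)).hom ▷ U

variable (U V) in
/-- The evaluation which turns the left dual `V` of `U` into a right dual. -/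
def rightEv : U ⊗ V ⟶ 𝟙_ C :=
  (θ U rfl).hom ▷ V ≫ (c (conj (deg U) U) V (by rw [deg_conj_self rfl])).hom ≫
    conjMap (deg U) (ε_ U V) (conj_tensor (X' := conj (deg U) V) rfl rfl) (Φ_unit (deg U)).symm

theorem Tortile.right_zigzag (h : Tortile U V)
    (hd : (θ (conj (deg U) V) (dual_eq_conj rfl)).hom ▷ U ≫ ε_ U V =
      conj (deg U) V ◁ (θ U rfl).hom ≫
        conjMap (deg U) (ε_ U V) (conj_tensor rfl rfl) (Φ_unit (deg U)).symm) :
    (ρ_ U).inv ≫ U ◁ rightCoev U V ≫ (α_ U V U).inv ≫ rightEv U V ▷ U ≫ (λ_ U).hom = 𝟙 U := by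
  obtain ⟨U₁, hU⟩ : ∃ A, A = conj (deg U) U := ⟨_, rfl⟩
  obtain ⟨V₁, hV⟩ : ∃ A, A = conj (deg U) V := ⟨_, rfl⟩
  have k : V₁ = conj (deg U₁) V := by rw [deg_conj_self hU, hV]
  have hd : (θ V₁ (dual_eq_conj hV)).hom ▷ U ≫ ε_ U V = V₁ ◁ (θ U hU).hom ≫
      conjMap (deg U) (ε_ U V) (conj_tensor hV hU) (Φ_unit (deg U)).symm := by
    subst hU hV
    exact hd
  suffices (ρ_ U).inv ≫ U ◁ ((η_ U V ≫ (c U V hV).hom) ≫ (θ V₁ (dual_eq_conj hV)).hom ▷ U) ≫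
      (α_ U V U).inv ≫ ((θ U hU).hom ▷ V ≫ (c U₁ V k).hom ≫ conjMap (deg U) (ε_ U V)
        (conj_tensor hV hU) (Φ_unit (deg U)).symm) ▷ U ≫ (λ_ U).hom = 𝟙 U by
    subst hU hV
    rw [rightCoev, rightEv]
    simpa only [Category.assoc] using this
  obtain ⟨U₂, hU₁⟩ : ∃ A, A = conj (deg U) U₁ := ⟨_, rfl⟩
  obtain ⟨V₂, hV₁⟩ : ∃ A, A = conj (deg U) V₁ := ⟨_, rfl⟩
  have dV₂ : deg V₂ = (deg U)⁻¹ := by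
    rw [hV₁, hV, deg_conj, deg_conj, deg_dual U V]; group
  have hs : V₁ = conj (deg V₂) V₂ := by rw [dV₂, hV₁, ← conj_comp, inv_mul_cancel, conj_id]
  have hU₂ : U₂ = conj (deg U * deg U) U := by rw [hU₁, hU, conj_comp]
  have hV₂ : V₂ = conj (deg U * deg U) V := by rw [hV₁, hV, conj_comp]
  have k₁ : V₂ = conj (deg U₁) V₁ := by rw [deg_conj_self hU, hV₁]
  have hu := Φ_unit (C := C) (deg U)
  have n₁ := c_natural (θ U hU).hom (θ V₁ (dual_eq_conj hV)).hom hV₁ k hV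
  rw [θ_conj _ _ _ hV₁ hV hs] at n₁
  have n₂ := congrArg (fun k => conjMap (deg U) k (conj_tensor hV₁ hU) hu.symm) hd
  beta_reduce at n₂
  rw [conjMap_comp _ _ _ _ (conj_tensor hV hU), conjMap_comp _ _ _ _ (conj_tensor hV₁ hU₁),
    conjMap_whiskerLeft _ _ _ hV₁ hU hU₁, conjMap_whiskerRight _ _ _ hV₁ hV hU,
    conjMap_conjMap _ _ _ _ _ _ _ (deg U * deg U) rfl (conj_tensor hV₂ hU₂) (Φ_unit _).symm,
    θ_conj _ _ _ hV₁ hV hs] at n₂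
  have n₃ := natural_right (X := U) (η_ U V ≫ (c U V hV).hom) hu.symm (conj_tensor hV₁ hU)
  rw [c_unit_right, c_tensor_right U V₁ U hV₁ hU, conjMap_comp _ _ _ _ (conj_tensor hU hV),
    c_conj _ _ _ hV hU hV hV₁ k₁] at n₃
  have hsq := h.squareTwist hU hV hU₁ hV₁
  refine _root_.right_zigzag (t := (θ U hU).hom)
    (T := (θ U hU).hom ≫ conjMap (deg U) (θ U hU).hom hU hU₁) (s₂ := (θ V₂ hs).hom)
    (d₂ := conjMap (deg U * deg U) (ε_ U V) (conj_tensor hV₂ hU₂) (Φ_unit _).symm)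
    (y₁ := conjMap (deg U) (η_ U V) (Φ_unit (deg U)).symm (conj_tensor hU hV) ≫ (c U₁ V₁ k₁).hom)
    (c U U hU) (c U₂ U (eq_conj_deg hU hU₁)) n₁ ?_ ?_ ?_ ?_
  · rw [MonoidalCategory.tensorHom_def', Category.assoc, n₂, whiskerLeft_comp, Category.assoc]
  · simpa only [Category.assoc] using n₃
  · exact (natural_left _ hU (eq_conj_deg hU hU₁)).symm
  · rw [← hsq]
    exact (θ U hU ≪≫ conjIso (deg U) (θ U hU) hU hU₁).hom_inv_id

end CrossedCategory

end CrossedSquareTwist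

section TwistedComodules

open TensorProduct Coalgebra Module

variable {K : Type u} [Field K] {G : Type u} [Group G]

/-- Structures on `V` of a comodule `U` with an isomorphism `U ≅ ᵁU`. -/
@[ext]
structure TwistedComodule (H : CrossedHopfAlgebra K G) (V : Type u) [AddCommGroup V]
    [Module K V] where
  deg : G
  ρ : V →ₗ[K] H.carrier ⊗[K] V
  isCoaction : IsCoaction H.carrier ρ
  mem : ∀ m : V, ρ m ∈ LinearMap.range ((H.comp deg).subtype.rTensor V)
  tw : V ≃ₗ[K] V
  tw_colinear : ∀ v, pushCoaction (H.φl deg) ρ (tw v) = tw.toLinearMap.lTensor H.carrier (ρ v)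

variable {H : CrossedHopfAlgebra K G} {V W U : Type u} [AddCommGroup V] [Module K V]
  [Module.Finite K V] [AddCommGroup W] [Module K W] [Module.Finite K W] [AddCommGroup U]
  [Module K U] [Module.Finite K U]

namespace TwistedComodule

/-- The underlying comodule. -/
noncomputable def obj (s : TwistedComodule H V) : Comod H where
  deg := s.deg
  V := ModuleCat.of K V
  finite := inferInstance
  ρ := s.ρ
  isCoaction := s.isCoaction
  mem := s.mem

/-- The object of the category of twisted objects. -/
noncomputable def twisted (s : TwistedComodule H V) : TwistedObject (Comod H) where
  obj := s.obj
  t := Comod.isoMk s.tw.toModuleIso (by change s.deg = s.deg * s.deg * s.deg⁻¹; group)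
    s.tw_colinear

end TwistedComodule

namespace TwistedObject

variable (Z : TwistedObject (Comod H))

/-- The linear automorphism of a twisted object. -/
noncomputable def twist : Z.obj.V ≃ₗ[K] Z.obj.V :=
  LinearEquiv.ofLinearMap Z.t.hom.f.hom Z.t.inv.f.hom
    (LinearMap.ext fun v => congrArg (fun k => ModuleCat.Hom.hom k v)
      (congrArg Comod.Hom.f Z.t.inv_hom_id))
    (LinearMap.ext fun v => congrArg (fun k => ModuleCat.Hom.hom k v)
      (congrArg Comod.Hom.f Z.t.hom_inv_id))

/-- The twisted comodule which is given by a twisted object. -/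
noncomputable def twistedComodule : TwistedComodule H Z.obj.V where
  deg := Z.obj.deg
  ρ := Z.obj.ρ
  isCoaction := Z.obj.isCoaction
  mem := Z.obj.mem
  tw := Z.twist
  tw_colinear := Z.t.hom.comm

theorem twistedComodule_twisted : Z.twistedComodule.twisted = Z := by
  obtain ⟨X, t⟩ := Z
  have e : ∀ t' : X ≅ conj (CrossedCategory.deg X) X, t'.hom.f = t.hom.f →
      (⟨X, t'⟩ : TwistedObject (Comod H)) = ⟨X, t⟩ := fun t' h => by
    congr 1
    ext1
    ext1
    exact h
  exact e _ rfl

theorem hom_ext_lin {Z Z' : TwistedObject (Comod H)} {k l : Z ⟶ Z'}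
    (h : ∀ v, k.f.f.hom v = l.f.f.hom v) : k = l := by
  ext1
  ext1
  ext1
  exact LinearMap.ext h

end TwistedObject

namespace TwistedComodule

theorem twisted_twistedComodule (s : TwistedComodule H V) : s.twisted.twistedComodule = s :=
  TwistedComodule.ext rfl rfl (LinearEquiv.ext fun _ => rfl)

theorem twisted_injective {s t : TwistedComodule H V} (h : s.twisted = t.twisted) : s = t := by
  have e : HEq s.twisted.twistedComodule t.twisted.twistedComodule := by rw [h]
  rw [twisted_twistedComodule, twisted_twistedComodule] at e
  exact eq_of_heq e

/-- Linear maps which underlie arrows of the category of twisted objects. -/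
def Hom (s : TwistedComodule H V) (t : TwistedComodule H W) (f : V →ₗ[K] W) : Prop :=
  ∃ k : s.twisted ⟶ t.twisted, k.f.f.hom = f

theorem Hom.comp {s : TwistedComodule H V} {t : TwistedComodule H W} {r : TwistedComodule H U} {f g}
    (h : Hom s t f) (h' : Hom t r g) : Hom s r (g ∘ₗ f) := by
  obtain ⟨k, rfl⟩ := h
  obtain ⟨l, rfl⟩ := h'
  exact ⟨k ≫ l, rfl⟩

theorem twisted_comm_iff {s : TwistedComodule H V} {t : TwistedComodule H W} (k : s.obj ⟶ t.obj)
    {X' Y' : Comod H} (hX : X' = CrossedCategory.conj (CrossedCategory.deg s.obj) s.obj)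
    (hY : Y' = CrossedCategory.conj (CrossedCategory.deg t.obj) t.obj)
    (hY' : Y' = CrossedCategory.conj (CrossedCategory.deg s.obj) t.obj) :
    (s.twisted.tw hX).hom ≫ conjMap (CrossedCategory.deg s.obj) k hX hY' =
        k ≫ (t.twisted.tw hY).hom ↔
      ∀ v, k.f.hom (s.tw v) = t.tw (k.f.hom v) := by
  subst hX hY
  constructor
  · intro h v
    have e := congrArg Comod.Hom.f h
    simp only [TwistedObject.tw, Iso.trans_hom, eqToIso.hom, conjMap, Comod.comp_f,
      Comod.eqToHom_f] at e
    exact congrArg (fun k => ModuleCat.Hom.hom k v) e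
  · intro h
    ext1
    simp only [TwistedObject.tw, Iso.trans_hom, eqToIso.hom, conjMap, Comod.comp_f,
      Comod.eqToHom_f]
    ext v
    exact h v

theorem hom_iff {s : TwistedComodule H V} {t : TwistedComodule H W} {f : V →ₗ[K] W} :
    Hom s t f ↔ s.deg = t.deg ∧ (∀ v, t.ρ (f v) = f.lTensor H.carrier (s.ρ v)) ∧
      ∀ v, f (s.tw v) = t.tw (f v) := by
  constructor
  · rintro ⟨k, rfl⟩
    exact ⟨k.f.deg_eq, k.f.comm, (twisted_comm_iff k.f rfl rfl
      (by rw [show CrossedCategory.deg s.obj = CrossedCategory.deg t.obj from k.f.deg_eq])).mp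
        (k.comm _ _ _)⟩
  · rintro ⟨hd, hc, ht⟩
    exact ⟨⟨⟨ModuleCat.ofHom f, hd, hc⟩, fun hX hY hY' =>
      (twisted_comm_iff (s := s) (t := t) _ hX hY hY').mpr ht⟩, rfl⟩

theorem Hom.deg_eq {s : TwistedComodule H V} {t : TwistedComodule H W} {f} (h : Hom s t f) :
    s.deg = t.deg := (hom_iff.mp h).1

theorem Hom.colinear {s : TwistedComodule H V} {t : TwistedComodule H W} {f} (h : Hom s t f)
    (v : V) : t.ρ (f v) = f.lTensor H.carrier (s.ρ v) := (hom_iff.mp h).2.1 v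

theorem Hom.tw_comm {s : TwistedComodule H V} {t : TwistedComodule H W} {f} (h : Hom s t f)
    (v : V) : f (s.tw v) = t.tw (f v) := (hom_iff.mp h).2.2 v

theorem Hom.symm {s : TwistedComodule H V} {t : TwistedComodule H W} {e : V ≃ₗ[K] W}
    (h : Hom s t e.toLinearMap) : Hom t s e.symm.toLinearMap := by
  refine hom_iff.mpr ⟨h.deg_eq.symm, fun w => ?_, fun w => ?_⟩
  · obtain ⟨v, rfl⟩ := e.surjective w
    have := h.colinear v
    rw [LinearEquiv.coe_coe] at this
    rw [this, ← LinearMap.lTensor_comp_apply]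
    simp
  · obtain ⟨v, rfl⟩ := e.surjective w
    have := h.tw_comm v
    rw [LinearEquiv.coe_coe] at this
    simp [← this]

theorem Hom.of_arrow {s : TwistedComodule H V} {t : TwistedComodule H W}
    {Z Z' : TwistedObject (Comod H)} (hs : s.twisted = Z) (ht : t.twisted = Z') (k : Z ⟶ Z')
    {f : V →ₗ[K] W}
    (hf : ∀ v : V, (eqToHom (congrArg TwistedObject.obj ht.symm)).f.hom
      (k.f.f.hom ((eqToHom (congrArg TwistedObject.obj hs)).f.hom v)) = f v) : Hom s t f := by
  refine ⟨eqToHom hs ≫ k ≫ eqToHom ht.symm, LinearMap.ext fun v => ?_⟩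
  rw [TwistedObject.comp_f, TwistedObject.comp_f, TwistedObject.eqToHom_f, TwistedObject.eqToHom_f]
  exact hf v

/-- Structure transport for twisted comodules. -/
noncomputable def transport (e : V ≃ₗ[K] W) (s : TwistedComodule H V) : TwistedComodule H W where
  deg := s.deg
  ρ := transportCoaction e s.ρ
  isCoaction := isCoaction_transport e s.isCoaction
  mem := transportCoaction_mem e s.mem
  tw := e.symm.trans (s.tw.trans e)
  tw_colinear w := by
    obtain ⟨v, rfl⟩ := e.surjective w
    have h := s.tw_colinear v
    rw [pushCoaction_apply] at h
    simp only [LinearEquiv.trans_apply, LinearEquiv.symm_apply_apply]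
    rw [pushCoaction_apply, transportCoaction_apply, transportCoaction_apply,
      ← LinearMap.comp_apply, LinearMap.rTensor_comp_lTensor, ← LinearMap.lTensor_comp_rTensor,
      LinearMap.comp_apply, h, ← LinearMap.lTensor_comp_apply, ← LinearMap.lTensor_comp_apply]
    congr 2
    ext
    simp

theorem transport_hom (e : V ≃ₗ[K] W) (s : TwistedComodule H V) :
    Hom s (s.transport e) e.toLinearMap :=
  hom_iff.mpr ⟨rfl, transportCoaction_apply e s.ρ, fun v => by simp [transport]⟩

/-- The dual of a twisted comodule, with the coaction given by an anti-automorphism. -/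
noncomputable def dual {κ : H.carrier ≃ₗ[K] H.carrier} (hκ : CrossedHopfAlgebra.IsAnti κ)
    (s : TwistedComodule H V) : TwistedComodule H (Dual K V) where
  deg := s.deg⁻¹
  ρ := dualCoaction κ s.ρ
  isCoaction := hκ.isCoaction s.isCoaction
  mem := hκ.dualCoaction_mem s.mem
  tw := s.tw.dualMap
  tw_colinear ξ := by
    have e := dualCoaction_natural κ (f := s.tw.toLinearMap) (ρ := s.ρ)
      (σ := pushCoaction (H.φl s.deg) s.ρ) s.tw_colinear ξ
    rw [dualCoaction_push hκ] at e
    rw [pushCoaction_apply]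
    refine (congrArg _ e).trans ?_
    rw [← LinearMap.comp_apply, LinearMap.rTensor_comp_lTensor, ← LinearMap.lTensor_comp_rTensor,
      LinearMap.comp_apply, pushCoaction_apply, ← LinearMap.rTensor_comp_apply]
    have e' : H.φl s.deg⁻¹ ∘ₗ H.φl s.deg = LinearMap.id := LinearMap.ext fun x => by
      change H.φ s.deg⁻¹ (H.φ s.deg x) = x
      rw [← H.φ_mul, inv_mul_cancel, H.φ_one]
    rw [e', LinearMap.rTensor_id]
    rfl

theorem dual_hom {κ : H.carrier ≃ₗ[K] H.carrier} (hκ : CrossedHopfAlgebra.IsAnti κ)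
    {s : TwistedComodule H V} {t : TwistedComodule H W} {f : V →ₗ[K] W} (h : Hom s t f) :
    Hom (t.dual hκ) (s.dual hκ) f.dualMap :=
  hom_iff.mpr ⟨congrArg _ h.deg_eq.symm, dualCoaction_natural κ h.colinear, fun ξ =>
    LinearMap.ext fun v => congrArg ξ (h.tw_comm v).symm⟩

theorem eval_hom {κ : H.carrier ≃ₗ[K] H.carrier} (hκ : CrossedHopfAlgebra.IsAnti κ)
    (s : TwistedComodule H V) : Hom s ((s.dual hκ.symm).dual hκ) (Dual.eval K V) :=
  hom_iff.mpr ⟨(inv_inv _).symm, dualCoaction_eval κ s.ρ, fun _ => rfl⟩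

end TwistedComodule

end TwistedComodules

section TwistedTensor

open TensorProduct Coalgebra Module

variable {K : Type u} [Field K] {G : Type u} [Group G] {Q : CoquasitriangularHopfAlgebra K G}
  {V W U : Type u} [AddCommGroup V] [Module K V] [Module.Finite K V] [AddCommGroup W]
  [Module K W] [Module.Finite K W] [AddCommGroup U] [Module K U] [Module.Finite K U]

theorem Comod.c_apply (X Y : Comod Q.toCrossedHopfAlgebra) (p : X.V ⊗[K] Y.V) :
    (CrossedBraiding.c X Y rfl).hom.f.hom p = Q.cobraiding.braidMap X.ρ Y.ρ p := by
  have e := congrArg (fun k => ModuleCat.Hom.hom k p) (Comod.c_hom_f Q X Y rfl)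
  exact e

/-- Twisted comodules over a coquasitriangular crossed Hopf algebra. -/
abbrev CoquasitriangularHopfAlgebra.Twisted (Q : CoquasitriangularHopfAlgebra K G) (V : Type u)
    [AddCommGroup V] [Module K V] :=
  TwistedComodule Q.toCrossedHopfAlgebra V

namespace TwistedComodule

/-- The tensor product of twisted comodules. -/
noncomputable def tensor (s : Q.Twisted V) (t : Q.Twisted W) :
    Q.Twisted (V ⊗[K] W) := (s.twisted ⊗ t.twisted).twistedComodule

theorem tensor_twisted (s : Q.Twisted V) (t : Q.Twisted W) :
    (s.tensor t).twisted = s.twisted ⊗ t.twisted := TwistedObject.twistedComodule_twisted _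

theorem tensor_tw (s : Q.Twisted V) (t : Q.Twisted W) (x : V ⊗[K] W) :
    (s.tensor t).tw x = Q.cobraiding.braidMap
      (pushCoaction (Q.φl s.deg) (pushCoaction (Q.φl t.deg) t.ρ)) (pushCoaction (Q.φl s.deg) s.ρ)
      (Q.cobraiding.braidMap (pushCoaction (Q.φl s.deg) s.ρ) (pushCoaction (Q.φl t.deg) t.ρ)
        (TensorProduct.map s.tw.toLinearMap t.tw.toLinearMap x)) := by
  have e : (TwistedObject.tensorObj s.twisted t.twisted).t.hom.f.hom x =
      (CrossedBraiding.c (CrossedCategory.conj (CrossedCategory.deg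
          (CrossedCategory.conj s.deg s.obj)) (CrossedCategory.conj t.deg t.obj))
          (CrossedCategory.conj s.deg s.obj) rfl).hom.f.hom
        ((CrossedBraiding.c (CrossedCategory.conj s.deg s.obj)
          (CrossedCategory.conj t.deg t.obj) rfl).hom.f.hom
          (TensorProduct.map s.tw.toLinearMap t.tw.toLinearMap x)) := by
    simp only [Iso.trans_hom, eqToIso.hom, Comod.comp_f, Comod.eqToHom_f]
    rfl
  have e₁ := Comod.c_apply (CrossedCategory.conj s.deg s.obj) (CrossedCategory.conj t.deg t.obj)
    (TensorProduct.map s.tw.toLinearMap t.tw.toLinearMap x)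
  have e₂ := Comod.c_apply (CrossedCategory.conj (CrossedCategory.deg
    (CrossedCategory.conj s.deg s.obj)) (CrossedCategory.conj t.deg t.obj))
    (CrossedCategory.conj s.deg s.obj)
  refine e.trans ((congrArg _ e₁).trans ((e₂ _).trans ?_))
  have h : (CrossedCategory.conj (CrossedCategory.deg (CrossedCategory.conj s.deg s.obj))
      (CrossedCategory.conj t.deg t.obj)).ρ =
        pushCoaction (Q.φl s.deg) (pushCoaction (Q.φl t.deg) t.ρ) := by
    change pushCoaction (Q.φl (s.deg * s.deg * s.deg⁻¹)) (pushCoaction (Q.φl t.deg) t.ρ) = _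
    rw [mul_inv_cancel_right]
  exact congrArg (fun ρ => Q.cobraiding.braidMap ρ _ _) h

variable (Q) in
/-- The trivial twisted comodule. -/
noncomputable def unit : Q.Twisted K :=
  (𝟙_ (TwistedObject (Comod Q.toCrossedHopfAlgebra))).twistedComodule

theorem unit_twisted : (unit Q).twisted = 𝟙_ (TwistedObject (Comod Q.toCrossedHopfAlgebra)) :=
  TwistedObject.twistedComodule_twisted _

theorem unit_tw (c : K) : (unit Q).tw c = c := by
  change ((TwistedObject.tensorUnit (C := Comod Q.toCrossedHopfAlgebra)).t.hom.f.hom c) = c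
  simp only [eqToIso.hom, Comod.eqToHom_f]
  rfl

/-- The conjugates of a twisted comodule. -/
noncomputable def conj (β : G) (s : Q.Twisted V) : Q.Twisted V :=
  (CrossedCategory.conj β s.twisted).twistedComodule

theorem conj_twisted (β : G) (s : Q.Twisted V) :
    (s.conj β).twisted = CrossedCategory.conj β s.twisted :=
  TwistedObject.twistedComodule_twisted _

theorem conj_tw (β : G) (s : Q.Twisted V) : (s.conj β).tw = s.tw := by
  ext v
  change ((TwistedObject.conjObj β s.twisted).t.hom.f.hom v) = _
  simp only [conjIso_hom, conjMap, Comod.comp_f, Comod.eqToHom_f]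
  rfl

theorem conj_one (s : Q.Twisted V) : s.conj 1 = s :=
  twisted_injective ((conj_twisted _ _).trans (conj_id _))

theorem conj_mul (β γ : G) (s : Q.Twisted V) : s.conj (β * γ) = (s.conj γ).conj β :=
  twisted_injective (by
    rw [conj_twisted, conj_twisted]
    exact (conj_comp β γ s.twisted).trans
      (congrArg (CrossedCategory.conj β) (conj_twisted γ s).symm))

theorem conj_tensor (β : G) (s : Q.Twisted V) (t : Q.Twisted W) :
    (s.tensor t).conj β = (s.conj β).tensor (t.conj β) :=
  twisted_injective (by
    rw [conj_twisted, tensor_twisted, tensor_twisted, conj_twisted, conj_twisted]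
    exact Φ_tensor β s.twisted t.twisted)

theorem conj_unit (β : G) : (unit Q).conj β = unit Q :=
  twisted_injective (by
    rw [conj_twisted, unit_twisted]
    exact Φ_unit β)

theorem conj_dual {κ : Q.toCrossedHopfAlgebra.carrier ≃ₗ[K] Q.toCrossedHopfAlgebra.carrier} (hκ : CrossedHopfAlgebra.IsAnti κ) (β : G)
    (s : Q.Twisted V) : (s.dual hκ).conj β = (s.conj β).dual hκ := by
  refine TwistedComodule.ext ?_ (dualCoaction_push hκ β s.ρ).symm ?_
  · change β * s.deg⁻¹ * β⁻¹ = (β * s.deg * β⁻¹)⁻¹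
    group
  · rw [conj_tw]
    change _ = (s.conj β).tw.dualMap
    rw [conj_tw]
    rfl

theorem tensor_hom {V' W' : Type u} [AddCommGroup V'] [Module K V'] [Module.Finite K V']
    [AddCommGroup W'] [Module K W'] [Module.Finite K W'] {s : Q.Twisted V}
    {t : Q.Twisted W} {s' : Q.Twisted V'} {t' : Q.Twisted W'}
    {f : V →ₗ[K] V'} {g : W →ₗ[K] W'} (h : Hom s s' f) (h' : Hom t t' g) :
    Hom (s.tensor t) (s'.tensor t') (TensorProduct.map f g) := by
  obtain ⟨k, rfl⟩ := h
  obtain ⟨l, rfl⟩ := h'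
  exact Hom.of_arrow (tensor_twisted s t) (tensor_twisted s' t') (k ⊗ₘ l) fun _ => rfl

theorem assoc_hom (s : Q.Twisted V) (t : Q.Twisted W)
    (r : Q.Twisted U) : Hom ((s.tensor t).tensor r) (s.tensor (t.tensor r))
      (TensorProduct.assoc K V W U).toLinearMap :=
  Hom.of_arrow ((tensor_twisted _ r).trans (congrArg (· ⊗ r.twisted) (tensor_twisted s t)))
    ((tensor_twisted s _).trans (congrArg (s.twisted ⊗ ·) (tensor_twisted t r)))
    (α_ s.twisted t.twisted r.twisted).hom fun _ => rfl

theorem lid_hom (s : Q.Twisted V) :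
    Hom ((unit Q).tensor s) s (TensorProduct.lid K V).toLinearMap :=
  Hom.of_arrow ((tensor_twisted _ s).trans (congrArg (· ⊗ s.twisted) unit_twisted)) rfl
    (λ_ s.twisted).hom fun _ => rfl

theorem rid_hom (s : Q.Twisted V) :
    Hom (s.tensor (unit Q)) s (TensorProduct.rid K V).toLinearMap :=
  Hom.of_arrow ((tensor_twisted s _).trans (congrArg (s.twisted ⊗ ·) unit_twisted)) rfl
    (ρ_ s.twisted).hom fun _ => rfl

theorem conj_hom (β : G) {s : Q.Twisted V} {t : Q.Twisted W} {f : V →ₗ[K] W}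
    (h : Hom s t f) : Hom (s.conj β) (t.conj β) f := by
  obtain ⟨k, rfl⟩ := h
  exact Hom.of_arrow (conj_twisted β s) (conj_twisted β t) ((Φ β).map k) fun _ => rfl

/-- The braiding of twisted comodules. -/
noncomputable def braiding (s : Q.Twisted V) (t : Q.Twisted W) :
    V ⊗[K] W ≃ₗ[K] W ⊗[K] V := Q.cobraiding.braidEquiv s.isCoaction t.isCoaction

theorem braiding_hom (s : Q.Twisted V) (t : Q.Twisted W) :
    Hom (s.tensor t) ((t.conj s.deg).tensor s) (s.braiding t).toLinearMap :=
  Hom.of_arrow (tensor_twisted s t)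
    ((tensor_twisted _ s).trans (congrArg (· ⊗ s.twisted) (conj_twisted s.deg t)))
    (CrossedBraiding.c s.twisted t.twisted rfl).hom fun p => by
      refine Eq.trans ?_ (Comod.c_apply s.obj t.obj p)
      rfl

theorem tw_hom (s : Q.Twisted V) : Hom s (s.conj s.deg) s.tw.toLinearMap :=
  Hom.of_arrow rfl (conj_twisted s.deg s) (CrossedTwist.θ s.twisted rfl).hom fun _ => rfl

end TwistedComodule

end TwistedTensor

section BraidMapDual

open TensorProduct Coalgebra Module

variable {K : Type u} [Field K] {G : Type u} [Group G] {Q : CoquasitriangularHopfAlgebra K G}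
  {V W : Type u} [AddCommGroup V] [Module K V] [Module.Finite K V] [AddCommGroup W]
  [Module K W] [Module.Finite K W]

open CrossedBraiding in
theorem Comod.braidMap_unit_right (X : Comod Q.toCrossedHopfAlgebra) (p : X.V ⊗[K] K) :
    Q.cobraiding.braidMap X.ρ (𝟙_ (Comod Q.toCrossedHopfAlgebra)).ρ p =
      TensorProduct.comm K X.V K p := by
  have e := congrArg Comod.Hom.f (c_unit_right X (Φ_unit _).symm)
  rw [Comod.c_hom_f] at e
  have e' := congrArg (fun k => ModuleCat.Hom.hom k p) e
  refine Eq.trans ?_ (e'.trans ?_)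
  · rfl
  · refine LinearMap.congr_fun (f := ((ρ_ X.V).hom ≫ (λ_ X.V).inv).hom)
      (TensorProduct.ext' fun v c => ?_) p
    change (1 : K) ⊗ₜ[K] (c • v) = c ⊗ₜ[K] v
    rw [← TensorProduct.smul_tmul, smul_eq_mul, mul_one]

open CrossedBraiding in
theorem Comod.braidMap_unit_left (X : Comod Q.toCrossedHopfAlgebra) (p : K ⊗[K] X.V) :
    Q.cobraiding.braidMap (𝟙_ (Comod Q.toCrossedHopfAlgebra)).ρ X.ρ p =
      TensorProduct.comm K K X.V p := by
  have e := congrArg Comod.Hom.f (c_unit_left X (conj_deg_unit _))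
  rw [Comod.c_hom_f] at e
  have e' := congrArg (fun k => ModuleCat.Hom.hom k p) e
  refine Eq.trans ?_ (e'.trans ?_)
  · rfl
  · refine LinearMap.congr_fun (f := ((λ_ X.V).hom ≫ (ρ_ X.V).inv).hom)
      (TensorProduct.ext' fun c v => ?_) p
    change (c • v) ⊗ₜ[K] (1 : K) = v ⊗ₜ[K] c
    rw [TensorProduct.smul_tmul, smul_eq_mul, mul_one]

namespace CrossedHopfAlgebra.Cobraiding

omit [Module.Finite K V] [Module.Finite K W] in
theorem dualDistrib_braidMap_tmul (ρ : V →ₗ[K] Q.carrier ⊗[K] V) (σ : W →ₗ[K] Q.carrier ⊗[K] W)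
    (ω : Dual K W) (ξ : Dual K V) (v : V) (w : W) :
    TensorProduct.dualDistrib K W V (ω ⊗ₜ ξ) (Q.cobraiding.braidMap ρ σ (v ⊗ₜ w)) =
      Q.cobraiding.γ (coefR σ ω w ⊗ₜ coefR ρ ξ v) := by
  rw [braidMap_tmul, coefR_apply, coefR_apply]
  generalize ρ v = x
  generalize σ w = y
  induction x with
  | zero => simp
  | add x x' hx hx' => simp only [map_add, bl_add_left, TensorProduct.tmul_add, hx, hx']
  | tmul a v =>
    induction y with
    | zero => simp
    | add y y' hy hy' => simp only [map_add, bl_add_right, TensorProduct.add_tmul, hy, hy']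
    | tmul b w =>
      simp only [bl_tmul, map_smul, TensorProduct.dualDistrib_apply, sliceR_tmul, smul_eq_mul,
        ← TensorProduct.smul_tmul', TensorProduct.tmul_smul]
      ring

theorem γ_coefR_one (X : Comod Q.toCrossedHopfAlgebra) (ξ : Dual K X.V) (v : X.V) :
    Q.cobraiding.γ (coefR X.ρ ξ v ⊗ₜ 1) = ξ v := by
  have e := dualDistrib_braidMap_tmul (Q := Q) (𝟙_ (Comod Q.toCrossedHopfAlgebra)).ρ X.ρ ξ
    (LinearMap.id : K →ₗ[K] K) (1 : K) v
  have e' : coefR (𝟙_ (Comod Q.toCrossedHopfAlgebra)).ρ (LinearMap.id : K →ₗ[K] K) (1 : K) =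
    (1 : Q.carrier) := one_smul K _
  rw [e'] at e
  rw [← e, Comod.braidMap_unit_left]
  simp

theorem γ_one_coefR (X : Comod Q.toCrossedHopfAlgebra) (ξ : Dual K X.V) (v : X.V) :
    Q.cobraiding.γ (1 ⊗ₜ coefR X.ρ ξ v) = ξ v := by
  have e := dualDistrib_braidMap_tmul (Q := Q) X.ρ (𝟙_ (Comod Q.toCrossedHopfAlgebra)).ρ
    (LinearMap.id : K →ₗ[K] K) ξ v (1 : K)
  have e' : coefR (𝟙_ (Comod Q.toCrossedHopfAlgebra)).ρ (LinearMap.id : K →ₗ[K] K) (1 : K) =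
    (1 : Q.carrier) := one_smul K _
  rw [e'] at e
  rw [← e, Comod.braidMap_unit_right]
  simp

omit [Module.Finite K V] [Module.Finite K W] in
theorem bilin_coefR_ext {A : Type*} [AddCommGroup A] [Module K A] {ρ : V →ₗ[K] A ⊗[K] V}
    {σ : W →ₗ[K] A ⊗[K] W} {ι κ : Type*} [Fintype ι] [Fintype κ] [DecidableEq ι] [DecidableEq κ]
    (b : Basis ι K V) (b' : Basis κ K W) {t t' : A →ₗ[K] A →ₗ[K] K}
    (h : ∀ i j k l, t (coefR σ (b'.coord i) (b' j)) (coefR ρ (b.coord k) (b l)) =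
      t' (coefR σ (b'.coord i) (b' j)) (coefR ρ (b.coord k) (b l))) (ω : Dual K W) (w : W)
    (ξ : Dual K V) (v : V) :
    t (coefR σ ω w) (coefR ρ ξ v) = t' (coefR σ ω w) (coefR ρ ξ v) := by
  have h₁ (i j k) (v : V) := LinearMap.congr_fun (b.ext
    (f₁ := t (coefR σ (b'.coord i) (b' j)) ∘ₗ coefR ρ (b.coord k))
    (f₂ := t' (coefR σ (b'.coord i) (b' j)) ∘ₗ coefR ρ (b.coord k)) (h i j k)) v
  have h₂ (i j) (ξ v) := LinearMap.congr_fun (b.dualBasis.ext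
    (f₁ := t (coefR σ (b'.coord i) (b' j)) ∘ₗ (coefR ρ).flip v)
    (f₂ := t' (coefR σ (b'.coord i) (b' j)) ∘ₗ (coefR ρ).flip v) fun k => by
      rw [b.coe_dualBasis]; exact h₁ i j k v) ξ
  have h₃ (i) (w : W) := LinearMap.congr_fun (b'.ext
    (f₁ := t.flip (coefR ρ ξ v) ∘ₗ coefR σ (b'.coord i))
    (f₂ := t'.flip (coefR ρ ξ v) ∘ₗ coefR σ (b'.coord i)) fun j => h₂ i j ξ v) w
  exact LinearMap.congr_fun (b'.dualBasis.ext
    (f₁ := t.flip (coefR ρ ξ v) ∘ₗ (coefR σ).flip w)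
    (f₂ := t'.flip (coefR ρ ξ v) ∘ₗ (coefR σ).flip w) fun i => by
      rw [b'.coe_dualBasis]; exact h₃ i w) ω

theorem γ_S_coefR (X Y : Comod Q.toCrossedHopfAlgebra) (ξ : Dual K X.V) (v : X.V) (ω : Dual K Y.V)
    (w : Y.V) : Q.cobraiding.γ (Q.S (coefR Y.ρ ω w) ⊗ₜ coefR X.ρ ξ v) =
      Q.cobraiding.γ (Q.φl X.deg (coefR Y.ρ ω w) ⊗ₜ Q.S.symm (coefR X.ρ ξ v)) := by
  classical
  let b := finBasis K X.V
  let b' := finBasis K Y.V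
  refine bilin_coefR_ext b b' (t := TensorProduct.curry Q.cobraiding.γ ∘ₗ Q.S.toLinearMap)
    (t' := (TensorProduct.curry Q.cobraiding.γ).compl₁₂ (Q.φl X.deg) Q.S.symm.toLinearMap)
    (fun i j k l => ?_) ω w ξ v
  let F : Matrix (Fin (finrank K Y.V) × Fin (finrank K X.V))
    (Fin (finrank K Y.V) × Fin (finrank K X.V)) K := Matrix.of fun p q =>
      Q.cobraiding.γ (coefR Y.ρ (b'.coord q.1) (b' p.1) ⊗ₜ coefR X.ρ (b.coord q.2) (b p.2))
  let E : Matrix (Fin (finrank K Y.V) × Fin (finrank K X.V))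
    (Fin (finrank K Y.V) × Fin (finrank K X.V)) K := Matrix.of fun p q =>
      Q.cobraiding.γ (Q.S (coefR Y.ρ (b'.coord q.1) (b' p.1)) ⊗ₜ coefR X.ρ (b.coord q.2) (b p.2))
  let E' : Matrix (Fin (finrank K Y.V) × Fin (finrank K X.V))
    (Fin (finrank K Y.V) × Fin (finrank K X.V)) K := Matrix.of fun p q =>
      Q.cobraiding.γ (Q.φl X.deg (coefR Y.ρ (b'.coord q.1) (b' p.1)) ⊗ₜ
        Q.S.symm (coefR X.ρ (b.coord q.2) (b p.2)))
  have hone : (1 : Matrix (Fin (finrank K Y.V) × Fin (finrank K X.V))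
      (Fin (finrank K Y.V) × Fin (finrank K X.V)) K) = Matrix.of fun p q =>
      (b'.coord q.1) (b' p.1) * (b.coord q.2) (b p.2) := by
    ext p q
    simp [Matrix.one_apply, Finsupp.single_apply, Prod.ext_iff, ← ite_and, and_comm]
  have h₁ : E * F = 1 := by
    rw [hone]
    ext p q
    rw [Matrix.mul_apply, Fintype.sum_prod_type]
    have e := Q.S_mul (coefR Y.ρ (b'.coord q.1) (b' p.1))
    rw [comul_coefR b', counit_coefR'] at e
    have e' := congrArg (fun x => Q.cobraiding.γ (x ⊗ₜ[K] coefR X.ρ (b.coord q.2) (b p.2))) e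
    simp only [map_sum, LinearMap.rTensor_tmul, LinearMap.mul'_apply, TensorProduct.sum_tmul,
      Q.cobraiding.mul_left, comul_coefR b, TensorProduct.map_tmul,
      Algebra.algebraMap_eq_smul_one, ← TensorProduct.smul_tmul', map_smul, γ_one_coefR] at e'
    exact e'
  have h₂ : F * E' = 1 := by
    rw [hone]
    ext p q
    rw [Matrix.mul_apply, Fintype.sum_prod_type_right]
    have e := Q.S_symm_mul (coefR X.ρ (b.coord q.2) (b p.2))
    rw [comul_coefR b, counit_coefR'] at e
    have e' := congrArg (fun x => Q.cobraiding.γ (coefR Y.ρ (b'.coord q.1) (b' p.1) ⊗ₜ[K] x)) e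
    simp only [map_sum, TensorProduct.comm_tmul, LinearMap.rTensor_tmul, LinearMap.mul'_apply,
      TensorProduct.tmul_sum, Q.cobraiding.mul_right X.deg _ _ _ (coefR_mem X _ _), comul_coefR b',
      TensorProduct.map_tmul, Algebra.algebraMap_eq_smul_one, TensorProduct.tmul_smul, map_smul,
      γ_coefR_one] at e'
    refine Eq.trans ?_ (e'.trans (mul_comm _ _))
    rfl
  have h : E = E' := left_inv_eq_right_inv h₁ h₂
  exact congrFun (congrFun h (j, l)) (i, k)

/-- The transpose of the braiding is the braiding of the dual comodules. -/
theorem dualDistrib_braidMap (X Y : Comod Q.toCrossedHopfAlgebra) (y : Dual K X.V ⊗[K] Dual K Y.V)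
    (x : X.V ⊗[K] Y.V) :
    TensorProduct.dualDistrib K Y.V X.V (TensorProduct.comm K _ _ y)
        (Q.cobraiding.braidMap X.ρ Y.ρ x) =
      TensorProduct.dualDistrib K X.V Y.V (TensorProduct.comm K _ _
        (Q.cobraiding.braidMap (dualCoaction Q.S.symm X.ρ)
          (pushCoaction (Q.φl X.deg) (dualCoaction Q.S.symm Y.ρ)) y)) x := by
  induction y with
  | zero => simp
  | add y y' h h' => simp only [map_add, LinearMap.add_apply, h, h']
  | tmul ξ ω =>
  induction x with
  | zero => simp
  | add x x' h h' => simp only [map_add, h, h']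
  | tmul v w =>
  have e (z : Dual K Y.V ⊗[K] Dual K X.V) :
      TensorProduct.dualDistrib K X.V Y.V (TensorProduct.comm K _ _ z) (v ⊗ₜ[K] w) =
        TensorProduct.dualDistrib K (Dual K Y.V) (Dual K X.V)
          (Dual.eval K Y.V w ⊗ₜ Dual.eval K X.V v) z := by
    induction z with
    | zero => simp
    | add z z' h h' => simp only [map_add, LinearMap.add_apply, h, h']
    | tmul ω ξ => simp [mul_comm]
  rw [TensorProduct.comm_tmul, dualDistrib_braidMap_tmul, e, dualDistrib_braidMap_tmul, coefR_dualCoaction,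
    ← dualCoaction_push isAnti_S.symm, coefR_dualCoaction]
  have e' : coefR (pushCoaction (Q.φl X.deg) Y.ρ) ω w = Q.φl X.deg (coefR Y.ρ ω w) := by
    rw [coefR_apply, pushCoaction_apply, sliceR_rTensor, coefR_apply]
  have e₁ := γ_S_coefR X Y.leftDual ξ v (Dual.eval K Y.V w) ω
  have e₂ : coefR Y.leftDual.ρ (Dual.eval K Y.V w) ω = Q.S.symm (coefR Y.ρ ω w) :=
    coefR_dualCoaction _ _ _ _
  rw [e₂, LinearEquiv.apply_symm_apply] at e₁
  rw [e', e₁]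
  exact congrArg (fun z => Q.cobraiding.γ (z ⊗ₜ _)) (isAnti_S.symm.φ X.deg _)

end CrossedHopfAlgebra.Cobraiding

end BraidMapDual

section RibbonComodules

open TensorProduct Coalgebra Module

variable {K : Type u} [Field K] {G : Type u} [Group G] {Q : CoquasitriangularHopfAlgebra K G}
  {V W U : Type u} [AddCommGroup V] [Module K V] [Module.Finite K V] [AddCommGroup W]
  [Module K W] [Module.Finite K W] [AddCommGroup U] [Module K U] [Module.Finite K U]

theorem sliceR_coevaluation (v : V) :
    sliceR V (Dual.eval K V v) (coevaluation K V (1 : K)) = v := by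
  rw [coevaluation_apply_one, map_sum]
  simp only [sliceR_tmul]
  exact (Basis.ofVectorSpace K V).sum_repr v

theorem sliceR_ext_eval_tmul {M : Type*} [AddCommGroup M] [Module K M]
    {x y : M ⊗[K] Dual K (V ⊗[K] W)}
    (h : ∀ v w, sliceR M (Dual.eval K (V ⊗[K] W) (v ⊗ₜ w)) x =
      sliceR M (Dual.eval K (V ⊗[K] W) (v ⊗ₜ w)) y) : x = y :=
  sliceR_ext_eval fun z => by
    induction z with
    | zero => simp [sliceR]
    | add z z' h h' => rw [map_add, sliceR_add, sliceR_add, h, h']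
    | tmul v w => exact h v w

theorem map_symm_coevaluation (e : V ≃ₗ[K] W) :
    TensorProduct.map e.toLinearMap e.symm.toLinearMap.dualMap (coevaluation K V (1 : K)) =
      coevaluation K W 1 := by
  have h := map_coevaluation (K := K) e.toLinearMap
  rw [← LinearMap.lTensor_comp_rTensor, LinearMap.comp_apply, h, ← LinearMap.lTensor_comp_apply,
    LinearMap.dualMap_comp_dualMap]
  simp

variable (K V W) in
/-- The arrow `W* ⊗ V* → (V ⊗ W)*`. -/
noncomputable def dualTensor : Dual K W ⊗[K] Dual K V →ₗ[K] Dual K (V ⊗[K] W) :=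
  TensorProduct.dualDistrib K V W ∘ₗ (TensorProduct.comm K _ _).toLinearMap

namespace TwistedComodule

open CrossedHopfAlgebra

variable {s : Q.Twisted V}
  {t : Q.Twisted W}

theorem unit_ρ (c : K) : (unit Q).ρ c = (1 : Q.carrier) ⊗ₜ[K] c := rfl

theorem tensor_ρ (s : Q.Twisted V)
    (t : Q.Twisted W) :
    (s.tensor t).ρ = tensorCoaction s.ρ t.ρ := rfl

theorem unit_hom_iff {x : V ⊗[K] W} :
    (∃ f, Hom (unit Q) (s.tensor t) f ∧ f 1 = x) ↔ s.deg * t.deg = 1 ∧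
      tensorCoaction s.ρ t.ρ x = (1 : Q.carrier) ⊗ₜ[K] x ∧ (s.tensor t).tw x = x := by
  constructor
  · rintro ⟨f, h, rfl⟩
    refine ⟨h.deg_eq.symm, ?_, ?_⟩
    · have e := h.colinear 1
      rwa [unit_ρ, LinearMap.lTensor_tmul] at e
    · have e := h.tw_comm 1
      rw [unit_tw] at e
      exact e.symm
  · rintro ⟨h₁, h₂, h₃⟩
    refine ⟨LinearMap.toSpanSingleton K _ x, hom_iff.mpr ⟨h₁.symm, fun c => ?_, fun c => ?_⟩, ?_⟩
    · rw [unit_ρ, LinearMap.lTensor_tmul, LinearMap.toSpanSingleton_apply, map_smul, tensor_ρ, h₂,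
        TensorProduct.tmul_smul]
    · rw [unit_tw]
      simp [h₃]
    · simp

/-- The coevaluation is an arrow of twisted comodules. -/
def IsRibbon (s : Q.Twisted V) : Prop :=
  Hom (unit Q) (s.tensor (s.dual isAnti_S.symm)) (coevaluation K V)

theorem isRibbon_iff : s.IsRibbon ↔
    (s.tensor (s.dual isAnti_S.symm)).tw (coevaluation K V 1) = coevaluation K V 1 := by
  constructor
  · intro h
    rw [← h.tw_comm, unit_tw]
  · intro h
    obtain ⟨f, hf, h1⟩ := (unit_hom_iff (s := s) (t := s.dual isAnti_S.symm)).mpr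
      ⟨mul_inv_cancel s.deg, coevaluation_colinear s.isCoaction Q.mul_S_symm, h⟩
    rwa [show f = coevaluation K V from LinearMap.ext_ring h1] at hf

theorem IsRibbon.of_equiv (h : s.IsRibbon) {e : V ≃ₗ[K] W} (he : Hom s t e.toLinearMap) :
    t.IsRibbon := by
  have := Hom.comp h (tensor_hom he (dual_hom isAnti_S.symm he.symm))
  rwa [show _ ∘ₗ _ = coevaluation K W from LinearMap.ext_ring (map_symm_coevaluation e)] at this

theorem IsRibbon.conj (h : s.IsRibbon) (β : G) : (s.conj β).IsRibbon := by
  have := conj_hom β h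
  rwa [conj_unit, conj_tensor, conj_dual] at this

theorem id_hom (s : Q.Twisted V) : Hom s s LinearMap.id :=
  ⟨𝟙 _, rfl⟩

theorem isRibbon_unit : (unit Q).IsRibbon := by
  have e : Hom (unit Q) ((unit Q).dual isAnti_S.symm) (LinearMap.toSpanSingleton K _
      (LinearMap.id : K →ₗ[K] K)) := by
    refine hom_iff.mpr ⟨inv_one.symm, fun c => sliceR_ext_eval fun d => ?_, fun c => ?_⟩
    · have e : coefR (unit Q).ρ (LinearMap.id : K →ₗ[K] K) d = d • (1 : Q.carrier) := rfl
      have e' := coefR_dualCoaction Q.S.symm (unit Q).ρ d (LinearMap.id : K →ₗ[K] K)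
      rw [e, map_smul, isAnti_S.symm.one] at e'
      rw [unit_ρ, LinearMap.lTensor_tmul, LinearMap.toSpanSingleton_apply, map_smul, map_smul,
        TensorProduct.tmul_smul, map_smul, sliceR_tmul]
      exact congrArg (c • ·) e'
    · rw [unit_tw]
      ext
      have e : ∀ ξ : Dual K K, ((unit Q).dual isAnti_S.symm).tw ξ 1 = ξ 1 := fun ξ =>
        congrArg ξ (unit_tw 1)
      rw [e]
  have := (rid_hom (unit Q)).symm.comp (tensor_hom (id_hom (unit Q)) e)
  rwa [show _ ∘ₗ _ = coevaluation K K from LinearMap.ext_ring (sliceR_ext_eval fun d => ?_)] at this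
  rw [sliceR_coevaluation]
  change sliceR K (Dual.eval K K d) ((1 : K) ⊗ₜ[K] ((1 : K) • (LinearMap.id : K →ₗ[K] K))) = d
  simp

omit [Module.Finite K V] in
theorem push_push {H : CrossedHopfAlgebra K G} (β γ : G) (ρ : V →ₗ[K] H.carrier ⊗[K] V) :
    pushCoaction (H.φl β) (pushCoaction (H.φl γ) ρ) = pushCoaction (H.φl (β * γ)) ρ := by
  ext v
  rw [pushCoaction_apply, pushCoaction_apply, pushCoaction_apply, ← LinearMap.rTensor_comp_apply]
  congr 2
  exact LinearMap.ext fun h => (H.φ_mul β γ h).symm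

omit [Module.Finite K V] in
theorem tw_push (s : Q.Twisted V) (β : G) (v : V) :
    pushCoaction (Q.φl (β * s.deg)) s.ρ (s.tw v) =
      s.tw.toLinearMap.lTensor Q.carrier (pushCoaction (Q.φl β) s.ρ v) := by
  rw [← push_push, pushCoaction_apply, s.tw_colinear, pushCoaction_apply, ← LinearMap.comp_apply,
    LinearMap.rTensor_comp_lTensor, ← LinearMap.lTensor_comp_rTensor, LinearMap.comp_apply]

theorem tensor_tw_eq (s : Q.Twisted V)
    (t : Q.Twisted W) (β : G) (x : V ⊗[K] W) :
    (s.tensor t).tw x = TensorProduct.map s.tw.toLinearMap t.tw.toLinearMap (Q.cobraiding.braidMap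
      (pushCoaction (Q.φl (β * s.deg)) t.ρ) (pushCoaction (Q.φl β) s.ρ)
      (Q.cobraiding.braidMap (pushCoaction (Q.φl β) s.ρ) (pushCoaction (Q.φl β) t.ρ) x)) := by
  have n₁ := LinearMap.congr_fun (Q.cobraiding.braidMap_natural s.tw.toLinearMap t.tw.toLinearMap
    (s.tw_push β) (t.tw_push β)) x
  have n₂ := LinearMap.congr_fun (Q.cobraiding.braidMap_natural t.tw.toLinearMap s.tw.toLinearMap
    (t.tw_push (β * s.deg)) (s.tw_push β))
    (Q.cobraiding.braidMap (pushCoaction (Q.φl β) s.ρ) (pushCoaction (Q.φl β) t.ρ) x)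
  simp only [LinearMap.comp_apply] at n₁ n₂
  rw [← n₂, ← n₁, tensor_tw, ← Q.cobraiding.braidMap_push β (pushCoaction _ (pushCoaction _ t.ρ)),
    ← Q.cobraiding.braidMap_push β (pushCoaction _ s.ρ) (pushCoaction _ t.ρ)]
  simp only [push_push, mul_assoc]

theorem dualDistrib_push (s : Q.Twisted V)
    (t : Q.Twisted W) (α β : G) (y : Dual K V ⊗[K] Dual K W)
    (x : V ⊗[K] W) :
    TensorProduct.dualDistrib K W V (TensorProduct.comm K _ _ y) (Q.cobraiding.braidMap
        (pushCoaction (Q.φl α) s.ρ) (pushCoaction (Q.φl β) t.ρ) x) =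
      TensorProduct.dualDistrib K V W (TensorProduct.comm K _ _ (Q.cobraiding.braidMap
        (pushCoaction (Q.φl α) (s.dual isAnti_S.symm).ρ)
        (pushCoaction (Q.φl (α * s.deg * α⁻¹ * β)) (t.dual isAnti_S.symm).ρ) y)) x := by
  have e := Cobraiding.dualDistrib_braidMap (CrossedCategory.conj α s.obj)
    (CrossedCategory.conj β t.obj) y x
  refine e.trans ?_
  change TensorProduct.dualDistrib K V W (TensorProduct.comm K _ _ (Q.cobraiding.braidMap
    (dualCoaction Q.S.symm (pushCoaction (Q.φl α) s.ρ)) (pushCoaction (Q.φl (α * s.deg * α⁻¹))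
      (dualCoaction Q.S.symm (pushCoaction (Q.φl β) t.ρ))) y)) x = _
  rw [dualCoaction_push isAnti_S.symm, dualCoaction_push isAnti_S.symm, push_push]
  rfl

theorem dualTensor_hom (s : Q.Twisted V)
    (t : Q.Twisted W) :
    Hom ((t.dual isAnti_S.symm).tensor (s.dual isAnti_S.symm))
      ((s.tensor t).dual isAnti_S.symm) (dualTensor K V W) := by
  refine hom_iff.mpr ⟨(mul_inv_rev _ _).symm, fun y => ?_, fun y => ?_⟩
  · refine sliceR_ext_eval_tmul fun v w => ?_
    have e₁ := sliceR_lTensor (M := Q.carrier) (V := Dual K W ⊗[K] Dual K V)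
      (Dual.eval K (V ⊗[K] W) (v ⊗ₜ w)) (dualTensor K V W)
      (tensorCoaction (dualCoaction Q.S.symm t.ρ) (dualCoaction Q.S.symm s.ρ) y)
    have e := coefR_dualCoaction Q.S.symm (tensorCoaction s.ρ t.ρ) (v ⊗ₜ w) (dualTensor K V W y)
    refine e.trans (Eq.trans ?_ e₁.symm)
    clear e e₁
    induction y with
    | zero => simp
    | add y y' h h' => simp only [map_add, LinearMap.add_apply, h, h']
    | tmul ω ξ =>
    have e : Dual.eval K (V ⊗[K] W) (v ⊗ₜ w) ∘ₗ dualTensor K V W =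
        TensorProduct.dualDistrib K _ _ (Dual.eval K W w ⊗ₜ Dual.eval K V v) :=
      TensorProduct.ext' fun ω ξ => by simp [dualTensor, mul_comm]
    have e' : dualTensor K V W (ω ⊗ₜ ξ) = TensorProduct.dualDistrib K V W (ξ ⊗ₜ ω) := rfl
    rw [e, tensorCoaction_tmul, sliceR_mulT, ← coefR_apply, ← coefR_apply, coefR_dualCoaction,
      coefR_dualCoaction, e', coefR_apply, tensorCoaction_tmul, sliceR_mulT, isAnti_S.symm.mul]
    rfl
  · refine LinearMap.ext fun x => ?_
    change _ = dualTensor K V W y ((s.tensor t).tw x)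
    rw [tensor_tw_eq s t (t.deg⁻¹ * s.deg⁻¹), inv_mul_cancel_right]
    have e : ∀ x, dualTensor K V W y (TensorProduct.map s.tw.toLinearMap t.tw.toLinearMap x) =
        dualTensor K V W (TensorProduct.map t.tw.toLinearMap.dualMap s.tw.toLinearMap.dualMap y) x :=
      fun x => by
        induction y with
        | zero => simp
        | add y y' h h' => simp only [map_add, LinearMap.add_apply, h, h']
        | tmul ω ξ =>
          refine LinearMap.congr_fun (f := dualTensor K V W (ω ⊗ₜ ξ) ∘ₗ TensorProduct.map _ _)
            (TensorProduct.ext' fun v w => ?_) x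
          simp [dualTensor]
    rw [e]
    refine Eq.trans ?_ (dualDistrib_push t s _ _ _ _).symm
    obtain ⟨z, hz⟩ : ∃ z, z = Q.cobraiding.braidMap (pushCoaction (Q.φl t.deg⁻¹)
      (t.dual isAnti_S.symm).ρ) (pushCoaction (Q.φl (t.deg⁻¹ * t.deg * t.deg⁻¹⁻¹ *
        (t.deg⁻¹ * s.deg⁻¹))) (s.dual isAnti_S.symm).ρ) (TensorProduct.map t.tw.toLinearMap.dualMap
          s.tw.toLinearMap.dualMap y) := ⟨_, rfl⟩
    rw [← hz]
    refine Eq.trans ?_ (dualDistrib_push s t _ _ z _).symm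
    subst hz
    rw [tensor_tw, push_push]
    have e₁ : t.deg⁻¹ * s.deg⁻¹ * s.deg * (t.deg⁻¹ * s.deg⁻¹)⁻¹ * (t.deg⁻¹ * s.deg⁻¹) = t.deg⁻¹ := by
      group
    have e₂ : t.deg⁻¹ * t.deg * t.deg⁻¹⁻¹ * (t.deg⁻¹ * s.deg⁻¹) = s.deg⁻¹ := by group
    rw [e₁, e₂]
    rfl

omit [Module.Finite K V] [Module.Finite K W] in
theorem sliceR_map_dualTensor (v : V) (w : W) (p : V ⊗[K] Dual K V) (q : W ⊗[K] Dual K W) :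
    sliceR _ (Dual.eval K (V ⊗[K] W) (v ⊗ₜ w)) (TensorProduct.map LinearMap.id (dualTensor K V W)
      ((TensorProduct.assoc K V W _).symm (TensorProduct.map LinearMap.id
        (TensorProduct.assoc K W _ _).toLinearMap (TensorProduct.assoc K V _ _
          (TensorProduct.map (TensorProduct.map LinearMap.id (LinearMap.toSpanSingleton K _ q) ∘ₗ
            (TensorProduct.rid K V).symm.toLinearMap) LinearMap.id p))))) =
      sliceR V (Dual.eval K V v) p ⊗ₜ[K] sliceR W (Dual.eval K W w) q := by
  induction p with
  | zero => simp
  | add p p' h h' => simp only [map_add, h, h', TensorProduct.add_tmul]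
  | tmul v' ξ =>
  induction q with
  | zero => simp
  | add q q' h h' =>
    simp only [TensorProduct.map_tmul, LinearMap.comp_apply, LinearEquiv.coe_coe,
      TensorProduct.rid_symm_apply, LinearMap.toSpanSingleton_apply, one_smul, LinearMap.id_apply,
      TensorProduct.tmul_add, TensorProduct.add_tmul, map_add] at h h' ⊢
    rw [h, h']
  | tmul w' ω =>
    simp [dualTensor, sliceR_tmul, TensorProduct.smul_tmul', TensorProduct.tmul_smul, smul_smul, mul_comm]

theorem IsRibbon.tensor (h : s.IsRibbon) (h' : t.IsRibbon) : (s.tensor t).IsRibbon := by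
  have i := h.comp ((tensor_hom ((rid_hom s).symm.comp (tensor_hom (id_hom s) h'))
    (id_hom (s.dual isAnti_S.symm))).comp ((assoc_hom _ _ _).comp ((tensor_hom (id_hom s)
      (assoc_hom _ _ _)).comp ((assoc_hom _ _ _).symm.comp (tensor_hom (id_hom _)
        (dualTensor_hom s t))))))
  rwa [show _ ∘ₗ _ = coevaluation K (V ⊗[K] W) from
    LinearMap.ext_ring (sliceR_ext_eval_tmul fun v w => ?_)] at i
  have e := sliceR_map_dualTensor v w (coevaluation K V 1) (coevaluation K W 1)
  rw [sliceR_coevaluation, sliceR_coevaluation, show LinearMap.toSpanSingleton K _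
    (coevaluation K W (1 : K)) = coevaluation K W from LinearMap.ext_ring (one_smul K _)] at e
  rw [sliceR_coevaluation]
  exact e

end TwistedComodule

end RibbonComodules

section RibbonDuals

open TensorProduct Coalgebra Module

variable {K : Type u} [Field K] {G : Type u} [Group G] {Q : CoquasitriangularHopfAlgebra K G}
  {V W U : Type u} [AddCommGroup V] [Module K V] [Module.Finite K V] [AddCommGroup W]
  [Module K W] [Module.Finite K W] [AddCommGroup U] [Module K U] [Module.Finite K U]

theorem sliceR_comm_coevaluation (ξ : Dual K V) :
    sliceR (Dual K V) ξ (TensorProduct.comm K _ _ (coevaluation K V (1 : K))) = ξ := by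
  rw [coevaluation_apply_one]
  simp only [map_sum, TensorProduct.comm_tmul, sliceR_tmul]
  exact (Basis.ofVectorSpace K V).sum_dual_apply_smul_coord ξ

omit [Module.Finite K V] [Module.Finite K W] [Module.Finite K U] in
theorem lid_map_assoc (e : U ⊗[K] V →ₗ[K] K) (p : V ⊗[K] W) (u : U) :
    TensorProduct.lid K W (TensorProduct.map e LinearMap.id ((TensorProduct.assoc K U V W).symm
      (u ⊗ₜ p))) = sliceR W (TensorProduct.curry e u) (TensorProduct.comm K V W p) := by
  induction p with
  | zero => simp
  | add p p' h h' => simp only [map_add, TensorProduct.tmul_add, h, h']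
  | tmul v w => simp

omit [Module.Finite K V] [Module.Finite K W] [Module.Finite K U] in
theorem rid_map_assoc (e : W ⊗[K] U →ₗ[K] K) (p : V ⊗[K] W) (u : U) :
    TensorProduct.rid K V (TensorProduct.map LinearMap.id e (TensorProduct.assoc K V W U
      (p ⊗ₜ u))) = sliceR V ((TensorProduct.curry e).flip u) p := by
  induction p with
  | zero => simp
  | add p p' h h' => simp only [map_add, TensorProduct.add_tmul, h, h']
  | tmul v w => simp

/-- The arrow to the left dual which is given by a pairing. -/
theorem Comod.curry_colinear {H : CrossedHopfAlgebra K G} {N X : Comod H} (e : N ⊗ X ⟶ 𝟙_ (Comod H))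
    (n : N.V) : X.leftDual.ρ (TensorProduct.curry e.f.hom n) =
      (TensorProduct.curry e.f.hom).lTensor H.carrier (N.ρ n) := by
  let k : N ⟶ X.leftDual :=
    (ρ_ N).inv ≫ N ◁ leftCoev X ≫ (α_ _ _ _).inv ≫ e ▷ X.leftDual ≫ (λ_ _).hom
  have hk : k.f.hom = TensorProduct.curry e.f.hom :=
    LinearMap.ext fun n => (lid_map_assoc e.f.hom (coevaluation K X.V (1 : K)) n).trans
      (sliceR_comm_coevaluation _)
  rw [← hk]
  exact k.comm n

/-- The arrow to the right dual which is given by a pairing. -/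
theorem Comod.curry_flip_colinear {H : CrossedHopfAlgebra K G} {N X : Comod H}
    (e : X ⊗ N ⟶ 𝟙_ (Comod H)) (n : N.V) :
    X.rightDual.ρ ((TensorProduct.curry e.f.hom).flip n) =
      (TensorProduct.curry e.f.hom).flip.lTensor H.carrier (N.ρ n) := by
  let b : 𝟙_ (Comod H) ⟶ X.rightDual ⊗ X :=
    { f := ModuleCat.ofHom ((TensorProduct.comm K _ _).toLinearMap ∘ₗ coevaluation K X.V)
      deg_eq := (inv_mul_cancel _).symm
      comm := fun c => by
        obtain ⟨c, rfl⟩ : ∃ d : K, c = d • 1 := ⟨c, by simp⟩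
        rw [map_smul, map_smul, map_smul, map_smul]
        congr 1
        exact comm_coevaluation_colinear X.isCoaction H.S_mul }
  let k : N ⟶ X.rightDual := (λ_ N).inv ≫ b ▷ N ≫ (α_ _ _ _).hom ≫ X.rightDual ◁ e ≫ (ρ_ _).hom
  have hk : k.f.hom = (TensorProduct.curry e.f.hom).flip := by
    refine LinearMap.ext fun n => ?_
    refine (rid_map_assoc e.f.hom (TensorProduct.comm K _ _ (coevaluation K X.V (1 : K))) n).trans ?_
    exact sliceR_comm_coevaluation _
  rw [← hk]
  exact k.comm n

namespace TwistedComodule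

open CrossedHopfAlgebra

variable {s : Q.Twisted V}
  {t : Q.Twisted W}

theorem map_tensor_tw {f : W →ₗ[K] K}
    (hf : ∀ w, f.lTensor Q.carrier (t.ρ w) = (1 : Q.carrier) ⊗ₜ[K] f w) (x : V ⊗[K] W) :
    TensorProduct.map LinearMap.id f ((s.tensor t).tw x) =
      TensorProduct.map s.tw.toLinearMap (f ∘ₗ t.tw.toLinearMap) x := by
  have hβ (β : G) (w : W) : (unit Q).ρ (f w) = f.lTensor Q.carrier
      (pushCoaction (Q.φl β) t.ρ w) := by
    rw [pushCoaction_apply, ← LinearMap.comp_apply (LinearMap.lTensor _ _),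
      LinearMap.lTensor_comp_rTensor, ← LinearMap.rTensor_comp_lTensor, LinearMap.comp_apply, hf, LinearMap.rTensor_tmul, unit_ρ]
    exact congrArg (· ⊗ₜ[K] f w) (map_one (Q.φ β)).symm
  have hg (β : G) (w : W) : (unit Q).ρ ((f ∘ₗ t.tw.toLinearMap) w) =
      (f ∘ₗ t.tw.toLinearMap).lTensor Q.carrier (pushCoaction (Q.φl β) t.ρ w) := by
    rw [LinearMap.lTensor_comp_apply, ← tw_push, ← hβ]
    rfl
  have n₁ := LinearMap.congr_fun (Q.cobraiding.braidMap_natural (ρ := pushCoaction (Q.φl 1) s.ρ)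
    (ρ₁ := pushCoaction (Q.φl 1) s.ρ) LinearMap.id (f ∘ₗ t.tw.toLinearMap) (fun v => by rw [LinearMap.lTensor_id]; rfl) (hg 1)) x
  have n₂ := LinearMap.congr_fun (Q.cobraiding.braidMap_natural (σ := pushCoaction (Q.φl 1) s.ρ)
    (σ₁ := pushCoaction (Q.φl 1) s.ρ) (f ∘ₗ t.tw.toLinearMap) LinearMap.id (hg (1 * s.deg))
    (fun v => by rw [LinearMap.lTensor_id]; rfl))
    (Q.cobraiding.braidMap (pushCoaction (Q.φl 1) s.ρ) (pushCoaction (Q.φl 1) t.ρ) x)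
  simp only [LinearMap.comp_apply] at n₁ n₂
  rw [tensor_tw_eq s t 1, ← LinearMap.comp_apply, ← TensorProduct.map_comp, LinearMap.id_comp,
    ← LinearMap.comp_id s.tw.toLinearMap, ← LinearMap.id_comp (f ∘ₗ _), TensorProduct.map_comp,
    LinearMap.comp_apply]
  have u₁ := Comod.braidMap_unit_left (CrossedCategory.conj 1 s.obj)
    (TensorProduct.map (f ∘ₗ t.tw.toLinearMap) LinearMap.id
      (Q.cobraiding.braidMap (pushCoaction (Q.φl 1) s.ρ) (pushCoaction (Q.φl 1) t.ρ) x))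
  have u₂ := Comod.braidMap_unit_right (CrossedCategory.conj 1 s.obj)
    (TensorProduct.map LinearMap.id (f ∘ₗ t.tw.toLinearMap) x)
  exact congrArg (TensorProduct.map _ _) (n₂.symm.trans (u₁.trans
    ((congrArg (TensorProduct.comm K K V) (n₁.symm.trans u₂)).trans
      ((TensorProduct.comm K V K).symm_apply_apply _))))

theorem contractLeft_colinear (s : Q.Twisted V)
    (p : Dual K V ⊗[K] V) :
    (contractLeft K V).lTensor Q.carrier (((s.dual isAnti_S.symm).tensor s).ρ p) =
      (1 : Q.carrier) ⊗ₜ[K] contractLeft K V p :=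
  lift_id_colinear s.isCoaction Q.S_symm_mul p

set_option maxRecDepth 4000 in
theorem IsRibbon.leftEv_hom (h : s.IsRibbon) :
    Hom ((s.dual isAnti_S.symm).tensor s) (unit Q) (contractLeft K V) := by
  refine hom_iff.mpr ⟨inv_mul_cancel _,
    fun p => (contractLeft_colinear s p).symm, fun p => ?_⟩
  rw [unit_tw]
  change contractLeft K V _ = contractLeft K V p
  induction p with
  | zero => simp
  | add p p' h h' => rw [map_add, map_add, map_add, h, h']
  | tmul ξ v =>
  have hm := ((lid_hom s).symm.comp ((tensor_hom h (id_hom s)).comp (assoc_hom _ _ _))).tw_comm v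
  simp only [LinearMap.comp_apply, LinearEquiv.coe_coe, TensorProduct.lid_symm_apply,
    TensorProduct.map_tmul, LinearMap.id_apply] at hm
  have hd := map_tensor_tw (s := s) (t := (s.dual isAnti_S.symm).tensor s)
    (contractLeft_colinear s)
  have e₁ := congrArg (fun z => TensorProduct.rid K V (TensorProduct.map LinearMap.id
    (contractLeft K V) z)) hm
  beta_reduce at e₁
  rw [hd] at e₁
  have e₂ (g : Dual K V ⊗[K] V →ₗ[K] K) (z : V ⊗[K] (Dual K V ⊗[K] V)) :
      TensorProduct.rid K V (TensorProduct.map s.tw.toLinearMap g z) =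
        s.tw (TensorProduct.rid K V (TensorProduct.map LinearMap.id g z)) := by
    induction z with
    | zero => simp
    | add x y hx hy => simp only [map_add, hx, hy]
    | tmul v c => simp
  rw [e₂, rid_map_assoc, rid_map_assoc] at e₁
  obtain ⟨u, hu⟩ : ∃ u, Dual.eval K V u = (TensorProduct.curry (contractLeft K V ∘ₗ
    ((s.dual isAnti_S.symm).tensor s).tw.toLinearMap)).flip v := (evalEquiv K V).surjective _
  rw [← hu, sliceR_coevaluation, show (TensorProduct.curry (contractLeft K V)).flip (s.tw v) =
    Dual.eval K V (s.tw v) from rfl, sliceR_coevaluation] at e₁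
  rw [← s.tw.injective e₁] at hu
  exact (LinearMap.congr_fun hu ξ).symm

omit [Module.Finite K V] in
theorem push_one {H : CrossedHopfAlgebra K G} (ρ : V →ₗ[K] H.carrier ⊗[K] V) :
    pushCoaction (H.φl 1) ρ = ρ := by
  ext v
  rw [pushCoaction_apply, show H.φl 1 = LinearMap.id from LinearMap.ext H.φ_one,
    LinearMap.rTensor_id]
  rfl

theorem θ_f (Z : TwistedObject (Comod Q.toCrossedHopfAlgebra))
    {Z' : TwistedObject (Comod Q.toCrossedHopfAlgebra)}
    (h : Z' = CrossedCategory.conj (CrossedCategory.deg Z) Z) :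
    (CrossedTwist.θ Z h).hom.f.f = Z.t.hom.f ≫ eqToHom (by subst h; rfl) := by
  subst h
  change (Z.tw rfl).hom.f = _
  simp only [TwistedObject.tw, Iso.trans_hom, eqToIso.hom, Comod.comp_f, Comod.eqToHom_f]

theorem whiskerLeft_f_f {X Y : TwistedObject (Comod Q.toCrossedHopfAlgebra)}
    (Z : TwistedObject (Comod Q.toCrossedHopfAlgebra)) (k : X ⟶ Y) :
    (Z ◁ k).f.f = Z.obj.V ◁ k.f.f := rfl

theorem whiskerRight_f_f {X Y : TwistedObject (Comod Q.toCrossedHopfAlgebra)} (k : X ⟶ Y)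
    (Z : TwistedObject (Comod Q.toCrossedHopfAlgebra)) :
    (k ▷ Z).f.f = k.f.f ▷ Z.obj.V := rfl

theorem c_f {X Y Y' : TwistedObject (Comod Q.toCrossedHopfAlgebra)}
    (h : Y' = CrossedCategory.conj (CrossedCategory.deg X) Y) :
    (CrossedBraiding.c X Y h).hom.f.f =
      ModuleCat.ofHom (Q.cobraiding.braidMap X.obj.ρ Y.obj.ρ) ≫
        eqToHom (X := Y.obj.V ⊗ X.obj.V) (Y := Y'.obj.V ⊗ X.obj.V) (by subst h; rfl) :=
  Comod.c_hom_f Q X.obj Y.obj (congrArg TwistedObject.obj h)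

theorem conj_t_f (β : G) (Z : TwistedObject (Comod Q.toCrossedHopfAlgebra)) :
    (CrossedCategory.conj β Z).t.hom.f = Z.t.hom.f := by
  change (TwistedObject.conjObj β Z).t.hom.f = _
  simp only [conjIso_hom, conjMap, Comod.comp_f, Comod.eqToHom_f]
  rfl

/-- The twisted objects of `s` and of its left dual form a pair of dual objects. -/
theorem IsRibbon.exists_pairing (h : s.IsRibbon) :
    ∃ _ : ExactPairing s.twisted (s.dual isAnti_S.symm).twisted,
      (η_ s.twisted (s.dual isAnti_S.symm).twisted).f = Comod.leftCoev s.obj ∧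
      (ε_ s.twisted (s.dual isAnti_S.symm).twisted).f = Comod.leftEv s.obj := by
  obtain ⟨b, hb⟩ := h
  obtain ⟨d, hd⟩ := leftEv_hom ⟨b, hb⟩
  let b' := eqToHom unit_twisted.symm ≫ b ≫ eqToHom (tensor_twisted s (s.dual isAnti_S.symm))
  let d' := eqToHom (tensor_twisted (s.dual isAnti_S.symm) s).symm ≫ d ≫ eqToHom unit_twisted
  have hb' : b'.f = Comod.leftCoev s.obj := by
    ext1
    simp only [b', TwistedObject.comp_f, TwistedObject.eqToHom_f]
    ext1
    exact hb
  have hd' : d'.f = Comod.leftEv s.obj := by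
    ext1
    simp only [d', TwistedObject.comp_f, TwistedObject.eqToHom_f]
    ext1
    exact hd
  refine ⟨⟨b', d', ?_, ?_⟩, hb', hd'⟩
  · ext1
    have e := ExactPairing.coevaluation_evaluation s.obj s.obj.leftDual
    change _ ◁ b'.f ≫ _ ≫ d'.f ▷ _ = _
    rw [hb', hd']
    exact e
  · ext1
    have e := ExactPairing.evaluation_coevaluation s.obj s.obj.leftDual
    change b'.f ▷ _ ≫ _ ≫ _ ◁ d'.f = _
    rw [hb', hd']
    exact e

theorem tortile [ExactPairing s.twisted (s.dual isAnti_S.symm).twisted]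
    (hη : (η_ s.twisted (s.dual isAnti_S.symm).twisted).f = Comod.leftCoev s.obj) :
    Tortile s.twisted (s.dual isAnti_S.symm).twisted := by
  intro U₁ V₁ hU hV
  subst hU hV
  ext1
  ext1
  simp only [conjMap, TwistedObject.comp_f, TwistedObject.eqToHom_f, Comod.comp_f,
    Comod.eqToHom_f, whiskerLeft_f_f, whiskerRight_f_f, θ_f, conj_t_f]
  have e : (η_ s.twisted (s.dual isAnti_S.symm).twisted).f.f.hom (1 : K) = coevaluation K V 1 := by
    rw [hη]
    rfl
  refine ModuleCat.hom_ext (LinearMap.ext_ring ?_)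
  change s.tw.toLinearMap.dualMap.lTensor V ((η_ s.twisted (s.dual isAnti_S.symm).twisted).f.f.hom (1 : K)) =
    s.tw.toLinearMap.rTensor _ ((η_ s.twisted (s.dual isAnti_S.symm).twisted).f.f.hom (1 : K))
  rw [e]
  exact (map_coevaluation (K := K) s.tw.toLinearMap).symm

/-- The pairing `v ⊗ ξ ↦ (ξ ⊗ tw(v))` composed with the braiding, by which the left dual is a
right dual. -/
noncomputable def rightPairing (s : Q.Twisted V) :
    V ⊗[K] Dual K V →ₗ[K] K :=
  contractLeft K V ∘ₗ Q.cobraiding.braidMap (pushCoaction (Q.φl s.deg) s.ρ)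
    (dualCoaction Q.S.symm s.ρ) ∘ₗ s.tw.toLinearMap.rTensor _

theorem rightPairing_tw (v : V) (ξ : Dual K V) :
    s.rightPairing (s.tw v ⊗ₜ ξ) = s.rightPairing (v ⊗ₜ s.tw.dualMap ξ) := by
  have e₁ := LinearMap.congr_fun (Q.cobraiding.braidMap_natural
    (σ := pushCoaction (Q.φl s.deg) (dualCoaction Q.S.symm s.ρ))
    (σ₁ := pushCoaction (Q.φl s.deg) (dualCoaction Q.S.symm s.ρ)) s.tw.toLinearMap
    LinearMap.id (s.tw_push s.deg) (fun v => by rw [LinearMap.lTensor_id]; rfl)) (s.tw v ⊗ₜ ξ)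
  have e₂ := LinearMap.congr_fun (Q.cobraiding.braidMap_natural (ρ := pushCoaction (Q.φl s.deg) s.ρ)
    (ρ₁ := pushCoaction (Q.φl s.deg) s.ρ) LinearMap.id (s.dual isAnti_S.symm).tw.toLinearMap
    (fun v => by rw [LinearMap.lTensor_id]; rfl) ((s.dual isAnti_S.symm).tw_push s.deg))
    (s.tw v ⊗ₜ ξ)
  rw [← push_push, Q.cobraiding.braidMap_push] at e₁
  rw [show s.deg * (s.dual isAnti_S.symm).deg = 1 from mul_inv_cancel s.deg, push_one] at e₂
  have e₃ (z : Dual K V ⊗[K] V) :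
      contractLeft K V (TensorProduct.map LinearMap.id s.tw.toLinearMap z) =
        contractLeft K V (TensorProduct.map s.tw.toLinearMap.dualMap LinearMap.id z) := by
    induction z with
    | zero => simp
    | add x y hx hy => simp only [map_add, hx, hy]
    | tmul ξ v => simp
  exact ((congrArg (contractLeft K V) e₁).trans (e₃ _)).trans (congrArg (contractLeft K V) e₂).symm

theorem IsRibbon.exists_rightCoev (h : s.IsRibbon) :
    ∃ b, Hom (unit Q) ((s.dual isAnti_S.symm).tensor s) b ∧
      (∀ v, TensorProduct.lid K V (TensorProduct.map s.rightPairing LinearMap.id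
        ((TensorProduct.assoc K V (Dual K V) V).symm (v ⊗ₜ b 1))) = v) ∧
      ∃ e : s.obj ⊗ s.obj.leftDual ⟶ 𝟙_ (Comod Q.toCrossedHopfAlgebra), e.f.hom = s.rightPairing := by
  obtain ⟨i, hη, hε⟩ := h.exists_pairing
  have hev : ∀ x : Dual K V ⊗[K] V, (ε_ s.twisted (s.dual isAnti_S.symm).twisted).f.f.hom x =
      contractLeft K V x := by
    rw [hε]
    exact fun _ => rfl
  have hz := Tortile.right_zigzag (tortile hη) (by
    ext1
    ext1
    simp only [conjMap, TwistedObject.comp_f, TwistedObject.eqToHom_f, Comod.comp_f,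
      Comod.eqToHom_f]
    simp only [whiskerLeft_f_f, whiskerRight_f_f, θ_f, conj_t_f]
    refine ModuleCat.hom_ext (TensorProduct.ext' fun (ξ : Dual K V) (v : V) => ?_)
    change (ε_ s.twisted (s.dual isAnti_S.symm).twisted).f.f.hom (s.tw.dualMap ξ ⊗ₜ[K] v) =
      (ε_ s.twisted (s.dual isAnti_S.symm).twisted).f.f.hom (ξ ⊗ₜ[K] s.tw v)
    exact (hev (s.tw.dualMap ξ ⊗ₜ v)).trans (hev (ξ ⊗ₜ s.tw v)).symm)
  have he : (rightEv s.twisted (s.dual isAnti_S.symm).twisted).f.f.hom = s.rightPairing := by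
    rw [rightEv]
    simp only [conjMap, TwistedObject.comp_f, TwistedObject.eqToHom_f, Comod.comp_f,
      Comod.eqToHom_f, whiskerRight_f_f, θ_f, c_f]
    exact LinearMap.ext fun x => hev (Q.cobraiding.braidMap (pushCoaction (Q.φl s.deg) s.ρ)
      (dualCoaction Q.S.symm s.ρ) (s.tw.toLinearMap.rTensor _ x))
  refine ⟨(rightCoev s.twisted (s.dual isAnti_S.symm).twisted).f.f.hom, ?_, ?_, ?_⟩
  · exact Hom.of_arrow unit_twisted (tensor_twisted _ _) (rightCoev s.twisted _) fun _ => rfl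
  · intro v
    have e := congrArg (fun k => ModuleCat.Hom.hom k v)
      (congrArg Comod.Hom.f (congrArg TwistedObject.Hom.f hz))
    rw [← he]
    exact e
  · exact ⟨_, he⟩

theorem IsRibbon.exists_dual_equiv (h : s.IsRibbon) : ∃ e : Dual K V ≃ₗ[K] Dual K V,
    Hom (s.dual isAnti_S.symm) (s.dual isAnti_S) e.toLinearMap ∧
      Hom (unit Q) ((s.dual isAnti_S).tensor s)
        ((TensorProduct.comm K _ _).toLinearMap ∘ₗ coevaluation K V) := by
  obtain ⟨b, hb, hz, k, hk⟩ := h.exists_rightCoev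
  let f : Dual K V →ₗ[K] Dual K V := (TensorProduct.curry s.rightPairing).flip
  have hf : Hom (s.dual isAnti_S.symm) (s.dual isAnti_S) f := by
    refine hom_iff.mpr ⟨rfl, fun ξ => ?_, fun ξ => LinearMap.ext fun v => (rightPairing_tw v ξ).symm⟩
    have e := Comod.curry_flip_colinear k ξ
    rw [hk] at e
    exact e
  have he (x : Dual K V ⊗[K] V) (v : V) : TensorProduct.lid K V (TensorProduct.map s.rightPairing
      LinearMap.id ((TensorProduct.assoc K V (Dual K V) V).symm (v ⊗ₜ x))) =
        sliceR V (Dual.eval K V v) (TensorProduct.comm K _ _ (f.rTensor V x)) := by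
    induction x with
    | zero => simp
    | add x y hx hy => simp only [map_add, TensorProduct.tmul_add, hx, hy]
    | tmul ξ u => simp [f]
  have hb' : f.rTensor V (b 1) = TensorProduct.comm K _ _ (coevaluation K V (1 : K)) := by
    rw [← (TensorProduct.comm K _ _).injective.eq_iff]
    refine sliceR_ext_eval fun v => ?_
    rw [← he, hz, TensorProduct.comm_comm, sliceR_coevaluation]
  have hs : Function.Surjective f := fun ξ => ⟨sliceR _ ξ (b 1), by
    rw [← sliceR_rTensor, hb', sliceR_comm_coevaluation]⟩
  refine ⟨LinearEquiv.ofBijective f ⟨LinearMap.injective_iff_surjective.mpr hs, hs⟩, hf, ?_⟩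
  have := hb.comp (tensor_hom hf (id_hom s))
  rwa [show _ ∘ₗ b = (TensorProduct.comm K _ _).toLinearMap ∘ₗ coevaluation K V from
    LinearMap.ext_ring hb'] at this

theorem IsRibbon.coev_hom (h : s.IsRibbon) : Hom (unit Q) ((s.dual isAnti_S).tensor s)
    ((TensorProduct.comm K _ _).toLinearMap ∘ₗ coevaluation K V) :=
  h.exists_dual_equiv.choose_spec.2

theorem IsRibbon.rdual (h : s.IsRibbon) : (s.dual isAnti_S).IsRibbon := by
  have := h.coev_hom.comp (tensor_hom (id_hom _) (eval_hom isAnti_S.symm s))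
  rwa [show _ ∘ₗ _ = coevaluation K (Dual K V) from LinearMap.ext_ring ?_] at this
  refine sliceR_ext_eval fun ξ => ?_
  rw [sliceR_coevaluation]
  refine Eq.trans ?_ (sliceR_comm_coevaluation ξ)
  exact sliceR_lTensor _ _ _

theorem IsRibbon.ldual (h : s.IsRibbon) : (s.dual isAnti_S.symm).IsRibbon := by
  obtain ⟨e, he, -⟩ := h.exists_dual_equiv
  exact h.rdual.of_equiv he.symm

theorem IsRibbon.ev_hom (h : s.IsRibbon) : Hom (s.tensor (s.dual isAnti_S)) (unit Q)
    (TensorProduct.lift (Dual.eval K V)) := by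
  have := (tensor_hom (eval_hom isAnti_S.symm s) (id_hom (s.dual isAnti_S))).comp h.rdual.leftEv_hom
  rwa [show _ ∘ₗ _ = TensorProduct.lift (Dual.eval K V) from
    TensorProduct.ext' fun v ξ => by simp] at this

end TwistedComodule

end RibbonDuals

section RibbonObjects

open TensorProduct Coalgebra Module

variable {K : Type u} [Field K] {G : Type u} [Group G] {Q : CoquasitriangularHopfAlgebra K G}
  {V : Type u} [AddCommGroup V] [Module K V] [Module.Finite K V]

namespace TwistedComodule

open CrossedHopfAlgebra

variable {s : Q.Twisted V}

theorem IsRibbon.ribbonExtension (h : s.IsRibbon) : ribbonExtension _ s.twisted := by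
  obtain ⟨i, hη, hε⟩ := h.exists_pairing
  refine ⟨_, i, fun β hU => ?_, tortile hη, Tortile.squareTwist (tortile hη)⟩
  have hs : s = s.conj β := twisted_injective (hU.trans (conj_twisted β s).symm)
  have hV : (s.dual isAnti_S.symm).twisted = CrossedCategory.conj β (s.dual isAnti_S.symm).twisted := by
    rw [← conj_twisted, conj_dual, ← hs]
  refine ⟨hV, ?_, ?_⟩
  all_goals
    ext1
    ext1
    simp only [conjMap, TwistedObject.comp_f, TwistedObject.eqToHom_f, Comod.comp_f,
      Comod.eqToHom_f]
    rfl

theorem isRibbon_of_ribbonExtension {Z : TwistedObject (Comod Q.toCrossedHopfAlgebra)}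
    (h : _root_.ribbonExtension _ Z) : Z.twistedComodule.IsRibbon := by
  obtain ⟨Y, i, -, ht, -⟩ := h
  let p : Z.obj.V ⊗[K] Y.obj.V := (η_ Z Y).f.f.hom (1 : K)
  let e : Y.obj.V ⊗[K] Z.obj.V →ₗ[K] K := (ε_ Z Y).f.f.hom
  have hx : (λ_ Z).inv ≫ η_ Z Y ▷ Z ≫ (α_ Z Y Z).hom ≫ Z ◁ ε_ Z Y ≫ (ρ_ Z).hom = 𝟙 Z := by
    rw [Iso.inv_comp_eq, Category.comp_id,
      ← (Iso.eq_comp_inv (ρ_ Z)).mp (ExactPairing.evaluation_coevaluation Z Y)]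
    simp only [Category.assoc]
  have hy : (ρ_ Y).inv ≫ Y ◁ η_ Z Y ≫ (α_ Y Z Y).inv ≫ ε_ Z Y ▷ Y ≫ (λ_ Y).hom = 𝟙 Y := by
    rw [Iso.inv_comp_eq, Category.comp_id,
      ← (Iso.eq_comp_inv (λ_ Y)).mp (ExactPairing.coevaluation_evaluation Z Y)]
    simp only [Category.assoc]
  have hz (v : Z.obj.V) : sliceR _ ((TensorProduct.curry e).flip v) p = v := by
    rw [← rid_map_assoc]
    exact congrArg (fun k => ModuleCat.Hom.hom k v) (congrArg Comod.Hom.f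
      (congrArg TwistedObject.Hom.f hx))
  have hz' (v : Y.obj.V) : sliceR _ (TensorProduct.curry e v) (TensorProduct.comm K _ _ p) = v := by
    rw [← lid_map_assoc]
    exact congrArg (fun k => ModuleCat.Hom.hom k v) (congrArg Comod.Hom.f
      (congrArg TwistedObject.Hom.f hy))
  have hp : (TensorProduct.curry e).lTensor Z.obj.V p = coevaluation K Z.obj.V 1 := by
    refine sliceR_ext_eval fun v => ?_
    rw [sliceR_lTensor, sliceR_coevaluation]
    exact hz v
  have htw : Y.twist.toLinearMap.lTensor _ p = Z.twist.toLinearMap.rTensor _ p := by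
    have e := congrArg (fun k => ModuleCat.Hom.hom k (1 : K)) (congrArg Comod.Hom.f
      (congrArg TwistedObject.Hom.f (ht rfl rfl)))
    simp only [conjMap, TwistedObject.comp_f, TwistedObject.eqToHom_f, Comod.comp_f,
      Comod.eqToHom_f, whiskerLeft_f_f, whiskerRight_f_f, θ_f, conj_t_f] at e
    exact e
  have hi : Hom Y.twistedComodule (Z.twistedComodule.dual isAnti_S.symm) (TensorProduct.curry e) := by
    refine hom_iff.mpr ⟨deg_dual Z Y, fun v => Comod.curry_colinear (ε_ Z Y).f v, fun v => ?_⟩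
    refine LinearMap.congr_fun (f := TensorProduct.curry e ∘ₗ Y.twist.toLinearMap)
      (g := Z.twist.toLinearMap.dualMap ∘ₗ TensorProduct.curry e) ?_ v
    have hc (f : Y.obj.V →ₗ[K] Dual K Z.obj.V) (v : Y.obj.V) : f v = sliceR _
        (TensorProduct.curry e v) (TensorProduct.comm K _ _ (f.lTensor Z.obj.V p)) := by
      have ht (x : Z.obj.V ⊗[K] Y.obj.V) : TensorProduct.comm K _ _ (f.lTensor Z.obj.V x) =
          f.rTensor Z.obj.V (TensorProduct.comm K _ _ x) := by
        induction x with
        | zero => simp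
        | add x y hx hy => simp only [map_add, hx, hy]
        | tmul v w => rfl
      rw [ht, sliceR_rTensor, hz']
    refine LinearMap.ext fun v => ?_
    rw [hc, hc (Z.twist.toLinearMap.dualMap ∘ₗ TensorProduct.curry e), LinearMap.lTensor_comp_apply,
      LinearMap.lTensor_comp_apply, hp, htw, ← map_coevaluation, ← hp]
    simp only [← LinearMap.comp_apply, LinearMap.lTensor_comp_rTensor,
      LinearMap.rTensor_comp_lTensor]
  have hη : Hom (unit Q) (Z.twistedComodule.tensor Y.twistedComodule) (η_ Z Y).f.f.hom :=
    Hom.of_arrow unit_twisted ((tensor_twisted _ _).trans (congrArg₂ (· ⊗ ·)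
      Z.twistedComodule_twisted Y.twistedComodule_twisted)) (η_ Z Y) fun _ => rfl
  have := hη.comp (tensor_hom (id_hom _) hi)
  rwa [show _ ∘ₗ _ = coevaluation K Z.obj.V from LinearMap.ext_ring hp] at this

end TwistedComodule

end RibbonObjects

section RibbonTheory

open TensorProduct Coalgebra Module

variable {K : Type u} [Field K] {G : Type u} [Group G] {Q : CoquasitriangularHopfAlgebra K G}
  {V W : Type u} [AddCommGroup V] [Module K V] [Module.Finite K V] [AddCommGroup W] [Module K W]
  [Module.Finite K W]

open TwistedComodule CrossedHopfAlgebra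

variable (Q V) in
/-- The ribbon comodules. -/
abbrev RibbonComodule := {s : Q.Twisted V // s.IsRibbon}

variable (Q) in
/-- The crossed theory of ribbon comodules. -/
noncomputable def ribbonTheory : CrossedTheory K G where
  Str V := RibbonComodule Q V
  deg s := s.1.deg
  Hom s t f := s.1.Hom t.1 f
  deg_eq h := h.deg_eq
  comp h h' := h.comp h'
  transport e s := ⟨s.1.transport e, s.2.of_equiv (transport_hom e s.1)⟩
  transport_hom e s := TwistedComodule.transport_hom e s.1
  transport_hom_symm e s := (TwistedComodule.transport_hom e s.1).symm
  tensor s t := ⟨s.1.tensor t.1, s.2.tensor t.2⟩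
  tensor_hom h h' := TwistedComodule.tensor_hom h h'
  deg_tensor _ _ := rfl
  unit := ⟨TwistedComodule.unit Q, isRibbon_unit⟩
  deg_unit := rfl
  assoc_hom s t r := TwistedComodule.assoc_hom s.1 t.1 r.1
  lid_hom s := TwistedComodule.lid_hom s.1
  rid_hom s := TwistedComodule.rid_hom s.1
  conj β s := ⟨s.1.conj β, s.2.conj β⟩
  conj_hom β _ _ _ h := TwistedComodule.conj_hom β h
  deg_conj _ _ := rfl
  conj_one s := Subtype.ext (TwistedComodule.conj_one s.1)
  conj_mul β γ s := Subtype.ext (TwistedComodule.conj_mul β γ s.1)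
  conj_tensor β s t := Subtype.ext (TwistedComodule.conj_tensor β s.1 t.1)
  conj_unit β := Subtype.ext (TwistedComodule.conj_unit β)
  rdual s := ⟨s.1.dual isAnti_S, s.2.rdual⟩
  rdual_hom h := TwistedComodule.dual_hom isAnti_S h
  deg_rdual _ := rfl
  ev_hom s := s.2.ev_hom
  coev_hom s := s.2.coev_hom
  ldual s := ⟨s.1.dual isAnti_S.symm, s.2.ldual⟩
  ldual_hom h := TwistedComodule.dual_hom isAnti_S.symm h
  eval_rdual_ldual s := TwistedComodule.eval_hom isAnti_S s.1
  eval_ldual_rdual s := TwistedComodule.eval_hom isAnti_S.symm s.1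

namespace RibbonTheory

/-- The twisted comodule which underlies a structure of the crossed theory. -/
noncomputable def val (s : (ribbonTheory Q).Str V) : Q.Twisted V :=
  Subtype.val (p := fun s : Q.Twisted V => s.IsRibbon) s

theorem isRibbon_val (s : (ribbonTheory Q).Str V) : (val s).IsRibbon :=
  Subtype.prop (p := fun s : Q.Twisted V => s.IsRibbon) s

theorem val_injective {s t : (ribbonTheory Q).Str V} (h : val s = val t) : s = t :=
  Subtype.ext (p := fun s : Q.Twisted V => s.IsRibbon) h

theorem hom_val {s : (ribbonTheory Q).Str V} {t : (ribbonTheory Q).Str W} {f : V →ₗ[K] W}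
    (h : (ribbonTheory Q).Hom s t f) : Hom (val s) (val t) f := h

variable (Q) in
/-- The braiding of ribbon comodules. -/
noncomputable def braiding : (ribbonTheory Q).Braiding where
  c s t := (val s).braiding (val t)
  hom s t := braiding_hom (val s) (val t)
  natural h h' x :=
    (LinearMap.congr_fun (Q.cobraiding.braidMap_natural _ _ (hom_val h).colinear
      (hom_val h').colinear) x).symm
  tensor_left s t r v w u := Q.cobraiding.braidMap_tensor_left (val s).ρ _ (val r).isCoaction
    (val t).mem v w u
  tensor_right s _ _ v w u := Q.cobraiding.braidMap_tensor_right (val s).isCoaction _ _ v w u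
  conj β s t := LinearEquiv.toLinearMap_injective (Q.cobraiding.braidMap_push β (val s).ρ (val t).ρ)

variable (Q) in
/-- The twist of ribbon comodules. -/
noncomputable def twist : CrossedTheory.Twist (braiding Q) where
  θ s := (val s).tw
  hom s := tw_hom (val s)
  natural h v := (hom_val h).tw_comm v
  tensor s t x := tensor_tw (val s) (val t) x
  conj β s := conj_tw β (val s)
  rdual _ _ := rfl

variable (Q) in
/-- The comodules which underlie ribbon comodules. -/
noncomputable def underlying : (ribbonTheory Q).Underlying Q.toCrossedHopfAlgebra where
  ρ s := (val s).ρ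
  isCoaction s := (val s).isCoaction
  mem s := (val s).mem
  hom h := (hom_val h).colinear

theorem exists_coact {T : CrossedTheory K G}
    (e : ∀ {V : Type u} [AddCommGroup V] [Module K V] [Module.Finite K V], T.Str V → V →ₗ[K] V)
    (he : ∀ {V W : Type u} [AddCommGroup V] [Module K V] [Module.Finite K V] [AddCommGroup W]
      [Module K W] [Module.Finite K W] {s : T.Str V} {t : T.Str W} {f : V →ₗ[K] W}, T.Hom s t f →
      ∀ v, e t (f v) = f (e s v)) :
    ∃ τ : T.hopf.carrier →ₗ[K] K, ∀ {V : Type u} [AddCommGroup V] [Module K V]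
      [Module.Finite K V] (s : T.Str V), coact τ (CrossedTheory.act s) = e s := by
  obtain ⟨τ, hτ⟩ := T.exists_lift (M := K) (fun s => LinearMap.id.compl₂ (e s))
    (fun h ξ v => congrArg ξ (he h v))
  exact ⟨τ, fun s => LinearMap.ext fun v => eq_of_dual_eq K fun ξ => by
    exact (coef_coact (H := T.hopf) τ (CrossedTheory.act s) ξ v).trans
      ((congrArg (fun c => τ (c ξ v)) (CrossedTheory.coefR_act s)).trans (hτ s ξ v))⟩

theorem exists_coact_symm : ∃ τ : (ribbonTheory Q).hopf.carrier →ₗ[K] K,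
    ∀ {V : Type u} [AddCommGroup V] [Module K V] [Module.Finite K V] (s : (ribbonTheory Q).Str V),
      coact τ (CrossedTheory.act s) = (val s).tw.symm.toLinearMap :=
  exists_coact (fun s => (val s).tw.symm.toLinearMap) fun h v => ((twist Q).natural_symm h v).symm

theorem coact_comp_eq_id {τ τ' : (ribbonTheory Q).hopf.carrier →ₗ[K] K}
    (h : ∀ {V : Type u} [AddCommGroup V] [Module K V] [Module.Finite K V]
      (s : (ribbonTheory Q).Str V) (v : V),
      coact τ (CrossedTheory.act s) (coact τ' (CrossedTheory.act s) v) = v)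
    (X : Comod (ribbonTheory Q).hopf) (v : X.V) : coact τ X.ρ (coact τ' X.ρ v) = v :=
  eq_of_dual_eq K fun ξ => CrossedTheory.transfer (T := ribbonTheory Q) (M := K)
    (fun X => LinearMap.id.compl₂ (coact τ X.ρ ∘ₗ coact τ' X.ρ)) (fun _ => LinearMap.id)
    (fun f ξ v => congrArg ξ ((congrArg _ (coact_natural τ' f.f.hom f.comm v)).trans
      (coact_natural τ f.f.hom f.comm _)))
    (fun _ _ _ => rfl) (fun s _ ξ v => congrArg ξ (h s v)) X rfl ξ v

theorem coact_τ (s : (ribbonTheory Q).Str V) :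
    coact (twist Q).cotwist.τ (CrossedTheory.act s) = (val s).tw.toLinearMap :=
  (twist Q).coact_act s

/-- The twist on a comodule over the coend. -/
noncomputable def strTwist (X : Comod (ribbonTheory Q).hopf) : X.V ≃ₗ[K] X.V :=
  LinearEquiv.ofLinearMap (coact (twist Q).cotwist.τ X.ρ) (coact exists_coact_symm.choose X.ρ)
    (LinearMap.ext <| coact_comp_eq_id (fun s v => by
      rw [coact_τ, exists_coact_symm.choose_spec]; exact (val s).tw.apply_symm_apply v) X)
    (LinearMap.ext <| coact_comp_eq_id (fun s v => by
      rw [coact_τ, exists_coact_symm.choose_spec]; exact (val s).tw.symm_apply_apply v) X)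

theorem strTwist_natural {X Y : Comod (ribbonTheory Q).hopf} (f : X ⟶ Y) (v : X.V) :
    strTwist Y (f.f.hom v) = f.f.hom (strTwist X v) :=
  coact_natural _ f.f.hom f.comm v

theorem strTwist_comod (s : (ribbonTheory Q).Str V) :
    strTwist (CrossedTheory.comod s) = (val s).tw :=
  LinearEquiv.toLinearMap_injective (coact_τ s)

theorem strTwist_colinear (X : Comod (ribbonTheory Q).hopf) (v : X.V) :
    pushCoaction (Q.φl X.deg) (pushCoaction (underlying Q).map X.ρ) (strTwist X v) =
      (strTwist X).toLinearMap.lTensor Q.carrier (pushCoaction (underlying Q).map X.ρ v) := by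
  refine sliceR_ext fun ξ => ?_
  rw [sliceR_lTensor]
  refine CrossedTheory.transfer (T := ribbonTheory Q) (M := Q.carrier)
    (fun X => (coefR (pushCoaction (Q.φl X.deg) (pushCoaction (underlying Q).map X.ρ))).compl₂
      (strTwist X).toLinearMap)
    (fun X => coefR (pushCoaction (underlying Q).map X.ρ) ∘ₗ (strTwist X).toLinearMap.dualMap)
    (fun {X Y} f ξ v => ?_) (fun {X Y} f ξ v => ?_) (fun s _ ξ v => ?_) X rfl ξ v
  · refine (congrArg (coefR _ ξ) (strTwist_natural f v)).trans ?_
    refine coefR_natural (fun v => ?_) ξ _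
    rw [pushCoaction_apply, (underlying Q).push_hom f, f.deg_eq, pushCoaction_apply,
      ← LinearMap.comp_apply, LinearMap.rTensor_comp_lTensor, ← LinearMap.lTensor_comp_rTensor,
      LinearMap.comp_apply]
    rfl
  · refine (coefR_natural ((underlying Q).push_hom f) _ v).trans ?_
    exact congrArg (fun ζ => coefR _ ζ v) (LinearMap.ext fun v =>
      congrArg ξ (strTwist_natural f v))
  · have e : pushCoaction (underlying Q).map (CrossedTheory.comod s).ρ = (val s).ρ :=
      (underlying Q).push_act s
    change coefR (pushCoaction _ (pushCoaction (underlying Q).map (CrossedTheory.comod s).ρ)) ξ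
      (strTwist (CrossedTheory.comod s) v) = coefR (pushCoaction (underlying Q).map
        (CrossedTheory.comod s).ρ) (ξ ∘ₗ (strTwist (CrossedTheory.comod s)).toLinearMap) v
    rw [e, strTwist_comod]
    have := congrArg (sliceR _ ξ) ((val s).tw_colinear v)
    rw [sliceR_lTensor] at this
    exact this

/-- The twisted comodule which is given by a comodule over the coend. -/
noncomputable def strTwisted (X : Comod (ribbonTheory Q).hopf) :
    Q.Twisted X.V where
  deg := X.deg
  ρ := pushCoaction (underlying Q).map X.ρ
  isCoaction := (underlying Q).isCoaction_push X
  mem := (underlying Q).push_mem X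
  tw := strTwist X
  tw_colinear := strTwist_colinear X

theorem strTwisted_hom {X Y : Comod (ribbonTheory Q).hopf} (f : X ⟶ Y) :
    Hom (strTwisted X) (strTwisted Y) f.f.hom :=
  hom_iff.mpr ⟨f.deg_eq, (underlying Q).push_hom f, fun v => (strTwist_natural f v).symm⟩

theorem strTwisted_comod (s : (ribbonTheory Q).Str V) :
    strTwisted (CrossedTheory.comod s) = val s :=
  TwistedComodule.ext rfl ((underlying Q).push_act s) (strTwist_comod s)

theorem tw_coevaluation_natural {s : Q.Twisted V}
    {t : Q.Twisted W} {f : V →ₗ[K] W} (h : Hom s t f) :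
    f.dualMap.lTensor W ((t.tensor (t.dual isAnti_S.symm)).tw (coevaluation K W 1)) =
      f.rTensor (Dual K V) ((s.tensor (s.dual isAnti_S.symm)).tw (coevaluation K V 1)) := by
  have e := (tensor_hom (id_hom t) (dual_hom isAnti_S.symm h)).tw_comm (coevaluation K W 1)
  have e' := (tensor_hom h (id_hom (s.dual isAnti_S.symm))).tw_comm (coevaluation K V 1)
  exact e.trans ((congrArg _ (map_coevaluation f).symm).trans e'.symm)

theorem isRibbon_strTwisted (X : Comod (ribbonTheory Q).hopf) : (strTwisted X).IsRibbon := by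
  refine isRibbon_iff.mpr (sliceR_ext_eval fun v => eq_of_dual_eq K fun ξ => ?_)
  let z (X : Comod (ribbonTheory Q).hopf) : X.V ⊗[K] Dual K X.V :=
    ((strTwisted X).tensor ((strTwisted X).dual isAnti_S.symm)).tw (coevaluation K X.V 1)
  let m (X : Comod (ribbonTheory Q).hopf) : X.V →ₗ[K] X.V :=
    { toFun := fun v => sliceR _ (Dual.eval K X.V v) (z X)
      map_add' := fun v w => by rw [map_add, sliceR_add]
      map_smul' := fun c v => by rw [map_smul, sliceR_smul]; rfl }
  rw [sliceR_coevaluation]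
  refine CrossedTheory.transfer (T := ribbonTheory Q) (M := K)
    (fun X => LinearMap.id.compl₂ (m X)) (fun X => LinearMap.id)
    (fun {X Y} f ξ v => congrArg ξ ?_) (fun _ _ _ => rfl) (fun s _ ξ v => congrArg ξ ?_) X rfl ξ v
  · have e := congrArg (sliceR _ (Dual.eval K X.V v)) (tw_coevaluation_natural (strTwisted_hom f))
    rw [sliceR_rTensor, sliceR_lTensor] at e
    exact e
  · change sliceR _ (Dual.eval K _ v) (((strTwisted (CrossedTheory.comod s)).tensor
      ((strTwisted (CrossedTheory.comod s)).dual isAnti_S.symm)).tw (coevaluation K _ 1)) = v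
    rw [strTwisted_comod, isRibbon_iff.mp (isRibbon_val s)]
    exact sliceR_coevaluation v

variable (Q) in
/-- Comodules over the coend are ribbon comodules. -/
noncomputable def recovery : (ribbonTheory Q).Recovery where
  str X := (⟨strTwisted X, isRibbon_strTwisted X⟩ : RibbonComodule Q X.V)
  deg_str _ := rfl
  hom f := strTwisted_hom f
  str_comod s := val_injective (strTwisted_comod s)

end RibbonTheory

end RibbonTheory

section RibbonFunctor

open TensorProduct Coalgebra Module

variable {K : Type u} [Field K] {G : Type u} [Group G] {Q : CoquasitriangularHopfAlgebra K G}

open TwistedComodule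

/-- The coribbon crossed Hopf algebra whose comodules are the ribbon comodules. -/
noncomputable def CoquasitriangularHopfAlgebra.ribbon (Q : CoquasitriangularHopfAlgebra K G) :
    CoribbonHopfAlgebra K G where
  toCrossedHopfAlgebra := (ribbonTheory Q).hopf
  cobraiding := (RibbonTheory.braiding Q).cobraiding
  cotwist := (RibbonTheory.twist Q).cotwist

theorem TwistedObject.eq_eqToHom_comp {Z Z' Y Y' : TwistedObject (Comod Q.toCrossedHopfAlgebra)}
    (h : Z = Y) (h' : Z' = Y') {k : Z ⟶ Z'} {l : Y ⟶ Y'} (e : HEq k.f.f l.f.f) :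
    k = eqToHom h ≫ l ≫ eqToHom h'.symm := by
  subst h h'
  rw [eqToHom_refl, eqToHom_refl, Category.id_comp, Category.comp_id]
  ext1
  ext1
  exact eq_of_heq e

namespace RibbonTheory

/-- The functor from the comodules over the coend to the category of twisted objects. -/
noncomputable def functor :
    Comod (ribbonTheory Q).hopf ⥤ TwistedObject (Comod Q.toCrossedHopfAlgebra) where
  obj X := (strTwisted X).twisted
  map {X Y} f :=
    { f := ⟨f.f, f.deg_eq, (underlying Q).push_hom f⟩
      comm := by
        obtain ⟨k, hk⟩ := strTwisted_hom f
        have e : k.f = (⟨f.f, f.deg_eq, (underlying Q).push_hom f⟩ :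
            (strTwisted X).twisted.obj ⟶ (strTwisted Y).twisted.obj) := by
          ext1
          ext1
          exact hk
        rw [← e]
        exact @fun _ _ hX hY hY' => k.comm hX hY hY' }

theorem strTwisted_tensor (X Y : Comod (ribbonTheory Q).hopf) :
    strTwisted (X ⊗ Y) = (strTwisted X).tensor (strTwisted Y) :=
  congrArg (val (V := X.V ⊗[K] Y.V)) ((recovery Q).str_tensor X Y)

theorem strTwisted_unit : strTwisted (𝟙_ (Comod (ribbonTheory Q).hopf)) = TwistedComodule.unit Q :=
  congrArg (val (V := K)) (recovery Q).str_unit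

theorem strTwisted_conj (β : G) (X : Comod (ribbonTheory Q).hopf) :
    strTwisted (conj β X) = (strTwisted X).conj β :=
  congrArg (val (V := X.V)) ((recovery Q).str_conj β X)

theorem obj_tensor (X Y : Comod (ribbonTheory Q).hopf) :
    functor.obj (X ⊗ Y) = functor.obj X ⊗ functor.obj Y :=
  (congrArg (TwistedComodule.twisted (V := X.V ⊗[K] Y.V)) (strTwisted_tensor X Y)).trans
    (tensor_twisted _ _)

theorem obj_conj (β : G) (X : Comod (ribbonTheory Q).hopf) :
    functor.obj (conj β X) = conj β (functor.obj X) :=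
  (congrArg (TwistedComodule.twisted (V := X.V)) (strTwisted_conj β X)).trans (conj_twisted β _)

variable (Q) in
/-- The crossed functor from the comodules over the coend to the category of twisted objects. -/
noncomputable def crossedFunctor :
    CrossedFunctor (Comod (ribbonTheory Q).hopf) (TwistedObject (Comod Q.toCrossedHopfAlgebra)) where
  F := functor
  deg_obj _ := rfl
  obj_tensor := obj_tensor
  obj_unit := (congrArg (TwistedComodule.twisted (V := K)) strTwisted_unit).trans unit_twisted
  map_tensor f g := TwistedObject.eq_eqToHom_comp (obj_tensor _ _) (obj_tensor _ _) HEq.rfl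
  map_associator X Y Z := TwistedObject.hom_ext_lin fun v => by
    simp only [TwistedObject.comp_f, TwistedObject.eqToHom_f, Comod.comp_f, Comod.eqToHom_f]
    rfl
  map_leftUnitor X := TwistedObject.hom_ext_lin fun v => by
    simp only [TwistedObject.comp_f, TwistedObject.eqToHom_f, Comod.comp_f, Comod.eqToHom_f]
    rfl
  map_rightUnitor X := TwistedObject.hom_ext_lin fun v => by
    simp only [TwistedObject.comp_f, TwistedObject.eqToHom_f, Comod.comp_f, Comod.eqToHom_f]
    rfl
  obj_conj := obj_conj
  map_conj β X Y f := TwistedObject.eq_eqToHom_comp (obj_conj β X) (obj_conj β Y) HEq.rfl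

/-- The ribbon comodule which is given by an object of the ribbon extension. -/
noncomputable def ofRibbon (Z : TwistedObject (Comod Q.toCrossedHopfAlgebra))
    (h : ribbonExtension _ Z) : (ribbonTheory Q).Str Z.obj.V :=
  (⟨Z.twistedComodule, isRibbon_of_ribbonExtension h⟩ : RibbonComodule Q Z.obj.V)

theorem functor_ofRibbon (Z : TwistedObject (Comod Q.toCrossedHopfAlgebra))
    (h : ribbonExtension _ Z) : functor.obj (CrossedTheory.comod (ofRibbon Z h)) = Z :=
  (congrArg (TwistedComodule.twisted (V := Z.obj.V)) (strTwisted_comod (ofRibbon Z h))).trans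
    Z.twistedComodule_twisted

theorem ofRibbon_functor (X : Comod (ribbonTheory Q).hopf) (h : ribbonExtension _ (functor.obj X)) :
    CrossedTheory.comod (ofRibbon (functor.obj X) h) = X :=
  (congrArg (CrossedTheory.comod (T := ribbonTheory Q) (V := X.V))
    (val_injective (s := ofRibbon (functor.obj X) h) (t := (recovery Q).str X)
      (twisted_twistedComodule (strTwisted X)))).trans ((recovery Q).comod_str X)

theorem ribbonExtension_functor (X : Comod (ribbonTheory Q).hopf) :
    ribbonExtension _ (functor.obj X) :=
  (isRibbon_strTwisted X).ribbonExtension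

theorem isIsoOnto : (crossedFunctor Q).IsIsoOnto (ribbonExtension _) where
  full := ⟨fun {X Y} k => ⟨(recovery Q).ofHom (f := k.f.f.hom) ⟨k, rfl⟩, rfl⟩⟩
  faithful := ⟨fun {X Y} f g h => by
    ext1
    exact congrArg (fun k => k.f.f) h⟩
  injective X Y h := by
    have h : functor.obj X = functor.obj Y := h
    have e : ∀ Z Z' : TwistedObject (Comod Q.toCrossedHopfAlgebra), Z = Z' → ∀ hZ hZ',
        CrossedTheory.comod (ofRibbon Z hZ) = CrossedTheory.comod (ofRibbon Z' hZ') := by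
      rintro Z _ rfl _ _
      rfl
    exact (ofRibbon_functor X (ribbonExtension_functor X)).symm.trans
      ((e _ _ h _ _).trans (ofRibbon_functor Y (ribbonExtension_functor Y)))
  range Z := ⟨fun h => ⟨_, functor_ofRibbon Z h⟩, by
    rintro ⟨X, rfl⟩
    exact ribbonExtension_functor X⟩

variable (Q) in
/-- The crossed functor from the comodules over the coribbon crossed Hopf algebra. -/
noncomputable def ribbonFunctor : CrossedFunctor (Comod Q.ribbon.toCrossedHopfAlgebra)
    (TwistedObject (Comod Q.toCrossedHopfAlgebra)) :=
  crossedFunctor Q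

theorem braidMap_eq (X Y : Comod (ribbonTheory Q).hopf) :
    (braiding Q).cobraiding.braidMap X.ρ Y.ρ =
      Q.cobraiding.braidMap (strTwisted X).ρ (strTwisted Y).ρ := by
  rw [← (recovery Q).act_str X, ← (recovery Q).act_str Y]
  exact (braiding Q).braidMap_act _ _

theorem c_f_heq {X Y Y' : TwistedObject (Comod Q.toCrossedHopfAlgebra)}
    (h : Y' = CrossedCategory.conj (CrossedCategory.deg X) Y) :
    HEq (CrossedBraiding.c X Y h).hom.f.f
      (ModuleCat.ofHom (Q.cobraiding.braidMap X.obj.ρ Y.obj.ρ)) := by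
  subst h
  rw [TwistedComodule.c_f rfl]
  exact heq_of_eq (Category.comp_id _)

theorem isBraided : (ribbonFunctor Q).IsBraided := by
  intro X Y Y' h
  subst h
  refine TwistedObject.eq_eqToHom_comp ((ribbonFunctor Q).obj_tensor X Y)
    ((ribbonFunctor Q).obj_tensor _ X) ?_
  refine HEq.trans (heq_of_eq ?_) (c_f_heq ((ribbonFunctor Q).obj_conj_deg rfl)).symm
  refine (Comod.c_rfl_f (Q := Q.ribbon.toCoquasitriangularHopfAlgebra) X Y).trans ?_
  exact congrArg ModuleCat.ofHom (braidMap_eq X Y)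

theorem isBalanced : (ribbonFunctor Q).IsBalanced := by
  intro X X' h
  subst h
  refine TwistedObject.hom_ext_lin fun v => ?_
  have e₁ := congrArg (fun k => ModuleCat.Hom.hom k v) (Comod.θ_hom_f Q.ribbon X rfl)
  have e₂ := congrArg (fun k => ModuleCat.Hom.hom k v)
    (TwistedComodule.θ_f _ ((crossedFunctor Q).obj_conj_deg (X := X) (Y := X) rfl))
  exact e₁.trans e₂.symm

theorem preservesFiber : (ribbonFunctor Q).PreservesFiber
    (Comod.fiber Q.ribbon.toCrossedHopfAlgebra) (Comod.fiber Q.toCrossedHopfAlgebra).twisted where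
  obj _ := rfl
  map f := by
    ext v
    rfl
  unit := by
    rw [eqToHom_map, eqToHom_trans]
    ext
    rfl
  tensor A B := by
    rw [eqToHom_map, eqToHom_trans]
    apply ModuleCat.MonoidalCategory.tensor_ext
    intro a b
    rfl
  conj β A := by
    rw [eqToHom_map, eqToHom_trans]
    ext v
    rfl

end RibbonTheory

theorem CoquasitriangularHopfAlgebra.ribbonTannakianIso_ribbon
    (Q : CoquasitriangularHopfAlgebra K G) :
    RibbonTannakianIso (Comod.fiber Q.ribbon.toCrossedHopfAlgebra)
      (Comod.fiber Q.toCrossedHopfAlgebra).twisted (ribbonExtension (Comod Q.toCrossedHopfAlgebra)) :=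
  ⟨Comod.isRibbonCategory Q.ribbon, RibbonTheory.ribbonFunctor Q, RibbonTheory.isIsoOnto,
    RibbonTheory.isBraided, RibbonTheory.isBalanced, RibbonTheory.preservesFiber⟩

end RibbonFunctor

section FunctorComposition

variable {G : Type w} [Group G]

namespace CrossedFunctor

variable {C : Type*} [Category* C] [MonoidalCategory C] [CrossedCategory G C]
  {D : Type*} [Category* D] [MonoidalCategory D] [CrossedCategory G D]
  {E : Type*} [Category* E] [MonoidalCategory E] [CrossedCategory G E]
  (F : CrossedFunctor C D)

theorem map_conjMap (β : G) {X Y X' Y' : C} (f : X ⟶ Y) (hX : X' = conj β X) (hY : Y' = conj β Y) :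
    F.F.map (conjMap β f hX hY) = conjMap β (F.F.map f)
      ((congrArg F.F.obj hX).trans (F.obj_conj β X))
      ((congrArg F.F.obj hY).trans (F.obj_conj β Y)) := by
  subst hX hY
  simp [conjMap, F.map_conj]

theorem map_conjMap_deg (A : C) {X Y X' Y' : C} (f : X ⟶ Y) (hX : X' = conj (deg A) X)
    (hY : Y' = conj (deg A) Y) : F.F.map (conjMap (deg A) f hX hY) =
      conjMap (deg (F.F.obj A)) (F.F.map f) (F.obj_conj_deg hX) (F.obj_conj_deg hY) :=
  (F.map_conjMap _ f hX hY).trans (conjMap_congr _ _ _ (F.deg_obj A).symm _ _ _ _)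

theorem map_whiskerLeft (X : C) {Y Z : C} (g : Y ⟶ Z) : F.F.map (X ◁ g) =
    eqToHom (F.obj_tensor X Y) ≫ F.F.obj X ◁ F.F.map g ≫ eqToHom (F.obj_tensor X Z).symm := by
  rw [← id_tensorHom, F.map_tensor, F.F.map_id, id_tensorHom]

theorem map_whiskerRight {X Y : C} (f : X ⟶ Y) (Z : C) : F.F.map (f ▷ Z) =
    eqToHom (F.obj_tensor X Z) ≫ F.F.map f ▷ F.F.obj Z ≫ eqToHom (F.obj_tensor Y Z).symm := by
  rw [← tensorHom_id, F.map_tensor, F.F.map_id, tensorHom_id]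

/-- The composite of crossed functors. -/
def comp (F' : CrossedFunctor D E) : CrossedFunctor C E where
  F := F.F ⋙ F'.F
  deg_obj X := (F'.deg_obj _).trans (F.deg_obj X)
  obj_tensor X Y := (congrArg F'.F.obj (F.obj_tensor X Y)).trans (F'.obj_tensor _ _)
  obj_unit := (congrArg F'.F.obj F.obj_unit).trans F'.obj_unit
  map_tensor f g := by simp [F.map_tensor, F'.map_tensor, eqToHom_map]
  map_associator X Y Z := by simp [F.map_associator, F'.map_associator, eqToHom_map]
  map_leftUnitor X := by simp [F.map_leftUnitor, F'.map_leftUnitor, eqToHom_map]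
  map_rightUnitor X := by simp [F.map_rightUnitor, F'.map_rightUnitor, eqToHom_map]
  obj_conj β X := (congrArg F'.F.obj (F.obj_conj β X)).trans (F'.obj_conj β _)
  map_conj β X Y f := by simp [F.map_conj, F'.map_conj, eqToHom_map]

variable {F} {F' : CrossedFunctor D E}

theorem IsBraided.comp [CrossedBraiding C] [CrossedBraiding D] [CrossedBraiding E]
    (h : F.IsBraided) (h' : F'.IsBraided) : (F.comp F').IsBraided := fun X Y Y' hY => by
  change F'.F.map (F.F.map _) = _
  rw [h X Y hY]
  simp only [Functor.map_comp, eqToHom_map, h' _ _ (F.obj_conj_deg hY), Category.assoc,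
    eqToHom_trans, eqToHom_trans_assoc]
  rfl

theorem IsBalanced.comp [CrossedBraiding C] [CrossedBraiding D] [CrossedBraiding E]
    [CrossedTwist C] [CrossedTwist D] [CrossedTwist E] (h : F.IsBalanced) (h' : F'.IsBalanced) :
    (F.comp F').IsBalanced := fun X _ hX =>
  (congrArg F'.F.map (h X hX)).trans (h' _ (F.obj_conj_deg hX))

theorem PreservesFiber.comp {K : Type u} [Field K] {X : CrossedFiberFunctor K C}
    {Y : CrossedFiberFunctor K D} {Z : CrossedFiberFunctor K E} (h : F.PreservesFiber X Y)
    (h' : F'.PreservesFiber Y Z) : (F.comp F').PreservesFiber X Z where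
  obj A := (h.obj A).trans (h'.obj _)
  map f := by
    rw [h.map, h'.map]
    simp [CrossedFunctor.comp]
  unit := by
    rw [h.unit, h'.unit]
    simp [CrossedFunctor.comp, eqToHom_map]
    erw [eqToHom_map, eqToHom_trans]
  tensor A B := by
    rw [h.tensor, h'.tensor]
    simp [CrossedFunctor.comp, eqToHom_map]
    erw [eqToHom_map, eqToHom_trans]
  conj β A := by
    rw [h.conj, h'.conj]
    simp [CrossedFunctor.comp, eqToHom_map]
    erw [eqToHom_map, eqToHom_trans]

/-- The composite of an isomorphism of categories onto `P` and an isomorphism which identifies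
`P` and `Q`. -/
theorem IsIsoOnto.comp {P : ObjectProperty D} {Q : ObjectProperty E} (h : F.IsIsoOnto P)
    (h' : F'.IsIsoOnto ⊤) (hPQ : ∀ Y, Q (F'.F.obj Y) ↔ P Y) : (F.comp F').IsIsoOnto Q where
  full := by have := h.full; have := h'.full; exact inferInstanceAs (F.F ⋙ F'.F).Full
  faithful := by
    have := h.faithful; have := h'.faithful; exact inferInstanceAs (F.F ⋙ F'.F).Faithful
  injective := h'.injective.comp h.injective
  range Z := by
    obtain ⟨Y, rfl⟩ := (h'.range Z).mp trivial
    rw [hPQ, h.range]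
    exact ⟨fun ⟨X, hX⟩ => ⟨X, congrArg F'.F.obj hX⟩, fun ⟨X, hX⟩ => ⟨X, h'.injective hX⟩⟩

end CrossedFunctor

end FunctorComposition

section TwistedFunctor

variable {G : Type w} [Group G]
  {C : Type*} [Category* C] [MonoidalCategory C] [CrossedCategory G C] [CrossedBraiding C]
  {D : Type*} [Category* D] [MonoidalCategory D] [CrossedCategory G D] [CrossedBraiding D]

theorem unit_eq_conj_deg (C : Type*) [Category* C] [MonoidalCategory C] [CrossedCategory G C] :
    𝟙_ C = conj (deg (𝟙_ C)) (𝟙_ C) := by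
  rw [deg_unit, conj_id]

omit [CrossedBraiding C] in
theorem TwistedObject.eq_comp_of_f {Z Z' Y Y' : TwistedObject C} (h : Z = Y) (h' : Z' = Y')
    {k : Z ⟶ Z'} {l : Y ⟶ Y'}
    (e : k.f = eqToHom (congrArg obj h) ≫ l.f ≫ eqToHom (congrArg obj h').symm) :
    k = eqToHom h ≫ l ≫ eqToHom h'.symm := by
  ext
  rw [e, comp_f, comp_f, eqToHom_f, eqToHom_f]

omit [CrossedBraiding C] in
theorem TwistedObject.tw_eq_of_eq {Z Y : TwistedObject C} (e : Z = Y) {U : C}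
    (h : U = conj (deg Z.obj) Z.obj) (h' : U = conj (deg Y.obj) Y.obj) :
    (Z.tw h).hom = eqToHom (congrArg obj e) ≫ (Y.tw h').hom := by
  subst e
  simp

open Functor.LaxMonoidal in
theorem CrossedFiberFunctor.twisted_ε {K : Type u} [Field K] (X : CrossedFiberFunctor K C) :
    ε X.twisted.F = ε X.F := by
  change ε X.F ≫ X.F.map (𝟙 _) = _
  rw [X.F.map_id]
  exact Category.comp_id _

open Functor.LaxMonoidal in
theorem CrossedFiberFunctor.twisted_μ {K : Type u} [Field K] (X : CrossedFiberFunctor K C)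
    (A B : TwistedObject C) : μ X.twisted.F A B = μ X.F A.obj B.obj := by
  change μ X.F A.obj B.obj ≫ X.F.map (𝟙 _) = _
  rw [X.F.map_id]
  exact Category.comp_id _

namespace CrossedFunctor

variable (F : CrossedFunctor C D)

/-- The functor on objects with an isomorphism `U ≅ ᵁU` which is given by a crossed functor. -/
abbrev twistedObj (Z : TwistedObject C) : TwistedObject D :=
  ⟨F.F.obj Z.obj, F.F.mapIso Z.t ≪≫ eqToIso (F.obj_conj_deg rfl)⟩

omit [CrossedBraiding C] [CrossedBraiding D] in
theorem twistedObj_tw (Z : TwistedObject C) {U' : C} (h : U' = conj (deg Z.obj) Z.obj)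
    (h' : F.F.obj U' = conj (deg (F.F.obj Z.obj)) (F.F.obj Z.obj)) :
    ((F.twistedObj Z).tw h').hom = F.F.map (Z.tw h).hom := by
  subst h
  simp [TwistedObject.tw, twistedObj]

variable {F} in
omit [CrossedBraiding C] [CrossedBraiding D] in
theorem twistedObj_ext {Z : TwistedObject C} {Y : TwistedObject D} (e : F.F.obj Z.obj = Y.obj)
    {U : C} (h : U = conj (deg Z.obj) Z.obj) {U' : D} (h' : U' = conj (deg Y.obj) Y.obj)
    (eU : F.F.obj U = U')
    (ht : F.F.map (Z.tw h).hom = eqToHom e ≫ (Y.tw h').hom ≫ eqToHom eU.symm) :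
    F.twistedObj Z = Y :=
  TwistedObject.obj_ext e fun {T} hX hY => by
    obtain rfl : T = U' := hY.trans h'.symm
    subst eU
    rw [twistedObj_tw F Z h, ht, eqToHom_refl, Category.comp_id]

/-- The functor on objects with an isomorphism `U ≅ ᵁU` which is given by a crossed functor. -/
def twistedFunctor : TwistedObject C ⥤ TwistedObject D where
  obj := F.twistedObj
  map {X Y} f := ⟨F.F.map f.f, TwistedObject.comm_of (X := F.twistedObj X) (Y := F.twistedObj Y) _
    (F.obj_conj_deg rfl) ((congrArg F.F.obj (by rw [deg_eq_of_hom f.f])).trans (F.obj_conj_deg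
      (Y' := conj (deg X.obj) Y.obj) (X := Y.obj) (by rw [deg_eq_of_hom f.f])))
    (F.obj_conj_deg rfl) (by
      rw [twistedObj_tw F X rfl, twistedObj_tw F Y (by rw [deg_eq_of_hom f.f])]
      refine (congrArg (_ ≫ ·) (F.map_conjMap_deg X.obj f.f rfl rfl).symm).trans ?_
      rw [← Functor.map_comp, ← Functor.map_comp]
      exact congrArg F.F.map (f.comm _ _ _))⟩
  map_id X := TwistedObject.hom_ext (F.F.map_id X.obj)
  map_comp f g := TwistedObject.hom_ext (F.F.map_comp f.f g.f)

theorem map_double {F : CrossedFunctor C D} (hF : F.IsBraided) (A B : C) {A' B' : C}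
    (hB : B' = conj (deg A) B) (hA : A' = conj (deg B') A) :
    F.F.map (CrossedBraiding.double A B hB hA).hom = eqToHom (F.obj_tensor A B) ≫
      (CrossedBraiding.double (F.F.obj A) (F.F.obj B) (F.obj_conj_deg hB) (F.obj_conj_deg hA)).hom ≫
        eqToHom (F.obj_tensor A' B').symm := by
  rw [CrossedBraiding.double_hom, F.F.map_comp, hF, hF, CrossedBraiding.double_hom]
  simp

theorem twistedObj_conj (β : G) (X : TwistedObject C) :
    F.twistedObj (conj β X) = conj β (F.twistedObj X) :=
  twistedObj_ext (F.obj_conj β X.obj)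
    (U := conj β (conj (deg X.obj) X.obj)) (U' := conj β (F.F.obj (conj (deg X.obj) X.obj)))
    (by
      change _ = conj (deg (conj β X.obj)) (conj β X.obj)
      rw [deg_conj, ← conj_comp, ← conj_comp]; congr 1; group)
    (by
      change _ = conj (deg (conj β (F.F.obj X.obj))) (conj β (F.F.obj X.obj))
      rw [deg_conj, ← conj_comp, F.obj_conj, F.deg_obj, ← conj_comp]; congr 1; group)
    (F.obj_conj β _) (by
      refine (congrArg F.F.map (TwistedObject.conjObj_tw β X rfl rfl _ rfl)).trans ?_
      refine Eq.trans ?_ (congrArg (eqToHom _ ≫ · ≫ eqToHom _)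
        (TwistedObject.conjObj_tw β (F.twistedObj X) (F.obj_conj_deg rfl) rfl _ rfl)).symm
      rw [twistedObj_tw F X rfl, map_conjMap]
      simp [conjMap])

variable {F}

theorem twistedObj_tensor (hF : F.IsBraided) (X Y : TwistedObject C) :
    F.twistedObj (X ⊗ Y) = F.twistedObj X ⊗ F.twistedObj Y := by
  obtain ⟨X₁, hX⟩ : ∃ A, A = conj (deg X.obj) X.obj := ⟨_, rfl⟩
  obtain ⟨Y₁, hY⟩ : ∃ A, A = conj (deg Y.obj) Y.obj := ⟨_, rfl⟩
  obtain ⟨Y₂, h₁⟩ : ∃ A, A = conj (deg X₁) Y₁ := ⟨_, rfl⟩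
  obtain ⟨X₂, h₂⟩ : ∃ A, A = conj (deg Y₂) X₁ := ⟨_, rfl⟩
  refine twistedObj_ext (F.obj_tensor X.obj Y.obj) (twist_target hX hY h₁ h₂)
    (twist_target (F.obj_conj_deg hX) (F.obj_conj_deg hY) (F.obj_conj_deg h₁) (F.obj_conj_deg h₂))
    (F.obj_tensor X₂ Y₂) ?_
  refine (congrArg F.F.map (TwistedObject.tensorObj_tw X Y hX hY h₁ h₂ _)).trans ?_
  refine Eq.trans ?_ (congrArg (eqToHom _ ≫ · ≫ eqToHom _) (TwistedObject.tensorObj_tw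
    (F.twistedObj X) (F.twistedObj Y) (F.obj_conj_deg hX) (F.obj_conj_deg hY) (F.obj_conj_deg h₁)
      (F.obj_conj_deg h₂) _)).symm
  rw [twistedObj_tw F X hX, twistedObj_tw F Y hY, F.F.map_comp, F.map_tensor, map_double hF]
  simp

/-- The crossed functor on objects with an isomorphism `U ≅ ᵁU` which is given by a braided
crossed functor. -/
def twisted (hF : F.IsBraided) : CrossedFunctor (TwistedObject C) (TwistedObject D) where
  F := F.twistedFunctor
  deg_obj X := F.deg_obj X.obj
  obj_tensor := twistedObj_tensor hF
  obj_unit := twistedObj_ext F.obj_unit (unit_eq_conj_deg C) (unit_eq_conj_deg D)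
    F.obj_unit (by
      refine (congrArg F.F.map (TwistedObject.tensorUnit_tw _)).trans ?_
      refine Eq.trans ?_ (congrArg (eqToHom _ ≫ · ≫ eqToHom _)
        (TwistedObject.tensorUnit_tw _)).symm
      simp)
  map_tensor f g := TwistedObject.eq_comp_of_f (twistedObj_tensor hF _ _)
    (twistedObj_tensor hF _ _) (F.map_tensor f.f g.f)
  map_associator X Y Z := by
    ext
    simp only [TwistedObject.comp_f, TwistedObject.eqToHom_f]
    exact F.map_associator X.obj Y.obj Z.obj
  map_leftUnitor X := by
    ext
    simp only [TwistedObject.comp_f, TwistedObject.eqToHom_f]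
    exact F.map_leftUnitor X.obj
  map_rightUnitor X := by
    ext
    simp only [TwistedObject.comp_f, TwistedObject.eqToHom_f]
    exact F.map_rightUnitor X.obj
  obj_conj := F.twistedObj_conj
  map_conj β X Y f := TwistedObject.eq_comp_of_f (F.twistedObj_conj β X) (F.twistedObj_conj β Y)
    (F.map_conj β f.f)

theorem twisted_isBraided (hF : F.IsBraided) : (twisted hF).IsBraided := fun X Y Y' h => by
  ext
  simp only [TwistedObject.comp_f, TwistedObject.eqToHom_f]
  exact hF X.obj Y.obj (congrArg TwistedObject.obj h)

theorem twisted_isBalanced (hF : F.IsBraided) : (twisted hF).IsBalanced := fun X _ h =>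
  TwistedObject.hom_ext (twistedObj_tw F X (congrArg TwistedObject.obj h)
    (F.obj_conj_deg (congrArg TwistedObject.obj h))).symm

theorem twisted_preservesFiber (hF : F.IsBraided) {K : Type u} [Field K] {X : CrossedFiberFunctor K C}
    {Y : CrossedFiberFunctor K D} (h : F.PreservesFiber X Y) :
    (twisted hF).PreservesFiber X.twisted Y.twisted where
  obj A := h.obj A.obj
  map f := h.map f.f
  unit := by
    rw [X.twisted_ε, Y.twisted_ε, h.unit]
    exact congrArg (fun k => _ ≫ Y.F.map k ≫ _)
      (TwistedObject.eqToHom_f (twisted hF).obj_unit.symm).symm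
  tensor A B := by
    rw [X.twisted_μ, Y.twisted_μ, h.tensor]
    exact congrArg (fun k => _ ≫ _ ≫ Y.F.map k ≫ _)
      (TwistedObject.eqToHom_f ((twisted hF).obj_tensor A B).symm).symm
  conj β A := by
    refine (h.conj β A.obj).trans ?_
    exact congrArg (fun k => _ ≫ _ ≫ Y.F.map k ≫ _)
      (TwistedObject.eqToHom_f ((twisted hF).obj_conj β A).symm).symm

theorem twisted_isIsoOnto (hF : F.IsBraided) (h : F.IsIsoOnto ⊤) : (twisted hF).IsIsoOnto ⊤ where
  full := ⟨fun {X Y} k => by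
    have := h.full
    have := h.faithful
    obtain ⟨f, hf⟩ := F.F.map_surjective k.f
    refine ⟨⟨f, TwistedObject.comm_of _ rfl (Y' := conj (deg X.obj) Y.obj)
      (by rw [deg_eq_of_hom f]) rfl (F.F.map_injective ?_)⟩, TwistedObject.hom_ext hf⟩
    rw [F.F.map_comp, F.F.map_comp, F.map_conjMap_deg, hf, ← twistedObj_tw F X rfl,
      ← twistedObj_tw F Y _ (F.obj_conj_deg (X := Y.obj) (by rw [deg_eq_of_hom f]))]
    exact k.comm _ _ _⟩
  faithful := ⟨fun {X Y} f g e => by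
    have := h.faithful
    exact TwistedObject.hom_ext (F.F.map_injective (congrArg TwistedObject.Hom.f e))⟩
  injective X Y e := by
    have := h.faithful
    have e' : X.obj = Y.obj := h.injective (congrArg TwistedObject.obj e)
    refine TwistedObject.obj_ext e' fun {U'} hX hY => F.F.map_injective ?_
    rw [← twistedObj_tw F X hX (F.obj_conj_deg hX), F.F.map_comp, eqToHom_map,
      ← twistedObj_tw F Y hY (F.obj_conj_deg hY)]
    exact TwistedObject.tw_eq_of_eq e _ _
  range Y := ⟨fun _ => by
    have := h.full
    have := h.faithful
    obtain ⟨U, t⟩ := Y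
    obtain ⟨X, rfl⟩ := (h.range U).mp trivial
    refine ⟨⟨X, F.F.preimageIso (t ≪≫ (eqToIso (F.obj_conj_deg rfl)).symm)⟩, ?_⟩
    exact congrArg (TwistedObject.mk _) (Iso.ext (by simp)), fun _ => trivial⟩

end CrossedFunctor

end TwistedFunctor

section RibbonTransfer

variable {G : Type w} [Group G]
  {C : Type*} [Category* C] [MonoidalCategory C] [CrossedCategory G C]
  {D : Type*} [Category* D] [MonoidalCategory D] [CrossedCategory G D]

namespace CrossedFunctor

variable (F : CrossedFunctor C D)

theorem map_leftUnitor_inv (X : C) : F.F.map (λ_ X).inv =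
    (λ_ (F.F.obj X)).inv ≫ eqToHom (by rw [F.obj_tensor, F.obj_unit]) := by
  rw [← cancel_mono (F.F.map (λ_ X).hom), ← F.F.map_comp, F.map_leftUnitor]
  simp

theorem map_rightUnitor_inv (X : C) : F.F.map (ρ_ X).inv =
    (ρ_ (F.F.obj X)).inv ≫ eqToHom (by rw [F.obj_tensor, F.obj_unit]) := by
  rw [← cancel_mono (F.F.map (ρ_ X).hom), ← F.F.map_comp, F.map_rightUnitor]
  simp

theorem map_associator_inv (X Y Z : C) : F.F.map (α_ X Y Z).inv =
    eqToHom (by rw [F.obj_tensor, F.obj_tensor]) ≫ (α_ (F.F.obj X) (F.F.obj Y) (F.F.obj Z)).inv ≫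
      eqToHom (by rw [F.obj_tensor, F.obj_tensor]) := by
  rw [← cancel_mono (F.F.map (α_ X Y Z).hom), ← F.F.map_comp, F.map_associator]
  simp

theorem map_eq_iff [F.F.Faithful] {X Y : C} {X' Y' : D} (f g : X ⟶ Y) {f' g' : X' ⟶ Y'}
    (hX : F.F.obj X = X') (hY : Y' = F.F.obj Y)
    (hf : F.F.map f = eqToHom hX ≫ f' ≫ eqToHom hY)
    (hg : F.F.map g = eqToHom hX ≫ g' ≫ eqToHom hY) : f' = g' ↔ f = g := by
  rw [← F.F.map_injective.eq_iff (a := f), hf, hg, cancel_epi, cancel_mono]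

variable {U V : C}

/-- The evaluation and the coevaluation of `F U` and `F V` are the images of those of `U`
and `V`. -/
def MapsPairing (b : 𝟙_ C ⟶ U ⊗ V) (d : V ⊗ U ⟶ 𝟙_ C) (b' : 𝟙_ D ⟶ F.F.obj U ⊗ F.F.obj V)
    (d' : F.F.obj V ⊗ F.F.obj U ⟶ 𝟙_ D) : Prop :=
  F.F.map b = eqToHom F.obj_unit ≫ b' ≫ eqToHom (F.obj_tensor U V).symm ∧
    F.F.map d = eqToHom (F.obj_tensor V U) ≫ d' ≫ eqToHom F.obj_unit.symm

variable {F}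

theorem MapsPairing.zigzag_iff [F.F.Faithful] {b : 𝟙_ C ⟶ U ⊗ V} {d : V ⊗ U ⟶ 𝟙_ C} {b' d'}
    (h : F.MapsPairing b d b' d') :
    b' ▷ F.F.obj U ≫ (α_ _ _ _).hom ≫ F.F.obj U ◁ d' =
        (λ_ (F.F.obj U)).hom ≫ (ρ_ (F.F.obj U)).inv ↔
      b ▷ U ≫ (α_ _ _ _).hom ≫ U ◁ d = (λ_ U).hom ≫ (ρ_ U).inv := by
  refine F.map_eq_iff _ _ (by rw [F.obj_tensor, F.obj_unit]) (by rw [F.obj_tensor, F.obj_unit])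
    ?_ ?_
  · simp [map_whiskerLeft, map_whiskerRight, map_associator, h.1, h.2]
  · simp [map_leftUnitor, map_rightUnitor_inv]

theorem MapsPairing.zigzag_iff' [F.F.Faithful] {b : 𝟙_ C ⟶ U ⊗ V} {d : V ⊗ U ⟶ 𝟙_ C} {b' d'}
    (h : F.MapsPairing b d b' d') :
    F.F.obj V ◁ b' ≫ (α_ _ _ _).inv ≫ d' ▷ F.F.obj V =
        (ρ_ (F.F.obj V)).hom ≫ (λ_ (F.F.obj V)).inv ↔
      V ◁ b ≫ (α_ _ _ _).inv ≫ d ▷ V = (ρ_ V).hom ≫ (λ_ V).inv := by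
  refine F.map_eq_iff _ _ (by rw [F.obj_tensor, F.obj_unit]) (by rw [F.obj_tensor, F.obj_unit])
    ?_ ?_
  · simp [map_whiskerLeft, map_whiskerRight, map_associator_inv, h.1, h.2]
  · simp [map_rightUnitor, map_leftUnitor_inv]

theorem exists_pairing [F.F.Faithful] [i : ExactPairing U V] :
    ∃ _ : ExactPairing (F.F.obj U) (F.F.obj V), F.MapsPairing (η_ U V) (ε_ U V) (η_ _ _) (ε_ _ _) := by
  have h : F.MapsPairing (η_ U V) (ε_ U V)
      (eqToHom F.obj_unit.symm ≫ F.F.map (η_ U V) ≫ eqToHom (F.obj_tensor U V))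
      (eqToHom (F.obj_tensor V U).symm ≫ F.F.map (ε_ U V) ≫ eqToHom F.obj_unit) :=
    ⟨by simp, by simp⟩
  exact ⟨⟨_, _, h.zigzag_iff'.mpr i.coevaluation_evaluation', h.zigzag_iff.mpr
    i.evaluation_coevaluation'⟩, h⟩

theorem exists_pairing_of_map [F.F.Full] [F.F.Faithful]
    [i : ExactPairing (F.F.obj U) (F.F.obj V)] :
    ∃ _ : ExactPairing U V, F.MapsPairing (η_ U V) (ε_ U V) (η_ _ _) (ε_ _ _) := by
  have h : F.MapsPairing (U := U) (V := V) (F.F.preimage _) (F.F.preimage _) (η_ _ _) (ε_ _ _) :=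
    ⟨F.F.map_preimage _, F.F.map_preimage _⟩
  exact ⟨⟨_, _, h.zigzag_iff'.mp i.coevaluation_evaluation', h.zigzag_iff.mp
    i.evaluation_coevaluation'⟩, h⟩

theorem map_conjMap_eq (β : G) {X Y X₁ Y₁ : C} {X' Y' X₁' Y₁' : D} {f : X ⟶ Y} {f' : X' ⟶ Y'}
    {hX : F.F.obj X = X'} {hY : Y' = F.F.obj Y} (hf : F.F.map f = eqToHom hX ≫ f' ≫ eqToHom hY)
    (h₁ : X₁ = conj β X) (h₂ : Y₁ = conj β Y) {δ : G} (hδ : β = δ) (h₁' : X₁' = conj δ X')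
    (h₂' : Y₁' = conj δ Y') : F.F.map (conjMap β f h₁ h₂) =
      eqToHom (by rw [h₁, h₁', F.obj_conj, hX, hδ]) ≫ conjMap δ f' h₁' h₂' ≫
        eqToHom (by rw [h₂, h₂', F.obj_conj, hY, hδ]) := by
  subst hX hδ h₁' h₂'
  rw [F.map_conjMap, hf]
  simp [conjMap, eqToHom_map]

variable [ExactPairing U V] [ExactPairing (F.F.obj U) (F.F.obj V)]

theorem conjStable_iff [F.F.Faithful] (hF : Function.Injective F.F.obj)
    (h : F.MapsPairing (η_ U V) (ε_ U V) (η_ _ _) (ε_ _ _)) :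
    ConjStable (F.F.obj U) (F.F.obj V) ↔ ConjStable U V := by
  have e (β : G) (X : C) : F.F.obj X = conj β (F.F.obj X) ↔ X = conj β X := by
    rw [← F.obj_conj, hF.eq_iff]
  refine forall_congr' fun β => ?_
  constructor
  · intro k hU
    obtain ⟨hV, k₁, k₂⟩ := k ((e β U).mpr hU)
    exact ⟨(e β V).mp hV,
      (F.map_eq_iff _ _ F.obj_unit _ (F.map_conjMap_eq β h.1 _ _ rfl _ _) h.1).mp k₁,
      (F.map_eq_iff _ _ _ F.obj_unit.symm (F.map_conjMap_eq β h.2 _ _ rfl _ _) h.2).mp k₂⟩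
  · intro k hU
    obtain ⟨hV, k₁, k₂⟩ := k ((e β U).mp hU)
    exact ⟨(e β V).mpr hV,
      (F.map_eq_iff _ _ F.obj_unit _ (F.map_conjMap_eq β h.1 _ _ rfl _ _) h.1).mpr k₁,
      (F.map_eq_iff _ _ _ F.obj_unit.symm (F.map_conjMap_eq β h.2 _ _ rfl _ _) h.2).mpr k₂⟩

variable [CrossedBraiding C] [CrossedTwist C] [CrossedBraiding D] [CrossedTwist D]

theorem tortile_iff [F.F.Faithful] (hF : F.IsBalanced)
    (h : F.MapsPairing (η_ U V) (ε_ U V) (η_ _ _) (ε_ _ _)) :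
    Tortile (F.F.obj U) (F.F.obj V) ↔ Tortile U V := by
  have e {U₁ V₁ : C} (hU : U₁ = conj (deg U) U) (hV : V₁ = conj (deg U) V) :=
    F.map_eq_iff (X' := 𝟙_ D) (Y' := F.F.obj U₁ ⊗ F.F.obj V) (f' :=
      conjMap (deg (F.F.obj U)) (η_ (F.F.obj U) (F.F.obj V)) (Φ_unit _).symm
        (conj_tensor (F.obj_conj_deg hU) (F.obj_conj_deg hV)) ≫ F.F.obj U₁ ◁
          (CrossedTwist.θ (F.F.obj V₁) (dual_eq_conj (F.obj_conj_deg hV))).hom)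
      (g' := η_ (F.F.obj U) (F.F.obj V) ≫
        (CrossedTwist.θ (F.F.obj U) (F.obj_conj_deg hU)).hom ▷ F.F.obj V)
      (conjMap (deg U) (η_ U V) (Φ_unit (deg U)).symm (conj_tensor hU hV) ≫
        U₁ ◁ (CrossedTwist.θ V₁ (dual_eq_conj hV)).hom)
      (η_ U V ≫ (CrossedTwist.θ U hU).hom ▷ V) F.obj_unit (F.obj_tensor U₁ V).symm
      (by
        rw [F.F.map_comp, F.map_conjMap_eq (deg U) h.1 _ _ (F.deg_obj U).symm
          (Φ_unit _).symm (conj_tensor (F.obj_conj_deg hU) (F.obj_conj_deg hV)),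
          map_whiskerLeft, hF V₁ (dual_eq_conj hV)]
        simp)
      (by
        rw [F.F.map_comp, h.1, map_whiskerRight, hF U hU]
        simp)
  constructor
  · intro k U₁ V₁ hU hV
    exact (e hU hV).mp (k (F.obj_conj_deg hU) (F.obj_conj_deg hV))
  · intro k U₁ V₁ hU hV
    obtain rfl : U₁ = F.F.obj (conj (deg U) U) := hU.trans (F.obj_conj_deg rfl).symm
    obtain rfl : V₁ = F.F.obj (conj (deg U) V) := hV.trans (F.obj_conj_deg rfl).symm
    exact (e rfl rfl).mpr (k rfl rfl)

omit [ExactPairing U V] [ExactPairing (F.F.obj U) (F.F.obj V)] in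
theorem isRibbonObject_iff (h : F.IsIsoOnto ⊤) (hF : F.IsBalanced) (U : C) :
    IsRibbonObject (F.F.obj U) ↔ IsRibbonObject U := by
  have := h.full
  have := h.faithful
  constructor
  · rintro ⟨V, i, hc, ht, -⟩
    obtain ⟨V, rfl⟩ := (h.range V).mp trivial
    obtain ⟨i', hi⟩ := exists_pairing_of_map (F := F) (U := U) (V := V)
    have ht : Tortile U V := (tortile_iff hF hi).mp ht
    exact ⟨V, i', (conjStable_iff h.injective hi).mp hc, ht, ht.squareTwist⟩
  · rintro ⟨V, i, hc, ht, -⟩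
    obtain ⟨i', hi⟩ := exists_pairing (F := F) (U := U) (V := V)
    have ht : Tortile (F.F.obj U) (F.F.obj V) := (tortile_iff hF hi).mpr ht
    exact ⟨F.F.obj V, i', (conjStable_iff h.injective hi).mpr hc, ht, ht.squareTwist⟩

end CrossedFunctor

/-- The ribbon extensions of isomorphic braided Tannakian crossed categories are isomorphic. -/
theorem RibbonTannakianIso.comp_twisted {K : Type u} [Field K]
    {E : Type*} [Category* E] [MonoidalCategory E] [CrossedCategory G E]
    [CrossedBraiding C] [CrossedBraiding D] [CrossedBraiding E] [CrossedTwist E]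
    {X : CrossedFiberFunctor K C} {Y : CrossedFiberFunctor K D} {Z : CrossedFiberFunctor K E}
    (h : RibbonTannakianIso Z X.twisted (ribbonExtension C)) (h' : BraidedTannakianIso X Y ⊤) :
    RibbonTannakianIso Z Y.twisted (ribbonExtension D) := by
  obtain ⟨hR, F, hF, hb, ht, hp⟩ := h
  obtain ⟨F', hF', hb', hp'⟩ := h'
  have k := CrossedFunctor.twisted_isIsoOnto hb' hF'
  have kt := CrossedFunctor.twisted_isBalanced hb'
  exact ⟨hR, F.comp (CrossedFunctor.twisted hb'),
    hF.comp k (CrossedFunctor.isRibbonObject_iff k kt),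
    hb.comp (CrossedFunctor.twisted_isBraided hb'), ht.comp kt,
    hp.comp (CrossedFunctor.twisted_preservesFiber hb' hp')⟩

end RibbonTransfer

theorem mainTheorem2 (K : Type u) [Field K] (G : Type u) [Group G] :
    (∀ H : CrossedHopfAlgebra K G,
      ∃ D : CoquasitriangularHopfAlgebra K G,
        BraidedTannakianIso (Comod.fiber D.toCrossedHopfAlgebra) (Comod.fiber H).center ⊤ ∧
        ∀ D' : CoquasitriangularHopfAlgebra K G,
          BraidedTannakianEquiv (Comod.fiber D'.toCrossedHopfAlgebra) (Comod.fiber H).center ⊤ →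
          ∃ i : CrossedHopfAlgebra.Iso D.toCrossedHopfAlgebra D'.toCrossedHopfAlgebra,
            i.PreservesCobraiding D.cobraiding D'.cobraiding) ∧
    (∀ H' : CoquasitriangularHopfAlgebra K G,
      ∃ R : CoribbonHopfAlgebra K G,
        RibbonTannakianIso (Comod.fiber R.toCrossedHopfAlgebra)
          (Comod.fiber H'.toCrossedHopfAlgebra).twisted
          (ribbonExtension (Comod H'.toCrossedHopfAlgebra)) ∧
        ∀ R' : CoribbonHopfAlgebra K G,
          RibbonTannakianEquiv (Comod.fiber R'.toCrossedHopfAlgebra)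
            (Comod.fiber H'.toCrossedHopfAlgebra).twisted
            (ribbonExtension (Comod H'.toCrossedHopfAlgebra)) →
          ∃ i : CrossedHopfAlgebra.Iso R.toCrossedHopfAlgebra R'.toCrossedHopfAlgebra,
            i.PreservesCobraiding R.cobraiding R'.cobraiding ∧
              i.PreservesCotwist R.cotwist R'.cotwist) ∧
    (∀ (H : CrossedHopfAlgebra K G) (D : CoquasitriangularHopfAlgebra K G)
      (R : CoribbonHopfAlgebra K G),
      BraidedTannakianIso (Comod.fiber D.toCrossedHopfAlgebra) (Comod.fiber H).center ⊤ →
      RibbonTannakianIso (Comod.fiber R.toCrossedHopfAlgebra)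
        (Comod.fiber D.toCrossedHopfAlgebra).twisted
        (ribbonExtension (Comod D.toCrossedHopfAlgebra)) →
      RibbonTannakianIso (Comod.fiber R.toCrossedHopfAlgebra) (Comod.fiber H).center.twisted
        (ribbonExtension (CrossedCenter (Comod H)))) := by
  exact ⟨fun H => ⟨H.centerDual, H.braidedTannakianIso_centerDual, fun _ h =>
      H.braidedTannakianIso_centerDual.unique h⟩,
    fun Q => ⟨Q.ribbon, Q.ribbonTannakianIso_ribbon, fun _ h =>
      Q.ribbonTannakianIso_ribbon.unique h⟩,
    fun _ _ _ h h' => h'.comp_twisted h⟩
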